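/- **Elliptic Hall algebra.** Let $\mathcal K=\mathbb C(v,t)$, $[i]=\frac{v^i-v^{-i}}{v-v^{-1}}$ and $\mathbf c_i=(v^i+v^{-i}-t^i-t^{-i})[i]/i$. For $\mathbf x=(r,d)\in\mathbb Z^{2,*}=\mathbb Z^2\setminus\{0\}$ put $d(\mathbf x)=\gcd(r,d)$. Let $\mathbf A_{\mathcal K}$ be the unital $\mathcal K$-algebra generated by $t_{\mathbf x}$, $\mathbf x\in\mathbb Z^{2,*}$, with the relations: (i) $[t_{\mathbf x},t_{\mathbf y}]=0$ if $\mathbf x,\mathbf y$ lie on the same line through the origin; (ii) $[t_{\mathbf y},t_{\mathbf x}]=\mathrm{sign}(\det(\mathbf x,\mathbf y))\,\mathbf c_{d(\mathbf y)}\,\frac{\theta_{\mathbf x+\mathbf y}}{v^{-1}-v}$ if $\mathbf x,\mathbf y$ are not collinear, $d(\mathbf x)=1$, and the triangle with vertices $0,\mathbf x,\mathbf x+\mathbf y$ has no interior lattice point, where $\sum_{i\ge 0}\theta_{i\mathbf x_0}s^i=\exp\big((v^{-1}-v)\sum_{i\ge1}t_{i\mathbf x_0}s^i\big)$ whenever $d(\mathbf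 x_0)=1$. Put $\tilde t_{\mathbf x}=t_{\mathbf x}/[d(\mathbf x)]$. The group $SL(2,\mathbb Z)$ acts on $\mathbf A_{\mathcal K}$ by $\mathcal K$-algebra automorphisms with $g\cdot\tilde t_{\mathbf x}=\tilde t_{g(\mathbf x)}$. Let $\mathbf A^+\subset\mathbf A_{\mathcal K}$ be the $\mathcal K$-subalgebra generated by the $\tilde t_{\mathbf x}$ with $\mathbf x\in\mathbb Z^{2,+}\setminus\{0\}$, where $\mathbb Z^{2,+}=\{(r,d): r\ge1,\text{ or } r=0 \text{ and } d\ge0\}$. **Spherical DAHA.** Let $\mathcal K'=\mathbb C(v,q)$ and $n\ge1$. The double affine Hecke algebra $\ddot{\mathbf H}_n$ is the $\mathcal K'$-algebra generated by $T_i^{\pm1}$ $(1\le i\le n-1)$ and $X_j^{\pm1},Y_j^{\pm1}$ $(1\le j\le n)$ with the relations $(T_i+v^{-1})(T_i-v)=0$; $T_iT_{i+1}T_i=T_{i+1}T_iT_{i+1}$; $T_iT_k=T_kT_i$ if $|i-k|>1$; $X_jX_k=X_kX_j$; $Y_jY_k=Y_kY_j$; $T_iX_iT_i=X_{i+1}$;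 $T_i^{-1}Y_iT_i^{-1}=Y_{i+1}$; $T_iX_k=X_kT_i$ and $T_iY_k=Y_kT_i$ if $|i-k|>1$; $Y_1X_1\cdots X_n=qX_1\cdots X_nY_1$; $X_1^{-1}Y_2=Y_2X_1^{-1}T_1^{-2}$ (if $n\ge 2$). Let $S=\frac{1}{[n]^+!}\sum_{w\in\mathfrak S_n}v^{l(w)}T_w$, where $[i]^+=\frac{v^{2i}-1}{v^2-1}$ and $[n]^+!=[2]^+\cdots[n]^+$. It is an idempotent, and $\mathbf S\ddot{\mathbf H}_n=S\ddot{\mathbf H}_nS$ is an algebra with unit $S$. **Theorem.** Let $n\ge1$. (a) There is a unique action $\rho$ of $SL(2,\mathbb Z)$ on $\mathbf S\ddot{\mathbf H}_n$ by $\mathcal K'$-algebra automorphisms such that $\rho\begin{pmatrix}1&0\\1&1\end{pmatrix}$ and $\rho\begin{pmatrix}1&1\\0&1\end{pmatrix}$ are the restrictions of $\mathcal K'$-algebra automorphisms $\rho_1,\rho_2$ of $\ddot{\mathbf H}_n$ with $$\rho_1:\ T_i\mapsto T_i,\quad X_i\mapsto X_iY_i(T_{i-1}\cdots T_1)(T_1\cdots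 T_{i-1}),\quad Y_i\mapsto Y_i,$$ $$\rho_2:\ T_i\mapsto T_i,\quad Y_i\mapsto Y_iX_i(T_{i-1}^{-1}\cdots T_1^{-1})(T_1^{-1}\cdots T_{i-1}^{-1}),\quad X_i\mapsto X_i.$$ There is a unique family $(P^n_{\mathbf x})_{\mathbf x\in\mathbb Z^{2,*}}$ in $\mathbf S\ddot{\mathbf H}_n$ with $P^n_{g(0,e)}=\rho(g)\big(S\sum_iY_i^e\,S\big)$ for all $e\ge1$ and $g\in SL(2,\mathbb Z)$ (here $(0,e)$ is a column vector). Let $\mathbf S\ddot{\mathbf H}_n^+$ be the $\mathcal K'$-subalgebra generated by the $P^n_{\mathbf x}$ with $\mathbf x\in\mathbb Z^{2,+}\setminus\{0\}$. (b) The assignment $$v\mapsto v,\qquad t\mapsto qv^{-1},\qquad \tilde t_{\mathbf x}\mapsto\frac{1}{d(\mathbf x)}\big(q^{-d(\mathbf x)}v^{d(\mathbf x)}-v^{-d(\mathbf x)}\big)P^n_{\mathbf x}\qquad(\mathbf x\in\mathbb Z^{2,*})$$ extends to a surjective $\mathbb C$-algebra homomorphism $\Psi_n:\mathbf A_{\mathcal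 K}\to\mathbf S\ddot{\mathbf H}_n$. It satisfies $\Psi_n(g\cdot a)=\rho(g)\Psi_n(a)$ for all $g\in SL(2,\mathbb Z)$ and $a\in\mathbf A_{\mathcal K}$, and $\Psi_n(\mathbf A^+)=\mathbf S\ddot{\mathbf H}_n^+$. -/

import Mathlib

namespace EllipticHall

open Equiv

/-! ### Reduced decompositions in the symmetric group -/

/-- The index `i` of the pair of neighbours `i, i+1` attached to the `i`-th simple reflection. -/
def lo {n : ℕ} (i : Fin (n - 1)) : Fin n := ⟨i.val, by omega⟩

/-- The index `i+1` of the pair of neighbours `i, i+1` attached to the `i`-th simple reflection. -/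
def hi {n : ℕ} (i : Fin (n - 1)) : Fin n := ⟨i.val + 1, by omega⟩

/-- The simple transposition `s_i = (i, i+1)`. -/
def simpleRefl {n : ℕ} (i : Fin (n - 1)) : Perm (Fin n) := swap (lo i) (hi i)

/-- The permutation represented by a word in the simple transpositions. -/
def wordPerm {n : ℕ} (L : List (Fin (n - 1))) : Perm (Fin n) := (L.map simpleRefl).prod

theorem exists_word {n : ℕ} (w : Perm (Fin n)) : ∃ L, wordPerm L = w := by
  rcases n with _ | m
  · exact ⟨[], Subsingleton.elim _ _⟩
  · have h : w ∈ Submonoid.closure (Set.range fun i : Fin m => swap i.castSucc i.succ) := by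
      rw [Perm.mclosure_swap_castSucc_succ]; trivial
    induction h using Submonoid.closure_induction with
    | mem x hx =>
      obtain ⟨i, rfl⟩ := hx
      exact ⟨[i], by simp [wordPerm, simpleRefl]; rfl⟩
    | one => exact ⟨[], rfl⟩
    | mul x y _ _ hx hy =>
      obtain ⟨a, rfl⟩ := hx
      obtain ⟨b, rfl⟩ := hy
      exact ⟨a ++ b, by simp [wordPerm]⟩

/-- `L` is a reduced decomposition of `w`: a word for `w` of the least possible length. -/
def IsReducedWord {n : ℕ} (w : Perm (Fin n)) (L : List (Fin (n - 1))) : Prop :=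
  wordPerm L = w ∧ ∀ M, wordPerm M = w → L.length ≤ M.length

theorem exists_reducedWord {n : ℕ} (w : Perm (Fin n)) : ∃ L, IsReducedWord w L := by
  classical
  have h : ∃ k, ∃ L, wordPerm L = w ∧ L.length = k := by
    obtain ⟨L, hL⟩ := exists_word w
    exact ⟨_, L, hL, rfl⟩
  obtain ⟨L, hL, hk⟩ := Nat.find_spec h
  exact ⟨L, hL, fun M hM => hk ▸ Nat.find_min' h ⟨M, hM, rfl⟩⟩

/-- A reduced decomposition of `w`. -/
noncomputable def reducedWord {n : ℕ} (w : Perm (Fin n)) : List (Fin (n - 1)) :=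
  (exists_reducedWord w).choose

theorem reducedWord_spec {n : ℕ} (w : Perm (Fin n)) : IsReducedWord w (reducedWord w) :=
  (exists_reducedWord w).choose_spec

/-- The length `l(w)` of a permutation, i.e. the length of its reduced decompositions. -/
noncomputable def permLength {n : ℕ} (w : Perm (Fin n)) : ℕ := (reducedWord w).length

/-- The inversions of `w⁻¹`. -/
def invSet {n : ℕ} (w : Perm (Fin n)) : Finset (Fin n × Fin n) :=
  Finset.univ.filter fun p => p.1 < p.2 ∧ w.symm p.2 < w.symm p.1

/-- The number of inversions. -/
def invCard {n : ℕ} (w : Perm (Fin n)) : ℕ := (invSet w).card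

theorem simpleRefl_mul_self {n : ℕ} (i : Fin (n - 1)) :
    (simpleRefl i : Perm (Fin n)) * simpleRefl i = 1 := swap_mul_self _ _

theorem simpleRefl_val {n : ℕ} (i : Fin (n - 1)) (a : Fin n) :
    ((simpleRefl i a : Fin n) : ℕ) =
      if a.val = i.val then i.val + 1 else if a.val = i.val + 1 then i.val else a.val := by
  unfold simpleRefl
  rw [swap_apply_def]
  simp only [lo, hi, Fin.ext_iff]
  split_ifs <;> rfl

theorem invCard_up {n : ℕ} (i : Fin (n - 1)) (w : Perm (Fin n))
    (h : w.symm (lo i) < w.symm (hi i)) :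
    invCard (simpleRefl i * w) = invCard w + 1 := by
  have hs : ∀ a : Fin n, simpleRefl i (simpleRefl i a) = a := fun a => by
    have := congrArg (fun f : Perm (Fin n) => f a) (simpleRefl_mul_self i)
    simpa using this
  have hsymm : ∀ a, (simpleRefl i * w).symm a = w.symm (simpleRefl i a) := by
    intro a
    rw [Equiv.symm_apply_eq]; simp [hs]
  have hnot : (lo i, hi i) ∉ (invSet w).image
      (fun p => ((simpleRefl i p.1, simpleRefl i p.2) : Fin n × Fin n)) := by
    simp only [Finset.mem_image, not_exists, not_and, Prod.forall, Prod.mk.injEq]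
    intro a b hab ha hb
    simp only [invSet, Finset.mem_filter, Finset.mem_univ, true_and] at hab
    have h1 := congrArg Fin.val ha
    have h2 := congrArg Fin.val hb
    rw [simpleRefl_val] at h1 h2
    have h3 : a.val < b.val := hab.1
    simp only [lo, hi] at h1 h2
    split_ifs at h1 h2 <;> omega
  have hinj : Function.Injective
      (fun p : Fin n × Fin n => ((simpleRefl i p.1, simpleRefl i p.2) : Fin n × Fin n)) := by
    rintro ⟨a, b⟩ ⟨c, d⟩ hh
    simpa using hh
  have hset : invSet (simpleRefl i * w) = insert (lo i, hi i) ((invSet w).image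
      (fun p => ((simpleRefl i p.1, simpleRefl i p.2) : Fin n × Fin n))) := by
    ext ⟨a, b⟩
    simp only [invSet, Finset.mem_filter, Finset.mem_univ, true_and, Finset.mem_insert,
      Finset.mem_image, Prod.exists, Prod.mk.injEq, hsymm]
    have key : ∀ c d : Fin n, c < d → ¬ (c = lo i ∧ d = hi i) →
        simpleRefl i c < simpleRefl i d := by
      intro c d hcd hne
      rw [Fin.lt_def, simpleRefl_val, simpleRefl_val]
      simp only [lo, hi, Fin.ext_iff] at hne
      have : c.val < d.val := hcd
      split_ifs <;> omega
    constructor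
    · rintro ⟨hab, hw⟩
      by_cases hc : a = lo i ∧ b = hi i
      · exact Or.inl hc
      · exact Or.inr ⟨_, _, ⟨key a b hab hc, hw⟩, hs a, hs b⟩
    · rintro (⟨rfl, rfl⟩ | ⟨c, d, ⟨hcd, hw⟩, rfl, rfl⟩)
      · refine ⟨by simp [lo, hi, Fin.lt_def], ?_⟩
        simpa [simpleRefl] using h
      · refine ⟨key c d hcd ?_, by simpa [hs] using hw⟩
        rintro ⟨rfl, rfl⟩
        exact absurd hw (not_lt.mpr h.le)
  rw [invCard, hset, Finset.card_insert_of_notMem hnot, Finset.card_image_of_injective _ hinj]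
  rfl

theorem simpleRefl_cancel {n : ℕ} (i : Fin (n - 1)) (w : Perm (Fin n)) :
    simpleRefl i * (simpleRefl i * w) = w := by
  rw [← mul_assoc, simpleRefl_mul_self, one_mul]

theorem symm_simpleRefl_mul {n : ℕ} (i : Fin (n - 1)) (w : Perm (Fin n)) (a : Fin n) :
    (simpleRefl i * w).symm a = w.symm (simpleRefl i a) := by
  rw [Equiv.symm_apply_eq]
  have := congrArg (fun f : Perm (Fin n) => f a) (simpleRefl_mul_self i)
  simpa using this.symm

theorem simpleRefl_lo {n : ℕ} (i : Fin (n - 1)) : simpleRefl i (lo i) = hi i := by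
  simp [simpleRefl]

theorem simpleRefl_hi {n : ℕ} (i : Fin (n - 1)) : simpleRefl i (hi i) = lo i := by
  simp [simpleRefl]

theorem lo_ne_hi {n : ℕ} (i : Fin (n - 1)) : (lo i : Fin n) ≠ hi i := by
  simp [lo, hi, Fin.ext_iff]

theorem invCard_down {n : ℕ} (i : Fin (n - 1)) (w : Perm (Fin n))
    (h : w.symm (hi i) < w.symm (lo i)) :
    invCard w = invCard (simpleRefl i * w) + 1 := by
  have := invCard_up i (simpleRefl i * w)
    (by rw [symm_simpleRefl_mul, symm_simpleRefl_mul, simpleRefl_lo, simpleRefl_hi]; exact h)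
  rwa [simpleRefl_cancel] at this

theorem up_or_down {n : ℕ} (i : Fin (n - 1)) (w : Perm (Fin n)) :
    w.symm (lo i) < w.symm (hi i) ∨ w.symm (hi i) < w.symm (lo i) :=
  lt_or_gt_of_ne (fun h => lo_ne_hi i (w.symm.injective h))

theorem invCard_one {n : ℕ} : invCard (1 : Perm (Fin n)) = 0 := by
  rw [invCard, Finset.card_eq_zero, invSet, Finset.filter_eq_empty_iff]
  rintro ⟨a, b⟩ _ ⟨h1, h2⟩
  exact absurd h1 (not_lt.mpr (le_of_lt h2))

theorem wordPerm_cons {n : ℕ} (i : Fin (n - 1)) (L : List (Fin (n - 1))) :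
    wordPerm (i :: L) = simpleRefl i * wordPerm L := by simp [wordPerm]

theorem invCard_wordPerm_le {n : ℕ} (L : List (Fin (n - 1))) :
    invCard (wordPerm L) ≤ L.length := by
  induction L with
  | nil => simp [wordPerm, invCard_one]
  | cons i L ih =>
    rw [wordPerm_cons, List.length_cons]
    rcases up_or_down i (wordPerm L) with h | h
    · rw [invCard_up i _ h]; omega
    · have := invCard_down i _ h; omega

/-- A permutation without descents is the identity. -/
theorem eq_one_of_no_descent {n : ℕ} (w : Perm (Fin n))
    (h : ∀ i : Fin (n - 1), w.symm (lo i) < w.symm (hi i)) : w = 1 := by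
  have hm : StrictMono w.symm := by
    rcases n with _ | m
    · exact fun a => a.elim0
    · exact Fin.strictMono_iff_lt_succ.mpr (fun i => h i)
  have h2 : (w.symm : Fin n → Fin n) = id := by
    have h1 := hm.orderIsoOfSurjective _ w.symm.surjective
    have h3 : hm.orderIsoOfSurjective _ w.symm.surjective = OrderIso.refl _ :=
      Subsingleton.elim _ _
    funext a
    exact congrArg (fun f : Fin n ≃o Fin n => f a) h3
  ext a
  have : w.symm (w a) = w a := congrFun h2 (w a)
  simp only [Equiv.symm_apply_apply] at this
  simp [← this]

theorem exists_word_invCard {n : ℕ} (k : ℕ) : ∀ w : Perm (Fin n), invCard w = k →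
    ∃ L, wordPerm L = w ∧ L.length = k := by
  induction k with
  | zero =>
    intro w hw
    refine ⟨[], ?_, rfl⟩
    refine (eq_one_of_no_descent w fun i => ?_).symm
    rcases up_or_down i w with h | h
    · exact h
    · have := invCard_down i w h; omega
  | succ k ih =>
    intro w hw
    by_cases hd : ∀ i : Fin (n - 1), w.symm (lo i) < w.symm (hi i)
    · rw [eq_one_of_no_descent w hd, invCard_one] at hw; omega
    · push Not at hd
      obtain ⟨i, hi'⟩ := hd
      rcases up_or_down i w with h | h
      · exact absurd h (not_lt.mpr hi')
      · have := invCard_down i w h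
        obtain ⟨L, hL, hl⟩ := ih (simpleRefl i * w) (by omega)
        exact ⟨i :: L, by rw [wordPerm_cons, hL, simpleRefl_cancel], by simp [hl]⟩

theorem permLength_eq {n : ℕ} (w : Perm (Fin n)) : permLength w = invCard w := by
  apply le_antisymm
  · obtain ⟨L, hL, hl⟩ := exists_word_invCard _ w rfl
    exact hl ▸ (reducedWord_spec w).2 L hL
  · have := invCard_wordPerm_le (reducedWord w)
    rwa [(reducedWord_spec w).1] at this

theorem simpleRefl_fix {n : ℕ} (i : Fin (n - 1)) (a : Fin n) (h1 : a.val ≠ i.val)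
    (h2 : a.val ≠ i.val + 1) : simpleRefl i a = a :=
  swap_apply_of_ne_of_ne (fun h => h1 (congrArg Fin.val h)) (fun h => h2 (congrArg Fin.val h))

theorem simpleRefl_braid {n : ℕ} (i j : Fin (n - 1)) (h : j.val = i.val + 1) :
    (simpleRefl i * simpleRefl j * simpleRefl i : Perm (Fin n)) =
      simpleRefl j * simpleRefl i * simpleRefl j := by
  have e1 : (lo j : Fin n) = hi i := Fin.ext h
  have h1 : (hi i : Fin n) ≠ hi j := fun hh => by
    have := congrArg Fin.val hh
    simp only [hi] at this; omega
  have h2 : (lo i : Fin n) ≠ hi j := fun hh => by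
    have := congrArg Fin.val hh
    simp only [hi, lo] at this; omega
  simp only [simpleRefl, e1]
  rw [swap_mul_swap_mul_swap (lo_ne_hi i) h2, swap_comm (lo i) (hi i), swap_comm (hi i) (hi j),
    swap_mul_swap_mul_swap h1.symm h2.symm, swap_comm]

theorem simpleRefl_comm {n : ℕ} (i j : Fin (n - 1)) (h : i.val + 1 < j.val) :
    (simpleRefl j * simpleRefl i : Perm (Fin n)) = simpleRefl i * simpleRefl j := by
  refine (Perm.Disjoint.commute fun a => ?_).eq
  by_cases h1 : a.val = j.val ∨ a.val = j.val + 1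
  · exact Or.inr (simpleRefl_fix i a (by omega) (by omega))
  · exact Or.inl (simpleRefl_fix j a (by omega) (by omega))

/-- Two words of minimal length for the same permutation have the same image in any monoid
where the braid relations hold. -/
theorem prod_eq_of_reduced {n : ℕ} {M : Type*} [Monoid M] (T : Fin (n - 1) → M)
    (hc : ∀ i j : Fin (n - 1), i.val + 1 < j.val → T i * T j = T j * T i)
    (hb : ∀ i j : Fin (n - 1), j.val = i.val + 1 → T i * T j * T i = T j * T i * T j) (k : ℕ) :
    ∀ (w : Perm (Fin n)) (L L' : List (Fin (n - 1))), invCard w = k → wordPerm L = w →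
      wordPerm L' = w → L.length = k → L'.length = k → (L.map T).prod = (L'.map T).prod := by
  induction k using Nat.strong_induction_on with
  | _ k ih =>
  have main : ∀ (w : Perm (Fin n)) (i j : Fin (n - 1)) (A B : List (Fin (n - 1))),
      i.val ≤ j.val → invCard w = k → wordPerm (i :: A) = w → wordPerm (j :: B) = w →
      (i :: A).length = k → (j :: B).length = k →
      ((i :: A).map T).prod = ((j :: B).map T).prod := by
    intro w i j A B hij hk hA hB hAl hBl
    rw [wordPerm_cons] at hA hB
    simp only [List.length_cons] at hAl hBl
    have hA' : wordPerm A = simpleRefl i * w := by rw [← hA, simpleRefl_cancel]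
    have hB' : wordPerm B = simpleRefl j * w := by rw [← hB, simpleRefl_cancel]
    have hiA := invCard_wordPerm_le A
    have hiB := invCard_wordPerm_le B
    have di : w.symm (hi i) < w.symm (lo i) := by
      rcases up_or_down i w with h | h
      · have := invCard_up i w h
        rw [hA'] at hiA; omega
      · exact h
    have dj : w.symm (hi j) < w.symm (lo j) := by
      rcases up_or_down j w with h | h
      · have := invCard_up j w h
        rw [hB'] at hiB; omega
      · exact h
    have ci := invCard_down i w di
    have cj := invCard_down j w dj
    simp only [List.map_cons, List.prod_cons]
    rcases Nat.lt_trichotomy j.val (i.val + 1) with h | h | h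
    · have hij' : i = j := Fin.ext (by omega)
      subst hij'
      rw [ih (k - 1) (by omega) (simpleRefl i * w) A B (by omega) hA' hB' (by omega) (by omega)]
    · have e1 : (lo j : Fin n) = hi i := Fin.ext h
      have e2 : simpleRefl i (hi j) = hi j :=
        simpleRefl_fix _ _ (by simp only [hi]; omega) (by simp only [hi]; omega)
      have e3 : simpleRefl j (lo i) = lo i :=
        simpleRefl_fix _ _ (by simp only [lo]; omega) (by simp only [lo]; omega)
      have f1 := invCard_down j (simpleRefl i * w) (by
        rw [symm_simpleRefl_mul, symm_simpleRefl_mul, e1, simpleRefl_hi, e2]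
        rw [e1] at dj; exact dj.trans di)
      have f2 := invCard_down i (simpleRefl j * (simpleRefl i * w)) (by
        rw [symm_simpleRefl_mul, symm_simpleRefl_mul, symm_simpleRefl_mul, symm_simpleRefl_mul,
          e3, simpleRefl_lo, ← e1, simpleRefl_lo, e2]
        rw [e1]; rw [e1] at dj; exact dj)
      obtain ⟨C, hC, hCl⟩ := exists_word_invCard _
        (simpleRefl i * (simpleRefl j * (simpleRefl i * w))) rfl
      have hbr := simpleRefl_braid i j h
      have hC2 : wordPerm C = simpleRefl j * (simpleRefl i * (simpleRefl j * w)) := by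
        rw [hC]; simpa only [mul_assoc] using congrArg (· * w) hbr
      rw [ih (k - 1) (by omega) (simpleRefl i * w) A (j :: i :: C) (by omega) hA'
        (by rw [wordPerm_cons, wordPerm_cons, hC, simpleRefl_cancel, simpleRefl_cancel])
        (by omega) (by simp only [List.length_cons]; omega)]
      rw [ih (k - 1) (by omega) (simpleRefl j * w) B (i :: j :: C) (by omega) hB'
        (by rw [wordPerm_cons, wordPerm_cons, hC2, simpleRefl_cancel, simpleRefl_cancel])
        (by omega) (by simp only [List.length_cons]; omega)]
      simp only [List.map_cons, List.prod_cons, ← mul_assoc]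
      rw [hb i j h]
    · have e1 : simpleRefl i (lo j) = lo j :=
        simpleRefl_fix _ _ (by simp only [lo]; omega) (by simp only [lo]; omega)
      have e2 : simpleRefl i (hi j) = hi j :=
        simpleRefl_fix _ _ (by simp only [hi]; omega) (by simp only [hi]; omega)
      have f1 := invCard_down j (simpleRefl i * w) (by
        rw [symm_simpleRefl_mul, symm_simpleRefl_mul, e1, e2]; exact dj)
      obtain ⟨C, hC, hCl⟩ := exists_word_invCard _ (simpleRefl j * (simpleRefl i * w)) rfl
      have hbr := simpleRefl_comm i j h
      have hC2 : wordPerm C = simpleRefl i * (simpleRefl j * w) := by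
        rw [hC]; simpa only [mul_assoc] using congrArg (· * w) hbr
      rw [ih (k - 1) (by omega) (simpleRefl i * w) A (j :: C) (by omega) hA'
        (by rw [wordPerm_cons, hC, simpleRefl_cancel])
        (by omega) (by simp only [List.length_cons]; omega)]
      rw [ih (k - 1) (by omega) (simpleRefl j * w) B (i :: C) (by omega) hB'
        (by rw [wordPerm_cons, hC2, simpleRefl_cancel])
        (by omega) (by simp only [List.length_cons]; omega)]
      simp only [List.map_cons, List.prod_cons, ← mul_assoc]
      rw [hc i j h]
  intro w L L' hk hL hL' hl hl'
  rcases L with _ | ⟨i, A⟩ <;> rcases L' with _ | ⟨j, B⟩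
  · rfl
  · simp at hl hl'; omega
  · simp at hl hl'; omega
  · rcases le_total i.val j.val with h | h
    · exact main w i j A B h hk hL hL' hl hl'
    · exact (main w j i B A h hk hL' hL hl' hl).symm

/-- The image of a reduced word under `T`. -/
noncomputable def reducedProd {n : ℕ} {M : Type*} [Monoid M] (T : Fin (n - 1) → M)
    (w : Perm (Fin n)) : M := ((reducedWord w).map T).prod

theorem reducedProd_up {n : ℕ} {M : Type*} [Monoid M] (T : Fin (n - 1) → M)
    (hc : ∀ i j : Fin (n - 1), i.val + 1 < j.val → T i * T j = T j * T i)
    (hb : ∀ i j : Fin (n - 1), j.val = i.val + 1 → T i * T j * T i = T j * T i * T j)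
    (i : Fin (n - 1)) (w : Perm (Fin n)) (h : w.symm (lo i) < w.symm (hi i)) :
    reducedProd T (simpleRefl i * w) = T i * reducedProd T w := by
  have h1 := permLength_eq w
  have h2 := permLength_eq (simpleRefl i * w)
  have h3 := invCard_up i w h
  unfold permLength at h1 h2
  have := prod_eq_of_reduced T hc hb _ (simpleRefl i * w) (reducedWord (simpleRefl i * w))
    (i :: reducedWord w) rfl (reducedWord_spec _).1
    (by rw [wordPerm_cons, (reducedWord_spec w).1]) h2 (by simp [h1, h3])
  simpa [reducedProd] using this

/-- The permutation of `Fin (n+1)` with `0 ↦ p` whose other values are ordered as those of `e`. -/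
def insertPerm {n : ℕ} (p : Fin (n + 1)) (e : Perm (Fin n)) : Perm (Fin (n + 1)) :=
  p.cycleRange.symm * Perm.decomposeFin.symm (0, e)

theorem insertPerm_zero {n : ℕ} (p : Fin (n + 1)) (e : Perm (Fin n)) : insertPerm p e 0 = p := by
  simp [insertPerm]

theorem insertPerm_succ {n : ℕ} (p : Fin (n + 1)) (e : Perm (Fin n)) (j : Fin n) :
    insertPerm p e j.succ = p.succAbove (e j) := by
  simp [insertPerm]

theorem insertPerm_bijective {n : ℕ} :
    Function.Bijective fun x : Fin (n + 1) × Perm (Fin n) => insertPerm x.1 x.2 := by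
  rw [Fintype.bijective_iff_injective_and_card]
  constructor
  · rintro ⟨p, e⟩ ⟨p', e'⟩ h
    simp only at h
    have hp : p = p' := by rw [← insertPerm_zero p e, h, insertPerm_zero]
    subst hp
    have : e = e' := by
      ext j
      have h1 := insertPerm_succ p e j
      rw [h, insertPerm_succ] at h1
      rw [Fin.succAbove_right_injective h1]
    rw [this]
  · simp [Fintype.card_perm, Nat.factorial_succ]

theorem invCard_insertPerm {n : ℕ} (p : Fin (n + 1)) (e : Perm (Fin n)) :
    invCard (insertPerm p e).symm = p.val + invCard e.symm := by
  have hset : invSet (insertPerm p e).symm =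
      ((Finset.univ.filter fun j => p.succAbove (e j) < p).image
        fun j : Fin n => ((0, j.succ) : Fin (n + 1) × Fin (n + 1))) ∪
      (invSet e.symm).image fun x => (x.1.succ, x.2.succ) := by
    ext ⟨a, b⟩
    simp only [invSet, Equiv.symm_symm, Finset.mem_filter, Finset.mem_univ, true_and,
      Finset.mem_union, Finset.mem_image, Prod.mk.injEq, Prod.exists]
    constructor
    · rintro ⟨h1, h2⟩
      obtain ⟨k, rfl⟩ := Fin.exists_succ_eq.mpr (Fin.ne_zero_of_lt h1)
      by_cases ha : a = 0
      · subst ha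
        rw [insertPerm_zero, insertPerm_succ] at h2
        exact Or.inl ⟨k, h2, rfl, rfl⟩
      · obtain ⟨j, rfl⟩ := Fin.exists_succ_eq.mpr ha
        rw [insertPerm_succ, insertPerm_succ, Fin.succAbove_lt_succAbove_iff] at h2
        exact Or.inr ⟨j, k, ⟨Fin.succ_lt_succ_iff.mp h1, h2⟩, rfl, rfl⟩
    · rintro (⟨k, h, rfl, rfl⟩ | ⟨j, k, ⟨h1, h2⟩, rfl, rfl⟩)
      · exact ⟨Fin.succ_pos k, by rwa [insertPerm_zero, insertPerm_succ]⟩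
      · refine ⟨Fin.succ_lt_succ_iff.mpr h1, ?_⟩
        rwa [insertPerm_succ, insertPerm_succ, Fin.succAbove_lt_succAbove_iff]
  have hcard : (Finset.univ.filter fun j => p.succAbove (e j) < p).card = p.val := by
    rw [← Fin.card_Iio p]
    refine Finset.card_bij (fun j _ => p.succAbove (e j)) ?_ ?_ ?_
    · intro j hj; simpa using hj
    · intro j _ k _ h; exact e.injective (Fin.succAbove_right_injective h)
    · intro b hb
      have hb' : b < p := by simpa using hb
      obtain ⟨j, rfl⟩ := Fin.exists_succAbove_eq hb'.ne
      exact ⟨e.symm j, by simpa using hb', by simp⟩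
  rw [invCard, hset, Finset.card_union_of_disjoint, Finset.card_image_of_injective,
    Finset.card_image_of_injective, hcard, invCard]
  · rintro ⟨a, b⟩ ⟨c, d⟩ h
    simpa using h
  · intro a b h
    simpa using h
  · rw [Finset.disjoint_left]
    simp only [Finset.mem_image, not_exists, not_and, Prod.forall, Prod.mk.injEq]
    rintro a b ⟨k, _, rfl, rfl⟩ c d _ h
    exact absurd h (Fin.succ_ne_zero c)

/-- The Poincare polynomial of the symmetric group. -/
theorem sum_pow_invCard {R : Type*} [CommSemiring R] (u : R) (n : ℕ) :
    ∑ w : Perm (Fin n), u ^ invCard w =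
      ∏ k ∈ Finset.range n, ∑ j ∈ Finset.range (k + 1), u ^ j := by
  have hinv : ∀ m, ∑ w : Perm (Fin m), u ^ invCard w = ∑ w : Perm (Fin m), u ^ invCard w.symm :=
    fun m => (Equiv.sum_comp (Equiv.inv (Perm (Fin m))) fun w => u ^ invCard w).symm
  induction n with
  | zero => simp [invCard, invSet]
  | succ n ih =>
    rw [hinv, ← (Equiv.ofBijective _ insertPerm_bijective).sum_comp, Fintype.sum_prod_type,
      Finset.prod_range_succ, ← ih, hinv, mul_comm, Finset.sum_mul,
      Finset.sum_range fun j => u ^ j * _]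
    refine Finset.sum_congr rfl fun p _ => ?_
    rw [Finset.mul_sum]
    refine Finset.sum_congr rfl fun e _ => ?_
    rw [Equiv.ofBijective_apply, invCard_insertPerm, pow_add]


/-! ### The ground fields -/

/-- The field `ℂ(a, b)` of rational functions in two variables. -/
abbrev RatField : Type := FractionRing (MvPolynomial (Fin 2) ℂ)

/-- `K = ℂ(v, t)`, the ground field of the elliptic Hall algebra. -/
abbrev K : Type := RatField

/-- `K' = ℂ(v, q)`, the ground field of the double affine Hecke algebra. -/
abbrev K' : Type := RatField

/-- The variable `v` of `K = ℂ(v, t)`. -/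
noncomputable def vK : K := algebraMap (MvPolynomial (Fin 2) ℂ) K (MvPolynomial.X 0)

/-- The variable `t` of `K = ℂ(v, t)`. -/
noncomputable def tK : K := algebraMap (MvPolynomial (Fin 2) ℂ) K (MvPolynomial.X 1)

/-- The variable `v` of `K' = ℂ(v, q)`. -/
noncomputable def v' : K' := algebraMap (MvPolynomial (Fin 2) ℂ) K' (MvPolynomial.X 0)

/-- The variable `q` of `K' = ℂ(v, q)`. -/
noncomputable def q' : K' := algebraMap (MvPolynomial (Fin 2) ℂ) K' (MvPolynomial.X 1)

/-! ### Lattice points and the action of `SL(2,ℤ)` -/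

/-- The lattice `ℤ²`, a point `x = (r, d)` being given by `x 0 = r`, `x 1 = d`. -/
abbrev Lattice : Type := Fin 2 → ℤ

/-- `ℤ² ∖ {0}`. -/
abbrev LatticeStar : Type := {x : Lattice // x ≠ 0}

/-- The group `SL(2,ℤ)`. -/
abbrev SL2Z : Type := Matrix.SpecialLinearGroup (Fin 2) ℤ

/-- `SL(2,ℤ)` acts on the column vectors in `ℤ² ∖ {0}` by matrix multiplication. -/
instance : MulAction SL2Z LatticeStar where
  smul g x := ⟨g.1.mulVec x.1, fun h => x.2 (by
    have h1 : (g⁻¹).1.mulVec (g.1.mulVec x.1) = x.1 := by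
      rw [Matrix.mulVec_mulVec, ← Matrix.SpecialLinearGroup.coe_mul, inv_mul_cancel,
        Matrix.SpecialLinearGroup.coe_one, Matrix.one_mulVec]
    rw [← h1, h, Matrix.mulVec_zero])⟩
  one_smul x := Subtype.ext (Matrix.one_mulVec x.1)
  mul_smul g h x := Subtype.ext (by
    change (g * h).1.mulVec x.1 = g.1.mulVec (h.1.mulVec x.1)
    rw [Matrix.mulVec_mulVec]; rfl)

theorem coe_smul (g : SL2Z) (x : LatticeStar) : ((g • x : LatticeStar) : Lattice) =
    g.1.mulVec x.1 := rfl

/-- `d(x) = gcd(r, d)` for `x = (r, d)`. -/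
def deg (x : Lattice) : ℕ := Int.gcd (x 0) (x 1)

/-- The determinant `det(x, y)`. -/
def det2 (x y : Lattice) : ℤ := x 0 * y 1 - x 1 * y 0

/-- The triangle with vertices `0`, `x`, `x + y` has no interior lattice point: no lattice point
is of the form `a x + b (x + y)` with `a, b > 0` and `a + b < 1`. (Only used when `x, y` are
not collinear, so that these points do form the interior of the triangle.) -/
def NoInteriorPoint (x y : Lattice) : Prop :=
  ∀ p : Lattice, ¬ ∃ a b : ℝ, 0 < a ∧ 0 < b ∧ a + b < 1 ∧
    ∀ i, (p i : ℝ) = a * (x i : ℝ) + b * ((x i : ℝ) + (y i : ℝ))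

/-- The multiple `m x` with `m ≥ 1`, here `m = k + 1`. -/
def multiple (k : ℕ) (x : LatticeStar) : LatticeStar :=
  ⟨((k : ℤ) + 1) • x.1, smul_ne_zero (by omega) x.2⟩

/-- `ℤ^{2,+} = {(r, d) : r ≥ 1, or r = 0 and d ≥ 0}`. -/
def IsPositive (x : Lattice) : Prop := 1 ≤ x 0 ∨ (x 0 = 0 ∧ 0 ≤ x 1)

theorem det2_smul (g : SL2Z) (x y : Lattice) :
    det2 (g.1.mulVec x) (g.1.mulVec y) = det2 x y := by
  have h : g.1 0 0 * g.1 1 1 - g.1 0 1 * g.1 1 0 = 1 := by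
    rw [← Matrix.det_fin_two]; exact g.2
  simp only [det2, Matrix.mulVec, dotProduct, Fin.sum_univ_two]
  linear_combination (x 0 * y 1 - x 1 * y 0) * h

theorem mulVec_inv (g : SL2Z) (x : Lattice) : (g⁻¹).1.mulVec (g.1.mulVec x) = x := by
  rw [Matrix.mulVec_mulVec, ← Matrix.SpecialLinearGroup.coe_mul, inv_mul_cancel,
    Matrix.SpecialLinearGroup.coe_one, Matrix.one_mulVec]

theorem deg_dvd (g : SL2Z) (x : Lattice) : deg x ∣ deg (g.1.mulVec x) := by
  have h0 : ((deg x : ℕ) : ℤ) ∣ x 0 := Int.gcd_dvd_left _ _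
  have h1 : ((deg x : ℕ) : ℤ) ∣ x 1 := Int.gcd_dvd_right _ _
  have key : ∀ i, ((deg x : ℕ) : ℤ) ∣ g.1.mulVec x i := fun i => by
    simp only [Matrix.mulVec, dotProduct, Fin.sum_univ_two]
    exact dvd_add (h0.mul_left _) (h1.mul_left _)
  exact Int.natCast_dvd_natCast.mp (Int.dvd_coe_gcd (key 0) (key 1))

theorem deg_smul (g : SL2Z) (x : Lattice) : deg (g.1.mulVec x) = deg x := by
  refine Nat.dvd_antisymm ?_ (deg_dvd g x)
  have := deg_dvd g⁻¹ (g.1.mulVec x)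
  rwa [mulVec_inv] at this

theorem NoInteriorPoint.smul {x y : Lattice} (h : NoInteriorPoint x y) (g : SL2Z) :
    NoInteriorPoint (g.1.mulVec x) (g.1.mulVec y) := by
  rintro p ⟨a, b, ha, hb, hab, hp⟩
  refine h ((g⁻¹).1.mulVec p) ⟨a, b, ha, hb, hab, ?_⟩
  have hx : ∀ z : Lattice, ∀ i, (z i : ℝ) =
      ((g⁻¹).1 i 0 : ℝ) * (g.1.mulVec z 0 : ℝ) + ((g⁻¹).1 i 1 : ℝ) * (g.1.mulVec z 1 : ℝ) := by
    intro z i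
    conv_lhs => rw [← mulVec_inv g z]
    simp only [Matrix.mulVec, dotProduct, Fin.sum_univ_two]
    push_cast; ring
  intro i
  rw [hx x i, hx y i]
  have h0 := hp 0
  have h1 := hp 1
  have : (((g⁻¹).1.mulVec p i : ℤ) : ℝ) =
      ((g⁻¹).1 i 0 : ℝ) * (p 0 : ℝ) + ((g⁻¹).1 i 1 : ℝ) * (p 1 : ℝ) := by
    simp only [Matrix.mulVec, dotProduct, Fin.sum_univ_two]
    push_cast; ring
  rw [this, h0, h1]; ring

theorem smul_multiple (g : SL2Z) (k : ℕ) (x : LatticeStar) :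
    g • multiple k x = multiple k (g • x) :=
  Subtype.ext (by simp only [coe_smul, multiple, Matrix.mulVec_smul])

/-! ### The elliptic Hall algebra -/

/-- The quantum integer `[i] = (v^i - v^{-i}) / (v - v^{-1})` in `K`. -/
noncomputable def qInt (i : ℕ) : K := (vK ^ i - vK⁻¹ ^ i) / (vK - vK⁻¹)

/-- `c_i = (v^i + v^{-i} - t^i - t^{-i}) [i] / i`. -/
noncomputable def cCoeff (i : ℕ) : K :=
  (vK ^ i + vK⁻¹ ^ i - tK ^ i - tK⁻¹ ^ i) * qInt i / (i : K)

/-- The free algebra on the symbols `t_x`, for `x ∈ ℤ² ∖ {0}`. -/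
abbrev FreeHall : Type := FreeAlgebra K LatticeStar

/-- The symbol `t_x`. -/
noncomputable def freeT (x : LatticeStar) : FreeHall := FreeAlgebra.ι K x

/-- The series `(v^{-1} - v) ∑_{i ≥ 1} t_{i x} s^i`. -/
noncomputable def tSeries (x : LatticeStar) : PowerSeries FreeHall :=
  PowerSeries.mk fun i => match i with
    | 0 => 0
    | k + 1 => (vK⁻¹ - vK) • freeT (multiple k x)

/-- The element `θ_{m x}`: the coefficient of `s^m` in `exp ((v^{-1} - v) ∑_{i ≥ 1} t_{i x} s^i)`.
The terms `f^k / k!` with `k > m` of the exponential series do not contribute to it. -/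
noncomputable def freeTheta (x : LatticeStar) (m : ℕ) : FreeHall :=
  ∑ k ∈ Finset.range (m + 1), ((k.factorial : K)⁻¹) • PowerSeries.coeff m (tSeries x ^ k)

/-- The defining relations of the elliptic Hall algebra. -/
inductive HallRel : FreeHall → FreeHall → Prop
  /-- `[t_x, t_y] = 0` if `x` and `y` lie on a line through the origin. -/
  | line (x y : LatticeStar) (h : det2 x.1 y.1 = 0) :
      HallRel (freeT x * freeT y) (freeT y * freeT x)
  /-- `[t_y, t_x] = ε_{x,y} c_{d(y)} θ_{x+y} / (v^{-1} - v)` if `d(x) = 1` and the triangle with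
  vertices `0, x, x + y` has no interior lattice point. Here `x + y = m z` with `d(z) = 1`. -/
  | triangle (x y z : LatticeStar) (m : ℕ) (hx : deg x.1 = 1) (hxy : det2 x.1 y.1 ≠ 0)
      (hT : NoInteriorPoint x.1 y.1) (hz : deg z.1 = 1) (hm : x.1 + y.1 = (m : ℤ) • z.1) :
      HallRel (freeT y * freeT x - freeT x * freeT y)
        ((((det2 x.1 y.1).sign : K) * cCoeff (deg y.1) / (vK⁻¹ - vK)) • freeTheta z m)

/-- The generic elliptic Hall algebra `A_K`. -/
def Hall : Type := RingQuot HallRel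

noncomputable instance : Ring Hall := inferInstanceAs (Ring (RingQuot HallRel))

noncomputable instance {R : Type*} [CommSemiring R] [Algebra R K] : Algebra R Hall :=
  inferInstanceAs (Algebra R (RingQuot HallRel))

/-- The quotient map onto `A_K`. -/
noncomputable def hallMk : FreeHall →ₐ[K] Hall := RingQuot.mkAlgHom K HallRel

/-- The generator `t_x` of `A_K`. -/
noncomputable def hallT (x : LatticeStar) : Hall := hallMk (freeT x)

/-- `t̃_x = t_x / [d(x)]`. -/
noncomputable def hallTt (x : LatticeStar) : Hall := (qInt (deg x.1))⁻¹ • hallT x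

/-- The subalgebra `A^+` of `A_K` generated by the `t̃_x` with `x ∈ ℤ^{2,+}`. -/
noncomputable def hallPlus : Subalgebra K Hall :=
  Algebra.adjoin K {a | ∃ x : LatticeStar, IsPositive x.1 ∧ a = hallTt x}

/-- The substitution `t_x ↦ t_{g x}` in the free algebra. -/
noncomputable def freeAct (g : SL2Z) : FreeHall →ₐ[K] FreeHall :=
  FreeAlgebra.lift K fun x => freeT (g • x)

theorem freeAct_T (g : SL2Z) (x : LatticeStar) : freeAct g (freeT x) = freeT (g • x) :=
  FreeAlgebra.lift_ι_apply _ _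

theorem freeAct_theta (g : SL2Z) (x : LatticeStar) (m : ℕ) :
    freeAct g (freeTheta x m) = freeTheta (g • x) m := by
  have hser : PowerSeries.map (freeAct g : FreeHall →+* FreeHall) (tSeries x) =
      tSeries (g • x) := by
    ext i
    rw [PowerSeries.coeff_map, tSeries, tSeries, PowerSeries.coeff_mk, PowerSeries.coeff_mk]
    rcases i with _ | k
    · simp
    · simp only [RingHom.coe_coe, map_smul, freeAct_T, smul_multiple]
  simp only [freeTheta, map_sum, map_smul]
  refine Finset.sum_congr rfl fun k _ => ?_
  rw [← hser, ← map_pow, PowerSeries.coeff_map]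
  rfl

theorem freeAct_rel (g : SL2Z) {a b : FreeHall} (h : HallRel a b) :
    HallRel (freeAct g a) (freeAct g b) := by
  cases h with
  | line x y h =>
    rw [map_mul, map_mul, freeAct_T, freeAct_T]
    exact HallRel.line _ _ (by rw [coe_smul, coe_smul, det2_smul]; exact h)
  | triangle x y z m hx hxy hT hz hm =>
    rw [map_sub, map_mul, map_mul, map_smul, freeAct_T, freeAct_T, freeAct_theta]
    have := HallRel.triangle (g • x) (g • y) (g • z) m
      (by rw [coe_smul, deg_smul]; exact hx)
      (by rw [coe_smul, coe_smul, det2_smul]; exact hxy)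
      (by rw [coe_smul, coe_smul]; exact hT.smul g)
      (by rw [coe_smul, deg_smul]; exact hz)
      (by rw [coe_smul, coe_smul, coe_smul, ← Matrix.mulVec_add, hm, Matrix.mulVec_smul])
    rwa [coe_smul, coe_smul, det2_smul, deg_smul] at this

/-- The endomorphism `t_x ↦ t_{g x}` of `A_K`. -/
noncomputable def hallEnd (g : SL2Z) : Hall →ₐ[K] Hall :=
  RingQuot.liftAlgHom K ⟨hallMk.comp (freeAct g), fun _ _ h =>
    RingQuot.mkAlgHom_rel K (freeAct_rel g h)⟩

theorem hallEnd_T (g : SL2Z) (x : LatticeStar) : hallEnd g (hallT x) = hallT (g • x) := by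
  have := RingQuot.liftAlgHom_mkAlgHom_apply K (hallMk.comp (freeAct g))
    (fun _ _ h => RingQuot.mkAlgHom_rel K (freeAct_rel g h)) (freeT x)
  rw [AlgHom.comp_apply, freeAct_T] at this
  exact this

theorem hall_ext {f g : Hall →ₐ[K] Hall} (h : ∀ x, f (hallT x) = g (hallT x)) : f = g := by
  apply RingQuot.ringQuot_ext'
  apply FreeAlgebra.hom_ext
  funext x
  exact h x

/-- The action of `SL(2,ℤ)` on `A_K` by automorphisms, with `g · t_x = t_{g x}`. -/
noncomputable def hallAct : SL2Z →* (Hall ≃ₐ[K] Hall) :=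
  (AlgEquiv.algHomUnitsEquiv K Hall).toMonoidHom.comp (MonoidHom.toHomUnits
    { toFun := hallEnd
      map_one' := hall_ext fun x => by rw [hallEnd_T, one_smul]; rfl
      map_mul' := fun g h => hall_ext fun x => by
        rw [hallEnd_T, mul_smul]
        change _ = hallEnd g (hallEnd h (hallT x))
        rw [hallEnd_T, hallEnd_T] })

theorem hallAct_T (g : SL2Z) (x : LatticeStar) : hallAct g (hallT x) = hallT (g • x) :=
  hallEnd_T g x

theorem hallAct_Tt (g : SL2Z) (x : LatticeStar) : hallAct g (hallTt x) = hallTt (g • x) := by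
  rw [hallTt, hallTt, map_smul, hallAct_T, coe_smul, deg_smul]

/-! ### The double affine Hecke algebra -/

/-- The generators of the double affine Hecke algebra of `GL(n)`. Indices start at `0`. -/
inductive DahaGen (n : ℕ) : Type
  | T (i : Fin (n - 1))
  | Tinv (i : Fin (n - 1))
  | X (j : Fin n)
  | Xinv (j : Fin n)
  | Y (j : Fin n)
  | Yinv (j : Fin n)

/-- The free algebra on the generators. -/
abbrev FreeDaha (n : ℕ) : Type := FreeAlgebra K' (DahaGen n)

/-- A generator, seen in the free algebra. -/
noncomputable def gen {n : ℕ} (a : DahaGen n) : FreeDaha n := FreeAlgebra.ι K' a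

open DahaGen in
/-- The defining relations of the double affine Hecke algebra. -/
inductive DahaRel (n : ℕ) : FreeDaha n → FreeDaha n → Prop
  | T_inv (i : Fin (n - 1)) : DahaRel n (gen (T i) * gen (Tinv i)) 1
  | inv_T (i : Fin (n - 1)) : DahaRel n (gen (Tinv i) * gen (T i)) 1
  | X_inv (j : Fin n) : DahaRel n (gen (X j) * gen (Xinv j)) 1
  | inv_X (j : Fin n) : DahaRel n (gen (Xinv j) * gen (X j)) 1
  | Y_inv (j : Fin n) : DahaRel n (gen (Y j) * gen (Yinv j)) 1
  | inv_Y (j : Fin n) : DahaRel n (gen (Yinv j) * gen (Y j)) 1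
  | hecke (i : Fin (n - 1)) : DahaRel n
      ((gen (T i) + algebraMap K' (FreeDaha n) v'⁻¹) * (gen (T i) - algebraMap K' (FreeDaha n) v')) 0
  | braid (i j : Fin (n - 1)) (h : j.val = i.val + 1) :
      DahaRel n (gen (T i) * gen (T j) * gen (T i)) (gen (T j) * gen (T i) * gen (T j))
  | T_T (i k : Fin (n - 1)) (h : i.val + 1 < k.val ∨ k.val + 1 < i.val) :
      DahaRel n (gen (T i) * gen (T k)) (gen (T k) * gen (T i))
  | X_X (j k : Fin n) : DahaRel n (gen (X j) * gen (X k)) (gen (X k) * gen (X j))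
  | Y_Y (j k : Fin n) : DahaRel n (gen (Y j) * gen (Y k)) (gen (Y k) * gen (Y j))
  | T_X_T (i : Fin (n - 1)) :
      DahaRel n (gen (T i) * gen (X (lo i)) * gen (T i)) (gen (X (hi i)))
  | T_Y_T (i : Fin (n - 1)) :
      DahaRel n (gen (Tinv i) * gen (Y (lo i)) * gen (Tinv i)) (gen (Y (hi i)))
  | T_X (i : Fin (n - 1)) (k : Fin n) (h : i.val + 1 < k.val ∨ k.val + 1 < i.val) :
      DahaRel n (gen (T i) * gen (X k)) (gen (X k) * gen (T i))
  | T_Y (i : Fin (n - 1)) (k : Fin n) (h : i.val + 1 < k.val ∨ k.val + 1 < i.val) :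
      DahaRel n (gen (T i) * gen (Y k)) (gen (Y k) * gen (T i))
  /-- `Y_1 X_1 ⋯ X_n = q X_1 ⋯ X_n Y_1`. -/
  | Y_prod_X (h : 0 < n) : DahaRel n
      (gen (Y ⟨0, h⟩) * (List.ofFn fun j : Fin n => gen (X j)).prod)
      (q' • ((List.ofFn fun j : Fin n => gen (X j)).prod * gen (Y ⟨0, h⟩)))
  /-- `X_1^{-1} Y_2 = Y_2 X_1^{-1} T_1^{-2}`. -/
  | X_Y (i : Fin (n - 1)) (h : i.val = 0) : DahaRel n
      (gen (Xinv (lo i)) * gen (Y (hi i)))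
      (gen (Y (hi i)) * gen (Xinv (lo i)) * (gen (Tinv i) * gen (Tinv i)))

/-- The double affine Hecke algebra of `GL(n)`. -/
def Daha (n : ℕ) : Type := RingQuot (DahaRel n)

noncomputable instance (n : ℕ) : Ring (Daha n) := inferInstanceAs (Ring (RingQuot (DahaRel n)))

noncomputable instance (n : ℕ) {R : Type*} [CommSemiring R] [Algebra R K'] :
    Algebra R (Daha n) := inferInstanceAs (Algebra R (RingQuot (DahaRel n)))

/-- The quotient map onto the double affine Hecke algebra. -/
noncomputable def dahaMk (n : ℕ) : FreeDaha n →ₐ[K'] Daha n := RingQuot.mkAlgHom K' (DahaRel n)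

namespace Daha

variable {n : ℕ}

/-- The generator `T_i`. -/
noncomputable def T (i : Fin (n - 1)) : Daha n := dahaMk n (gen (DahaGen.T i))
/-- The inverse of `T_i`. -/
noncomputable def Tinv (i : Fin (n - 1)) : Daha n := dahaMk n (gen (DahaGen.Tinv i))
/-- The generator `X_j`. -/
noncomputable def X (j : Fin n) : Daha n := dahaMk n (gen (DahaGen.X j))
/-- The generator `Y_j`. -/
noncomputable def Y (j : Fin n) : Daha n := dahaMk n (gen (DahaGen.Y j))

theorem rel {a b : FreeDaha n} (h : DahaRel n a b) : dahaMk n a = dahaMk n b :=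
  RingQuot.mkAlgHom_rel K' h

end Daha

/-! ### The symmetrizer -/

/-- `[i]^+ = (v^{2i} - 1) / (v^2 - 1)`. -/
noncomputable def plusInt (i : ℕ) : K' := (v' ^ (2 * i) - 1) / (v' ^ 2 - 1)

/-- `[n]^+! = [2]^+ ⋯ [n]^+`. -/
noncomputable def plusFactorial (n : ℕ) : K' := ∏ i ∈ Finset.Icc 2 n, plusInt i

/-- `T_w = T_{i_1} ⋯ T_{i_r}`, for a reduced decomposition `w = s_{i_1} ⋯ s_{i_r}`. -/
noncomputable def dahaT {n : ℕ} (w : Perm (Fin n)) : Daha n := reducedProd Daha.T w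

/-- `S̃ = ∑_w v^{l(w)} T_w`. -/
noncomputable def preSymm (n : ℕ) : Daha n := ∑ w : Perm (Fin n), v' ^ permLength w • dahaT w

/-- `S = S̃ / [n]^+!`. -/
noncomputable def symmetrizer (n : ℕ) : Daha n := (plusFactorial n)⁻¹ • preSymm n

theorem v'_pow_ne_one {k : ℕ} (hk : 0 < k) : v' ^ k ≠ 1 := by
  intro h
  have h1 : (MvPolynomial.X 0 ^ k : MvPolynomial (Fin 2) ℂ) = 1 := by
    apply IsFractionRing.injective (MvPolynomial (Fin 2) ℂ) K'
    rw [map_pow, map_one]; exact h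
  have h2 := congrArg (MvPolynomial.eval fun _ => (0 : ℂ)) h1
  simp [hk.ne'] at h2

theorem v'_ne_zero : v' ≠ 0 := by
  intro h
  have h1 : (MvPolynomial.X 0 : MvPolynomial (Fin 2) ℂ) = 0 := by
    apply IsFractionRing.injective (MvPolynomial (Fin 2) ℂ) K'
    rw [map_zero]; exact h
  exact MvPolynomial.X_ne_zero _ h1

theorem plusFactorial_ne_zero (n : ℕ) : plusFactorial n ≠ 0 := by
  refine Finset.prod_ne_zero_iff.mpr fun i hi => div_ne_zero ?_ ?_
  · exact sub_ne_zero.mpr (v'_pow_ne_one (by have := (Finset.mem_Icc.mp hi).1; omega))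
  · exact sub_ne_zero.mpr (v'_pow_ne_one (by omega))

theorem sum_pow_permLength (n : ℕ) :
    ∑ w : Perm (Fin n), (v' ^ 2) ^ permLength w = plusFactorial n := by
  simp only [permLength_eq]
  rw [sum_pow_invCard]
  have h : ∀ k, ∑ j ∈ Finset.range (k + 1), (v' ^ 2) ^ j = plusInt (k + 1) := fun k => by
    rw [geom_sum_eq (v'_pow_ne_one (by omega)), plusInt, pow_mul]
  simp only [h]
  induction n with
  | zero => simp [plusFactorial]
  | succ n ih =>
    rw [Finset.prod_range_succ, ih]
    rcases n with _ | n
    · have : plusInt 1 = 1 := div_self (sub_ne_zero.mpr (v'_pow_ne_one (by omega)))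
      simp [plusFactorial, this]
    · rw [plusFactorial, plusFactorial, Finset.prod_Icc_succ_top (show 2 ≤ n + 1 + 1 by omega)]

theorem Daha.T_comm {n : ℕ} (i j : Fin (n - 1)) (h : i.val + 1 < j.val) :
    (Daha.T i : Daha n) * Daha.T j = Daha.T j * Daha.T i := by
  have := Daha.rel (DahaRel.T_T (n := n) i j (Or.inl h))
  rwa [map_mul, map_mul] at this

theorem Daha.T_braid {n : ℕ} (i j : Fin (n - 1)) (h : j.val = i.val + 1) :
    (Daha.T i : Daha n) * Daha.T j * Daha.T i = Daha.T j * Daha.T i * Daha.T j := by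
  have := Daha.rel (DahaRel.braid (n := n) i j h)
  rwa [map_mul, map_mul, map_mul, map_mul] at this

theorem Daha.T_sq {n : ℕ} (i : Fin (n - 1)) :
    (Daha.T i : Daha n) * Daha.T i = (v' - v'⁻¹) • Daha.T i + 1 := by
  have h := Daha.rel (DahaRel.hecke (n := n) i)
  rw [map_mul, map_add, map_sub, AlgHom.commutes, AlgHom.commutes, map_zero] at h
  change (Daha.T i + algebraMap K' (Daha n) v'⁻¹) * (Daha.T i - algebraMap K' (Daha n) v') = 0 at h
  rw [Algebra.algebraMap_eq_smul_one, Algebra.algebraMap_eq_smul_one, add_mul, mul_sub, mul_sub,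
    mul_smul_comm, mul_one, smul_one_mul, smul_mul_smul_comm, inv_mul_cancel₀ v'_ne_zero,
    mul_one, one_smul] at h
  rw [sub_smul]
  have h2 := eq_neg_of_add_eq_zero_left h
  rw [← sub_eq_zero] at h ⊢
  rw [← h]; abel

theorem T_mul_preSymm {n : ℕ} (i : Fin (n - 1)) :
    Daha.T i * preSymm n = v' • preSymm n := by
  classical
  set f : Perm (Fin n) → Daha n := fun w => v' ^ permLength w • dahaT w with hf
  set up : Finset (Perm (Fin n)) := Finset.univ.filter fun w => w.symm (lo i) < w.symm (hi i)
  have hsum : preSymm n = ∑ w ∈ up, (f w + f (simpleRefl i * w)) := by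
    rw [preSymm, Finset.sum_add_distrib,
      ← Finset.sum_filter_add_sum_filter_not Finset.univ
        (fun w : Perm (Fin n) => w.symm (lo i) < w.symm (hi i))]
    congr 1
    refine Finset.sum_bij' (fun w _ => simpleRefl i * w) (fun w _ => simpleRefl i * w) ?_ ?_
      (fun w _ => simpleRefl_cancel i w) (fun w _ => simpleRefl_cancel i w) ?_
    · intro w hw
      have h := (Finset.mem_filter.mp hw).2
      refine Finset.mem_filter.mpr ⟨Finset.mem_univ _, ?_⟩
      rw [symm_simpleRefl_mul, symm_simpleRefl_mul, simpleRefl_lo, simpleRefl_hi]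
      exact (up_or_down i w).resolve_left h
    · intro w hw
      have h := (Finset.mem_filter.mp hw).2
      refine Finset.mem_filter.mpr ⟨Finset.mem_univ _, ?_⟩
      rw [symm_simpleRefl_mul, symm_simpleRefl_mul, simpleRefl_lo, simpleRefl_hi]
      exact not_lt.mpr h.le
    · intro w _
      rw [simpleRefl_cancel]
  rw [hsum, Finset.mul_sum, Finset.smul_sum]
  refine Finset.sum_congr rfl fun w hw => ?_
  have h := (Finset.mem_filter.mp hw).2
  have h1 : dahaT (simpleRefl i * w) = Daha.T i * dahaT w :=
    reducedProd_up Daha.T Daha.T_comm Daha.T_braid i w h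
  have h2 : permLength (simpleRefl i * w) = permLength w + 1 := by
    rw [permLength_eq, permLength_eq, invCard_up i w h]
  simp only [hf]
  rw [h1, h2, mul_add, mul_smul_comm, mul_smul_comm, ← mul_assoc, Daha.T_sq, add_mul, one_mul,
    smul_mul_assoc, smul_add, smul_add, smul_smul, smul_smul, smul_smul, pow_succ]
  have e : v' ^ permLength w * v' * (v' - v'⁻¹) = v' * (v' ^ permLength w * v') -
      v' ^ permLength w := by
    field_simp [v'_ne_zero]
  rw [e, sub_smul, mul_comm v' (v' ^ permLength w)]
  abel

theorem preSymm_mul_preSymm (n : ℕ) :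
    preSymm n * preSymm n = plusFactorial n • preSymm n := by
  have hword : ∀ L : List (Fin (n - 1)),
      (L.map Daha.T).prod * preSymm n = v' ^ L.length • preSymm n := by
    intro L
    induction L with
    | nil => simp
    | cons i L ih =>
      rw [List.map_cons, List.prod_cons, mul_assoc, ih, mul_smul_comm, T_mul_preSymm,
        smul_smul, List.length_cons, pow_succ]
  conv_lhs => enter [1]; rw [preSymm]
  rw [Finset.sum_mul, ← sum_pow_permLength, Finset.sum_smul]
  refine Finset.sum_congr rfl fun w _ => ?_
  rw [smul_mul_assoc, dahaT, reducedProd, hword, smul_smul, permLength, ← pow_add, ← pow_mul,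
    two_mul]

theorem symmetrizer_idem (n : ℕ) : IsIdempotentElem (symmetrizer n) := by
  rw [IsIdempotentElem, symmetrizer, smul_mul_smul_comm, preSymm_mul_preSymm, smul_smul, mul_assoc,
    inv_mul_cancel₀ (plusFactorial_ne_zero n), mul_one]

/-! ### The spherical algebra -/

/-- The algebra structure on the corner `e A e`, with unit `e`. -/
noncomputable abbrev cornerAlgebra {R A : Type*} [CommSemiring R] [Semiring A] [Algebra R A] {e : A}
    (he : IsIdempotentElem e) : Algebra R he.Corner where
  smul r a := ⟨r • a.1, by
    obtain ⟨b, hb⟩ := a.2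
    exact ⟨r • b, by rw [← hb]; simp⟩⟩
  algebraMap :=
    { toFun := fun r => ⟨r • e, r • e, by simp [he.eq]⟩
      map_one' := Subtype.ext (one_smul R e)
      map_mul' := fun r s => Subtype.ext (by
        change (r * s) • e = (r • e) * (s • e)
        rw [smul_mul_smul_comm, he.eq])
      map_zero' := Subtype.ext (zero_smul R e)
      map_add' := fun r s => Subtype.ext (add_smul r s e) }
  commutes' r a := Subtype.ext (by
    have ha := (Subsemigroup.mem_corner_iff he).mp a.2
    change (r • e) * a.1 = a.1 * (r • e)
    rw [smul_mul_assoc, mul_smul_comm, ha.1, ha.2])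
  smul_def' r a := Subtype.ext (by
    have ha := (Subsemigroup.mem_corner_iff he).mp a.2
    change r • a.1 = (r • e) * a.1
    rw [smul_mul_assoc, ha.1])

/-- The spherical double affine Hecke algebra `S H S`, an algebra with unit `S`. -/
def Spherical (n : ℕ) : Type := (symmetrizer_idem n).Corner

noncomputable instance (n : ℕ) : Ring (Spherical n) :=
  inferInstanceAs (Ring (symmetrizer_idem n).Corner)

noncomputable instance (n : ℕ) {R : Type*} [CommSemiring R] [Algebra R K'] :
    Algebra R (Spherical n) := cornerAlgebra (R := R) (symmetrizer_idem n)

/-- The inclusion of the spherical algebra into the double affine Hecke algebra. -/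
def Spherical.val {n : ℕ} (a : Spherical n) : Daha n := Subtype.val a

/-- The element `S a S`. -/
noncomputable def sandwich {n : ℕ} (a : Daha n) : Spherical n :=
  ⟨symmetrizer n * a * symmetrizer n, a, rfl⟩

/-! ### The action of `SL(2,ℤ)` on the spherical algebra -/

/-- For the index `j` (starting at `0`), the word `T_j ⋯ T_1 T_1 ⋯ T_j`
in generators numbered from `1`. -/
noncomputable def loopT {n : ℕ} (j : Fin n) : Daha n :=
  (List.ofFn fun k : Fin j.val => Daha.T ⟨j.val - 1 - k.val, by omega⟩).prod *
    (List.ofFn fun k : Fin j.val => Daha.T (n := n) ⟨k.val, by omega⟩).prod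

/-- `T_j^{-1} ⋯ T_1^{-1} T_1^{-1} ⋯ T_j^{-1}`. -/
noncomputable def loopTinv {n : ℕ} (j : Fin n) : Daha n :=
  (List.ofFn fun k : Fin j.val => Daha.Tinv ⟨j.val - 1 - k.val, by omega⟩).prod *
    (List.ofFn fun k : Fin j.val => Daha.Tinv (n := n) ⟨k.val, by omega⟩).prod

/-- `r` is the automorphism `ρ_1`: `T_i ↦ T_i`,
`X_i ↦ X_i Y_i (T_{i-1} ⋯ T_1)(T_1 ⋯ T_{i-1})`, `Y_i ↦ Y_i`. -/
def IsRho1 {n : ℕ} (r : Daha n ≃ₐ[K'] Daha n) : Prop :=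
  (∀ i, r (Daha.T i) = Daha.T i) ∧
  (∀ j, r (Daha.X j) = Daha.X j * Daha.Y j * loopT j) ∧
  (∀ j, r (Daha.Y j) = Daha.Y j)

/-- `r` is the automorphism `ρ_2`: `T_i ↦ T_i`,
`Y_i ↦ Y_i X_i (T_{i-1}^{-1} ⋯ T_1^{-1})(T_1^{-1} ⋯ T_{i-1}^{-1})`, `X_i ↦ X_i`. -/
def IsRho2 {n : ℕ} (r : Daha n ≃ₐ[K'] Daha n) : Prop :=
  (∀ i, r (Daha.T i) = Daha.T i) ∧
  (∀ j, r (Daha.Y j) = Daha.Y j * Daha.X j * loopTinv j) ∧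
  (∀ j, r (Daha.X j) = Daha.X j)

/-- The matrix `A_1`. -/
def A1 : SL2Z := ⟨!![1, 0; 1, 1], by simp [Matrix.det_fin_two]⟩

/-- The matrix `A_2`. -/
def A2 : SL2Z := ⟨!![1, 1; 0, 1], by simp [Matrix.det_fin_two]⟩

/-- `ρ` is the action of `SL(2,ℤ)` on the spherical algebra for which `A_1` and `A_2` act by the
restrictions of the automorphisms `ρ_1` and `ρ_2` of the double affine Hecke algebra. As `A_1` and
`A_2` generate `SL(2,ℤ)`, this determines `ρ`. -/
def IsCherednikAction (n : ℕ) (ρ : SL2Z →* (Spherical n ≃ₐ[K'] Spherical n)) : Prop :=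
  ∃ r1 r2 : Daha n ≃ₐ[K'] Daha n, IsRho1 r1 ∧ IsRho2 r2 ∧
    (∀ a, (ρ A1 a).val = r1 a.val) ∧ (∀ a, (ρ A2 a).val = r2 a.val)

/-- The point `(0, e)`, `e > 0`. -/
def vertical (e : ℕ) (he : 0 < e) : LatticeStar :=
  ⟨![0, (e : ℤ)], fun h => by have := congrFun h 1; simp at this; omega⟩

/-- `P` is the family `(P_x)`: if `x = g (0, e)` with `e > 0` and `g ∈ SL(2,ℤ)`, then
`P_x = ρ(g) (S (∑_i Y_i^e) S)`. -/
def IsPowerSumFamily {n : ℕ} (ρ : SL2Z →* (Spherical n ≃ₐ[K'] Spherical n))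
    (P : LatticeStar → Spherical n) : Prop :=
  ∀ (e : ℕ) (he : 0 < e) (g : SL2Z),
    P (g • vertical e he) = ρ g (sandwich (∑ j : Fin n, Daha.Y j ^ e))

/-- The subalgebra generated by the `P_x` with `x ∈ ℤ^{2,+}`. -/
noncomputable def sphericalPlus {n : ℕ} (P : LatticeStar → Spherical n) :
    Subalgebra K' (Spherical n) :=
  Algebra.adjoin K' {a | ∃ x : LatticeStar, IsPositive x.1 ∧ a = P x}

end EllipticHall

/-!
# The elliptic Hall algebra maps onto the spherical double affine Hecke algebra

*The action of `SL(2,ℤ)`.* Eliminating the other generators, the double affine Hecke algebra is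
given by the `T_i`, `X₁` and `Y₁`, with the quadratic relations and the relations `IsElliptic` of a
central extension of the elliptic braid group. These are relations between units, so that the
substitutions `X₁ ↦ X₁ Y₁` and `Y₁ ↦ Y₁ X₁` can be checked to preserve them in an arbitrary group
(`IsElliptic.mul_right`, `IsElliptic.swap`), which gives `ρ₁` and `ρ₂`. They satisfy the braid
relation, and the fourth power of the quarter turn `ρ₁ ρ₂⁻¹ ρ₁` is the conjugation by the full twist
of the `T_i` (`rot_pow_four`). This is trivial on the spherical algebra, where the full twist is a
scalar. Since the relations of `IsModularPair` define `SL(2,ℤ)` (`IsModularPair.exists_hom`), the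
group acts. The stabilizer of `(0, e)` is generated by `A₁`, and `ρ₁` fixes the `Y_j`, so that the
family `P` is well defined.

*The relations.* As `SL(2,ℤ)` acts on both sides, it is enough to check the relations of the elliptic
Hall algebra for one pair in each orbit. Collinear points can be moved to the vertical axis, where
everything is a function of the commuting `Y_j`. The pairs in the triangle relation reduce to four
standard ones (`exists_normal_form`), with two commutators to compute. That of `P_{0,l}` and
`P_{±1,0}` follows from the conjugation of the power sums of the `Y_j` by `X₁`, which permutes the
`Y_j` cyclically and multiplies one of them by a power of `q` (`commutator_one`). That of `P_{-1,l}`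
and `P_{1,0}` is a symmetrized combination of monomials in `Y₁` and `Y_n`
(`commutator_opposite`). Its generating function is evaluated by symmetrizing products of fractions
`(1 - v⁻² c s Y_j) / (1 - c s Y_j)` (`IsSymmetrized.symmetrized_identity`), and turns out to be the
series `∏ (1 - v⁻² s Y_j) (1 - v² q⁻¹ s Y_j) / ((1 - s Y_j) (1 - q⁻¹ s Y_j))`, up to a constant. The
logarithmic derivative of this series is a combination of power sums, and this identifies its
coefficients with the images of the `θ_{0,l}` (`freePsi_theta_vertical`).

*Surjectivity.* It has to be shown that the `P_x` generate the spherical algebra. Over the local ring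
of rational functions which are regular at `v = q = 1`, the words in the `T_i`, `X_j`, `Y_j` of a
given bidegree span a finitely generated module (`lattice_fg`). Modulo the maximal ideal, these words
multiply as in the crossed product of the symmetric group with a commutative ring generated by the
`X_j`, `Y_j` (`isCrossed`), and the `P_{a,b}` with `a, b ≥ 0` become the power sums `∑ X_j^a Y_j^b`
(`IsPowerSumFamily.hasSym_quadrant`). Polarized power sums generate the symmetric polynomials in
characteristic zero (`IsCrossed.symmetrized_mem`), so that Nakayama's lemma applies
(`sandwich_mem_of_mem_lattice`). No basis of the double affine Hecke algebra is needed. Finally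
`X_1 ⋯ X_n Y_1 ⋯ Y_n` is a common denominator for all elements, and the inverses of its factors
are obtained from the `P_x` through the action of the quarter turn (`adjoin_range_eq_top`).
-/

namespace EllipticHall

/-! ### Braid relations in a group -/

section Braid

variable {G : Type*} [Group G]

/-- The product `f 0 * f 1 * ⋯ * f (k - 1)`. -/
def upProd {M : Type*} [Monoid M] (f : ℕ → M) : ℕ → M
  | 0 => 1
  | k + 1 => upProd f k * f k

/-- The product `f (k - 1) * ⋯ * f 1 * f 0`. -/
def downProd {M : Type*} [Monoid M] (f : ℕ → M) : ℕ → M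
  | 0 => 1
  | k + 1 => f k * downProd f k

/-- The positive half twist on `k` strands. -/
def halfTwist (T : ℕ → G) : ℕ → G
  | 0 => 1
  | k + 1 => upProd T k * halfTwist T k

/-- The sequence `x, T₀ x T₀, T₁ T₀ x T₀ T₁, …`. It is `X₁, X₂, …` for the family `T_i`, and
`Y₁, Y₂, …` for the family `T_i⁻¹`. -/
def strand (T : ℕ → G) (x : G) : ℕ → G
  | 0 => x
  | i + 1 => T i * strand T x i * T i

/-- `T₀, …, T_{n-2}` satisfy the relations of the braid group on `n` strands. The other `T_i` are
arbitrary. -/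
structure IsBraid (n : ℕ) (T : ℕ → G) : Prop where
  comm : ∀ i j, i + 1 < j → j + 1 < n → Commute (T i) (T j)
  braid : ∀ i, i + 2 < n → T i * T (i + 1) * T i = T (i + 1) * T i * T (i + 1)

/-- The relations between `x = X₁` and the `T_i` in the affine braid group of `GL(n)`. -/
structure IsAffine (n : ℕ) (T : ℕ → G) (x : G) : Prop where
  comm : ∀ i, 0 < i → i + 1 < n → Commute (T i) x
  braid : 1 < n → Commute x (T 0 * x * T 0)

theorem upProd_inv (T : ℕ → G) (k : ℕ) : upProd T⁻¹ k = (downProd T k)⁻¹ := by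
  induction k with
  | zero => simp [upProd, downProd]
  | succ k ih => simp [upProd, downProd, ih]

theorem downProd_inv (T : ℕ → G) (k : ℕ) : downProd T⁻¹ k = (upProd T k)⁻¹ := by
  induction k with
  | zero => simp [upProd, downProd]
  | succ k ih => simp [upProd, downProd, ih]

theorem strand_eq (T : ℕ → G) (x : G) (k : ℕ) :
    strand T x k = downProd T k * x * upProd T k := by
  induction k with
  | zero => simp [strand, upProd, downProd]
  | succ k ih => simp only [strand, upProd, downProd, ih, mul_assoc]

theorem IsBraid.inv {n : ℕ} {T : ℕ → G} (h : IsBraid n T) : IsBraid n T⁻¹ where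
  comm i j hij hj := (h.comm i j hij hj).inv_inv
  braid i hi := by
    have := congrArg (·⁻¹) (h.braid i hi)
    simpa [mul_assoc] using this

theorem IsBraid.commute_upProd {n : ℕ} {T : ℕ → G} (h : IsBraid n T) {i k : ℕ} (hk : k < i)
    (hi : i + 1 < n) : Commute (upProd T k) (T i) := by
  induction k with
  | zero => exact Commute.one_left _
  | succ k ih => exact (ih (by omega)).mul_left (h.comm k i hk hi)

theorem IsBraid.commute_halfTwist {n : ℕ} {T : ℕ → G} (h : IsBraid n T) {i k : ℕ} (hk : k ≤ i)
    (hi : i + 1 < n) : Commute (halfTwist T k) (T i) := by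
  induction k with
  | zero => exact Commute.one_left _
  | succ k ih => exact (h.commute_upProd (by omega) hi).mul_left (ih (by omega))

theorem IsBraid.upProd_mul {n : ℕ} {T : ℕ → G} (h : IsBraid n T) {i k : ℕ} (hk : i + 1 < k)
    (hn : k < n) : upProd T k * T i = T (i + 1) * upProd T k := by
  induction k with
  | zero => omega
  | succ k ih =>
    rcases Nat.lt_or_ge (i + 1) k with hik | hik
    · rw [upProd, mul_assoc, ← (h.comm i k hik hn).eq, ← mul_assoc, ih hik (by omega), mul_assoc]
    · obtain rfl : k = i + 1 := by omega
      have h1 := (h.commute_upProd (Nat.lt_succ_self i) hn).eq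
      rw [upProd, upProd, mul_assoc, mul_assoc, ← mul_assoc (T i), h.braid i hn,
        ← mul_assoc, ← mul_assoc, Nat.succ_eq_add_one] at *
      rw [h1]; simp only [mul_assoc]

theorem IsBraid.downProd_mul {n : ℕ} {T : ℕ → G} (h : IsBraid n T) {i k : ℕ} (hk : i + 1 < k)
    (hn : k < n) : downProd T k * T (i + 1) = T i * downProd T k := by
  have := congrArg (·⁻¹) (h.inv.upProd_mul hk hn)
  simpa [upProd_inv] using this.symm

theorem IsBraid.mul_upProd_mul_upProd {n : ℕ} {T : ℕ → G} (h : IsBraid n T) {j k : ℕ}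
    (hk : j < k) (hn : k < n) : T 0 * upProd T k * upProd T j = upProd T (j + 1) * upProd T k := by
  induction j with
  | zero => simp [upProd]
  | succ j ih =>
    rw [upProd, ← mul_assoc, ih (by omega), mul_assoc, h.upProd_mul hk hn, ← mul_assoc]
    rfl

/-- Conjugation by the half twist reverses the order of the strands. -/
theorem IsBraid.halfTwist_mul {n : ℕ} {T : ℕ → G} (h : IsBraid n T) {i j k : ℕ}
    (hk : i + j + 2 = k) (hn : k ≤ n) : halfTwist T k * T i = T j * halfTwist T k := by
  induction k generalizing i j with
  | zero => omega
  | succ k ih =>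
    rcases j with _ | j
    · obtain rfl : k = i + 1 := by omega
      rw [halfTwist, halfTwist, mul_assoc, mul_assoc, (h.commute_halfTwist le_rfl hn).eq,
        ← mul_assoc, ← mul_assoc, ← mul_assoc, ← mul_assoc,
        h.mul_upProd_mul_upProd (Nat.lt_succ_self i) hn, mul_assoc (upProd T (i + 1)) (upProd T i)]
      rfl
    · rw [halfTwist, mul_assoc, ih (by omega : i + j + 2 = k) (by omega), ← mul_assoc,
        h.upProd_mul (by omega) (by omega), mul_assoc]

theorem IsBraid.halfTwist_succ {n : ℕ} {T : ℕ → G} (h : IsBraid n T) {k : ℕ} (hk : k < n) :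
    halfTwist T (k + 1) = halfTwist T k * downProd T k := by
  induction k with
  | zero => simp [halfTwist, upProd, downProd]
  | succ k ih =>
    conv_lhs => rw [halfTwist, ih (by omega), upProd]
    rw [halfTwist, downProd]
    have := (h.commute_halfTwist (le_refl k) hk).eq
    calc _ = upProd T k * (T k * halfTwist T k) * downProd T k := by simp only [mul_assoc]
      _ = _ := by rw [← this]; simp only [mul_assoc]

theorem IsAffine.commute_strand_of_lt {n : ℕ} {T : ℕ → G} {x : G} (hT : IsBraid n T)
    (hx : IsAffine n T x) {i j : ℕ} (hij : j < i) (hi : i + 1 < n) :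
    Commute (T i) (strand T x j) := by
  induction j with
  | zero => exact hx.comm i hij hi
  | succ j ih =>
    have h1 := (hT.comm j i hij hi).symm
    exact (h1.mul_right (ih (by omega))).mul_right h1

theorem IsAffine.commute_strand_of_gt {n : ℕ} {T : ℕ → G} {x : G} (hT : IsBraid n T)
    (hx : IsAffine n T x) {i j : ℕ} (hij : i + 1 < j) (hj : j < n) :
    Commute (T i) (strand T x j) := by
  induction j with
  | zero => omega
  | succ j ih =>
    rcases Nat.lt_or_ge (i + 1) j with h | h
    · have h1 := hT.comm i j h hj
      exact (h1.mul_right (ih h (by omega))).mul_right h1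
    · obtain rfl : j = i + 1 := by omega
      have h1 := hx.commute_strand_of_lt hT (Nat.lt_succ_self i) hj
      have h2 := hT.braid i hj
      simp only [strand]
      set X := strand T x i
      change T i * _ = _ * T i
      calc T i * (T (i + 1) * (T i * X * T i) * T (i + 1))
          = (T i * T (i + 1) * T i) * X * T i * T (i + 1) := by simp only [mul_assoc]
        _ = T (i + 1) * T i * (T (i + 1) * X) * T i * T (i + 1) := by rw [h2]; simp only [mul_assoc]
        _ = T (i + 1) * T i * X * (T (i + 1) * T i * T (i + 1)) := by
          rw [h1.eq]; simp only [mul_assoc]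
        _ = _ := by rw [← h2]; simp only [mul_assoc]

theorem IsAffine.commute_strand {n : ℕ} {T : ℕ → G} {x : G} (hT : IsBraid n T)
    (hx : IsAffine n T x) {i j : ℕ} (hi : i < n) (hj : j < n) :
    Commute (strand T x i) (strand T x j) := by
  have h0 : ∀ j, j < n → Commute x (strand T x j) := by
    intro j hj
    rcases j with _ | j
    · exact Commute.refl _
    · induction j with
      | zero => exact hx.braid hj
      | succ j ih =>
        have h1 := (hx.comm (j + 1) (by omega) hj).symm
        exact (h1.mul_right (ih (by omega))).mul_right h1
  have main : ∀ i j, i < j → j < n → Commute (strand T x i) (strand T x j) := by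
    intro i j hij hj
    induction i with
    | zero => exact h0 j hj
    | succ i ih =>
      have h1 := hx.commute_strand_of_gt hT hij hj
      exact (h1.mul_left (ih (by omega))).mul_left h1
  rcases Nat.lt_trichotomy i j with h | h | h
  · exact main i j h hj
  · rw [h]
  · exact (main j i h hi).symm

theorem IsAffine.commute_prod {n : ℕ} {T : ℕ → G} {x : G} (hT : IsBraid n T)
    (hx : IsAffine n T x) {i k : ℕ} (hk : k ≤ n) (hi : i + 1 < k) :
    Commute (T i) (upProd (strand T x) k) := by
  induction k with
  | zero => omega
  | succ k ih =>
    rcases Nat.lt_or_ge (i + 1) k with h | h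
    · exact (ih (by omega) h).mul_right (hx.commute_strand_of_gt hT h (by omega))
    · obtain rfl : k = i + 1 := by omega
      have h1 : Commute (T i) (upProd (strand T x) i) := by
        have : ∀ m ≤ i, Commute (T i) (upProd (strand T x) m) := by
          intro m hm
          induction m with
          | zero => exact Commute.one_right _
          | succ m ih' =>
            exact (ih' (by omega)).mul_right (hx.commute_strand_of_lt hT (by omega) (by omega))
        exact this i le_rfl
      have h2 : Commute (strand T x i) (strand T x (i + 1)) :=
        hx.commute_strand hT (by omega) (by omega)
      have h3 : Commute (T i) (strand T x i * strand T x (i + 1)) := by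
        have h4 := h2.eq
        simp only [strand] at h4 ⊢
        set X := strand T x i
        change T i * _ = _ * T i
        calc _ = (T i * X * T i) * X * T i := by simp only [mul_assoc]
          _ = _ := by rw [← h4]
      simp only [upProd, mul_assoc]
      exact h1.mul_right h3

theorem commute_upProd_of {M : Type*} [Monoid M] {f : ℕ → M} {a : M} {k : ℕ}
    (h : ∀ i < k, Commute (f i) a) : Commute (upProd f k) a := by
  induction k with
  | zero => exact Commute.one_left _
  | succ k ih => exact (ih fun i hi => h i (by omega)).mul_left (h k (by omega))

theorem commute_downProd_of {M : Type*} [Monoid M] {f : ℕ → M} {a : M} {k : ℕ}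
    (h : ∀ i < k, Commute (f i) a) : Commute (downProd f k) a := by
  induction k with
  | zero => exact Commute.one_left _
  | succ k ih => exact (h k (by omega)).mul_left (ih fun i hi => h i (by omega))

theorem commute_halfTwist_of {T : ℕ → G} {a : G} {k : ℕ}
    (h : ∀ i, i + 1 < k → Commute (T i) a) : Commute (halfTwist T k) a := by
  induction k with
  | zero => exact Commute.one_left _
  | succ k ih =>
    exact (commute_upProd_of fun i hi => h i (by omega)).mul_left
      (ih fun i hi => h i (by omega))

theorem IsAffine.commute_halfTwist {n : ℕ} {T : ℕ → G} {x : G} (hT : IsBraid n T)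
    (hx : IsAffine n T x) {j k : ℕ} (hj : j ≤ k) (hk : k < n) :
    Commute (halfTwist T j) (strand T x k) :=
  commute_halfTwist_of fun _ hi => hx.commute_strand_of_gt hT (by omega) hk

/-- Reversing the strands with a half twist turns `X_n⁻¹` into an element generating
`X_n⁻¹, X_{n-1}⁻¹, …`. -/
theorem strand_conj_inv {n : ℕ} {T : ℕ → G} {x D : G}
    (hD : ∀ i j, i + j + 2 = n → D * T i = T j * D) {j k : ℕ} (hj : j + k + 1 = n) :
    strand T (D⁻¹ * (strand T x (n - 1))⁻¹ * D) j = D⁻¹ * (strand T x k)⁻¹ * D := by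
  induction j generalizing k with
  | zero => obtain rfl : k = n - 1 := by omega
            rfl
  | succ j ih =>
    rw [strand, ih (by omega : j + (k + 1) + 1 = n)]
    have h1 := hD j k (by omega)
    have h2 : T j * D⁻¹ = D⁻¹ * T k := by
      rw [mul_inv_eq_iff_eq_mul, mul_assoc, ← h1, inv_mul_cancel_left]
    simp only [strand]
    calc _ = (T j * D⁻¹) * (T k * strand T x k * T k)⁻¹ * (D * T j) := by simp only [mul_assoc]
      _ = _ := by rw [h1, h2]; group

/-! ### The elliptic braid group -/

/-- The relations between `T_i`, `x = X₁`, `y = Y₁` in the elliptic braid group, with a central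
element `q`. This is a presentation of the double affine Hecke algebra, the quadratic relations
of the `T_i` apart, which only involves `X₁` and `Y₁`. -/
structure IsElliptic (n : ℕ) (T : ℕ → G) (x y q : G) : Prop where
  isBraid : IsBraid n T
  affX : IsAffine n T x
  affY : IsAffine n T⁻¹ y
  central : ∀ g, Commute q g
  mixed : 1 < n → T 0 * x * (T 0)⁻¹ * y = y * T 0 * x * T 0
  loop : y * x = q * (upProd T (n - 1) * downProd T (n - 1)) * x * y

namespace IsElliptic

variable {n : ℕ} {T : ℕ → G} {x y q : G}

theorem commute_x (h : IsElliptic n T x y q) {i : ℕ} (h0 : 0 < i) (hi : i + 1 < n) :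
    Commute (T i) x := h.affX.comm i h0 hi

theorem commute_y (h : IsElliptic n T x y q) {i : ℕ} (h0 : 0 < i) (hi : i + 1 < n) :
    Commute (T i) y := by
  have := (h.affY.comm i h0 hi).inv_left
  rwa [Pi.inv_apply, inv_inv] at this

/-- The exchange of `x` and `y`. -/
theorem swap (h : IsElliptic n T x y q) : IsElliptic n T⁻¹ y x q⁻¹ where
  isBraid := h.isBraid.inv
  affX := h.affY
  affY := by rw [inv_inv]; exact h.affX
  central g := (h.central g).inv_left
  mixed hn := by
    have := h.mixed hn
    simp only [Pi.inv_apply, inv_inv]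
    calc _ = (T 0)⁻¹ * (y * T 0 * x * T 0) * (T 0)⁻¹ := by group
      _ = _ := by rw [← this]; group
  loop := by
    have := h.loop
    rw [upProd_inv, downProd_inv, ← mul_inv_rev]
    rw [mul_assoc, this]
    rw [(h.central (upProd T (n - 1) * downProd T (n - 1))).eq]
    group

theorem commute_T_y (h : IsElliptic n T x y q) (hn : 1 < n) :
    Commute (T 0) ((T 0)⁻¹ * y * (T 0)⁻¹ * y) := by
  have h3 := (h.affY.braid hn).eq
  simp only [Pi.inv_apply] at h3
  calc T 0 * ((T 0)⁻¹ * y * (T 0)⁻¹ * y) = y * ((T 0)⁻¹ * y * (T 0)⁻¹) * T 0 := by group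
    _ = _ := by rw [h3]

/-- Replacing `x` by `x * y`. -/
theorem mul_right (h : IsElliptic n T x y q) : IsElliptic n T (x * y) y q where
  isBraid := h.isBraid
  affX :=
    { comm := fun i h0 hi => (h.commute_x h0 hi).mul_right (h.commute_y h0 hi)
      braid := fun hn => by
        have h1 := h.mixed hn
        have h2 := (h.affX.braid hn).eq
        have h5 := (h.commute_T_y hn).eq
        set t := T 0
        have h4 : y * t * x = t * x * t⁻¹ * y * t⁻¹ := by rw [h1]; group
        change x * y * (t * (x * y) * t) = t * (x * y) * t * (x * y)
        calc x * y * (t * (x * y) * t) = x * (y * t * x) * y * t := by group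
          _ = x * (t * x * t) * t⁻¹ * ((t⁻¹ * y * t⁻¹ * y) * t) := by rw [h4]; group
          _ = t * x * (t * x * t⁻¹ * y * t⁻¹) * y := by rw [h2, ← h5]; group
          _ = _ := by rw [← h4]; group }
  affY := h.affY
  central := h.central
  mixed hn := by
    have h1 := h.mixed hn
    have h5 := (h.commute_T_y hn).eq
    set t := T 0
    have h4 : y * t * x = t * x * t⁻¹ * y * t⁻¹ := by rw [h1]; group
    calc t * (x * y) * t⁻¹ * y = t * x * (t * (t⁻¹ * y * t⁻¹ * y)) := by group
      _ = t * x * t⁻¹ * y * t⁻¹ * y * t := by rw [h5]; group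
      _ = _ := by rw [← h4]; group
  loop := by
    rw [← mul_assoc, h.loop]; group

/-- Replacing `x` by `x * y⁻¹`. -/
theorem mul_inv_right (h : IsElliptic n T x y q) : IsElliptic n T (x * y⁻¹) y q where
  isBraid := h.isBraid
  affX :=
    { comm := fun i h0 hi => (h.commute_x h0 hi).mul_right (h.commute_y h0 hi).inv_right
      braid := fun hn => by
        have h1 := h.mixed hn
        have h2 := (h.affX.braid hn).eq
        have h3 := (h.affY.braid hn).eq
        simp only [Pi.inv_apply] at h3
        set t := T 0
        have h4 : y⁻¹ * t * x = t * x * t * y⁻¹ * t := by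
          calc y⁻¹ * t * x = y⁻¹ * (t * x * t⁻¹ * y) * y⁻¹ * t := by group
            _ = _ := by rw [h1]; group
        have h6 : y⁻¹ * t * y⁻¹ * t = t * y⁻¹ * t * y⁻¹ := by
          have := congrArg (·⁻¹) h3
          simpa [mul_assoc] using this.symm
        change x * y⁻¹ * (t * (x * y⁻¹) * t) = t * (x * y⁻¹) * t * (x * y⁻¹)
        calc x * y⁻¹ * (t * (x * y⁻¹) * t) = x * (y⁻¹ * t * x) * y⁻¹ * t := by group
          _ = x * (t * x * t) * (y⁻¹ * t * y⁻¹ * t) := by rw [h4]; group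
          _ = t * x * (t * x * t * y⁻¹ * t) * y⁻¹ := by rw [h2, h6]; group
          _ = _ := by rw [← h4]; group }
  affY := h.affY
  central := h.central
  mixed hn := by
    have h1 := h.mixed hn
    have h3 := (h.affY.braid hn).eq
    simp only [Pi.inv_apply] at h3
    set t := T 0
    have h4 : y * t * x = t * x * t⁻¹ * y * t⁻¹ := by rw [h1]; group
    calc t * (x * y⁻¹) * t⁻¹ * y = t * x * y⁻¹ * (t⁻¹ * y * t⁻¹ * y) * y⁻¹ * t := by group
      _ = t * x * t⁻¹ * y * t⁻¹ * y⁻¹ * t := by rw [← h3]; group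
      _ = _ := by rw [← h4]; group
  loop := by
    rw [← mul_assoc, h.loop]; group

/-- The conjugate of `y` by `x`, read off from the loop relation. -/
theorem conj_eq (h : IsElliptic n T x y q) :
    x * y * x⁻¹ = q⁻¹ * (upProd T (n - 1) * downProd T (n - 1))⁻¹ * y := by
  have h1 := h.loop
  have h2 := (h.central (upProd T (n - 1) * downProd T (n - 1))⁻¹).inv_left.eq
  set L := upProd T (n - 1) * downProd T (n - 1)
  calc x * y * x⁻¹ = L⁻¹ * q⁻¹ * (q * L * x * y) * x⁻¹ := by group
    _ = _ := by rw [← h1, h2]; group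

/-- Up to `q`, the left-hand side is the image of `X₁` under the square of the quarter turn
`x ↦ x y x⁻¹`, `y ↦ x⁻¹`. -/
theorem strand_eq_conj_x (h : IsElliptic n T x y q) (hn : 0 < n) :
    (upProd T (n - 1) * downProd T (n - 1))⁻¹ * x⁻¹ =
      (halfTwist T n)⁻¹ * (strand T x (n - 1))⁻¹ * halfTwist T n := by
  obtain ⟨k, rfl⟩ : ∃ k, n = k + 1 := ⟨n - 1, by omega⟩
  have h1 := (h.affX.commute_halfTwist h.isBraid (le_refl k) (Nat.lt_succ_self k)).inv_right.eq
  rw [Nat.add_sub_cancel, h.isBraid.halfTwist_succ (Nat.lt_succ_self k)]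
  calc _ = (downProd T k)⁻¹ * (strand T x k)⁻¹ * downProd T k := by rw [strand_eq]; group
    _ = (downProd T k)⁻¹ * (halfTwist T k)⁻¹ * (halfTwist T k * (strand T x k)⁻¹) *
        downProd T k := by group
    _ = _ := by rw [h1]; group

/-- Up to `q`, the left-hand side is the image of `Y₁` under the square of the quarter turn
`x ↦ x y x⁻¹`, `y ↦ x⁻¹`. -/
theorem strand_eq_conj_y (h : IsElliptic n T x y q) (hn : 0 < n) :
    y⁻¹ * (upProd T (n - 1) * downProd T (n - 1)) =
      (halfTwist T n)⁻¹ * (strand T⁻¹ y (n - 1))⁻¹ * halfTwist T n := by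
  obtain ⟨k, rfl⟩ : ∃ k, n = k + 1 := ⟨n - 1, by omega⟩
  have h0 : Commute (halfTwist T k) (strand T⁻¹ y k) :=
    commute_halfTwist_of fun i hi => by
      have := (h.affY.commute_strand_of_gt h.isBraid.inv hi (Nat.lt_succ_self k)).inv_left
      rwa [Pi.inv_apply, inv_inv] at this
  have h1 := h0.inv_right.eq
  rw [Nat.add_sub_cancel, h.isBraid.halfTwist_succ (Nat.lt_succ_self k)]
  calc _ = (downProd T k)⁻¹ * (strand T⁻¹ y k)⁻¹ * downProd T k := by
        rw [strand_eq, upProd_inv, downProd_inv]; group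
    _ = (downProd T k)⁻¹ * (halfTwist T k)⁻¹ * (halfTwist T k * (strand T⁻¹ y k)⁻¹) *
        downProd T k := by group
    _ = _ := by rw [h1]; group

/-- Conjugation by `x = X₁` moves `Y_{j+1}` to `Y_j`, up to the conjugation by `T_{n-1} ⋯ T_1`.
Together with `x_conj_y` it describes the action of this conjugation on all the `Y_j`. -/
theorem x_conj_strand_succ (h : IsElliptic n T x y q) {j : ℕ} (hj : j + 1 < n) :
    x * strand T⁻¹ y (j + 1) * x⁻¹ =
      (downProd T (n - 1))⁻¹ * strand T⁻¹ y j * downProd T (n - 1) := by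
  induction j with
  | zero =>
    have h1 := h.mixed hj
    have h2 : ∀ k, k + 1 < n → (downProd T (k + 1))⁻¹ * y * downProd T (k + 1) =
        (T 0)⁻¹ * y * T 0 := by
      intro k hk
      induction k with
      | zero => simp [downProd]
      | succ k ih =>
        rw [← ih (by omega), downProd]
        have := (h.commute_y (Nat.succ_pos k) hk).eq
        calc _ = (downProd T (k + 1))⁻¹ * (T (k + 1))⁻¹ * (y * T (k + 1)) *
              downProd T (k + 1) := by group
          _ = _ := by rw [← this]; group
    obtain ⟨k, hk⟩ : ∃ k, n - 1 = k + 1 := ⟨n - 2, by omega⟩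
    rw [hk]
    simp only [strand, Pi.inv_apply]
    rw [h2 k (by omega)]
    set t := T 0
    calc x * (t⁻¹ * y * t⁻¹) * x⁻¹ = t⁻¹ * (t * x * t⁻¹ * y) * t⁻¹ * x⁻¹ := by group
      _ = _ := by rw [h1]; group
  | succ j ih =>
    have h1 := (h.commute_x (Nat.succ_pos j) hj).inv_left.eq
    have h2 := h.isBraid.downProd_mul (i := j) (k := n - 1) (by omega) (by omega)
    have h3 := ih (by omega)
    have h4 : downProd T (n - 1) * (T (j + 1))⁻¹ = (T j)⁻¹ * downProd T (n - 1) := by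
      rw [mul_inv_eq_iff_eq_mul, mul_assoc, h2, inv_mul_cancel_left]
    have h5 : x⁻¹ * (T (j + 1))⁻¹ = (T (j + 1))⁻¹ * x⁻¹ :=
      ((h.commute_x (Nat.succ_pos j) hj).inv_inv.eq).symm
    rw [strand, Pi.inv_apply]
    conv_rhs => rw [strand, Pi.inv_apply]
    have h6 : (T (j + 1))⁻¹ * (downProd T (n - 1))⁻¹ = (downProd T (n - 1))⁻¹ * (T j)⁻¹ := by
      rw [← mul_inv_rev, ← mul_inv_rev, h2]
    set t := T (j + 1)
    set d := downProd T (n - 1)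
    calc x * (t⁻¹ * strand T⁻¹ y (j + 1) * t⁻¹) * x⁻¹
        = (x * t⁻¹) * strand T⁻¹ y (j + 1) * (t⁻¹ * x⁻¹) := by group
      _ = t⁻¹ * (x * strand T⁻¹ y (j + 1) * x⁻¹) * t⁻¹ := by rw [← h1, ← h5]; group
      _ = (t⁻¹ * d⁻¹) * strand T⁻¹ y j * (d * t⁻¹) := by rw [h3]; group
      _ = _ := by rw [h4, h6]; group

theorem x_conj_y (h : IsElliptic n T x y q) :
    x * y * x⁻¹ = q⁻¹ * ((downProd T (n - 1))⁻¹ * strand T⁻¹ y (n - 1) * downProd T (n - 1)) := by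
  rw [h.conj_eq, strand_eq, upProd_inv, downProd_inv]; group

end IsElliptic

/-- The relation between `Y₁` and `X₁ ⋯ X_k`. -/
theorem conj_upProd {n : ℕ} {T : ℕ → G} {x y : G} (hT : IsBraid n T) (hx : IsAffine n T x)
    (hm : 1 < n → T 0 * x * (T 0)⁻¹ * y = y * T 0 * x * T 0)
    (hy : ∀ i, 0 < i → i + 1 < n → Commute (T i) y) {k : ℕ} (hk : k < n) :
    y * upProd (strand T x) (k + 1) * y⁻¹ = y * x * y⁻¹ * x⁻¹ *
      upProd (strand T x) (k + 1) * (upProd T k * downProd T k)⁻¹ := by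
  -- conjugation by `y` multiplies `X_{k+1}` by the inverse of a generator of the pure braid group
  have h1 : ∀ k, k + 1 < n → y * strand T x (k + 1) * y⁻¹ =
      strand T x (k + 1) * (upProd T k * T k * T k * (upProd T k)⁻¹)⁻¹ := by
    intro k hk
    induction k with
    | zero =>
      have := hm hk
      simp only [strand, upProd]
      set t := T 0
      calc y * (t * x * t) * y⁻¹ = (y * t * x * t) * y⁻¹ := by group
        _ = _ := by rw [← this]; group
    | succ k ih =>
      have h2 := (hy (k + 1) (Nat.succ_pos k) hk).eq
      have h3 := (hT.commute_upProd (Nat.lt_succ_self k) hk).eq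
      have h4 := hT.braid k hk
      have h5 := ih (by omega)
      have h6 : y * T (k + 1) = T (k + 1) * y := h2.symm
      have h7 : T (k + 1) * y⁻¹ = y⁻¹ * T (k + 1) :=
        (hy (k + 1) (Nat.succ_pos k) hk).inv_right.eq
      rw [strand]
      set X := strand T x (k + 1)
      rw [upProd]
      set u := upProd T k
      set s := T (k + 1)
      set t := T k
      have h8 : t * s * s * t⁻¹ = s⁻¹ * t * t * s := by
        calc t * s * s * t⁻¹ = s⁻¹ * (s * t * s) * s * t⁻¹ := by group
          _ = s⁻¹ * (t * s * t) * s * t⁻¹ := by rw [h4]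
          _ = s⁻¹ * t * (s * t * s) * t⁻¹ := by group
          _ = s⁻¹ * t * (t * s * t) * t⁻¹ := by rw [h4]
          _ = _ := by group
      calc y * (s * X * s) * y⁻¹ = (y * s) * X * (s * y⁻¹) := by group
        _ = s * (y * X * y⁻¹) * s := by rw [h6, h7]; group
        _ = (s * X * s) * s⁻¹ * (u * t * t * u⁻¹)⁻¹ * s := by rw [h5]; group
        _ = (s * X * s) * ((s⁻¹ * u * s) * (s⁻¹ * t * t * s) * (s⁻¹ * u * s)⁻¹)⁻¹ := by group
        _ = (s * X * s) * (u * (t * s * s * t⁻¹) * u⁻¹)⁻¹ := by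
          rw [mul_assoc s⁻¹ u s, h3, inv_mul_cancel_left, h8]
        _ = _ := by group
  induction k with
  | zero => simp [upProd, downProd, strand]
  | succ k ih =>
    have h2 := ih (by omega)
    have h3 := h1 k hk
    have h4 : Commute (upProd T k * downProd T k)⁻¹ (strand T x (k + 1)) := by
      refine Commute.inv_left (Commute.mul_left ?_ ?_)
      · exact commute_upProd_of fun i hi => hx.commute_strand_of_gt hT (by omega) hk
      · exact commute_downProd_of fun i hi => hx.commute_strand_of_gt hT (by omega) hk
    rw [upProd]
    set A := upProd (strand T x) (k + 1)
    rw [upProd, downProd]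
    set B := strand T x (k + 1)
    set c := y * x * y⁻¹ * x⁻¹
    calc y * (A * B) * y⁻¹ = (y * A * y⁻¹) * (y * B * y⁻¹) := by group
      _ = c * A * ((upProd T k * downProd T k)⁻¹ * B) *
          (upProd T k * T k * T k * (upProd T k)⁻¹)⁻¹ := by rw [h2, h3]; group
      _ = _ := by rw [h4.eq]; group

end Braid
end EllipticHall

namespace EllipticHall

section Braid

variable {G : Type*} [Group G]

/-- The relation `Y₁ X₁ ⋯ X_n = q X₁ ⋯ X_n Y₁`. -/
theorem IsElliptic.y_mul_upProd {n : ℕ} {T : ℕ → G} {x y q : G} (h : IsElliptic n T x y q)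
    (hn : 0 < n) : y * upProd (strand T x) n = q * (upProd (strand T x) n * y) := by
  obtain ⟨k, rfl⟩ : ∃ k, n = k + 1 := ⟨n - 1, by omega⟩
  have h1 := conj_upProd h.isBraid h.affX h.mixed (fun i h0 hi => h.commute_y h0 hi)
    (Nat.lt_succ_self k)
  have h2 := h.loop
  rw [Nat.add_sub_cancel] at h2
  have h3 : Commute (upProd T k * downProd T k) (upProd (strand T x) (k + 1)) :=
    (commute_upProd_of fun i hi => h.affX.commute_prod h.isBraid le_rfl (by omega)).mul_left
      (commute_downProd_of fun i hi => h.affX.commute_prod h.isBraid le_rfl (by omega))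
  set P := upProd (strand T x) (k + 1)
  set L := upProd T k * downProd T k
  calc y * P = (y * P * y⁻¹) * y := by group
    _ = y * x * y⁻¹ * x⁻¹ * (P * L⁻¹) * y := by rw [h1]; group
    _ = (y * x) * y⁻¹ * x⁻¹ * (L⁻¹ * P) * y := by rw [h3.inv_left.eq]
    _ = _ := by rw [h2]; group

/-- The converse: the loop relation follows from the relation of `Y₁` with `X₁ ⋯ X_n`. -/
theorem loop_of_y_mul_upProd {n : ℕ} {T : ℕ → G} {x y q : G} (hT : IsBraid n T)
    (hx : IsAffine n T x)
    (hm : 1 < n → T 0 * x * (T 0)⁻¹ * y = y * T 0 * x * T 0)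
    (hy : ∀ i, 0 < i → i + 1 < n → Commute (T i) y) (hn : 0 < n)
    (h : y * upProd (strand T x) n = q * (upProd (strand T x) n * y)) :
    y * x = q * (upProd T (n - 1) * downProd T (n - 1)) * x * y := by
  obtain ⟨k, rfl⟩ : ∃ k, n = k + 1 := ⟨n - 1, by omega⟩
  have h1 := conj_upProd hT hx hm hy (Nat.lt_succ_self k)
  rw [Nat.add_sub_cancel]
  have h3 : Commute (upProd T k * downProd T k) (upProd (strand T x) (k + 1)) :=
    (commute_upProd_of fun i hi => hx.commute_prod hT le_rfl (by omega)).mul_left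
      (commute_downProd_of fun i hi => hx.commute_prod hT le_rfl (by omega))
  set P := upProd (strand T x) (k + 1)
  set L := upProd T k * downProd T k
  calc y * x = (y * x * y⁻¹ * x⁻¹ * P * L⁻¹) * L * P⁻¹ * x * y := by group
    _ = (y * P) * y⁻¹ * L * P⁻¹ * x * y := by rw [← h1]
    _ = q * (P * L) * P⁻¹ * x * y := by rw [h]; group
    _ = _ := by rw [← h3.eq]; group

theorem prod_ofFn_eq_upProd {M : Type*} [Monoid M] (f : ℕ → M) (k : ℕ) :
    (List.ofFn fun j : Fin k => f j).prod = upProd f k := by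
  induction k with
  | zero => rfl
  | succ k ih =>
    rw [List.ofFn_succ', List.concat_eq_append, List.prod_append, upProd, ← ih]
    simp

theorem prod_ofFn_eq_downProd {M : Type*} [Monoid M] (f : ℕ → M) (k : ℕ) :
    (List.ofFn fun j : Fin k => f (k - 1 - j)).prod = downProd f k := by
  induction k with
  | zero => rfl
  | succ k ih =>
    rw [List.ofFn_succ, List.prod_cons, downProd, ← ih]
    congr 3
    funext i
    simp only [Fin.val_succ]
    congr 1
    omega

theorem map_upProd {M N F : Type*} [Monoid M] [Monoid N] [FunLike F M N] [MonoidHomClass F M N]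
    (φ : F) (f : ℕ → M) (k : ℕ) : φ (upProd f k) = upProd (fun i => φ (f i)) k := by
  induction k with
  | zero => exact map_one φ
  | succ k ih => rw [upProd, map_mul, ih]; rfl

theorem map_downProd {M N F : Type*} [Monoid M] [Monoid N] [FunLike F M N] [MonoidHomClass F M N]
    (φ : F) (f : ℕ → M) (k : ℕ) : φ (downProd f k) = downProd (fun i => φ (f i)) k := by
  induction k with
  | zero => exact map_one φ
  | succ k ih => rw [downProd, map_mul, ih]; rfl

theorem upProd_congr {M : Type*} [Monoid M] {f g : ℕ → M} {k : ℕ} (h : ∀ i < k, f i = g i) :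
    upProd f k = upProd g k := by
  induction k with
  | zero => rfl
  | succ k ih => rw [upProd, upProd, ih fun i hi => h i (by omega), h k (by omega)]

end Braid

/-! ### The double affine Hecke algebra through the elliptic braid group -/

theorem q'_ne_zero : q' ≠ 0 := by
  intro h
  have h1 : (MvPolynomial.X 1 : MvPolynomial (Fin 2) ℂ) = 0 := by
    apply IsFractionRing.injective (MvPolynomial (Fin 2) ℂ) K'
    rw [map_zero]; exact h
  exact MvPolynomial.X_ne_zero _ h1

/-- A nonzero scalar, as a unit of an algebra. -/
noncomputable def scalarUnit (A : Type*) [Ring A] [Algebra K' A] (c : K') (hc : c ≠ 0) : Aˣ :=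
  Units.map (algebraMap K' A : K' →* A) (Units.mk0 c hc)

/-- The central element `q` of the double affine Hecke algebra. -/
noncomputable def qUnit (A : Type*) [Ring A] [Algebra K' A] : Aˣ := scalarUnit A q' q'_ne_zero

theorem qUnit_val (A : Type*) [Ring A] [Algebra K' A] :
    ((qUnit A : Aˣ) : A) = algebraMap K' A q' := rfl

theorem qUnit_central {A : Type*} [Ring A] [Algebra K' A] (g : Aˣ) : Commute (qUnit A) g :=
  Units.ext (Algebra.commutes q' (g : A))

/-- The generators `T_i` as units, numbered from `0`, and continued by `1`. -/
noncomputable def unitT (n : ℕ) (i : ℕ) : (Daha n)ˣ :=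
  if h : i < n - 1 then
    { val := Daha.T ⟨i, h⟩
      inv := Daha.Tinv ⟨i, h⟩
      val_inv := by
        have := Daha.rel (DahaRel.T_inv (n := n) ⟨i, h⟩)
        rwa [map_mul, map_one] at this
      inv_val := by
        have := Daha.rel (DahaRel.inv_T (n := n) ⟨i, h⟩)
        rwa [map_mul, map_one] at this }
  else 1

/-- The generators `X_j` as units, numbered from `0`, and continued by `1`. -/
noncomputable def unitX (n : ℕ) (j : ℕ) : (Daha n)ˣ :=
  if h : j < n then
    { val := Daha.X ⟨j, h⟩
      inv := dahaMk n (gen (DahaGen.Xinv ⟨j, h⟩))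
      val_inv := by
        have := Daha.rel (DahaRel.X_inv (n := n) ⟨j, h⟩)
        rwa [map_mul, map_one] at this
      inv_val := by
        have := Daha.rel (DahaRel.inv_X (n := n) ⟨j, h⟩)
        rwa [map_mul, map_one] at this }
  else 1

/-- The generators `Y_j` as units, numbered from `0`, and continued by `1`. -/
noncomputable def unitY (n : ℕ) (j : ℕ) : (Daha n)ˣ :=
  if h : j < n then
    { val := Daha.Y ⟨j, h⟩
      inv := dahaMk n (gen (DahaGen.Yinv ⟨j, h⟩))
      val_inv := by
        have := Daha.rel (DahaRel.Y_inv (n := n) ⟨j, h⟩)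
        rwa [map_mul, map_one] at this
      inv_val := by
        have := Daha.rel (DahaRel.inv_Y (n := n) ⟨j, h⟩)
        rwa [map_mul, map_one] at this }
  else 1

variable {n : ℕ}

theorem unitT_val {i : ℕ} (h : i < n - 1) : ((unitT n i : (Daha n)ˣ) : Daha n) = Daha.T ⟨i, h⟩ := by
  rw [unitT, dif_pos h]

theorem unitT_inv_val {i : ℕ} (h : i < n - 1) :
    (((unitT n i)⁻¹ : (Daha n)ˣ) : Daha n) = Daha.Tinv ⟨i, h⟩ := by
  rw [unitT, dif_pos h]; rfl

theorem unitX_val {j : ℕ} (h : j < n) : ((unitX n j : (Daha n)ˣ) : Daha n) = Daha.X ⟨j, h⟩ := by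
  rw [unitX, dif_pos h]

theorem unitX_inv_val {j : ℕ} (h : j < n) : (((unitX n j)⁻¹ : (Daha n)ˣ) : Daha n) =
    dahaMk n (gen (DahaGen.Xinv ⟨j, h⟩)) := by
  rw [unitX, dif_pos h]; rfl

theorem unitY_val {j : ℕ} (h : j < n) : ((unitY n j : (Daha n)ˣ) : Daha n) = Daha.Y ⟨j, h⟩ := by
  rw [unitY, dif_pos h]

theorem unitY_inv_val {j : ℕ} (h : j < n) : (((unitY n j)⁻¹ : (Daha n)ˣ) : Daha n) =
    dahaMk n (gen (DahaGen.Yinv ⟨j, h⟩)) := by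
  rw [unitY, dif_pos h]; rfl

theorem unitT_isBraid (n : ℕ) : IsBraid n (unitT n) where
  comm i j hij hj := Units.ext (by
    rw [Units.val_mul, Units.val_mul, unitT_val (by omega : i < n - 1),
      unitT_val (by omega : j < n - 1)]
    exact Daha.T_comm _ _ hij)
  braid i hi := Units.ext (by
    simp only [Units.val_mul]
    rw [unitT_val (by omega : i < n - 1), unitT_val (by omega : i + 1 < n - 1)]
    exact Daha.T_braid _ _ rfl)

theorem strand_unitX {j : ℕ} (hj : j < n) : strand (unitT n) (unitX n 0) j = unitX n j := by
  induction j with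
  | zero => rfl
  | succ j ih =>
    rw [strand, ih (by omega)]
    have := Daha.rel (DahaRel.T_X_T (n := n) ⟨j, by omega⟩)
    rw [map_mul, map_mul] at this
    apply Units.ext
    rw [Units.val_mul, Units.val_mul, unitT_val (by omega : j < n - 1), unitX_val hj,
      unitX_val (by omega : j < n)]
    exact this

theorem strand_unitY {j : ℕ} (hj : j < n) : strand (unitT n)⁻¹ (unitY n 0) j = unitY n j := by
  induction j with
  | zero => rfl
  | succ j ih =>
    rw [strand, ih (by omega)]
    have := Daha.rel (DahaRel.T_Y_T (n := n) ⟨j, by omega⟩)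
    rw [map_mul, map_mul] at this
    apply Units.ext
    rw [Pi.inv_apply, Units.val_mul, Units.val_mul, unitT_inv_val (by omega : j < n - 1),
      unitY_val hj, unitY_val (by omega : j < n)]
    exact this

/-- The relation `T_{i+1} X_i = X_i T_{i+1}` follows from `T_i X_{i+2} = X_{i+2} T_i`, which is
among the defining ones. -/
theorem IsAffine.mk_of_far {G : Type*} [Group G] {T : ℕ → G} {x : G} (hT : IsBraid n T)
    (hc : ∀ i, 1 < i → i + 1 < n → Commute (T i) x)
    (h2 : 2 < n → Commute (T 0) (strand T x 2)) (hb : 1 < n → Commute x (T 0 * x * T 0)) :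
    IsAffine n T x where
  comm i h0 hi := by
    rcases Nat.lt_or_ge 1 i with h | h
    · exact hc i h hi
    · obtain rfl : i = 1 := by omega
      have h3 := (h2 hi).eq
      have h4 := hT.braid 0 hi
      simp only [strand, Nat.zero_add] at h3 h4
      set t := T 0
      set s := T 1
      change s * x = x * s
      calc s * x = t⁻¹ * s⁻¹ * (s * t * s) * x * (t * s) * s⁻¹ * t⁻¹ := by group
        _ = t⁻¹ * s⁻¹ * (t * (s * (t * x * t) * s)) * s⁻¹ * t⁻¹ := by rw [← h4]; group
        _ = x * (t * s * t) * s⁻¹ * t⁻¹ := by rw [h3]; group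
        _ = _ := by rw [h4]; group
  braid := hb

theorem daha_isElliptic (hn : 0 < n) :
    IsElliptic n (unitT n) (unitX n 0) (unitY n 0) (qUnit (Daha n)) := by
  have hXX : ∀ i j, i < n → j < n → Commute (unitX n i) (unitX n j) := fun i j hi hj =>
    Units.ext (by
      rw [Units.val_mul, Units.val_mul, unitX_val hi, unitX_val hj]
      have := Daha.rel (DahaRel.X_X (n := n) ⟨i, hi⟩ ⟨j, hj⟩)
      rwa [map_mul, map_mul] at this)
  have hYY : ∀ i j, i < n → j < n → Commute (unitY n i) (unitY n j) := fun i j hi hj =>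
    Units.ext (by
      rw [Units.val_mul, Units.val_mul, unitY_val hi, unitY_val hj]
      have := Daha.rel (DahaRel.Y_Y (n := n) ⟨i, hi⟩ ⟨j, hj⟩)
      rwa [map_mul, map_mul] at this)
  have hTX : ∀ i k, i + 1 < n → k < n → (i + 1 < k ∨ k + 1 < i) →
      Commute (unitT n i) (unitX n k) := fun i k hi hk h => Units.ext (by
      rw [Units.val_mul, Units.val_mul, unitT_val (by omega : i < n - 1), unitX_val hk]
      have := Daha.rel (DahaRel.T_X (n := n) ⟨i, by omega⟩ ⟨k, hk⟩ h)
      rwa [map_mul, map_mul] at this)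
  have hTY : ∀ i k, i + 1 < n → k < n → (i + 1 < k ∨ k + 1 < i) →
      Commute (unitT n i) (unitY n k) := fun i k hi hk h => Units.ext (by
      rw [Units.val_mul, Units.val_mul, unitT_val (by omega : i < n - 1), unitY_val hk]
      have := Daha.rel (DahaRel.T_Y (n := n) ⟨i, by omega⟩ ⟨k, hk⟩ h)
      rwa [map_mul, map_mul] at this)
  have hT := unitT_isBraid n
  have hx : IsAffine n (unitT n) (unitX n 0) := IsAffine.mk_of_far hT
    (fun i h1 hi => hTX i 0 hi hn (Or.inr h1))
    (fun h => by rw [strand_unitX h]; exact hTX 0 2 (by omega) h (Or.inl (by omega)))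
    (fun h => by
      have := strand_unitX h
      simp only [strand] at this
      rw [this]; exact hXX 0 1 hn h)
  have hy : IsAffine n (unitT n)⁻¹ (unitY n 0) := IsAffine.mk_of_far hT.inv
    (fun i h1 hi => (hTY i 0 hi hn (Or.inr h1)).inv_left)
    (fun h => by
      rw [strand_unitY h]; exact (hTY 0 2 (by omega) h (Or.inl (by omega))).inv_left)
    (fun h => by
      have := strand_unitY h
      simp only [strand] at this
      rw [this]; exact hYY 0 1 hn h)
  have hy' : ∀ i, 0 < i → i + 1 < n → Commute (unitT n i) (unitY n 0) := fun i h0 hi => by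
    have := (hy.comm i h0 hi).inv_left
    rwa [Pi.inv_apply, inv_inv] at this
  have hm : 1 < n → unitT n 0 * unitX n 0 * (unitT n 0)⁻¹ * unitY n 0 =
      unitY n 0 * unitT n 0 * unitX n 0 * unitT n 0 := by
    intro h
    have h1 := Daha.rel (DahaRel.X_Y (n := n) ⟨0, by omega⟩ rfl)
    simp only [map_mul] at h1
    have h2 : (unitX n 0)⁻¹ * unitY n 1 =
        unitY n 1 * (unitX n 0)⁻¹ * ((unitT n 0)⁻¹ * (unitT n 0)⁻¹) := by
      apply Units.ext
      simp only [Units.val_mul]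
      rw [unitX_inv_val hn, unitY_val h, unitT_inv_val (by omega : 0 < n - 1)]
      exact h1
    have h3 := strand_unitY h
    simp only [strand, Pi.inv_apply] at h3
    set x := unitX n 0
    set y := unitY n 0
    set t := unitT n 0
    calc t * x * t⁻¹ * y = t * x * (t⁻¹ * y * t⁻¹) * x⁻¹ * (t⁻¹ * t⁻¹) * (t * t) * x * t := by group
      _ = t * x * (unitY n 1 * x⁻¹ * (t⁻¹ * t⁻¹)) * (t * t) * x * t := by rw [h3]; group
      _ = t * (t⁻¹ * y * t⁻¹) * (t * t) * x * t := by rw [← h2, h3]; group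
      _ = _ := by group
  have hq : ∀ g, Commute (qUnit (Daha n)) g := qUnit_central
  refine ⟨hT, hx, hy, hq, hm, loop_of_y_mul_upProd hT hx hm hy' hn ?_⟩
  have h1 := Daha.rel (DahaRel.Y_prod_X (n := n) hn)
  rw [map_mul, map_smul, map_mul, map_list_prod, List.map_ofFn] at h1
  have h2 : ((upProd (strand (unitT n) (unitX n 0)) n : (Daha n)ˣ) : Daha n) =
      (List.ofFn (dahaMk n ∘ fun j : Fin n => gen (DahaGen.X j))).prod := by
    rw [upProd_congr (g := unitX n) fun i hi => strand_unitX hi]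
    rw [← Units.coeHom_apply, map_upProd, ← prod_ofFn_eq_upProd]
    congr 2
    funext j
    exact unitX_val j.2
  apply Units.ext
  simp only [Units.val_mul]
  rw [h2, unitY_val hn, qUnit_val, ← Algebra.smul_def]
  exact h1

/-- A homomorphism from the double affine Hecke algebra is determined by its values at the `T_i`,
`X₁` and `Y₁`. -/
theorem Daha.hom_ext {A : Type*} [Ring A] [Algebra K' A] {f g : Daha n →ₐ[K'] A}
    (hT : ∀ i, f (Daha.T i) = g (Daha.T i))
    (hX : f (unitX n 0 : Daha n) = g (unitX n 0 : Daha n))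
    (hY : f (unitY n 0 : Daha n) = g (unitY n 0 : Daha n)) : f = g := by
  have hu : ∀ u : (Daha n)ˣ, f (u : Daha n) = g (u : Daha n) →
      f ((u⁻¹ : (Daha n)ˣ) : Daha n) = g ((u⁻¹ : (Daha n)ˣ) : Daha n) := by
    intro u hu
    have h1 : Units.map (f : Daha n →* A) u = Units.map (g : Daha n →* A) u := Units.ext hu
    exact congrArg (fun w : Aˣ => ((w⁻¹ : Aˣ) : A)) h1
  have hT' : ∀ i, f (unitT n i : Daha n) = g (unitT n i : Daha n) := fun i => by
    by_cases h : i < n - 1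
    · rw [unitT_val h]; exact hT _
    · rw [unitT, dif_neg h, Units.val_one, map_one, map_one]
  have hX' : ∀ j, j < n → f (unitX n j : Daha n) = g (unitX n j : Daha n) := fun j hj => by
    rw [← strand_unitX hj]
    clear hj
    induction j with
    | zero => exact hX
    | succ j ih => simp only [strand, Units.val_mul, map_mul, ih, hT']
  have hY' : ∀ j, j < n → f (unitY n j : Daha n) = g (unitY n j : Daha n) := fun j hj => by
    rw [← strand_unitY hj]
    clear hj
    induction j with
    | zero => exact hY
    | succ j ih => simp only [strand, Units.val_mul, map_mul, ih, Pi.inv_apply, hu _ (hT' j)]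
  apply RingQuot.ringQuot_ext'
  apply FreeAlgebra.hom_ext
  funext a
  rcases a with i | i | j | j | j | j
  · exact hT i
  · have := hu _ (hT' i)
    rw [unitT_inv_val i.2] at this
    exact this
  · have := hX' _ j.2
    rw [unitX_val j.2] at this
    exact this
  · have := hu _ (hX' _ j.2)
    rw [unitX_inv_val j.2] at this
    exact this
  · have := hY' _ j.2
    rw [unitY_val j.2] at this
    exact this
  · have := hu _ (hY' _ j.2)
    rw [unitY_inv_val j.2] at this
    exact this

/-- The values of a homomorphism from the double affine Hecke algebra at the generators. -/
noncomputable def genValue {A : Type*} [Ring A] (T : ℕ → Aˣ) (x y : Aˣ) : DahaGen n → A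
  | .T i => T i
  | .Tinv i => ((T i)⁻¹ : Aˣ)
  | .X j => (strand T x j : Aˣ)
  | .Xinv j => ((strand T x j)⁻¹ : Aˣ)
  | .Y j => (strand T⁻¹ y j : Aˣ)
  | .Yinv j => ((strand T⁻¹ y j)⁻¹ : Aˣ)

theorem genValue_rel {A : Type*} [Ring A] [Algebra K' A] {T : ℕ → Aˣ} {x y : Aˣ} (hn : 0 < n)
    (h : IsElliptic n T x y (qUnit A))
    (hH : ∀ i, i + 1 < n →
      ((T i : A) + algebraMap K' A v'⁻¹) * ((T i : A) - algebraMap K' A v') = 0)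
    {a b : FreeDaha n} (hab : DahaRel n a b) :
    FreeAlgebra.lift K' (genValue T x y) a = FreeAlgebra.lift K' (genValue T x y) b := by
  have hg : ∀ c, FreeAlgebra.lift K' (genValue T x y) (gen c : FreeDaha n) = genValue T x y c :=
    fun c => FreeAlgebra.lift_ι_apply _ _
  cases hab with
  | T_inv i => simp [hg, genValue]
  | inv_T i => simp [hg, genValue]
  | X_inv i => simp [hg, genValue]
  | inv_X i => simp [hg, genValue]
  | Y_inv i => simp [hg, genValue]
  | inv_Y i => simp [hg, genValue]
  | hecke i =>
    simp only [map_mul, map_add, map_sub, hg, AlgHom.commutes, map_zero, genValue]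
    exact hH i (by omega)
  | braid i j hij =>
    simp only [map_mul, hg, genValue, ← Units.val_mul, Units.val_inj, hij]
    exact h.isBraid.braid i (by omega)
  | T_T i k hik =>
    simp only [map_mul, hg, genValue, ← Units.val_mul, Units.val_inj]
    rcases hik with hik | hik
    · exact h.isBraid.comm _ _ hik (by omega)
    · exact (h.isBraid.comm _ _ hik (by omega)).symm
  | X_X j k =>
    simp only [map_mul, hg, genValue, ← Units.val_mul, Units.val_inj]
    exact h.affX.commute_strand h.isBraid j.2 k.2
  | Y_Y j k =>
    simp only [map_mul, hg, genValue, ← Units.val_mul, Units.val_inj]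
    exact h.affY.commute_strand h.isBraid.inv j.2 k.2
  | T_X_T i => simp only [map_mul, hg, genValue, ← Units.val_mul, lo, hi, strand]
  | T_Y_T i =>
    simp only [map_mul, hg, genValue, ← Units.val_mul, lo, hi, strand, Pi.inv_apply]
  | T_X i k hik =>
    simp only [map_mul, hg, genValue, ← Units.val_mul, Units.val_inj]
    rcases hik with hik | hik
    · exact h.affX.commute_strand_of_gt h.isBraid hik k.2
    · exact h.affX.commute_strand_of_lt h.isBraid (by omega) (by omega)
  | T_Y i k hik =>
    simp only [map_mul, hg, genValue, ← Units.val_mul, Units.val_inj]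
    have : Commute (T⁻¹ i) (strand T⁻¹ y k) := by
      rcases hik with hik | hik
      · exact h.affY.commute_strand_of_gt h.isBraid.inv hik k.2
      · exact h.affY.commute_strand_of_lt h.isBraid.inv (by omega) (by omega)
    have := this.inv_left
    rwa [Pi.inv_apply, inv_inv] at this
  | Y_prod_X h0 =>
    have h1 := congrArg (Units.val) (h.y_mul_upProd hn)
    have h2 : (List.ofFn fun j : Fin n => ((strand T x j : Aˣ) : A)).prod =
        (upProd (strand T x) n : Aˣ) := by
      rw [← Units.coeHom_apply, map_upProd, ← prod_ofFn_eq_upProd]; rfl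
    rw [map_mul, map_smul, map_mul, map_list_prod, List.map_ofFn]
    simp only [Function.comp_def, hg, genValue, h2, Algebra.smul_def]
    simpa [strand, qUnit_val] using h1
  | X_Y i h0 =>
    obtain ⟨i, hi⟩ := i
    obtain rfl : i = 0 := h0
    simp only [map_mul, hg, genValue, ← Units.val_mul, Units.val_inj, lo, EllipticHall.hi, strand,
      Pi.inv_apply]
    have h1 := h.mixed (by omega)
    set t := T 0
    calc x⁻¹ * (t⁻¹ * y * t⁻¹) = x⁻¹ * t⁻¹ * (y * t * x * t) * t⁻¹ * x⁻¹ * t⁻¹ * t⁻¹ := by group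
      _ = _ := by rw [← h1]; group

/-- The homomorphism from the double affine Hecke algebra with given values of the `T_i`, `X₁`
and `Y₁`. -/
noncomputable def Daha.lift {A : Type*} [Ring A] [Algebra K' A] {T : ℕ → Aˣ} {x y : Aˣ}
    (hn : 0 < n) (h : IsElliptic n T x y (qUnit A))
    (hH : ∀ i, i + 1 < n →
      ((T i : A) + algebraMap K' A v'⁻¹) * ((T i : A) - algebraMap K' A v') = 0) :
    Daha n →ₐ[K'] A :=
  RingQuot.liftAlgHom K' ⟨FreeAlgebra.lift K' (genValue T x y), fun _ _ hab =>
    genValue_rel hn h hH hab⟩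

theorem Daha.lift_gen {A : Type*} [Ring A] [Algebra K' A] {T : ℕ → Aˣ} {x y : Aˣ}
    (hn : 0 < n) (h : IsElliptic n T x y (qUnit A))
    (hH : ∀ i, i + 1 < n →
      ((T i : A) + algebraMap K' A v'⁻¹) * ((T i : A) - algebraMap K' A v') = 0) (c : DahaGen n) :
    Daha.lift hn h hH (dahaMk n (gen c)) = genValue T x y c := by
  have := RingQuot.liftAlgHom_mkAlgHom_apply K' (FreeAlgebra.lift K' (genValue (n := n) T x y))
    (fun _ _ hab => genValue_rel hn h hH hab) (gen c)
  rw [gen, FreeAlgebra.lift_ι_apply] at this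
  exact this

end EllipticHall

namespace EllipticHall

/-! ### The group `SL(2,ℤ)` by generators and relations -/

section Modular

/-- The matrix of the rotation by a quarter turn. -/
def rotSL : SL2Z := A1 * A2⁻¹ * A1

theorem rotSL_val : rotSL.1 = !![0, -1; 1, 0] := by
  rw [rotSL, Matrix.SpecialLinearGroup.coe_mul, Matrix.SpecialLinearGroup.coe_mul,
    Matrix.SpecialLinearGroup.coe_inv]
  simp [A1, A2, Matrix.adjugate_fin_two]

theorem rotSL_eq : rotSL = A2⁻¹ * A1 * A2⁻¹ := by
  apply Subtype.ext
  rw [rotSL_val, Matrix.SpecialLinearGroup.coe_mul, Matrix.SpecialLinearGroup.coe_mul,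
    Matrix.SpecialLinearGroup.coe_inv]
  simp [A1, A2, Matrix.adjugate_fin_two]

theorem rotSL_sq_val : (rotSL ^ 2).1 = !![-1, 0; 0, -1] := by
  rw [pow_two, Matrix.SpecialLinearGroup.coe_mul, rotSL_val]
  simp

theorem rotSL_pow_four : rotSL ^ 4 = 1 := by
  rw [show 4 = 2 * 2 from rfl, pow_mul, pow_two (rotSL ^ 2)]
  apply Subtype.ext
  rw [Matrix.SpecialLinearGroup.coe_mul, rotSL_sq_val, Matrix.SpecialLinearGroup.coe_one]
  simp [Matrix.one_fin_two]

theorem closure_A1_A2 : Subgroup.closure {A1, A2} = (⊤ : Subgroup SL2Z) := by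
  rw [eq_top_iff, ← SpecialLinearGroup.SL2Z_generators, Subgroup.closure_le]
  have h1 : A1 ∈ Subgroup.closure {A1, A2} := Subgroup.subset_closure (by simp)
  have h2 : A2 ∈ Subgroup.closure {A1, A2} := Subgroup.subset_closure (by simp)
  rintro x (rfl | rfl)
  · have : ModularGroup.S = rotSL := Subtype.ext (by rw [rotSL_val]; rfl)
    rw [SetLike.mem_coe, this]
    exact mul_mem (mul_mem h1 (inv_mem h2)) h1
  · exact h2

/-- The product of a word in two letters. -/
def letterProd {M : Type*} [Monoid M] (a b : M) (w : List Bool) : M :=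
  (w.map fun c => if c then a else b).prod

theorem letterProd_cons {M : Type*} [Monoid M] (a b : M) (c : Bool) (w : List Bool) :
    letterProd a b (c :: w) = (if c then a else b) * letterProd a b w := by
  simp only [letterProd, List.map_cons, List.prod_cons]

theorem letterProd_pos (w : List Bool) : (∀ i j, 0 ≤ (letterProd A1 A2 w).1 i j) ∧
    ∀ i, 1 ≤ (letterProd A1 A2 w).1 i i := by
  induction w with
  | nil =>
    simp only [letterProd, List.map_nil, List.prod_nil, Matrix.SpecialLinearGroup.coe_one]
    exact ⟨fun i j => by fin_cases i <;> fin_cases j <;> simp, fun i => by simp⟩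
  | cons c w ih =>
    obtain ⟨h1, h2⟩ := ih
    have e : (letterProd A1 A2 (c :: w)).1 =
        (if c then A1 else A2).1 * (letterProd A1 A2 w).1 := by
      rw [letterProd_cons]; rfl
    rw [e]
    set m := (letterProd A1 A2 w).1
    have a00 := h1 0 0
    have a01 := h1 0 1
    have a10 := h1 1 0
    have a11 := h1 1 1
    have b0 := h2 0
    have b1 := h2 1
    constructor
    · intro i j
      cases c <;> fin_cases i <;> fin_cases j <;>
        simp [A1, A2, Matrix.mul_apply, Fin.sum_univ_two] <;> omega
    · intro i
      cases c <;> fin_cases i <;>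
        simp [A1, A2, Matrix.mul_apply, Fin.sum_univ_two] <;> omega

theorem eq_nil_of_letterProd_eq_one {w : List Bool} (h : letterProd A1 A2 w = 1) : w = [] := by
  rcases w with _ | ⟨c, w⟩
  · rfl
  · exfalso
    obtain ⟨h1, h2⟩ := letterProd_pos w
    have e : (letterProd A1 A2 (c :: w)).1 =
        (if c then A1 else A2).1 * (letterProd A1 A2 w).1 := by
      rw [letterProd_cons]; rfl
    rw [h] at e
    set m := (letterProd A1 A2 w).1
    have e1 := congrFun (congrFun e 1) 0
    have e2 := congrFun (congrFun e 0) 1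
    have a01 := h1 0 1
    have a10 := h1 1 0
    have b0 := h2 0
    have b1 := h2 1
    cases c
    · simp [A2, Matrix.mul_apply, Fin.sum_univ_two] at e2
      omega
    · simp [A1, Matrix.mul_apply, Fin.sum_univ_two] at e1
      omega

variable {G : Type*} [Group G]

/-- Two elements `a`, `b` of a group with the relations of `A_1`, `A_2`. -/
structure IsModularPair (a b : G) : Prop where
  braid : a * b⁻¹ * a = b⁻¹ * a * b⁻¹
  order : (a * b⁻¹ * a) ^ 4 = 1

namespace IsModularPair

variable {a b : G}

theorem rot_a (h : IsModularPair a b) : a * b⁻¹ * a * a = b⁻¹ * (a * b⁻¹ * a) := by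
  have := h.braid
  calc a * b⁻¹ * a * a = (b⁻¹ * a * b⁻¹) * a := by rw [← this]
    _ = _ := by group

theorem a_rot (h : IsModularPair a b) : a * (a * b⁻¹ * a) = a * b⁻¹ * a * b⁻¹ := by
  have := h.braid
  calc a * (a * b⁻¹ * a) = a * (b⁻¹ * a * b⁻¹) := by rw [← this]
    _ = _ := by group

/-- In a group generated by a pair with the relations of `A_1`, `A_2`, every element is a word in
`a`, `b` without inverses, up to powers of the rotation on both sides. -/
theorem normal_form (h : IsModularPair a b) {g : G} (hg : g ∈ Subgroup.closure {a, b}) :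
    ∃ (k l : ℕ) (w : List Bool),
      g = (a * b⁻¹ * a) ^ k * letterProd a b w * (a * b⁻¹ * a) ^ l := by
  have h1 := h.rot_a
  have h2 := h.a_rot
  have h4 := h.order
  have h0 := h.braid
  obtain ⟨s, hs⟩ : ∃ s, s = a * b⁻¹ * a := ⟨_, rfl⟩
  rw [← hs] at h0 h1 h2 h4 ⊢
  set N : Set G := {g | ∃ (k l : ℕ) (w : List Bool), g = s ^ k * letterProd a b w * s ^ l}
  have hsN : ∀ g ∈ N, s * g ∈ N := by
    rintro _ ⟨k, l, w, rfl⟩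
    exact ⟨k + 1, l, w, by rw [pow_succ']; group⟩
  have hsN' : ∀ g ∈ N, s⁻¹ * g ∈ N := by
    intro g hg
    have : s⁻¹ = s * (s * s) := by
      rw [inv_eq_iff_mul_eq_one, ← h4]; simp only [pow_succ, pow_zero, one_mul, mul_assoc]
    rw [this, mul_assoc, mul_assoc]
    exact hsN _ (hsN _ (hsN _ hg))
  have hcomm : Commute (s ^ 2) a := by
    change s ^ 2 * a = a * s ^ 2
    have h3 : s * b⁻¹ = a * s := h2.symm
    calc s ^ 2 * a = s * (s * a) := by rw [pow_two, mul_assoc]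
      _ = (s * b⁻¹) * s := by rw [h1]; group
      _ = _ := by rw [h3, pow_two, mul_assoc]
  have haN : ∀ g ∈ N, a * g ∈ N := by
    rintro _ ⟨k, l, w, rfl⟩
    obtain ⟨m, rfl | rfl⟩ := Nat.even_or_odd' k
    · refine ⟨2 * m, l, true :: w, ?_⟩
      have h3 := (hcomm.pow_left m).eq
      rw [pow_mul]
      simp only [letterProd, List.map_cons, List.prod_cons, if_true]
      simp only [← mul_assoc, h3]
    · have h3 := (hcomm.pow_left m).eq
      have e : ∀ u, a * (s ^ (2 * m + 1) * u * s ^ l) = s ^ (2 * m) * (a * s * u) * s ^ l := by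
        intro u
        rw [pow_succ, pow_mul]
        simp only [← mul_assoc, h3]
      rw [e]
      rcases w with _ | ⟨c, w⟩
      · refine ⟨2 * m, l + 1, [true], ?_⟩
        simp only [letterProd, List.map_nil, List.prod_nil, List.map_cons, List.prod_cons, if_true]
        rw [pow_succ']; group
      · rcases c with _ | _
        · refine ⟨2 * m + 1, l, w, ?_⟩
          simp only [letterProd, List.map_cons, List.prod_cons]
          rw [h2, pow_succ]
          simp
          group
        · refine ⟨2 * m + 2, l, false :: w, ?_⟩
          simp only [letterProd, List.map_cons, List.prod_cons, if_true]
          have h5 : a * s * a = s * s * b := by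
            calc a * s * a = s * b⁻¹ * a := by rw [h2]
              _ = s * (b⁻¹ * a * b⁻¹) * b := by group
              _ = _ := by rw [← h0]
          rw [← mul_assoc (a * s), h5, pow_add, pow_two]
          simp
          group
  have hbN' : ∀ g ∈ N, b⁻¹ * g ∈ N := by
    intro g hg
    have : b⁻¹ = s⁻¹ * (a * s) := by rw [h2]; group
    rw [this, mul_assoc, mul_assoc]
    exact hsN' _ (haN _ (hsN _ hg))
  have hbN : ∀ g ∈ N, b * g ∈ N := by
    intro g hg
    have : b = a * (s⁻¹ * a) := by rw [hs]; group
    rw [this, mul_assoc, mul_assoc]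
    exact haN _ (hsN' _ (haN _ hg))
  have haN' : ∀ g ∈ N, a⁻¹ * g ∈ N := by
    intro g hg
    have : a⁻¹ = s * (b * s⁻¹) := by
      rw [inv_eq_iff_mul_eq_one, ← mul_assoc, h2]; group
    rw [this, mul_assoc, mul_assoc]
    exact hsN _ (hbN _ (hsN' _ hg))
  refine Subgroup.closure_induction_left (p := fun g _ => g ∈ N) ⟨0, 0, [], by simp [letterProd]⟩
    ?_ ?_ hg
  · rintro x (rfl | rfl) y _ hy
    · exact haN y hy
    · exact hbN y hy
  · rintro x (rfl | rfl) y _ hy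
    · exact haN' y hy
    · exact hbN' y hy

/-- The relations of a modular pair are defining relations of `SL(2,ℤ)`: the word of a normal form
is empty if its matrix is the identity, as matrices of words have nonnegative entries. -/
theorem exists_hom (h : IsModularPair a b) : ∃ f : SL2Z →* G, f A1 = a ∧ f A2 = b := by
  set u : G × SL2Z := (a, A1)
  set w : G × SL2Z := (b, A2)
  have huw : IsModularPair u w :=
    ⟨Prod.ext h.braid rotSL_eq, Prod.ext h.order rotSL_pow_four⟩
  set H := Subgroup.closure {u, w}
  set p : H →* SL2Z := (MonoidHom.snd G SL2Z).comp H.subtype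
  have hu : u ∈ H := Subgroup.subset_closure (by simp)
  have hw : w ∈ H := Subgroup.subset_closure (by simp)
  have hp2 : ∀ l : List Bool, (letterProd u w l).2 = letterProd A1 A2 l := by
    intro l
    induction l with
    | nil => rfl
    | cons c l ih =>
      simp only [letterProd, List.map_cons, List.prod_cons, Prod.snd_mul] at ih ⊢
      rw [ih]
      cases c <;> rfl
  have hinj : Function.Injective p := by
    rw [injective_iff_map_eq_one]
    rintro ⟨g, hg⟩ hg1
    obtain ⟨k, l, L, rfl⟩ := huw.normal_form hg
    have e : rotSL ^ k * letterProd A1 A2 L * rotSL ^ l = 1 := by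
      rw [← hp2]; exact hg1
    have e1 : letterProd A1 A2 L * rotSL ^ (k + l) = 1 := by
      rw [add_comm, pow_add]
      calc letterProd A1 A2 L * (rotSL ^ l * rotSL ^ k) =
          (rotSL ^ k)⁻¹ * (rotSL ^ k * letterProd A1 A2 L * rotSL ^ l) * rotSL ^ k := by group
        _ = 1 := by rw [e]; group
    have e2 : ∀ m : ℕ, rotSL ^ m = rotSL ^ (m % 4) := fun m => by
      conv_lhs => rw [← Nat.div_add_mod m 4, pow_add, pow_mul, rotSL_pow_four, one_pow, one_mul]
    have hd := (letterProd_pos L).2 0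
    rw [e2, mul_eq_one_iff_eq_inv] at e1
    have hlt := Nat.mod_lt (k + l) (by norm_num : 0 < 4)
    have hr : (k + l) % 4 = 0 := by
      by_contra hne
      rw [e1] at hd
      obtain hr | hr | hr : (k + l) % 4 = 1 ∨ (k + l) % 4 = 2 ∨ (k + l) % 4 = 3 := by omega
      · rw [hr, pow_one, Matrix.SpecialLinearGroup.coe_inv, rotSL_val] at hd
        simp [Matrix.adjugate_fin_two] at hd
      · rw [hr, Matrix.SpecialLinearGroup.coe_inv, rotSL_sq_val] at hd
        simp [Matrix.adjugate_fin_two] at hd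
      · have : (rotSL ^ 3)⁻¹ = rotSL := by
          rw [inv_eq_iff_mul_eq_one, ← pow_succ]; exact rotSL_pow_four
        rw [hr, this, rotSL_val] at hd
        simp at hd
    rw [hr, pow_zero, inv_one] at e1
    apply Subtype.ext
    change (u * w⁻¹ * u) ^ k * letterProd u w L * (u * w⁻¹ * u) ^ l = 1
    rw [eq_nil_of_letterProd_eq_one e1]
    simp only [letterProd, List.map_nil, List.prod_nil, mul_one]
    rw [← pow_add, ← Nat.div_add_mod (k + l) 4, hr, add_zero, pow_mul, huw.order, one_pow]
  have hsurj : Function.Surjective p := by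
    rw [← MonoidHom.range_eq_top, eq_top_iff, ← closure_A1_A2, Subgroup.closure_le]
    rintro x (rfl | rfl)
    · exact ⟨⟨u, hu⟩, rfl⟩
    · exact ⟨⟨w, hw⟩, rfl⟩
  set e := MulEquiv.ofBijective p ⟨hinj, hsurj⟩
  refine ⟨((MonoidHom.fst G SL2Z).comp H.subtype).comp e.symm.toMonoidHom, ?_, ?_⟩
  · have : e.symm A1 = ⟨u, hu⟩ := by rw [MulEquiv.symm_apply_eq]; rfl
    change (e.symm A1).1.1 = a
    rw [this]
  · have : e.symm A2 = ⟨w, hw⟩ := by rw [MulEquiv.symm_apply_eq]; rfl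
    change (e.symm A2).1.1 = b
    rw [this]

end IsModularPair

/-- A homomorphism from `SL(2,ℤ)` is determined by its values at `A_1` and `A_2`. -/
theorem SL2Z_hom_ext {f g : SL2Z →* G} (h1 : f A1 = g A1) (h2 : f A2 = g A2) : f = g :=
  MonoidHom.eq_of_eqOn_dense closure_A1_A2 (by rintro x (rfl | rfl) <;> assumption)

end Modular
end EllipticHall

namespace EllipticHall

open Equiv

variable {n : ℕ}

/-! ### The symmetrizer -/

theorem wordPerm_append {n : ℕ} (L M : List (Fin (n - 1))) :
    wordPerm (L ++ M) = wordPerm L * wordPerm M := by simp [wordPerm]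

theorem wordPerm_reverse {n : ℕ} (L : List (Fin (n - 1))) :
    wordPerm L.reverse = (wordPerm L)⁻¹ := by
  induction L with
  | nil => simp [wordPerm]
  | cons i L ih =>
    rw [List.reverse_cons, wordPerm_append, ih, wordPerm_cons i L, mul_inv_rev]
    congr 1

theorem invCard_inv {n : ℕ} (w : Perm (Fin n)) : invCard w⁻¹ = invCard w := by
  have h : ∀ w : Perm (Fin n), invCard w⁻¹ ≤ invCard w := fun w => by
    have h1 := invCard_wordPerm_le (reducedWord w).reverse
    rwa [wordPerm_reverse, (reducedWord_spec w).1, List.length_reverse, ← permLength,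
      permLength_eq] at h1
  refine le_antisymm (h w) ?_
  simpa using h w⁻¹

theorem invCard_up_right {n : ℕ} (i : Fin (n - 1)) (w : Perm (Fin n))
    (h : w (lo i) < w (hi i)) : invCard (w * simpleRefl i) = invCard w + 1 := by
  rw [← invCard_inv, mul_inv_rev, ← invCard_inv w]
  have : (simpleRefl i : Perm (Fin n))⁻¹ = simpleRefl i :=
    inv_eq_of_mul_eq_one_left (simpleRefl_mul_self i)
  rw [this]
  exact invCard_up i w⁻¹ h

theorem dahaT_up_right {n : ℕ} (i : Fin (n - 1)) (w : Perm (Fin n))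
    (h : w (lo i) < w (hi i)) : dahaT (w * simpleRefl i) = dahaT w * Daha.T i := by
  have h1 := permLength_eq w
  have h2 := permLength_eq (w * simpleRefl i)
  have h3 := invCard_up_right i w h
  unfold permLength at h1 h2
  have := prod_eq_of_reduced Daha.T Daha.T_comm Daha.T_braid _ (w * simpleRefl i)
    (reducedWord (w * simpleRefl i)) (reducedWord w ++ [i]) rfl (reducedWord_spec _).1
    (by rw [wordPerm_append, (reducedWord_spec w).1]; simp [wordPerm]) h2 (by simp [h1, h3])
  simpa [dahaT, reducedProd] using this

theorem preSymm_mul_T {n : ℕ} (i : Fin (n - 1)) :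
    preSymm n * Daha.T i = v' • preSymm n := by
  classical
  set f : Perm (Fin n) → Daha n := fun w => v' ^ permLength w • dahaT w with hf
  set up : Finset (Perm (Fin n)) := Finset.univ.filter fun w => w (lo i) < w (hi i)
  have hcan : ∀ w : Perm (Fin n), w * simpleRefl i * simpleRefl i = w := fun w => by
    rw [mul_assoc, simpleRefl_mul_self, mul_one]
  have hsum : preSymm n = ∑ w ∈ up, (f w + f (w * simpleRefl i)) := by
    rw [preSymm, Finset.sum_add_distrib,
      ← Finset.sum_filter_add_sum_filter_not Finset.univ
        (fun w : Perm (Fin n) => w (lo i) < w (hi i))]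
    congr 1
    refine Finset.sum_bij' (fun w _ => w * simpleRefl i) (fun w _ => w * simpleRefl i) ?_ ?_
      (fun w _ => hcan w) (fun w _ => hcan w) ?_
    · intro w hw
      have h := (Finset.mem_filter.mp hw).2
      refine Finset.mem_filter.mpr ⟨Finset.mem_univ _, ?_⟩
      rw [Perm.mul_apply, Perm.mul_apply, simpleRefl_lo, simpleRefl_hi]
      exact lt_of_le_of_ne (not_lt.mp h) fun h => lo_ne_hi i (w.injective h).symm
    · intro w hw
      have h := (Finset.mem_filter.mp hw).2
      refine Finset.mem_filter.mpr ⟨Finset.mem_univ _, ?_⟩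
      rw [Perm.mul_apply, Perm.mul_apply, simpleRefl_lo, simpleRefl_hi]
      exact not_lt.mpr h.le
    · intro w _
      rw [hcan]
  rw [hsum, Finset.sum_mul, Finset.smul_sum]
  refine Finset.sum_congr rfl fun w hw => ?_
  have h := (Finset.mem_filter.mp hw).2
  have h1 := dahaT_up_right i w h
  have h2 : permLength (w * simpleRefl i) = permLength w + 1 := by
    rw [permLength_eq, permLength_eq, invCard_up_right i w h]
  simp only [hf]
  rw [h1, h2, add_mul, smul_mul_assoc, smul_mul_assoc, mul_assoc, Daha.T_sq, mul_add, mul_one,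
    mul_smul_comm, smul_add, smul_add, smul_smul, smul_smul, smul_smul, pow_succ]
  have e : v' ^ permLength w * v' * (v' - v'⁻¹) = v' * (v' ^ permLength w * v') -
      v' ^ permLength w := by
    field_simp [v'_ne_zero]
  rw [e, sub_smul, mul_comm v' (v' ^ permLength w)]
  abel

/-- The symmetrizer is an eigenvector of `u` for the eigenvalue `c`, on both sides. -/
def IsEigen (c : K') (u : Daha n) : Prop :=
  u * symmetrizer n = c • symmetrizer n ∧ symmetrizer n * u = c • symmetrizer n

theorem isEigen_one : IsEigen 1 (1 : Daha n) := by simp [IsEigen]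

theorem IsEigen.mul {c d : K'} {u w : Daha n} (hu : IsEigen c u) (hw : IsEigen d w) :
    IsEigen (c * d) (u * w) := by
  constructor
  · rw [mul_assoc, hw.1, mul_smul_comm, hu.1, smul_smul, mul_comm]
  · rw [← mul_assoc, hu.2, smul_mul_assoc, hw.2, smul_smul]

theorem IsEigen.inv {c : K'} {u : (Daha n)ˣ} (hc : c ≠ 0) (hu : IsEigen c (u : Daha n)) :
    IsEigen c⁻¹ ((u⁻¹ : (Daha n)ˣ) : Daha n) := by
  constructor
  · have h := congrArg (fun a => c⁻¹ • (((u⁻¹ : (Daha n)ˣ) : Daha n) * a)) hu.1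
    simpa [smul_smul, hc] using h.symm
  · have h := congrArg (fun a => c⁻¹ • (a * ((u⁻¹ : (Daha n)ˣ) : Daha n))) hu.2
    simpa [smul_smul, hc, mul_assoc] using h.symm

theorem isEigen_T (i : Fin (n - 1)) : IsEigen v' (Daha.T i) := by
  constructor
  · rw [symmetrizer, mul_smul_comm, T_mul_preSymm, smul_comm]
  · rw [symmetrizer, smul_mul_assoc, preSymm_mul_T, smul_comm]

theorem isEigen_unitT {i : ℕ} (h : i + 1 < n) : IsEigen v' (unitT n i : Daha n) := by
  rw [unitT_val (by omega : i < n - 1)]; exact isEigen_T _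

theorem isEigen_upProd {k : ℕ} (hk : k < n) :
    IsEigen (v' ^ k) ((upProd (unitT n) k : (Daha n)ˣ) : Daha n) := by
  induction k with
  | zero => rw [pow_zero]; exact isEigen_one
  | succ k ih => rw [pow_succ]; exact (ih (by omega)).mul (isEigen_unitT hk)

theorem isEigen_downProd {k : ℕ} (hk : k < n) :
    IsEigen (v' ^ k) ((downProd (unitT n) k : (Daha n)ˣ) : Daha n) := by
  induction k with
  | zero => rw [pow_zero]; exact isEigen_one
  | succ k ih => rw [pow_succ']; exact (isEigen_unitT hk).mul (ih (by omega))

theorem isEigen_halfTwist {k : ℕ} (hk : k ≤ n) :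
    ∃ c ≠ 0, IsEigen c ((halfTwist (unitT n) k : (Daha n)ˣ) : Daha n) := by
  induction k with
  | zero => exact ⟨1, one_ne_zero, isEigen_one⟩
  | succ k ih =>
    obtain ⟨c, hc, h⟩ := ih (by omega)
    exact ⟨_, mul_ne_zero (pow_ne_zero k v'_ne_zero) hc, (isEigen_upProd hk).mul h⟩

/-! ### The automorphisms `ρ₁`, `ρ₂` -/

theorem unitT_hecke {i : ℕ} (h : i + 1 < n) :
    ((unitT n i : Daha n) + algebraMap K' (Daha n) v'⁻¹) *
      ((unitT n i : Daha n) - algebraMap K' (Daha n) v') = 0 := by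
  have h1 := Daha.rel (DahaRel.hecke (n := n) ⟨i, by omega⟩)
  rw [map_mul, map_add, map_sub, AlgHom.commutes, AlgHom.commutes, map_zero] at h1
  rw [unitT_val (by omega : i < n - 1)]
  exact h1

/-- The action of an automorphism on the units. -/
noncomputable def unitAct (r : Daha n ≃ₐ[K'] Daha n) : (Daha n)ˣ →* (Daha n)ˣ :=
  Units.map (r : Daha n →* Daha n)

theorem unitAct_val (r : Daha n ≃ₐ[K'] Daha n) (u : (Daha n)ˣ) :
    ((unitAct r u : (Daha n)ˣ) : Daha n) = r (u : Daha n) := rfl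

theorem unitAct_mul (r s : Daha n ≃ₐ[K'] Daha n) (u : (Daha n)ˣ) :
    unitAct (r * s) u = unitAct r (unitAct s u) := rfl

theorem unitAct_inv (r : Daha n ≃ₐ[K'] Daha n) {u w : (Daha n)ˣ} (h : unitAct r u = w) :
    unitAct r⁻¹ w = u := by
  rw [← h, ← unitAct_mul, inv_mul_cancel]
  exact Units.ext rfl

theorem daha_aut_ext {r s : Daha n ≃ₐ[K'] Daha n}
    (hT : ∀ i, unitAct r (unitT n i) = unitAct s (unitT n i))
    (hX : unitAct r (unitX n 0) = unitAct s (unitX n 0))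
    (hY : unitAct r (unitY n 0) = unitAct s (unitY n 0)) : r = s := by
  have : (r : Daha n →ₐ[K'] Daha n) = s := by
    refine Daha.hom_ext (fun i => ?_) (congrArg Units.val hX) (congrArg Units.val hY)
    have := congrArg Units.val (hT i)
    rw [unitAct_val, unitAct_val, unitT_val i.2] at this
    exact this
  exact AlgEquiv.ext fun a => congrArg (fun f : Daha n →ₐ[K'] Daha n => f a) this

/-- Two systems of generators expressed through one another give an automorphism. -/
theorem exists_aut (hn : 0 < n) {x y x' y' : (Daha n)ˣ}
    (h : IsElliptic n (unitT n) x y (qUnit _)) (h' : IsElliptic n (unitT n) x' y' (qUnit _))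
    (hinv : ∀ f g : (Daha n)ˣ →* (Daha n)ˣ,
      (f (unitX n 0) = x ∧ f (unitY n 0) = y) → (g (unitX n 0) = x' ∧ g (unitY n 0) = y') →
      f (g (unitX n 0)) = unitX n 0 ∧ f (g (unitY n 0)) = unitY n 0 ∧
      g (f (unitX n 0)) = unitX n 0 ∧ g (f (unitY n 0)) = unitY n 0) :
    ∃ r : Daha n ≃ₐ[K'] Daha n, (∀ i, unitAct r (unitT n i) = unitT n i) ∧
      unitAct r (unitX n 0) = x ∧ unitAct r (unitY n 0) = y := by
  set f := Daha.lift hn h (fun i hi => unitT_hecke hi)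
  set g := Daha.lift hn h' (fun i hi => unitT_hecke hi)
  have hfT : ∀ i : Fin (n - 1), f (Daha.T i) = Daha.T i := fun i => by
    have := Daha.lift_gen hn h (fun i hi => unitT_hecke hi) (DahaGen.T i)
    rw [genValue, unitT_val i.2] at this
    exact this
  have hgT : ∀ i : Fin (n - 1), g (Daha.T i) = Daha.T i := fun i => by
    have := Daha.lift_gen hn h' (fun i hi => unitT_hecke hi) (DahaGen.T i)
    rw [genValue, unitT_val i.2] at this
    exact this
  have hfX : f (unitX n 0 : Daha n) = x := by
    rw [unitX_val hn]; exact Daha.lift_gen hn h (fun i hi => unitT_hecke hi) (DahaGen.X ⟨0, hn⟩)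
  have hfY : f (unitY n 0 : Daha n) = y := by
    rw [unitY_val hn]; exact Daha.lift_gen hn h (fun i hi => unitT_hecke hi) (DahaGen.Y ⟨0, hn⟩)
  have hgX : g (unitX n 0 : Daha n) = x' := by
    rw [unitX_val hn]; exact Daha.lift_gen hn h' (fun i hi => unitT_hecke hi) (DahaGen.X ⟨0, hn⟩)
  have hgY : g (unitY n 0 : Daha n) = y' := by
    rw [unitY_val hn]; exact Daha.lift_gen hn h' (fun i hi => unitT_hecke hi) (DahaGen.Y ⟨0, hn⟩)
  obtain ⟨e1, e2, e3, e4⟩ := hinv (Units.map (f : Daha n →* Daha n))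
    (Units.map (g : Daha n →* Daha n)) ⟨Units.ext hfX, Units.ext hfY⟩ ⟨Units.ext hgX, Units.ext hgY⟩
  refine ⟨AlgEquiv.ofAlgHom f g ?_ ?_, fun i => ?_, Units.ext hfX, Units.ext hfY⟩
  · exact Daha.hom_ext (fun i => by rw [AlgHom.comp_apply, hgT, hfT]; rfl)
      (congrArg Units.val e1) (congrArg Units.val e2)
  · exact Daha.hom_ext (fun i => by rw [AlgHom.comp_apply, hfT, hgT]; rfl)
      (congrArg Units.val e3) (congrArg Units.val e4)
  · by_cases hi : i < n - 1
    · apply Units.ext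
      rw [unitAct_val, unitT_val hi]
      exact hfT _
    · rw [unitT, dif_neg hi, map_one]

theorem exists_rho1 (hn : 0 < n) :
    ∃ r : Daha n ≃ₐ[K'] Daha n, (∀ i, unitAct r (unitT n i) = unitT n i) ∧
      unitAct r (unitX n 0) = unitX n 0 * unitY n 0 ∧ unitAct r (unitY n 0) = unitY n 0 := by
  have h := daha_isElliptic hn
  refine exists_aut hn h.mul_right h.mul_inv_right fun f g ⟨f1, f2⟩ ⟨g1, g2⟩ => ?_
  simp [f1, f2, g1, g2]

theorem exists_rho2 (hn : 0 < n) :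
    ∃ r : Daha n ≃ₐ[K'] Daha n, (∀ i, unitAct r (unitT n i) = unitT n i) ∧
      unitAct r (unitX n 0) = unitX n 0 ∧ unitAct r (unitY n 0) = unitY n 0 * unitX n 0 := by
  have h := daha_isElliptic hn
  have h1 := h.swap.mul_right.swap
  have h2 := h.swap.mul_inv_right.swap
  rw [inv_inv, inv_inv] at h1 h2
  refine exists_aut hn h1 h2 fun f g ⟨f1, f2⟩ ⟨g1, g2⟩ => ?_
  simp [f1, f2, g1, g2]

/-- The automorphism `ρ₁`. -/
noncomputable def rho1 (hn : 0 < n) : Daha n ≃ₐ[K'] Daha n := (exists_rho1 hn).choose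

/-- The automorphism `ρ₂`. -/
noncomputable def rho2 (hn : 0 < n) : Daha n ≃ₐ[K'] Daha n := (exists_rho2 hn).choose

theorem rho1_T (hn : 0 < n) (i : ℕ) : unitAct (rho1 hn) (unitT n i) = unitT n i :=
  (exists_rho1 hn).choose_spec.1 i

theorem rho1_X (hn : 0 < n) : unitAct (rho1 hn) (unitX n 0) = unitX n 0 * unitY n 0 :=
  (exists_rho1 hn).choose_spec.2.1

theorem rho1_Y (hn : 0 < n) : unitAct (rho1 hn) (unitY n 0) = unitY n 0 :=
  (exists_rho1 hn).choose_spec.2.2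

theorem rho2_T (hn : 0 < n) (i : ℕ) : unitAct (rho2 hn) (unitT n i) = unitT n i :=
  (exists_rho2 hn).choose_spec.1 i

theorem rho2_X (hn : 0 < n) : unitAct (rho2 hn) (unitX n 0) = unitX n 0 :=
  (exists_rho2 hn).choose_spec.2.1

theorem rho2_Y (hn : 0 < n) : unitAct (rho2 hn) (unitY n 0) = unitY n 0 * unitX n 0 :=
  (exists_rho2 hn).choose_spec.2.2

theorem map_strand {G : Type*} [Group G] (f : G →* G) (T : ℕ → G) (x : G)
    (hT : ∀ i, f (T i) = T i) (j : ℕ) : f (strand T x j) = strand T (f x) j := by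
  induction j with
  | zero => rfl
  | succ j ih => simp only [strand, map_mul, ih, hT]

theorem strand_mul_right {G : Type*} [Group G] (T : ℕ → G) (x y : G) (j : ℕ) :
    strand T (x * y) j = strand T x j * strand T⁻¹ y j * (downProd T j * upProd T j) := by
  rw [strand_eq, strand_eq, strand_eq, upProd_inv, downProd_inv]; group

theorem loopT_eq {j : ℕ} (hj : j < n) : loopT ⟨j, hj⟩ =
    ((downProd (unitT n) j * upProd (unitT n) j : (Daha n)ˣ) : Daha n) := by
  rw [loopT, Units.val_mul, ← Units.coeHom_apply, ← Units.coeHom_apply, map_upProd, map_downProd,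
    ← prod_ofFn_eq_upProd, ← prod_ofFn_eq_downProd]
  congr 3
  · funext k
    exact (unitT_val (by have := k.2; simp only at this; omega)).symm
  · funext k
    exact (unitT_val (by have := k.2; simp only at this; omega)).symm

theorem loopTinv_eq {j : ℕ} (hj : j < n) : loopTinv ⟨j, hj⟩ =
    ((downProd (unitT n)⁻¹ j * upProd (unitT n)⁻¹ j : (Daha n)ˣ) : Daha n) := by
  rw [loopTinv, Units.val_mul, ← Units.coeHom_apply, ← Units.coeHom_apply, map_upProd,
    map_downProd, ← prod_ofFn_eq_upProd, ← prod_ofFn_eq_downProd]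
  congr 3
  · funext k
    exact (unitT_inv_val (by have := k.2; simp only at this; omega)).symm
  · funext k
    exact (unitT_inv_val (by have := k.2; simp only at this; omega)).symm

theorem unitAct_X (r : Daha n ≃ₐ[K'] Daha n) (hT : ∀ i, unitAct r (unitT n i) = unitT n i)
    {j : ℕ} (hj : j < n) :
    unitAct r (unitX n j) = strand (unitT n) (unitAct r (unitX n 0)) j := by
  rw [← strand_unitX hj, map_strand _ _ _ hT]

theorem unitAct_Y (r : Daha n ≃ₐ[K'] Daha n) (hT : ∀ i, unitAct r (unitT n i) = unitT n i)
    {j : ℕ} (hj : j < n) :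
    unitAct r (unitY n j) = strand (unitT n)⁻¹ (unitAct r (unitY n 0)) j := by
  rw [← strand_unitY hj, map_strand _ _ _ fun i => by rw [Pi.inv_apply, map_inv, hT]]

theorem rho1_isRho1 (hn : 0 < n) : IsRho1 (rho1 hn) := by
  refine ⟨fun i => ?_, fun j => ?_, fun j => ?_⟩
  · have := congrArg Units.val (rho1_T hn i)
    rwa [unitAct_val, unitT_val i.2] at this
  · have := congrArg Units.val (unitAct_X _ (rho1_T hn) j.2)
    rw [rho1_X, strand_mul_right, strand_unitX j.2, strand_unitY j.2, Units.val_mul, Units.val_mul,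
      ← loopT_eq j.2, unitAct_val, unitX_val j.2, unitY_val j.2] at this
    exact this
  · have := congrArg Units.val (unitAct_Y _ (rho1_T hn) j.2)
    rw [rho1_Y, strand_unitY j.2, unitAct_val, unitY_val j.2] at this
    exact this

theorem rho2_isRho2 (hn : 0 < n) : IsRho2 (rho2 hn) := by
  refine ⟨fun i => ?_, fun j => ?_, fun j => ?_⟩
  · have := congrArg Units.val (rho2_T hn i)
    rwa [unitAct_val, unitT_val i.2] at this
  · have := congrArg Units.val (unitAct_Y _ (rho2_T hn) j.2)
    rw [rho2_Y, strand_mul_right, inv_inv, strand_unitX j.2, strand_unitY j.2, Units.val_mul,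
      Units.val_mul, ← loopTinv_eq j.2, unitAct_val, unitX_val j.2, unitY_val j.2] at this
    exact this
  · have := congrArg Units.val (unitAct_X _ (rho2_T hn) j.2)
    rw [rho2_X, strand_unitX j.2, unitAct_val, unitX_val j.2] at this
    exact this

theorem unitAct_T_of (r : Daha n ≃ₐ[K'] Daha n) (h : ∀ i, r (Daha.T i) = Daha.T i) (i : ℕ) :
    unitAct r (unitT n i) = unitT n i := by
  by_cases hi : i < n - 1
  · apply Units.ext
    rw [unitAct_val, unitT_val hi]; exact h _
  · rw [unitT, dif_neg hi, map_one]

theorem IsRho1.eq (hn : 0 < n) {r : Daha n ≃ₐ[K'] Daha n} (h : IsRho1 r) : r = rho1 hn := by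
  refine daha_aut_ext (fun i => ?_) ?_ ?_
  · rw [unitAct_T_of r h.1, rho1_T]
  · apply Units.ext
    rw [unitAct_val, unitAct_val, unitX_val hn, h.2.1, (rho1_isRho1 hn).2.1]
  · apply Units.ext
    rw [unitAct_val, unitAct_val, unitY_val hn, h.2.2, (rho1_isRho1 hn).2.2]

theorem IsRho2.eq (hn : 0 < n) {r : Daha n ≃ₐ[K'] Daha n} (h : IsRho2 r) : r = rho2 hn := by
  refine daha_aut_ext (fun i => ?_) ?_ ?_
  · rw [unitAct_T_of r h.1, rho2_T]
  · apply Units.ext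
    rw [unitAct_val, unitAct_val, unitX_val hn, h.2.2, (rho2_isRho2 hn).2.2]
  · apply Units.ext
    rw [unitAct_val, unitAct_val, unitY_val hn, h.2.1, (rho2_isRho2 hn).2.1]

/-- The automorphism of the double affine Hecke algebra over the rotation by a quarter turn. -/
noncomputable def rot (hn : 0 < n) : Daha n ≃ₐ[K'] Daha n := rho1 hn * (rho2 hn)⁻¹ * rho1 hn

theorem rho2_inv_T (hn : 0 < n) (i : ℕ) : unitAct (rho2 hn)⁻¹ (unitT n i) = unitT n i :=
  unitAct_inv _ (rho2_T hn i)

theorem rho2_inv_X (hn : 0 < n) : unitAct (rho2 hn)⁻¹ (unitX n 0) = unitX n 0 :=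
  unitAct_inv _ (rho2_X hn)

theorem rho2_inv_Y (hn : 0 < n) :
    unitAct (rho2 hn)⁻¹ (unitY n 0) = unitY n 0 * (unitX n 0)⁻¹ :=
  unitAct_inv _ (by rw [map_mul, map_inv, rho2_X, rho2_Y]; group)

theorem rot_T (hn : 0 < n) (i : ℕ) : unitAct (rot hn) (unitT n i) = unitT n i := by
  simp only [rot, unitAct_mul, rho1_T, rho2_inv_T]

theorem rot_X (hn : 0 < n) :
    unitAct (rot hn) (unitX n 0) = unitX n 0 * unitY n 0 * (unitX n 0)⁻¹ := by
  simp only [rot, unitAct_mul, rho1_X, rho1_Y, map_mul, map_inv, rho2_inv_X, rho2_inv_Y]; group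

theorem rot_Y (hn : 0 < n) : unitAct (rot hn) (unitY n 0) = (unitX n 0)⁻¹ := by
  simp only [rot, unitAct_mul, rho1_X, rho1_Y, map_mul, map_inv, rho2_inv_Y]; group

theorem rot_eq (hn : 0 < n) : rot hn = (rho2 hn)⁻¹ * rho1 hn * (rho2 hn)⁻¹ := by
  refine daha_aut_ext (fun i => ?_) ?_ ?_
  · rw [rot_T]; simp only [unitAct_mul, rho1_T, rho2_inv_T]
  · rw [rot_X]
    simp only [unitAct_mul, rho1_X, map_mul, rho2_inv_X, rho2_inv_Y]
    group
  · rw [rot_Y]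
    simp only [unitAct_mul, rho1_X, rho1_Y, map_mul, map_inv, rho2_inv_X, rho2_inv_Y]
    group

theorem unitAct_q (r : Daha n ≃ₐ[K'] Daha n) : unitAct r (qUnit _) = qUnit _ :=
  Units.ext (r.commutes q')

theorem rot_Y_eq (hn : 0 < n) {j : ℕ} (hj : j < n) :
    unitAct (rot hn) (unitY n j) = (unitX n j)⁻¹ := by
  rw [unitAct_Y _ (rot_T hn) hj, rot_Y, ← strand_unitX hj]
  clear hj
  induction j with
  | zero => rfl
  | succ j ih => simp only [strand, ih, Pi.inv_apply, mul_inv_rev, mul_assoc]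

/-- The positive half twist, as a unit of the double affine Hecke algebra. -/
noncomputable def twist (n : ℕ) : (Daha n)ˣ := halfTwist (unitT n) n

theorem twist_mul_T {i j : ℕ} (h : i + j + 2 = n) : twist n * unitT n i = unitT n j * twist n :=
  (unitT_isBraid n).halfTwist_mul h le_rfl

theorem strand_mul_left_central {G : Type*} [Group G] (T : ℕ → G) (x : G) {q : G}
    (hq : ∀ g, Commute q g) (j : ℕ) : strand T (q * x) j = q * strand T x j := by
  induction j with
  | zero => rfl
  | succ j ih =>
    simp only [strand]
    rw [ih, ← mul_assoc (T j), ← (hq (T j)).eq]; simp only [mul_assoc]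

/-- The square of the quarter turn inverts the `X_j`, up to `q` and the conjugation by the half
twist. -/
theorem rot_sq_X (hn : 0 < n) {j k : ℕ} (h : j + k + 1 = n) :
    unitAct (rot hn) (unitAct (rot hn) (unitX n j)) =
      (qUnit _)⁻¹ * ((twist n)⁻¹ * (unitX n k)⁻¹ * twist n) := by
  have he := daha_isElliptic hn
  rw [unitAct_X _ (rot_T hn) (by omega : j < n), map_strand _ _ _ (rot_T hn), rot_X]
  have e : unitAct (rot hn) (unitX n 0 * unitY n 0 * (unitX n 0)⁻¹) =
      (qUnit _)⁻¹ * ((twist n)⁻¹ * (unitX n (n - 1))⁻¹ * twist n) := by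
    rw [twist, ← strand_unitX (by omega : n - 1 < n), ← he.strand_eq_conj_x hn, map_mul, map_mul,
      map_inv, rot_X, rot_Y]
    rw [← mul_assoc (qUnit (Daha n))⁻¹]
    calc _ = unitX n 0 * unitY n 0 * (unitX n 0)⁻¹ * (unitY n 0)⁻¹ * (unitX n 0)⁻¹ := by group
      _ = _ := by rw [he.conj_eq]; group
  rw [e, strand_mul_left_central _ _ fun g => (qUnit_central g).inv_left,
    ← strand_unitX (by omega : n - 1 < n), strand_conj_inv (fun i j hij => twist_mul_T hij) h,
    strand_unitX (by omega)]

theorem rot_sq_Y (hn : 0 < n) {j k : ℕ} (h : j + k + 1 = n) :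
    unitAct (rot hn) (unitAct (rot hn) (unitY n j)) =
      qUnit _ * ((twist n)⁻¹ * (unitY n k)⁻¹ * twist n) := by
  have he := daha_isElliptic hn
  have hT' : ∀ i, unitAct (rot hn) ((unitT n)⁻¹ i) = (unitT n)⁻¹ i := fun i => by
    rw [Pi.inv_apply, map_inv, rot_T]
  rw [unitAct_Y _ (rot_T hn) (by omega : j < n), map_strand _ _ _ hT', rot_Y]
  have e : unitAct (rot hn) (unitX n 0)⁻¹ =
      qUnit _ * ((twist n)⁻¹ * (unitY n (n - 1))⁻¹ * twist n) := by
    rw [twist, ← strand_unitY (by omega : n - 1 < n), ← he.strand_eq_conj_y hn, map_inv, rot_X]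
    rw [he.conj_eq]
    have := (he.central ((unitY n 0)⁻¹ * (upProd (unitT n) (n - 1) * downProd (unitT n) (n - 1)))).eq
    rw [this]; group
  rw [e, strand_mul_left_central _ _ qUnit_central,
    ← strand_unitY (by omega : n - 1 < n), strand_conj_inv (fun i j hij => ?_) h,
    strand_unitY (by omega)]
  have := twist_mul_T (n := n) (i := i) (j := j) hij
  rw [Pi.inv_apply, Pi.inv_apply, mul_inv_eq_iff_eq_mul, mul_assoc, this, inv_mul_cancel_left]

theorem unitAct_twist (r : Daha n ≃ₐ[K'] Daha n) (hT : ∀ i, unitAct r (unitT n i) = unitT n i) :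
    unitAct r (twist n) = twist n := by
  have h1 : ∀ k, unitAct r (upProd (unitT n) k) = upProd (unitT n) k := fun k => by
    rw [map_upProd]; simp only [hT]
  have h2 : ∀ k, unitAct r (halfTwist (unitT n) k) = halfTwist (unitT n) k := fun k => by
    induction k with
    | zero => exact map_one _
    | succ k ih => rw [halfTwist, map_mul, ih, h1]
  exact h2 n

/-- Conjugation by a unit. -/
noncomputable def conjAut (u : (Daha n)ˣ) : Daha n ≃ₐ[K'] Daha n where
  toFun a := (u : Daha n) * a * ((u⁻¹ : (Daha n)ˣ) : Daha n)
  invFun a := ((u⁻¹ : (Daha n)ˣ) : Daha n) * a * (u : Daha n)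
  left_inv a := by simp [mul_assoc]
  right_inv a := by simp [mul_assoc]
  map_mul' a b := by simp [mul_assoc]
  map_add' a b := by simp [mul_add, add_mul]
  commutes' c := by
    rw [← Algebra.commutes, mul_assoc, Units.mul_inv, mul_one]

theorem unitAct_conjAut (u w : (Daha n)ˣ) : unitAct (conjAut u) w = u * w * u⁻¹ := Units.ext rfl

/-- The fourth power of the rotation is the conjugation by the full twist, which is trivial on the
spherical algebra. -/
theorem rot_pow_four (hn : 0 < n) : rot hn ^ 4 = conjAut ((twist n)⁻¹ * (twist n)⁻¹) := by
  have e : rot hn ^ 4 = rot hn * (rot hn * (rot hn * rot hn)) := by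
    simp only [pow_succ, pow_zero, one_mul, mul_assoc]
  have hD := unitAct_twist (rot hn) (rot_T hn)
  refine daha_aut_ext (fun i => ?_) ?_ ?_
  · rw [e, unitAct_conjAut]
    simp only [unitAct_mul, rot_T]
    by_cases hi : i + 1 < n
    · obtain ⟨j, hj⟩ : ∃ j, i + j + 2 = n := ⟨n - 2 - i, by omega⟩
      have h1 := twist_mul_T hj
      have h2 := twist_mul_T (n := n) (i := j) (j := i) (by omega)
      have h3 : Commute (twist n * twist n) (unitT n i) := by
        change _ * _ = _ * _
        rw [mul_assoc, h1, ← mul_assoc, h2, mul_assoc]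
      rw [← mul_inv_rev, inv_inv, h3.inv_left.eq, mul_assoc, inv_mul_cancel, mul_one]
    · rw [unitT, dif_neg (by omega)]; simp
  · have hq := (qUnit_central (A := Daha n) (unitX n 0 * twist n)).eq
    rw [e, unitAct_conjAut]
    simp only [unitAct_mul]
    rw [rot_sq_X hn (by omega : 0 + (n - 1) + 1 = n)]
    simp only [map_mul, map_inv, hD, unitAct_q]
    rw [rot_sq_X hn (k := 0) (by omega : (n - 1) + 0 + 1 = n)]
    calc _ = (qUnit _)⁻¹ * ((twist n)⁻¹ * (twist n)⁻¹ * (unitX n 0 * twist n * qUnit _) *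
          twist n) := by group
      _ = (qUnit _)⁻¹ * ((twist n)⁻¹ * (twist n)⁻¹ * qUnit _) * unitX n 0 * twist n * twist n := by
        rw [← hq]; group
      _ = _ := by
        rw [← (qUnit_central ((twist n)⁻¹ * (twist n)⁻¹)).eq]; simp [mul_assoc]
  · have hq := (qUnit_central (A := Daha n) (unitY n 0 * twist n)).inv_left.eq
    rw [e, unitAct_conjAut]
    simp only [unitAct_mul]
    rw [rot_sq_Y hn (by omega : 0 + (n - 1) + 1 = n)]
    simp only [map_mul, map_inv, hD, unitAct_q]
    rw [rot_sq_Y hn (k := 0) (by omega : (n - 1) + 0 + 1 = n)]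
    calc _ = qUnit _ * ((twist n)⁻¹ * (twist n)⁻¹ * (unitY n 0 * twist n * (qUnit _)⁻¹) *
          twist n) := by group
      _ = qUnit _ * ((twist n)⁻¹ * (twist n)⁻¹ * (qUnit _)⁻¹) * unitY n 0 * twist n * twist n := by
        rw [← hq]; group
      _ = _ := by
        rw [← (qUnit_central ((twist n)⁻¹ * (twist n)⁻¹)).inv_left.eq]; simp [mul_assoc]

/-! ### The action on the spherical algebra -/

theorem Spherical.ext {a b : Spherical n} (h : a.val = b.val) : a = b := Subtype.ext h

theorem Spherical.val_mul (a b : Spherical n) : (a * b).val = a.val * b.val := rfl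

theorem Spherical.val_add (a b : Spherical n) : (a + b).val = a.val + b.val := rfl

theorem Spherical.val_smul (c : K') (a : Spherical n) : (c • a).val = c • a.val := rfl

theorem Spherical.symm_mul_val (a : Spherical n) : symmetrizer n * a.val = a.val :=
  ((Subsemigroup.mem_corner_iff (symmetrizer_idem n)).mp a.2).1

theorem Spherical.val_mul_symm (a : Spherical n) : a.val * symmetrizer n = a.val :=
  ((Subsemigroup.mem_corner_iff (symmetrizer_idem n)).mp a.2).2

theorem sandwich_val (a : Daha n) : (sandwich a).val = symmetrizer n * a * symmetrizer n := rfl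

theorem map_symmetrizer (r : Daha n ≃ₐ[K'] Daha n) (h : ∀ i, r (Daha.T i) = Daha.T i) :
    r (symmetrizer n) = symmetrizer n := by
  have h1 : ∀ w : Perm (Fin n), r (dahaT w) = dahaT w := fun w => by
    rw [dahaT, reducedProd, map_list_prod, List.map_map]
    congr 2
    funext i
    exact h i
  rw [symmetrizer, preSymm, map_smul, map_sum]
  simp only [map_smul, h1]

/-- The restriction to the spherical algebra of an automorphism fixing the symmetrizer. -/
noncomputable def restrict (r : Daha n ≃ₐ[K'] Daha n) (h : r (symmetrizer n) = symmetrizer n) :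
    Spherical n ≃ₐ[K'] Spherical n :=
  have h' : r.symm (symmetrizer n) = symmetrizer n := by rw [AlgEquiv.symm_apply_eq, h]
  { toFun := fun a => ⟨r a.1, by
      obtain ⟨b, hb⟩ := a.2
      exact ⟨r b, by
        have := congrArg r hb
        simp only [map_mul, h] at this
        exact this⟩⟩
    invFun := fun a => ⟨r.symm a.1, by
      obtain ⟨b, hb⟩ := a.2
      exact ⟨r.symm b, by
        have := congrArg r.symm hb
        simp only [map_mul, h'] at this
        exact this⟩⟩
    left_inv := fun a => Subtype.ext (r.symm_apply_apply a.1)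
    right_inv := fun a => Subtype.ext (r.apply_symm_apply a.1)
    map_mul' := fun a b => Subtype.ext (map_mul r a.1 b.1)
    map_add' := fun a b => Subtype.ext (map_add r a.1 b.1)
    commutes' := fun c => Subtype.ext (by
      change r (c • symmetrizer n) = c • symmetrizer n
      rw [map_smul, h]) }

theorem rho1_symmetrizer (hn : 0 < n) : rho1 hn (symmetrizer n) = symmetrizer n :=
  map_symmetrizer _ (rho1_isRho1 hn).1

theorem rho2_symmetrizer (hn : 0 < n) : rho2 hn (symmetrizer n) = symmetrizer n :=
  map_symmetrizer _ (rho2_isRho2 hn).1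

/-- The full twist is a scalar on the symmetrizer, so that it commutes with the spherical algebra. -/
theorem conjAut_twist_symmetrizer (a : Spherical n) :
    conjAut ((twist n)⁻¹ * (twist n)⁻¹) a.val = a.val := by
  obtain ⟨c, hc, h⟩ := isEigen_halfTwist (n := n) le_rfl
  have h1 : IsEigen (c * c) ((twist n * twist n : (Daha n)ˣ) : Daha n) := h.mul h
  have h2 := h1.inv (mul_ne_zero hc hc)
  rw [← mul_inv_rev]
  change ((twist n * twist n)⁻¹ : (Daha n)ˣ) * a.val *
    (((twist n * twist n)⁻¹⁻¹ : (Daha n)ˣ) : Daha n) = a.val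
  rw [inv_inv, ← a.symm_mul_val, ← mul_assoc, h2.1, smul_mul_assoc, a.symm_mul_val, smul_mul_assoc,
    ← a.val_mul_symm, mul_assoc, h1.2, mul_smul_comm, a.val_mul_symm, smul_smul,
    inv_mul_cancel₀ (mul_ne_zero hc hc), one_smul]

/-- The restrictions of `ρ₁` and `ρ₂` satisfy the defining relations of `SL(2,ℤ)`. -/
theorem exists_cherednikAction (hn : 0 < n) : ∃ ρ, IsCherednikAction n ρ := by
  set a := restrict (rho1 hn) (rho1_symmetrizer hn)
  set b := restrict (rho2 hn) (rho2_symmetrizer hn)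
  have hb : ∀ x, (b⁻¹ x).val = (rho2 hn)⁻¹ x.val := fun x => rfl
  have h : IsModularPair a b := by
    constructor
    · apply AlgEquiv.ext
      intro x
      apply Spherical.ext
      exact congrArg (fun r : Daha n ≃ₐ[K'] Daha n => r x.val) (rot_eq hn)
    · apply AlgEquiv.ext
      intro x
      apply Spherical.ext
      have e := congrArg (fun r : Daha n ≃ₐ[K'] Daha n => r x.val) (rot_pow_four hn)
      simp only [conjAut_twist_symmetrizer] at e
      exact e
  obtain ⟨ρ, h1, h2⟩ := h.exists_hom
  exact ⟨ρ, rho1 hn, rho2 hn, rho1_isRho1 hn, rho2_isRho2 hn, fun a => by rw [h1]; rfl,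
    fun a => by rw [h2]; rfl⟩

theorem IsCherednikAction.A1_val (hn : 0 < n) {ρ : SL2Z →* (Spherical n ≃ₐ[K'] Spherical n)}
    (h : IsCherednikAction n ρ) (a : Spherical n) : (ρ A1 a).val = rho1 hn a.val := by
  obtain ⟨r1, r2, h1, h2, h3, h4⟩ := h
  rw [h3, h1.eq hn]

theorem IsCherednikAction.A2_val (hn : 0 < n) {ρ : SL2Z →* (Spherical n ≃ₐ[K'] Spherical n)}
    (h : IsCherednikAction n ρ) (a : Spherical n) : (ρ A2 a).val = rho2 hn a.val := by
  obtain ⟨r1, r2, h1, h2, h3, h4⟩ := h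
  rw [h4, h2.eq hn]

theorem IsCherednikAction.unique (hn : 0 < n) {ρ ρ' : SL2Z →* (Spherical n ≃ₐ[K'] Spherical n)}
    (h : IsCherednikAction n ρ) (h' : IsCherednikAction n ρ') : ρ = ρ' :=
  SL2Z_hom_ext
    (AlgEquiv.ext fun a => Spherical.ext (by rw [h.A1_val hn, h'.A1_val hn]))
    (AlgEquiv.ext fun a => Spherical.ext (by rw [h.A2_val hn, h'.A2_val hn]))

theorem IsCherednikAction.A2_inv_val (hn : 0 < n) {ρ : SL2Z →* (Spherical n ≃ₐ[K'] Spherical n)}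
    (h : IsCherednikAction n ρ) (a : Spherical n) : (ρ A2⁻¹ a).val = (rho2 hn)⁻¹ a.val := by
  have h1 := h.A2_val hn (ρ A2⁻¹ a)
  have h2 : ρ A2 (ρ A2⁻¹ a) = a := by
    rw [← AlgEquiv.mul_apply, ← map_mul, mul_inv_cancel, map_one]; rfl
  rw [h2] at h1
  rw [h1, ← AlgEquiv.mul_apply, inv_mul_cancel]; rfl

theorem IsCherednikAction.rot_val (hn : 0 < n) {ρ : SL2Z →* (Spherical n ≃ₐ[K'] Spherical n)}
    (h : IsCherednikAction n ρ) (a : Spherical n) : (ρ rotSL a).val = rot hn a.val := by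
  rw [rotSL, map_mul, map_mul, AlgEquiv.mul_apply, AlgEquiv.mul_apply, h.A1_val hn,
    h.A2_inv_val hn, h.A1_val hn]
  rfl

end EllipticHall

namespace EllipticHall

open Equiv

/-! ### Orbits of `SL(2,ℤ)` on the lattice -/

theorem A1_pow (k : ℕ) : (A1 ^ k).1 = !![1, 0; (k : ℤ), 1] := by
  induction k with
  | zero => rw [pow_zero]; simp [Matrix.one_fin_two]
  | succ k ih =>
    rw [pow_succ, Matrix.SpecialLinearGroup.coe_mul, ih]
    simp [A1]

theorem A1_zpow (k : ℤ) : (A1 ^ k).1 = !![1, 0; k, 1] := by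
  obtain ⟨m, rfl | rfl⟩ := k.eq_nat_or_neg
  · rw [zpow_natCast, A1_pow]
  · rw [zpow_neg, zpow_natCast, Matrix.SpecialLinearGroup.coe_inv, A1_pow]
    simp [Matrix.adjugate_fin_two_of]

theorem coe_vertical (e : ℕ) (he : 0 < e) : (vertical e he).1 = ![0, (e : ℤ)] := rfl

theorem deg_vertical (e : ℕ) (he : 0 < e) : deg (vertical e he).1 = e := by
  simp [deg, coe_vertical]

theorem deg_pos (x : LatticeStar) : 0 < deg x.1 := by
  rw [deg, Int.gcd_pos_iff]
  by_contra h
  push Not at h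
  exact x.2 (funext fun i => by fin_cases i; exacts [h.1, h.2])

theorem smul_apply_zero (g : SL2Z) (x : Lattice) :
    g.1.mulVec x 0 = g.1 0 0 * x 0 + g.1 0 1 * x 1 := by
  simp [Matrix.mulVec, dotProduct, Fin.sum_univ_two]

theorem smul_apply_one (g : SL2Z) (x : Lattice) :
    g.1.mulVec x 1 = g.1 1 0 * x 0 + g.1 1 1 * x 1 := by
  simp [Matrix.mulVec, dotProduct, Fin.sum_univ_two]

theorem det_eq_one (g : SL2Z) : g.1 0 0 * g.1 1 1 - g.1 0 1 * g.1 1 0 = 1 := by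
  rw [← Matrix.det_fin_two]; exact g.2

theorem lattice_ext {x y : Lattice} (h0 : x 0 = y 0) (h1 : x 1 = y 1) : x = y :=
  funext fun i => by fin_cases i; exacts [h0, h1]

theorem exists_smul_vertical (x : LatticeStar) :
    ∃ g : SL2Z, x = g • vertical (deg x.1) (deg_pos x) := by
  obtain ⟨a, b, hab⟩ : ∃ a b, x.1 0 = deg x.1 * a ∧ x.1 1 = deg x.1 * b :=
    ⟨x.1 0 / deg x.1, x.1 1 / deg x.1,
      (Int.mul_ediv_cancel' (Int.gcd_dvd_left (x.1 0) (x.1 1))).symm,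
      (Int.mul_ediv_cancel' (Int.gcd_dvd_right (x.1 0) (x.1 1))).symm⟩
  have hd : ((deg x.1 : ℕ) : ℤ) ≠ 0 := by have := deg_pos x; omega
  have hb : (deg x.1 : ℤ) = x.1 0 * Int.gcdA (x.1 0) (x.1 1) + x.1 1 * Int.gcdB (x.1 0) (x.1 1) :=
    Int.gcd_eq_gcd_ab _ _
  set u := Int.gcdA (x.1 0) (x.1 1)
  set w := Int.gcdB (x.1 0) (x.1 1)
  have h1 : a * u + b * w = 1 := by
    apply mul_left_cancel₀ hd
    rw [mul_one]
    conv_rhs => rw [hb, hab.1, hab.2]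
    ring
  obtain ⟨g, hg⟩ : ∃ g : SL2Z, g.1 = !![w, a; -u, b] :=
    ⟨⟨!![w, a; -u, b], by rw [Matrix.det_fin_two_of]; linarith⟩, rfl⟩
  refine ⟨g, Subtype.ext ?_⟩
  rw [coe_smul]
  apply lattice_ext
  · rw [smul_apply_zero, coe_vertical, hg, hab.1]
    simp [mul_comm]
  · rw [smul_apply_one, coe_vertical, hg, hab.2]
    simp [mul_comm]

/-- The stabilizer of `(0, e)` is generated by `A₁`, which fixes the power sums of the `Y_j`. -/
theorem smul_vertical_eq {g h : SL2Z} {e f : ℕ} {he : 0 < e} {hf : 0 < f}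
    (H : g • vertical e he = h • vertical f hf) : e = f ∧ ∃ k : ℤ, g = h * A1 ^ k := by
  have hef : e = f := by
    have := congrArg (fun x : LatticeStar => deg x.1) H
    simpa only [coe_smul, deg_smul, deg_vertical] using this
  subst hef
  refine ⟨rfl, ?_⟩
  have h1 : (h⁻¹ * g) • vertical e he = vertical e he := by
    rw [mul_smul, H, inv_smul_smul]
  have h2 := congrArg Subtype.val h1
  rw [coe_smul] at h2
  have e0 := congrFun h2 0
  have e1 := congrFun h2 1
  rw [smul_apply_zero, coe_vertical] at e0
  rw [smul_apply_one, coe_vertical] at e1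
  have hd := det_eq_one (h⁻¹ * g)
  set m := h⁻¹ * g with hm
  simp at e0 e1
  have he0 : (e : ℤ) ≠ 0 := by omega
  have h01 : m.1 0 1 = 0 := e0.resolve_right he.ne'
  have h11 : m.1 1 1 = 1 := mul_right_cancel₀ he0 (e1.trans (one_mul _).symm)
  have h00 : m.1 0 0 = 1 := by rw [h01, h11] at hd; linarith
  refine ⟨m.1 1 0, ?_⟩
  have : m = A1 ^ (m.1 1 0) := by
    apply Subtype.ext
    rw [A1_zpow]
    ext i j
    fin_cases i <;> fin_cases j <;> simp [h00, h01, h11]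
  rw [← this, hm, mul_inv_cancel_left]

/-! ### The family `P` -/

variable {n : ℕ}

theorem rho1_Y_eq (hn : 0 < n) {j : ℕ} (hj : j < n) :
    unitAct (rho1 hn) (unitY n j) = unitY n j := by
  rw [unitAct_Y _ (rho1_T hn) hj, rho1_Y, strand_unitY hj]

theorem IsCherednikAction.A1_sandwich (hn : 0 < n)
    {ρ : SL2Z →* (Spherical n ≃ₐ[K'] Spherical n)} (h : IsCherednikAction n ρ) (a : Daha n) :
    ρ A1 (sandwich a) = sandwich (rho1 hn a) := by
  apply Spherical.ext
  rw [h.A1_val hn, sandwich_val, sandwich_val, map_mul, map_mul, rho1_symmetrizer]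

theorem rot_symmetrizer (hn : 0 < n) : rot hn (symmetrizer n) = symmetrizer n :=
  map_symmetrizer _ fun i => by
    have := congrArg Units.val (rot_T hn i)
    rwa [unitAct_val, unitT_val i.2] at this

theorem IsCherednikAction.rot_sandwich (hn : 0 < n)
    {ρ : SL2Z →* (Spherical n ≃ₐ[K'] Spherical n)} (h : IsCherednikAction n ρ) (a : Daha n) :
    ρ rotSL (sandwich a) = sandwich (rot hn a) := by
  apply Spherical.ext
  rw [h.rot_val hn, sandwich_val, sandwich_val, map_mul, map_mul, rot_symmetrizer]

/-- The power sum `∑_j u_j^e` of a family of units. -/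
noncomputable def psum (u : ℕ → (Daha n)ˣ) (e : ℕ) : Daha n :=
  ∑ j ∈ Finset.range n, (u j : Daha n) ^ e

theorem psum_unitY (e : ℕ) : psum (unitY n) e = ∑ j : Fin n, Daha.Y j ^ e := by
  rw [psum, Finset.sum_range]
  refine Finset.sum_congr rfl fun j _ => ?_
  rw [unitY_val j.2]

theorem map_psum (r : Daha n ≃ₐ[K'] Daha n) (u : ℕ → (Daha n)ˣ) (e : ℕ) :
    r (psum u e) = psum (fun j => unitAct r (u j)) e := by
  simp only [psum, map_sum, map_pow, unitAct_val]

theorem psum_congr {u w : ℕ → (Daha n)ˣ} (h : ∀ j < n, u j = w j) (e : ℕ) :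
    psum u e = psum w e :=
  Finset.sum_congr rfl fun j hj => by rw [h j (Finset.mem_range.mp hj)]

theorem rho1_psum_Y (hn : 0 < n) (e : ℕ) : rho1 hn (psum (unitY n) e) = psum (unitY n) e := by
  rw [map_psum]
  exact psum_congr (fun j hj => rho1_Y_eq hn hj) e

theorem IsCherednikAction.A1_zpow_psum (hn : 0 < n)
    {ρ : SL2Z →* (Spherical n ≃ₐ[K'] Spherical n)} (h : IsCherednikAction n ρ) (e : ℕ) (k : ℤ) :
    ρ (A1 ^ k) (sandwich (psum (unitY n) e)) = sandwich (psum (unitY n) e) := by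
  have h1 : ρ A1 ∈ MulAction.stabilizer (Spherical n ≃ₐ[K'] Spherical n)
      (sandwich (psum (unitY n) e)) := by
    rw [MulAction.mem_stabilizer_iff]
    change ρ A1 _ = _
    rw [h.A1_sandwich hn, rho1_psum_Y]
  have := zpow_mem h1 k
  rw [← map_zpow, MulAction.mem_stabilizer_iff] at this
  exact this

/-- The family `P`, defined through a choice of a matrix for every lattice point. -/
noncomputable def powerFamily (ρ : SL2Z →* (Spherical n ≃ₐ[K'] Spherical n)) (x : LatticeStar) :
    Spherical n :=
  ρ (exists_smul_vertical x).choose (sandwich (psum (unitY n) (deg x.1)))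

theorem isPowerSumFamily_iff {ρ : SL2Z →* (Spherical n ≃ₐ[K'] Spherical n)}
    {P : LatticeStar → Spherical n} : IsPowerSumFamily ρ P ↔
      ∀ (e : ℕ) (he : 0 < e) (g : SL2Z),
        P (g • vertical e he) = ρ g (sandwich (psum (unitY n) e)) := by
  simp only [IsPowerSumFamily, psum_unitY]

theorem powerFamily_isPowerSumFamily (hn : 0 < n)
    {ρ : SL2Z →* (Spherical n ≃ₐ[K'] Spherical n)} (h : IsCherednikAction n ρ) :
    IsPowerSumFamily ρ (powerFamily ρ) := by
  rw [isPowerSumFamily_iff]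
  intro e he g
  obtain ⟨h1, k, hk⟩ := smul_vertical_eq (exists_smul_vertical (g • vertical e he)).choose_spec
  have h2 : sandwich (psum (unitY n) (deg (g • vertical e he).1)) =
      sandwich (psum (unitY n) e) := congrArg (fun d => sandwich (psum (unitY n) d)) h1.symm
  rw [powerFamily, h2]
  conv_rhs => rw [hk, map_mul, AlgEquiv.mul_apply, h.A1_zpow_psum hn]

theorem IsPowerSumFamily.unique {ρ : SL2Z →* (Spherical n ≃ₐ[K'] Spherical n)}
    {P P' : LatticeStar → Spherical n} (h : IsPowerSumFamily ρ P) (h' : IsPowerSumFamily ρ P') :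
    P = P' := by
  funext x
  obtain ⟨g, hg⟩ := exists_smul_vertical x
  rw [hg, h, h']

theorem IsPowerSumFamily.smul {ρ : SL2Z →* (Spherical n ≃ₐ[K'] Spherical n)}
    {P : LatticeStar → Spherical n} (h : IsPowerSumFamily ρ P) (g : SL2Z) (x : LatticeStar) :
    P (g • x) = ρ g (P x) := by
  obtain ⟨k, hk⟩ := exists_smul_vertical x
  rw [hk, ← mul_smul, h, h, map_mul, AlgEquiv.mul_apply]

/-! ### Some members of the family -/

theorem sandwich_add (a b : Daha n) : sandwich (a + b) = sandwich a + sandwich b :=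
  Spherical.ext (by
    rw [Spherical.val_add]; simp only [sandwich_val, mul_add, add_mul])

theorem sandwich_smul (c : K') (a : Daha n) : sandwich (c • a) = c • sandwich a :=
  Spherical.ext (by
    rw [Spherical.val_smul]; simp only [sandwich_val, mul_smul_comm, smul_mul_assoc])

theorem sandwich_sub (a b : Daha n) : sandwich (a - b) = sandwich a - sandwich b := by
  rw [sub_eq_add_neg, ← neg_one_smul K' b, sandwich_add, sandwich_smul, neg_one_smul,
    ← sub_eq_add_neg]

theorem sandwich_zero : sandwich (0 : Daha n) = 0 := by
  rw [← zero_smul K' (0 : Daha n), sandwich_smul, zero_smul]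

theorem sandwich_sum {ι : Type*} (s : Finset ι) (f : ι → Daha n) :
    sandwich (∑ i ∈ s, f i) = ∑ i ∈ s, sandwich (f i) := by
  classical
  induction s using Finset.induction_on with
  | empty => simp [sandwich_zero]
  | insert i s hi ih => rw [Finset.sum_insert hi, Finset.sum_insert hi, sandwich_add, ih]

theorem sandwich_one : sandwich (1 : Daha n) = 1 :=
  Spherical.ext (by rw [sandwich_val, mul_one]; exact symmetrizer_idem n)

theorem sandwich_eigen_mul {c : K'} {u : Daha n} (hu : IsEigen c u) (a : Daha n) :
    sandwich (u * a) = c • sandwich a :=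
  Spherical.ext (by
    rw [Spherical.val_smul, sandwich_val, sandwich_val, ← mul_assoc, hu.2, smul_mul_assoc,
      smul_mul_assoc])

theorem sandwich_mul_eigen {c : K'} {u : Daha n} (hu : IsEigen c u) (a : Daha n) :
    sandwich (a * u) = c • sandwich a :=
  Spherical.ext (by
    rw [Spherical.val_smul, sandwich_val, sandwich_val, mul_assoc, mul_assoc, hu.1, mul_smul_comm,
      mul_smul_comm, ← mul_assoc])

theorem sandwich_mul_left {a : Daha n} (h : Commute a (symmetrizer n)) (b : Daha n) :
    sandwich (a * b) = sandwich a * sandwich b :=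
  Spherical.ext (by
    rw [Spherical.val_mul, sandwich_val, sandwich_val, sandwich_val]
    have h1 : symmetrizer n * a * symmetrizer n * (symmetrizer n * b * symmetrizer n) =
        symmetrizer n * a * (symmetrizer n * symmetrizer n) * b * symmetrizer n := by
      simp only [mul_assoc]
    rw [h1, (symmetrizer_idem n).eq, mul_assoc (symmetrizer n) a (symmetrizer n), h.eq]
    simp only [← mul_assoc]
    rw [(symmetrizer_idem n).eq])

theorem sandwich_mul_right {b : Daha n} (h : Commute b (symmetrizer n)) (a : Daha n) :
    sandwich (a * b) = sandwich a * sandwich b :=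
  Spherical.ext (by
    rw [Spherical.val_mul, sandwich_val, sandwich_val, sandwich_val]
    have h1 : symmetrizer n * a * symmetrizer n * (symmetrizer n * b * symmetrizer n) =
        symmetrizer n * a * (symmetrizer n * symmetrizer n) * (b * symmetrizer n) := by
      simp only [mul_assoc]
    rw [h1, (symmetrizer_idem n).eq, h.eq, ← mul_assoc _ (symmetrizer n) b,
      mul_assoc _ (symmetrizer n) (symmetrizer n), (symmetrizer_idem n).eq,
      mul_assoc _ (symmetrizer n) b, ← h.eq]
    simp only [mul_assoc])

theorem sandwich_conj {c : K'} {D : (Daha n)ˣ} (hc : c ≠ 0) (hD : IsEigen c (D : Daha n))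
    (a : Daha n) : sandwich (((D⁻¹ : (Daha n)ˣ) : Daha n) * a * (D : Daha n)) = sandwich a := by
  rw [sandwich_mul_eigen hD, sandwich_eigen_mul (hD.inv hc), smul_smul, mul_inv_cancel₀ hc,
    one_smul]

theorem sandwich_psum_conj {c : K'} (hc : c ≠ 0) {u w : ℕ → (Daha n)ˣ}
    (h : ∀ j k, j + k + 1 = n →
      w j = scalarUnit _ c hc * ((twist n)⁻¹ * u k * twist n)) (e : ℕ) :
    sandwich (psum w e) = c ^ e • sandwich (psum u e) := by
  obtain ⟨d, hd, hD⟩ := isEigen_halfTwist (n := n) le_rfl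
  have h1 : psum w e = c ^ e • (((twist n)⁻¹ : (Daha n)ˣ) * psum u e * (twist n : Daha n)) := by
    rw [psum, ← Finset.sum_range_reflect, psum, Finset.mul_sum, Finset.sum_mul, Finset.smul_sum]
    refine Finset.sum_congr rfl fun j hj => ?_
    have hj' := Finset.mem_range.mp hj
    have h2 : ∀ m : ℕ, (((twist n)⁻¹ * u j * twist n) ^ m : (Daha n)ˣ) =
        (twist n)⁻¹ * (u j) ^ m * twist n := fun m => by
      have := (conj_pow (i := m) (a := (twist n)⁻¹) (b := u j))
      rwa [inv_inv] at this
    have h3 := congrArg Units.val (h2 e)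
    have h4 : Commute (scalarUnit (Daha n) c hc) ((twist n)⁻¹ * u j * twist n) :=
      Units.ext (Algebra.commutes c _)
    rw [h (n - 1 - j) j (by omega), ← Units.val_pow_eq_pow_val, h4.mul_pow, Units.val_mul, h3,
      Units.val_mul, Units.val_mul, Units.val_pow_eq_pow_val, Units.val_pow_eq_pow_val,
      Algebra.smul_def, map_pow]
    rfl
  rw [h1, sandwich_smul, twist, sandwich_conj hd hD]

section Members

variable (hn : 0 < n) {ρ : SL2Z →* (Spherical n ≃ₐ[K'] Spherical n)}
  {P : LatticeStar → Spherical n}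

theorem IsPowerSumFamily.vertical (hP : IsPowerSumFamily ρ P) (e : ℕ) (he : 0 < e) :
    P (vertical e he) = sandwich (psum (unitY n) e) := by
  have := isPowerSumFamily_iff.mp hP e he 1
  rwa [one_smul, map_one] at this

theorem IsPowerSumFamily.rot_vertical (hn : 0 < n) (h : IsCherednikAction n ρ)
    (hP : IsPowerSumFamily ρ P) (e : ℕ) (he : 0 < e) :
    P (rotSL • EllipticHall.vertical e he) = sandwich (psum (fun j => (unitX n j)⁻¹) e) := by
  rw [hP.smul, hP.vertical, h.rot_sandwich hn, map_psum]
  rw [psum_congr fun j hj => rot_Y_eq hn hj]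

theorem IsPowerSumFamily.rot_sq_vertical (hn : 0 < n) (h : IsCherednikAction n ρ)
    (hP : IsPowerSumFamily ρ P) (e : ℕ) (he : 0 < e) :
    P (rotSL • rotSL • EllipticHall.vertical e he) =
      q' ^ e • sandwich (psum (fun j => (unitY n j)⁻¹) e) := by
  rw [hP.smul, hP.smul, hP.vertical, h.rot_sandwich hn, h.rot_sandwich hn, map_psum, map_psum]
  exact sandwich_psum_conj q'_ne_zero (fun j k hjk => rot_sq_Y hn hjk) e

theorem IsPowerSumFamily.rot_cube_vertical (hn : 0 < n) (h : IsCherednikAction n ρ)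
    (hP : IsPowerSumFamily ρ P) (e : ℕ) (he : 0 < e) :
    P (rotSL • rotSL • rotSL • EllipticHall.vertical e he) =
      q' ^ e • sandwich (psum (unitX n) e) := by
  rw [hP.smul, hP.smul, hP.rot_vertical hn h, h.rot_sandwich hn, h.rot_sandwich hn, map_psum,
    map_psum]
  refine sandwich_psum_conj q'_ne_zero (fun j k hjk => ?_) e
  rw [map_inv, map_inv, rot_sq_X hn hjk]
  change _ = qUnit _ * _
  have := (qUnit_central (A := Daha n) ((twist n)⁻¹ * (unitX n k)⁻¹ * twist n)⁻¹).eq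
  rw [mul_inv_rev, inv_inv, ← this]
  group

end Members
end EllipticHall

namespace EllipticHall

open Equiv

variable {n : ℕ}

/-! ### Commutation of the Hecke generators with power sums -/

section Exchange

variable {A : Type*} [Ring A] [Algebra K' A] {t a b : A} {c : K'}

/-- The exchange rule for powers, for two commuting elements with `t b t = a` and `t⁻¹ = t - c`. -/
theorem exchange_pow (hab : Commute a b) (h : t * a = b * t + c • a) (l : ℕ) :
    t * a ^ l = b ^ l * t + c • ∑ i ∈ Finset.range l, a ^ (i + 1) * b ^ (l - 1 - i) := by
  induction l with
  | zero => simp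
  | succ l ih =>
    rw [pow_succ, ← mul_assoc, ih, add_mul, mul_assoc, h, Finset.sum_range_succ', mul_add,
      ← mul_assoc, ← pow_succ, add_assoc, smul_add, mul_smul_comm, smul_mul_assoc, Finset.sum_mul]
    congr 1
    rw [add_comm]
    congr 1
    · congr 1
      refine Finset.sum_congr rfl fun i hi => ?_
      have := Finset.mem_range.mp hi
      rw [mul_assoc, (hab.symm.pow_left _).eq, ← mul_assoc, ← pow_succ]
      congr 2
      omega
    · rw [(hab.symm.pow_left _).eq]; simp

theorem exchange_pow' (h : t * b = a * t - c • a) (l : ℕ) :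
    t * b ^ l = a ^ l * t - c • ∑ i ∈ Finset.range l, a ^ (i + 1) * b ^ (l - 1 - i) := by
  induction l with
  | zero => simp
  | succ l ih =>
    rw [pow_succ, ← mul_assoc, ih, sub_mul, mul_assoc, h, Finset.sum_range_succ, mul_sub,
      ← mul_assoc, ← pow_succ, sub_sub, smul_add, mul_smul_comm, smul_mul_assoc, Finset.sum_mul]
    congr 1
    rw [add_comm]
    congr 1
    · congr 1
      refine Finset.sum_congr rfl fun i hi => ?_
      have := Finset.mem_range.mp hi
      rw [mul_assoc, ← pow_succ]
      congr 2
      omega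
    · simp [pow_succ]

theorem commute_pow_add_pow (hab : Commute a b) (h : t * a = b * t + c • a)
    (h' : t * b = a * t - c • a) (l : ℕ) : Commute t (a ^ l + b ^ l) := by
  rw [Commute, SemiconjBy, mul_add, exchange_pow hab h, exchange_pow' h', add_mul]
  abel

end Exchange

theorem unitT_inv_eq {i : ℕ} (h : i + 1 < n) : (((unitT n i)⁻¹ : (Daha n)ˣ) : Daha n) =
    (unitT n i : Daha n) - algebraMap K' (Daha n) (v' - v'⁻¹) := by
  have h1 := unitT_hecke h
  have h2 : (unitT n i : Daha n) *
      ((unitT n i : Daha n) - algebraMap K' (Daha n) (v' - v'⁻¹)) = 1 := by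
    have h3 : algebraMap K' (Daha n) v'⁻¹ * algebraMap K' (Daha n) v' = 1 := by
      rw [← map_mul, inv_mul_cancel₀ v'_ne_zero, map_one]
    have h4 := Algebra.commutes v' (unitT n i : Daha n)
    rw [add_mul, mul_sub, mul_sub, h3, Algebra.commutes v'⁻¹ (unitT n i : Daha n)] at h1
    rw [map_sub, mul_sub, mul_sub, ← sub_eq_zero]
    rw [← h1]; abel
  exact (Units.inv_eq_of_mul_eq_one_right h2)

theorem exchange_of {i : ℕ} (hi : i + 1 < n) {a b : (Daha n)ˣ}
    (h : unitT n i * b * unitT n i = a) :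
    (unitT n i : Daha n) * a = b * unitT n i + (v' - v'⁻¹) • (a : Daha n) ∧
      (unitT n i : Daha n) * b = a * unitT n i - (v' - v'⁻¹) • (a : Daha n) := by
  have h1 : (unitT n i)⁻¹ * a = b * unitT n i := by rw [← h]; group
  have h2 : unitT n i * b = a * (unitT n i)⁻¹ := by rw [← h]; group
  have h1' := congrArg Units.val h1
  have h2' := congrArg Units.val h2
  rw [Units.val_mul, unitT_inv_eq hi, sub_mul, ← Algebra.smul_def, Units.val_mul] at h1'
  rw [Units.val_mul, Units.val_mul, unitT_inv_eq hi, mul_sub, ← Algebra.commutes,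
    ← Algebra.smul_def] at h2'
  exact ⟨by rw [← h1']; abel, h2'⟩

theorem commute_unitT_psum {u : ℕ → (Daha n)ˣ}
    (hu : ∀ i j, i < n → j < n → Commute (u i) (u j))
    (hT : ∀ i j, i + 1 < n → j < n → j ≠ i → j ≠ i + 1 → Commute (unitT n i) (u j))
    (h : ∀ i, i + 1 < n → unitT n i * u i * unitT n i = u (i + 1) ∨
      unitT n i * u (i + 1) * unitT n i = u i) (e : ℕ) {i : ℕ} (hi : i + 1 < n) :
    Commute (unitT n i : Daha n) (psum u e) := by
  have h1 : Commute (unitT n i : Daha n) ((u i : Daha n) ^ e + (u (i + 1) : Daha n) ^ e) := by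
    have hc : Commute (u i : Daha n) (u (i + 1) : Daha n) :=
      congrArg Units.val (hu i (i + 1) (by omega) hi).eq
    rcases h i hi with h | h
    · rw [add_comm]
      exact commute_pow_add_pow hc.symm (exchange_of hi h).1 (exchange_of hi h).2 e
    · exact commute_pow_add_pow hc (exchange_of hi h).1 (exchange_of hi h).2 e
  have h2 : psum u e = (∑ j ∈ ((Finset.range n).erase i).erase (i + 1), (u j : Daha n) ^ e) +
      ((u i : Daha n) ^ e + (u (i + 1) : Daha n) ^ e) := by
    rw [psum, ← Finset.add_sum_erase _ _ (Finset.mem_range.mpr (by omega : i < n)),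
      ← Finset.add_sum_erase ((Finset.range n).erase i) (fun j => (u j : Daha n) ^ e)
        (Finset.mem_erase.mpr ⟨Nat.succ_ne_self i, Finset.mem_range.mpr hi⟩)]
    abel
  rw [h2]
  refine Commute.add_right (Commute.sum_right _ _ _ fun j hj => ?_) h1
  have h3 := Finset.mem_erase.mp hj
  have h4 := Finset.mem_erase.mp h3.2
  exact Commute.pow_right (congrArg Units.val
    (hT i j hi (Finset.mem_range.mp h4.2) h4.1 h3.1).eq) e

theorem commute_unitT_unitX {i j : ℕ} (hi : i + 1 < n) (hj : j < n) (h1 : j ≠ i)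
    (h2 : j ≠ i + 1) : Commute (unitT n i) (unitX n j) := by
  have he := daha_isElliptic (n := n) (by omega)
  rw [← strand_unitX hj]
  rcases Nat.lt_or_gt_of_ne h1 with h | h
  · exact he.affX.commute_strand_of_lt he.isBraid h hi
  · exact he.affX.commute_strand_of_gt he.isBraid (by omega) hj

theorem commute_unitT_unitY {i j : ℕ} (hi : i + 1 < n) (hj : j < n) (h1 : j ≠ i)
    (h2 : j ≠ i + 1) : Commute (unitT n i) (unitY n j) := by
  have he := (daha_isElliptic (n := n) (by omega)).swap
  rw [← strand_unitY hj]
  have : Commute ((unitT n)⁻¹ i) (strand (unitT n)⁻¹ (unitY n 0) j) := by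
    rcases Nat.lt_or_gt_of_ne h1 with h | h
    · exact he.affX.commute_strand_of_lt he.isBraid h hi
    · exact he.affX.commute_strand_of_gt he.isBraid (by omega) hj
  simpa using this.inv_left

theorem commute_unitX {i j : ℕ} (hi : i < n) (hj : j < n) : Commute (unitX n i) (unitX n j) := by
  have he := daha_isElliptic (n := n) (by omega)
  rw [← strand_unitX hi, ← strand_unitX hj]
  exact he.affX.commute_strand he.isBraid hi hj

theorem commute_unitY {i j : ℕ} (hi : i < n) (hj : j < n) : Commute (unitY n i) (unitY n j) := by
  have he := (daha_isElliptic (n := n) (by omega)).swap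
  rw [← strand_unitY hi, ← strand_unitY hj]
  exact he.affX.commute_strand he.isBraid hi hj

theorem unitX_succ {i : ℕ} (hi : i + 1 < n) :
    unitX n (i + 1) = unitT n i * unitX n i * unitT n i := by
  rw [← strand_unitX hi, ← strand_unitX (by omega : i < n)]; rfl

theorem unitY_succ {i : ℕ} (hi : i + 1 < n) :
    unitY n (i + 1) = (unitT n i)⁻¹ * unitY n i * (unitT n i)⁻¹ := by
  rw [← strand_unitY hi, ← strand_unitY (by omega : i < n)]; rfl

theorem commute_psum_unitX (e : ℕ) {i : ℕ} (hi : i + 1 < n) :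
    Commute (unitT n i : Daha n) (psum (unitX n) e) :=
  commute_unitT_psum (fun _ _ => commute_unitX) (fun _ _ => commute_unitT_unitX)
    (fun _ hi => Or.inl (unitX_succ hi).symm) e hi

theorem commute_psum_unitY (e : ℕ) {i : ℕ} (hi : i + 1 < n) :
    Commute (unitT n i : Daha n) (psum (unitY n) e) :=
  commute_unitT_psum (fun _ _ => commute_unitY) (fun _ _ => commute_unitT_unitY)
    (fun _ hi => Or.inr (by rw [unitY_succ hi]; group)) e hi

theorem commute_symmetrizer {a : Daha n} (h : ∀ i, i + 1 < n → Commute (unitT n i : Daha n) a) :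
    Commute a (symmetrizer n) := by
  have h1 : ∀ i, Commute a (Daha.T i) := fun i => by
    have := h i.val (by omega)
    rw [unitT_val i.2] at this
    exact this.symm
  rw [symmetrizer, preSymm]
  refine Commute.smul_right (Commute.sum_right _ _ _ fun w _ => Commute.smul_right ?_ _) _
  rw [dahaT, reducedProd]
  refine Commute.list_prod_right _ _ fun b hb => ?_
  obtain ⟨i, _, rfl⟩ := List.mem_map.mp hb
  exact h1 i

/-! ### The elements `P_{±1,l}` and their commutators with `P_{0,l}` -/

theorem commute_psum_psum {u w : ℕ → (Daha n)ˣ} (h : ∀ i < n, ∀ j < n, Commute (u i) (w j))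
    (e f : ℕ) : Commute (psum u e) (psum w f) :=
  Commute.sum_left _ _ _ fun i hi => Commute.sum_right _ _ _ fun j hj =>
    (Commute.pow_pow (congrArg Units.val
      (h i (Finset.mem_range.mp hi) j (Finset.mem_range.mp hj)).eq) e f)

theorem conj_pow' {G : Type*} [Group G] (g u : G) (l : ℕ) : (g * u * g⁻¹) ^ l = g * u ^ l * g⁻¹ :=
  conj_pow

/-- The conjugate of a power sum of the `Y_j` by `X₁`: all but one of the `Y_j` are permuted, up to
a conjugation which does not affect the power sum, and the remaining one is multiplied by a power
of `q`. -/
theorem psum_unitY_mul_unitX (hn : 0 < n) (l : ℕ) :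
    psum (unitY n) l * (unitX n 0 : Daha n) - (unitX n 0 : Daha n) * psum (unitY n) l =
      (q' ^ l - 1) • ((unitX n 0 : Daha n) * (unitY n 0 : Daha n) ^ l) := by
  have he := daha_isElliptic hn
  set x := unitX n 0
  set t := downProd (unitT n) (n - 1)
  have ht : Commute (t : Daha n) (psum (unitY n) l) := by
    have : ∀ k, k < n → Commute ((downProd (unitT n) k : (Daha n)ˣ) : Daha n)
        (psum (unitY n) l) := by
      intro k hk
      induction k with
      | zero => exact Commute.one_left _
      | succ k ih =>
        rw [downProd, Units.val_mul]
        exact (commute_psum_unitY l hk).mul_left (ih (by omega))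
    exact this _ (by omega)
  have h1 : ∀ j, j + 1 < n → (x : Daha n) * (unitY n (j + 1) : Daha n) ^ l * (x⁻¹ : (Daha n)ˣ) =
      (t⁻¹ : (Daha n)ˣ) * (unitY n j : Daha n) ^ l * t := by
    intro j hj
    have h2 := he.x_conj_strand_succ hj
    rw [strand_unitY hj, strand_unitY (by omega)] at h2
    have h3 := congrArg (fun u => u ^ l) h2
    rw [conj_pow', show t⁻¹ * unitY n j * t = t⁻¹ * unitY n j * t⁻¹⁻¹ by group, conj_pow',
      inv_inv] at h3
    have := congrArg Units.val h3
    simpa only [Units.val_mul, Units.val_pow_eq_pow_val] using this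
  have h0 : (x : Daha n) * (unitY n 0 : Daha n) ^ l * (x⁻¹ : (Daha n)ˣ) =
      (q'⁻¹ ^ l) • ((t⁻¹ : (Daha n)ˣ) * (unitY n (n - 1) : Daha n) ^ l * t) := by
    have h2 := he.x_conj_y
    rw [strand_unitY (by omega)] at h2
    have h3 := congrArg (fun u => u ^ l) h2
    rw [conj_pow', (qUnit_central _).inv_left.mul_pow,
      show t⁻¹ * unitY n (n - 1) * t = t⁻¹ * unitY n (n - 1) * t⁻¹⁻¹ by group, conj_pow',
      inv_inv] at h3
    have := congrArg Units.val h3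
    simp only [Units.val_mul, Units.val_pow_eq_pow_val] at this
    rw [this, Algebra.smul_def, map_pow]
    rfl
  obtain ⟨m, rfl⟩ : ∃ m, n = m + 1 := ⟨n - 1, by omega⟩
  have h4 : (x : Daha (m + 1)) * psum (unitY (m + 1)) l * (x⁻¹ : (Daha (m + 1))ˣ) =
      psum (unitY (m + 1)) l + (1 - q' ^ l) •
        ((x : Daha (m + 1)) * (unitY (m + 1) 0 : Daha (m + 1)) ^ l * (x⁻¹ : (Daha (m + 1))ˣ)) := by
    have h5 : (t⁻¹ : (Daha (m + 1))ˣ) * psum (unitY (m + 1)) l * (t : Daha (m + 1)) =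
        psum (unitY (m + 1)) l := by
      rw [mul_assoc, ← ht.eq, ← mul_assoc, Units.inv_mul, one_mul]
    conv_rhs => rw [← h5]
    rw [sub_smul, one_smul, h0, smul_smul, ← mul_pow, mul_inv_cancel₀ q'_ne_zero, one_pow,
      one_smul, psum]
    conv_lhs => rw [Finset.sum_range_succ', mul_add, add_mul, h0, Finset.mul_sum, Finset.sum_mul]
    conv_rhs => rw [Finset.sum_range_succ, mul_add, add_mul, Finset.mul_sum, Finset.sum_mul]
    rw [Finset.sum_congr rfl fun j hj => h1 j (by have := Finset.mem_range.mp hj; omega)]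
    simp only [Nat.add_sub_cancel]
    abel
  have h6 := congrArg (fun a => a * (x : Daha (m + 1))) h4
  simp only [add_mul, smul_mul_assoc, Units.inv_mul_cancel_right] at h6
  rw [h6, sub_smul, sub_smul]
  abel

theorem psum_unitY_mul_unitX_inv (hn : 0 < n) (l : ℕ) :
    psum (unitY n) l * ((unitX n 0)⁻¹ : (Daha n)ˣ) - ((unitX n 0)⁻¹ : (Daha n)ˣ) * psum (unitY n) l =
      -((q' ^ l - 1) • ((unitY n 0 : Daha n) ^ l * ((unitX n 0)⁻¹ : (Daha n)ˣ))) := by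
  have h := psum_unitY_mul_unitX hn l
  have h1 := congrArg (fun a => (((unitX n 0)⁻¹ : (Daha n)ˣ) : Daha n) * a *
    (((unitX n 0)⁻¹ : (Daha n)ˣ) : Daha n)) h
  simp only [mul_sub, sub_mul, mul_smul_comm, smul_mul_assoc, ← mul_assoc, Units.inv_mul,
    one_mul, Units.mul_inv_cancel_right] at h1
  rw [← h1]; abel

theorem sandwich_unitX {j : ℕ} (hj : j < n) :
    sandwich (unitX n j : Daha n) = (v' ^ 2) ^ j • sandwich (unitX n 0 : Daha n) := by
  rw [← strand_unitX hj, strand_eq, Units.val_mul, Units.val_mul,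
    sandwich_mul_eigen (isEigen_upProd hj), sandwich_eigen_mul (isEigen_downProd hj), smul_smul,
    ← pow_mul, two_mul, pow_add]

theorem sandwich_unitX_inv {j : ℕ} (hj : j < n) :
    sandwich (((unitX n j)⁻¹ : (Daha n)ˣ) : Daha n) =
      (v'⁻¹ ^ 2) ^ j • sandwich (((unitX n 0)⁻¹ : (Daha n)ˣ) : Daha n) := by
  have hv := pow_ne_zero j v'_ne_zero
  rw [← strand_unitX hj, strand_eq, mul_inv_rev, mul_inv_rev, ← mul_assoc, Units.val_mul,
    Units.val_mul, sandwich_mul_eigen ((isEigen_downProd hj).inv hv),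
    sandwich_eigen_mul ((isEigen_upProd hj).inv hv), smul_smul, ← pow_mul, two_mul, pow_add,
    inv_pow]

/-- The point `(a, b)` with `a ≠ 0`. -/
def point (a b : ℤ) (ha : a ≠ 0) : LatticeStar := ⟨![a, b], fun h => ha (congrFun h 0)⟩

theorem rotSL_smul (x : LatticeStar) : (rotSL • x).1 = ![-x.1 1, x.1 0] := by
  rw [coe_smul]
  apply lattice_ext
  · rw [smul_apply_zero, rotSL_val]; simp
  · rw [smul_apply_one, rotSL_val]; simp

theorem A1_zpow_smul (k : ℤ) (x : LatticeStar) : (A1 ^ k • x).1 = ![x.1 0, x.1 1 + k * x.1 0] := by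
  rw [coe_smul]
  apply lattice_ext
  · rw [smul_apply_zero, A1_zpow]; simp
  · rw [smul_apply_one, A1_zpow]; simp [add_comm]

theorem IsCherednikAction.A1_pow_sandwich (hn : 0 < n)
    {ρ : SL2Z →* (Spherical n ≃ₐ[K'] Spherical n)} (h : IsCherednikAction n ρ) (k : ℕ)
    (a : Daha n) : ρ (A1 ^ k) (sandwich a) = sandwich ((rho1 hn ^ k) a) := by
  induction k generalizing a with
  | zero => simp
  | succ k ih =>
    rw [pow_succ', map_mul, AlgEquiv.mul_apply, ih, h.A1_sandwich hn, pow_succ']; rfl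

theorem rho1_pow_X (hn : 0 < n) (l : ℕ) :
    unitAct (rho1 hn ^ l) (unitX n 0) = unitX n 0 * unitY n 0 ^ l := by
  induction l with
  | zero => rw [pow_zero, pow_zero, mul_one]; exact Units.ext rfl
  | succ l ih =>
    rw [pow_succ', unitAct_mul, ih, map_mul, map_pow, rho1_X, rho1_Y, pow_succ', mul_assoc]

section Members

variable {ρ : SL2Z →* (Spherical n ≃ₐ[K'] Spherical n)} {P : LatticeStar → Spherical n}

theorem IsPowerSumFamily.one_zero (hn : 0 < n) (h : IsCherednikAction n ρ)
    (hP : IsPowerSumFamily ρ P) : P (point 1 0 one_ne_zero) =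
      q' • sandwich (psum (unitX n) 1) := by
  have := hP.rot_cube_vertical hn h 1 one_pos
  rw [pow_one] at this
  rw [← this]
  congr 1
  apply Subtype.ext
  rw [rotSL_smul, rotSL_smul, rotSL_smul]
  apply lattice_ext <;> simp [point, coe_vertical]

theorem IsPowerSumFamily.neg_one_zero (hn : 0 < n) (h : IsCherednikAction n ρ)
    (hP : IsPowerSumFamily ρ P) : P (point (-1) 0 (by decide)) =
      sandwich (psum (fun j => (unitX n j)⁻¹) 1) := by
  have := hP.rot_vertical hn h 1 one_pos
  rw [← this]
  congr 1
  apply Subtype.ext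
  rw [rotSL_smul]
  apply lattice_ext <;> simp [point, coe_vertical]

theorem IsPowerSumFamily.one_left (hn : 0 < n) (h : IsCherednikAction n ρ)
    (hP : IsPowerSumFamily ρ P) (l : ℕ) : P (point 1 l one_ne_zero) =
      (q' * ∑ j ∈ Finset.range n, (v' ^ 2) ^ j) •
        sandwich ((unitX n 0 : Daha n) * (unitY n 0 : Daha n) ^ l) := by
  have h1 : P (point 1 0 one_ne_zero) =
      (q' * ∑ j ∈ Finset.range n, (v' ^ 2) ^ j) • sandwich (unitX n 0 : Daha n) := by
    rw [hP.one_zero hn h, psum, sandwich_sum, mul_smul, Finset.sum_smul]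
    congr 1
    refine Finset.sum_congr rfl fun j hj => ?_
    rw [pow_one, sandwich_unitX (Finset.mem_range.mp hj)]
  have h2 : point 1 l one_ne_zero = A1 ^ l • point 1 0 one_ne_zero := by
    apply Subtype.ext
    rw [← zpow_natCast, A1_zpow_smul]
    apply lattice_ext <;> simp [point]
  have h3 := congrArg Units.val (rho1_pow_X hn l)
  rw [Units.val_mul, Units.val_pow_eq_pow_val] at h3
  rw [h2, hP.smul, h1, map_smul, h.A1_pow_sandwich hn, ← h3]
  rfl

theorem IsPowerSumFamily.neg_one_left (hn : 0 < n) (h : IsCherednikAction n ρ)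
    (hP : IsPowerSumFamily ρ P) (l : ℕ) : P (point (-1) l (by decide)) =
      (∑ j ∈ Finset.range n, (v'⁻¹ ^ 2) ^ j) •
        sandwich ((unitY n 0 : Daha n) ^ l * (((unitX n 0)⁻¹ : (Daha n)ˣ) : Daha n)) := by
  have h1 : P (point (-1) 0 (by decide)) =
      (∑ j ∈ Finset.range n, (v'⁻¹ ^ 2) ^ j) •
        sandwich (((unitX n 0)⁻¹ : (Daha n)ˣ) : Daha n) := by
    rw [hP.neg_one_zero hn h, psum, sandwich_sum, Finset.sum_smul]
    refine Finset.sum_congr rfl fun j hj => ?_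
    rw [pow_one, sandwich_unitX_inv (Finset.mem_range.mp hj)]
  have h2 : point (-1) 0 (by decide) = A1 ^ l • point (-1) l (by decide) := by
    apply Subtype.ext
    rw [← zpow_natCast, A1_zpow_smul]
    apply lattice_ext <;> simp [point]
  have h3 : unitAct (rho1 hn ^ l) (unitY n 0 ^ l * (unitX n 0)⁻¹) = (unitX n 0)⁻¹ := by
    have h4 : unitAct (rho1 hn ^ l) (unitY n 0) = unitY n 0 := by
      generalize l = k
      induction k with
      | zero => exact Units.ext rfl
      | succ k ih => rw [pow_succ', unitAct_mul, ih, rho1_Y]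
    rw [map_mul, map_inv, map_pow, rho1_pow_X, h4]; group
  have h5 := congrArg Units.val h3
  rw [unitAct_val, Units.val_mul, Units.val_pow_eq_pow_val] at h5
  apply (ρ (A1 ^ l)).injective
  rw [← hP.smul, ← h2, h1, map_smul, h.A1_pow_sandwich hn, h5]

theorem IsPowerSumFamily.commutator_one (hn : 0 < n) (h : IsCherednikAction n ρ)
    (hP : IsPowerSumFamily ρ P) (l : ℕ) (hl : 0 < l) :
    P (EllipticHall.vertical l hl) * P (point 1 0 one_ne_zero) -
      P (point 1 0 one_ne_zero) * P (EllipticHall.vertical l hl) =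
      (q' ^ l - 1) • P (point 1 l one_ne_zero) := by
  have hS := commute_symmetrizer (n := n) fun i hi => commute_psum_unitY l hi
  have h0 := hP.one_left hn h 0
  rw [pow_zero, mul_one] at h0
  rw [hP.vertical, hP.one_left hn h l]
  have h0' : P (point 1 0 one_ne_zero) = _ := h0
  rw [h0', mul_smul_comm, smul_mul_assoc, ← sandwich_mul_left hS, ← sandwich_mul_right hS,
    ← smul_sub, ← sandwich_sub, psum_unitY_mul_unitX hn, sandwich_smul, smul_comm]

theorem IsPowerSumFamily.commutator_neg_one (hn : 0 < n) (h : IsCherednikAction n ρ)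
    (hP : IsPowerSumFamily ρ P) (l : ℕ) (hl : 0 < l) :
    P (EllipticHall.vertical l hl) * P (point (-1) 0 (by decide)) -
      P (point (-1) 0 (by decide)) * P (EllipticHall.vertical l hl) =
      -((q' ^ l - 1) • P (point (-1) l (by decide))) := by
  have hS := commute_symmetrizer (n := n) fun i hi => commute_psum_unitY l hi
  have h0 := hP.neg_one_left hn h 0
  rw [pow_zero, one_mul] at h0
  rw [hP.vertical, hP.neg_one_left hn h l]
  have h0' : P (point (-1) 0 (by decide)) = _ := h0
  rw [h0', mul_smul_comm, smul_mul_assoc, ← sandwich_mul_left hS, ← sandwich_mul_right hS,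
    ← smul_sub, ← sandwich_sub, psum_unitY_mul_unitX_inv hn, ← neg_smul, sandwich_smul, smul_comm,
    neg_smul]

end Members
end EllipticHall

namespace EllipticHall

/-! ### Symmetrized rational functions of commuting elements -/

/-- Commuting elements `y_0, …, y_{n-1}` and units `T_i` as in the affine Hecke algebra, with Hecke
parameter `v`, together with an idempotent `S` on which the `T_i` act by `v` from both sides. All
the elements `1 - c y_j` are required to be invertible. -/
structure IsSymmetrized {k A : Type*} [Field k] [Ring A] [Algebra k A] (v : k) (n : ℕ) (T : ℕ → Aˣ)
    (S : A) (y : ℕ → A) : Prop where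
  ne_zero : v ≠ 0
  comm : ∀ i j, i < n → j < n → Commute (y i) (y j)
  far : ∀ i j, i + 1 < n → j < n → j ≠ i → j ≠ i + 1 → Commute (T i : A) (y j)
  loop : ∀ i, i + 1 < n → (T i : A) * y (i + 1) * T i = y i
  hecke : ∀ i, i + 1 < n → (((T i)⁻¹ : Aˣ) : A) = (T i : A) - (v - v⁻¹) • 1
  T_mul : ∀ i, i + 1 < n → (T i : A) * S = v • S
  mul_T : ∀ i, i + 1 < n → S * (T i : A) = v • S
  idem : S * S = S
  isUnit : ∀ (c : k) (j : ℕ), IsUnit (1 - c • y j)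
  commute_of : ∀ a, (∀ i, i + 1 < n → Commute (T i : A) a) → Commute a S

namespace IsSymmetrized

variable {k A : Type*} [Field k] [Ring A] [Algebra k A] {v : k} {n : ℕ} {T : ℕ → Aˣ} {S : A} {y : ℕ → A}

/-- Reversing the order of the `y_j` replaces the `T_i` by their inverses and `v` by `v⁻¹`. -/
theorem flip (h : IsSymmetrized v n T S y) :
    IsSymmetrized v⁻¹ n (fun i => (T (n - 2 - i))⁻¹) S (fun j => y (n - 1 - j)) where
  ne_zero := inv_ne_zero h.ne_zero
  comm i j hi hj := h.comm _ _ (by omega) (by omega)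
  far i j hi hj h1 h2 := by
    have : Commute (T (n - 2 - i) : A) (y (n - 1 - j)) :=
      h.far _ _ (by omega) (by omega) (by omega) (by omega)
    exact this.units_inv_left
  loop i hi := by
    have h1 := h.loop (n - 2 - i) (by omega)
    rw [show n - 2 - i + 1 = n - 1 - i by omega] at h1
    rw [show n - 1 - (i + 1) = n - 2 - i by omega, ← h1]
    simp [mul_assoc]
  hecke i hi := by
    rw [inv_inv, h.hecke _ (by omega), inv_inv, sub_sub, ← add_smul]
    simp
  T_mul i hi := by
    have h1 := h.T_mul (n - 2 - i) (by omega)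
    rw [Units.inv_mul_eq_iff_eq_mul, mul_smul_comm, h1, smul_smul, inv_mul_cancel₀ h.ne_zero,
      one_smul]
  mul_T i hi := by
    have h1 := h.mul_T (n - 2 - i) (by omega)
    rw [Units.mul_inv_eq_iff_eq_mul, smul_mul_assoc, h1, smul_smul, inv_mul_cancel₀ h.ne_zero,
      one_smul]
  idem := h.idem
  isUnit c j := h.isUnit c _
  commute_of a ha := h.commute_of a fun i hi => by
    have := ha (n - 2 - i) (by omega)
    rw [show n - 2 - (n - 2 - i) = i by omega] at this
    simpa using this.units_inv_left

/-- The unit `1 - c y_j`. -/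
noncomputable def lin (h : IsSymmetrized v n T S y) (c : k) (j : ℕ) : Aˣ := (h.isUnit c j).unit

theorem lin_val (h : IsSymmetrized v n T S y) (c : k) (j : ℕ) : (h.lin c j : A) = 1 - c • y j := rfl

theorem commute_lin (h : IsSymmetrized v n T S y) (c d : k) {i j : ℕ} (hi : i < n) (hj : j < n) :
    Commute (h.lin c i) (h.lin d j) := by
  apply Units.ext
  have := ((h.comm i j hi hj).smul_left c).smul_right d
  exact (((Commute.one_left _).sub_left (((Commute.one_right _)).sub_right this)).eq)

theorem commute_T_lin (h : IsSymmetrized v n T S y) (c : k) {i j : ℕ} (hi : i + 1 < n)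
    (hj : j < n) (h1 : j ≠ i) (h2 : j ≠ i + 1) : Commute (T i) (h.lin c j) :=
  Units.ext ((Commute.one_right (T i : A)).sub_right ((h.far i j hi hj h1 h2).smul_right c)).eq

/-- The fraction `(1 - v⁻² c y_j) / (1 - c y_j)`. -/
noncomputable def frac (h : IsSymmetrized v n T S y) (c : k) (j : ℕ) : Aˣ :=
  h.lin (v⁻¹ ^ 2 * c) j * (h.lin c j)⁻¹

theorem commute_T_frac (h : IsSymmetrized v n T S y) (c : k) {i j : ℕ} (hi : i + 1 < n)
    (hj : j < n) (h1 : j ≠ i) (h2 : j ≠ i + 1) : Commute (T i) (h.frac c j) :=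
  (h.commute_T_lin _ hi hj h1 h2).mul_right (h.commute_T_lin _ hi hj h1 h2).inv_right

theorem frac_val (h : IsSymmetrized v n T S y) (c : k) (j : ℕ) :
    (h.frac c j : A) = (v⁻¹ ^ 2) • 1 + (1 - v⁻¹ ^ 2) • (((h.lin c j)⁻¹ : Aˣ) : A) := by
  rw [frac, Units.val_mul, Units.mul_inv_eq_iff_eq_mul, add_mul, smul_mul_assoc, smul_mul_assoc,
    Units.inv_mul, one_mul, lin_val, lin_val]
  module

theorem exchange (h : IsSymmetrized v n T S y) {i : ℕ} (hi : i + 1 < n) :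
    (T i : A) * y i = y (i + 1) * T i + (v - v⁻¹) • y i := by
  have h1 : (((T i)⁻¹ : Aˣ) : A) * y i = y (i + 1) * T i := by
    rw [← h.loop i hi]; simp [mul_assoc]
  rw [h.hecke i hi, sub_mul, smul_mul_assoc, one_mul] at h1
  rw [← h1]; abel

theorem exchange' (h : IsSymmetrized v n T S y) {i : ℕ} (hi : i + 1 < n) :
    (T i : A) * y (i + 1) = y i * T i - (v - v⁻¹) • y i := by
  have h1 : y i * (((T i)⁻¹ : Aˣ) : A) = T i * y (i + 1) := by
    rw [← h.loop i hi]; simp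
  rw [h.hecke i hi, mul_sub, mul_smul_comm, mul_one] at h1
  exact h1.symm

/-- As `S T_i = v S`, this means that after symmetrization `(1 - c y_i)⁻¹` can be replaced by
`(1 - c y_{i+1})⁻¹` at the cost of the fraction `(1 - v⁻² c y_i) / (1 - c y_i)`. -/
theorem T_mul_inv_lin (h : IsSymmetrized v n T S y) (c : k) {i : ℕ} (hi : i + 1 < n) :
    (T i : A) * (((h.lin c i)⁻¹ : Aˣ) : A) * S =
      v • ((h.frac c i : A) * (((h.lin c (i + 1))⁻¹ : Aˣ) : A) * S) := by
  have hv := h.ne_zero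
  have h1 : (h.lin c (i + 1) : A) * T i = T i * h.lin c i + (c * (v - v⁻¹)) • y i := by
    rw [lin_val, lin_val, sub_mul, mul_sub, mul_smul_comm, h.exchange hi, smul_mul_assoc]
    simp only [one_mul, mul_one]
    module
  have h2 : (T i : A) * (((h.lin c i)⁻¹ : Aˣ) : A) =
      (((h.lin c (i + 1))⁻¹ : Aˣ) : A) * (T i + (c * (v - v⁻¹)) •
        (y i * (((h.lin c i)⁻¹ : Aˣ) : A))) := by
    rw [eq_comm, Units.inv_mul_eq_iff_eq_mul, ← mul_assoc, h1, add_mul, Units.mul_inv_cancel_right,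
      smul_mul_assoc]
  have h3 : c • (y i * (((h.lin c i)⁻¹ : Aˣ) : A)) = (((h.lin c i)⁻¹ : Aˣ) : A) - 1 := by
    have := Units.mul_inv (h.lin c i)
    rw [lin_val, sub_mul, one_mul, smul_mul_assoc] at this
    rw [← this]; abel
  have h4 : (c * (v - v⁻¹)) • (y i * (((h.lin c i)⁻¹ : Aˣ) : A)) =
      (v - v⁻¹) • ((((h.lin c i)⁻¹ : Aˣ) : A) - 1) := by
    rw [mul_comm, mul_smul, h3]
  have h5 : Commute (((h.lin c i)⁻¹ : Aˣ) : A) (((h.lin c (i + 1))⁻¹ : Aˣ) : A) :=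
    congrArg Units.val (h.commute_lin c c (by omega : i < n) hi).inv_inv.eq
  rw [h2, h4, frac_val, mul_assoc, add_mul, h.T_mul i hi, smul_mul_assoc, sub_mul, one_mul, add_mul,
    smul_mul_assoc, smul_mul_assoc, one_mul, add_mul, smul_mul_assoc, smul_mul_assoc, h5.eq, mul_add,
    mul_smul_comm, mul_smul_comm, mul_sub, mul_assoc]
  match_scalars <;> field_simp <;> ring

theorem sandwich_inv_lin (h : IsSymmetrized v n T S y) (c : k) {m : ℕ} (hm : m ≤ n) {z : A}
    (hz : ∀ i, i + 1 < m → Commute (T i : A) z) {l : ℕ} (hk : l < m) :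
    S * z * ((upProd (h.frac c) l : Aˣ) : A) * (((h.lin c l)⁻¹ : Aˣ) : A) * S =
      S * z * (((h.lin c 0)⁻¹ : Aˣ) : A) * S := by
  induction l with
  | zero => simp [upProd]
  | succ l ih =>
    rw [← ih (by omega)]
    have h1 := h.T_mul_inv_lin c (i := l) (by omega)
    have h2 : (h.frac c l : A) * (((h.lin c (l + 1))⁻¹ : Aˣ) : A) * S =
        v⁻¹ • ((T l : A) * (((h.lin c l)⁻¹ : Aˣ) : A) * S) := by
      rw [h1, smul_smul, inv_mul_cancel₀ h.ne_zero, one_smul]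
    have h3 : Commute (T l : A) (z * ((upProd (h.frac c) l : Aˣ) : A)) := by
      refine (hz l hk).mul_right (congrArg Units.val (commute_upProd_of fun i hi => ?_).symm.eq)
      exact (h.commute_T_frac c (by omega) (by omega) (by omega) (by omega)).symm
    rw [upProd, Units.val_mul]
    calc S * z * (((upProd (h.frac c) l : Aˣ) : A) * h.frac c l) *
          (((h.lin c (l + 1))⁻¹ : Aˣ) : A) * S
        = S * (z * ((upProd (h.frac c) l : Aˣ) : A)) *
          ((h.frac c l : A) * (((h.lin c (l + 1))⁻¹ : Aˣ) : A) * S) := by simp only [mul_assoc]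
      _ = v⁻¹ • (S * ((z * ((upProd (h.frac c) l : Aˣ) : A)) * T l) *
          ((((h.lin c l)⁻¹ : Aˣ) : A) * S)) := by
          rw [h2, mul_smul_comm]; simp only [mul_assoc]
      _ = v⁻¹ • ((S * T l) * (z * ((upProd (h.frac c) l : Aˣ) : A)) *
          ((((h.lin c l)⁻¹ : Aˣ) : A) * S)) := by rw [← h3.eq]; simp only [mul_assoc]
      _ = _ := by
          rw [h.mul_T l (by omega), smul_mul_assoc, smul_mul_assoc, smul_smul,
            inv_mul_cancel₀ h.ne_zero, one_smul]
          simp only [mul_assoc]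

/-- A telescoping sum: the product of the first `l` fractions is, after symmetrization, an affine
function of `(1 - c y_0)⁻¹`. -/
theorem sandwich_upProd_frac (h : IsSymmetrized v n T S y) (c : k) {m : ℕ} (hm : m ≤ n) {z : A}
    (hz : ∀ i, i + 1 < m → Commute (T i : A) z) {l : ℕ} (hk : l ≤ m) :
    S * z * ((upProd (h.frac c) l : Aˣ) : A) * S - S * z * (((h.lin c 0)⁻¹ : Aˣ) : A) * S =
      (v⁻¹ ^ 2) ^ l • (S * z * S - S * z * (((h.lin c 0)⁻¹ : Aˣ) : A) * S) := by
  induction l with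
  | zero => simp [upProd]
  | succ l ih =>
    have h1 := h.sandwich_inv_lin c hm hz (l := l) (by omega)
    have h2 := ih (by omega)
    rw [upProd, Units.val_mul, frac_val, mul_add, mul_add, add_mul, mul_smul_comm, mul_smul_comm,
      mul_smul_comm, mul_smul_comm, smul_mul_assoc, smul_mul_assoc, mul_one, ← mul_assoc, h1,
      pow_succ]
    linear_combination (norm := module) (v⁻¹ ^ 2) • h2

theorem commute_T_lin_mul (h : IsSymmetrized v n T S y) (c : k) {i : ℕ} (hi : i + 1 < n) :
    Commute (T i) (h.lin c i * h.lin c (i + 1)) := by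
  apply Units.ext
  simp only [Units.val_mul, lin_val]
  have h0 : (T i : A) * (y i * y (i + 1)) = y i * y (i + 1) * T i := by
    have hc := (h.comm i (i + 1) (by omega) hi).eq
    rw [← mul_assoc, h.exchange hi, add_mul, mul_assoc, h.exchange' hi, mul_sub, ← mul_assoc,
      mul_smul_comm, smul_mul_assoc, hc]
    abel
  have h1 : (1 - c • y i) * (1 - c • y (i + 1)) =
      1 - c • (y i + y (i + 1)) + (c * c) • (y i * y (i + 1)) := by
    simp only [sub_mul, mul_sub, one_mul, mul_one, smul_mul_assoc, mul_smul_comm]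
    module
  rw [h1]
  simp only [mul_add, add_mul, mul_sub, sub_mul, mul_one, one_mul, mul_smul_comm, smul_mul_assoc,
    h0, h.exchange hi, h.exchange' hi]
  module

theorem commute_frac (h : IsSymmetrized v n T S y) (c : k) {i j : ℕ} (hi : i < n) (hj : j < n)
    (d : k) : Commute (h.frac c i) (h.lin d j) :=
  (h.commute_lin _ _ hi hj).mul_left (h.commute_lin _ _ hi hj).inv_left

theorem commute_T_upProd_frac (h : IsSymmetrized v n T S y) (c : k) {i : ℕ} (hi : i + 1 < n) :
    Commute (T i) (upProd (h.frac c) n) := by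
  have h0 : Commute (T i) (h.frac c i * h.frac c (i + 1)) := by
    have h1 := (h.commute_T_lin_mul (v⁻¹ ^ 2 * c) hi).mul_right
      (h.commute_T_lin_mul c hi).inv_right
    have h2 := (h.commute_lin (v⁻¹ ^ 2 * c) c hi (by omega : i < n)).inv_right.eq
    have h3 := (h.commute_lin c c hi (by omega : i < n)).inv_inv.eq
    have h4 : h.frac c i * h.frac c (i + 1) = h.lin (v⁻¹ ^ 2 * c) i * h.lin (v⁻¹ ^ 2 * c) (i + 1) *
        (h.lin c i * h.lin c (i + 1))⁻¹ := by
      rw [frac, frac, mul_inv_rev, h3, mul_assoc, ← mul_assoc (h.lin c i)⁻¹, ← h2]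
      simp only [mul_assoc]
    rwa [h4]
  have key : ∀ l, i + 2 ≤ l → l ≤ n → Commute (T i) (upProd (h.frac c) l) := by
    intro l hk
    induction l, hk using Nat.le_induction with
    | base =>
      intro _
      rw [upProd, upProd, mul_assoc]
      refine Commute.mul_right (commute_upProd_of fun j hj => ?_).symm h0
      exact (h.commute_T_frac c hi (by omega) (by omega) (by omega)).symm
    | succ l hk ih =>
      intro hkn
      rw [upProd]
      exact (ih (by omega)).mul_right (h.commute_T_frac c hi (by omega) (by omega) (by omega))
  exact key n hi le_rfl

theorem downProd_eq_upProd_flip {M : Type*} [Monoid M] (f : ℕ → M) (n : ℕ) :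
    downProd f n = upProd (fun j => f (n - 1 - j)) n := by
  have key : ∀ l ≤ n, upProd (fun j => f (n - 1 - j)) l * downProd f (n - l) = downProd f n := by
    intro l hk
    induction l with
    | zero => simp [upProd]
    | succ l ih =>
      rw [← ih (by omega), upProd, mul_assoc, show n - l = (n - (l + 1)) + 1 by omega]
      congr 1
      rw [downProd, show n - 1 - l = n - (l + 1) by omega]
  have := key n le_rfl
  rw [Nat.sub_self, downProd, mul_one] at this
  exact this.symm

/-- The symmetrization of the generating function of the commutators `[P_{-1,l}, P_{1,0}]`. -/
theorem symmetrized_identity (h : IsSymmetrized v n T S y) (hn : 0 < n) (r : k) :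
    ((1 - r * v ^ 2) * (1 - (v⁻¹ ^ 2) ^ n)) •
      ((v ^ 2) ^ (n - 1) • (S * (((h.lin 1 0)⁻¹ : Aˣ) : A) * S) +
        (1 - (v ^ 2) ^ (n - 1)) •
          (S * (((h.lin 1 0)⁻¹ : Aˣ) : A) * (((h.lin r (n - 1))⁻¹ : Aˣ) : A) * S) -
        S * (((h.lin r (n - 1))⁻¹ : Aˣ) : A) * S) =
      (1 - r) • (S * ((upProd (h.frac 1) n : Aˣ) : A) * ((upProd (h.flip.frac r) n : Aˣ) : A) * S -
        S) := by
  have hv := h.ne_zero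
  set x := h.lin 1 0 with hx
  set G := upProd (h.flip.frac r) n with hG
  -- the identities for the single and the mixed products, in the given and in the reversed order
  have e1 := h.sandwich_upProd_frac 1 le_rfl (z := 1) (fun i _ => Commute.one_right _) le_rfl
  have e1' := h.sandwich_upProd_frac (v ^ 2 * r) le_rfl (z := 1) (fun i _ => Commute.one_right _)
    le_rfl
  have e2 := h.flip.sandwich_upProd_frac r le_rfl (z := 1) (fun i _ => Commute.one_right _) le_rfl
  have e3 := h.flip.sandwich_upProd_frac r (m := n - 1) (by omega)
    (z := (((h.lin 1 0)⁻¹ : Aˣ) : A)) (fun i hi => by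
      have : Commute (T (n - 2 - i)) (h.lin 1 0) :=
        h.commute_T_lin 1 (by omega) (by omega) (by omega) (by omega)
      exact congrArg Units.val this.inv_inv.eq) le_rfl
  have hfl : ∀ c j, j < n → h.flip.lin c j = h.lin c (n - 1 - j) := fun c j hj => Units.ext rfl
  rw [hfl r 0 hn, Nat.sub_zero, inv_inv] at e2 e3
  have hfr : ∀ j, j < n → h.flip.frac r j = (h.frac (v ^ 2 * r) (n - 1 - j))⁻¹ := fun j hj => by
    rw [frac, frac, mul_inv_rev, inv_inv, hfl _ j hj, hfl _ j hj, inv_inv,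
      show v⁻¹ ^ 2 * (v ^ 2 * r) = r by field_simp]
  have hGinv : upProd (h.frac (v ^ 2 * r)) n = G⁻¹ := by
    rw [hG, upProd_congr hfr, ← downProd_eq_upProd_flip fun j => (h.frac (v ^ 2 * r) j)⁻¹]
    exact (inv_inv _).symm.trans (congrArg _ (downProd_inv _ _).symm)
  -- the symmetric function `G` commutes with the symmetrizer
  have hGS : Commute (G : A) S := h.commute_of _ fun i hi => by
    have := h.flip.commute_T_upProd_frac r (i := n - 2 - i) (by omega)
    simp only [show n - 2 - (n - 2 - i) = i by omega] at this
    have h2 : Commute (T i) G := by simpa using this.inv_left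
    exact congrArg Units.val h2.eq
  have hG0 : upProd (h.flip.frac r) (n - 1) = h.frac (v ^ 2 * r) 0 * G := by
    have h1 : G = upProd (h.flip.frac r) (n - 1) * (h.frac (v ^ 2 * r) 0)⁻¹ := by
      obtain ⟨m, rfl⟩ : ∃ m, n = m + 1 := ⟨n - 1, by omega⟩
      have := hfr m (by omega)
      rw [show m + 1 - 1 - m = 0 by omega] at this
      rw [hG, upProd, this]; rfl
    have h2 : Commute G (h.frac (v ^ 2 * r) 0) := commute_upProd_of fun j hj => by
      rw [hfr j hj]
      have h3 := fun d => h.commute_frac (v ^ 2 * r) (i := n - 1 - j) (by omega) hn d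
      exact ((h3 _).mul_right (h3 _).inv_right).inv_left
    rw [← h2.eq, h1, inv_mul_cancel_right]
  -- partial fractions
  have hpf : (1 - r * v ^ 2) • (((x⁻¹ : Aˣ) : A) * (h.frac (v ^ 2 * r) 0 : A)) =
      (1 - r) • ((x⁻¹ : Aˣ) : A) + (r - r * v ^ 2) • (((h.lin (v ^ 2 * r) 0)⁻¹ : Aˣ) : A) := by
    have h1 : (1 - r * v ^ 2) • (h.lin r 0 : A) =
        (1 - r) • (h.lin (v ^ 2 * r) 0 : A) + (r - r * v ^ 2) • (x : A) := by
      rw [hx, lin_val, lin_val, lin_val]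
      match_scalars <;> ring
    have h2 := congrArg (fun a => ((x⁻¹ : Aˣ) : A) * a * (((h.lin (v ^ 2 * r) 0)⁻¹ : Aˣ) : A)) h1
    simp only [mul_add, add_mul, mul_smul_comm, smul_mul_assoc, Units.inv_mul, one_mul,
      Units.mul_inv_cancel_right] at h2
    rw [← h2, frac, Units.val_mul, show v⁻¹ ^ 2 * (v ^ 2 * r) = r by field_simp, mul_assoc]
  rw [hGinv] at e1'
  simp only [mul_one, h.idem] at e1 e1' e2
  set F := upProd (h.frac 1) n
  set g := h.lin r (n - 1)
  set w := h.lin (v ^ 2 * r) 0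
  set C := S * ((x⁻¹ : Aˣ) : A) * ((g⁻¹ : Aˣ) : A) * S
  have hGG : S * ((G⁻¹ : Aˣ) : A) * S * (G : A) = S := by
    rw [mul_assoc, ← hGS.eq, ← mul_assoc, Units.inv_mul_cancel_right, h.idem]
  have e4 : S * (F : A) * S * (G : A) = S * (F : A) * (G : A) * S := by
    rw [mul_assoc _ S, ← hGS.eq, ← mul_assoc]
  have e5 : S * (G : A) = S * (G : A) * S := by rw [mul_assoc, hGS.eq, ← mul_assoc, h.idem]
  have f1 := congrArg (· * (G : A)) e1
  have f1' := congrArg (· * (G : A)) e1'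
  simp only [sub_mul, smul_mul_assoc, hGG, e4] at f1 f1'
  have f3 : (1 - r * v ^ 2) • (S * ((x⁻¹ : Aˣ) : A) * ((upProd (h.flip.frac r) (n - 1) : Aˣ) : A) *
      S) = (1 - r) • (S * ((x⁻¹ : Aˣ) : A) * S * (G : A)) +
        (r - r * v ^ 2) • (S * ((w⁻¹ : Aˣ) : A) * S * (G : A)) := by
    have h1 : S * ((x⁻¹ : Aˣ) : A) * ((upProd (h.flip.frac r) (n - 1) : Aˣ) : A) * S =
        S * (((x⁻¹ : Aˣ) : A) * (h.frac (v ^ 2 * r) 0 : A)) * S * (G : A) := by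
      rw [hG0, Units.val_mul, mul_assoc _ S, ← hGS.eq]
      simp only [mul_assoc]
    rw [h1, ← smul_mul_assoc, ← smul_mul_assoc, ← mul_smul_comm, hpf]
    simp only [mul_add, add_mul, mul_smul_comm, smul_mul_assoc]
  have hm : (v⁻¹ ^ 2) ^ n * (v ^ 2) ^ n = 1 := by
    rw [← mul_pow, ← mul_pow, inv_mul_cancel₀ hv, one_pow, one_pow]
  rw [← e5] at e2
  set B := S * ((x⁻¹ : Aˣ) : A) * ((upProd (h.flip.frac r) (n - 1) : Aˣ) : A) * S
  set D := S * ((g⁻¹ : Aˣ) : A) * S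
  set m := (v⁻¹ ^ 2) ^ n
  set m' := (v ^ 2) ^ n
  set d := (v ^ 2) ^ (n - 1)
  have g1 : d • (S * ((x⁻¹ : Aˣ) : A) * S) + (1 - d) • C - D = B - D := by
    linear_combination (norm := module) -e3
  have g2 : (1 - m) • D = S - m • (S * (G : A)) := by
    have h1 : m • m' • (S - D) = S - D := by rw [smul_smul, hm, one_smul]
    rw [← e2] at h1
    linear_combination (norm := module) h1
  have g3 : ((1 - r * v ^ 2) * (1 - m)) • B = (1 - r) • (S * (F : A) * (G : A) * S) +
      (r - r * v ^ 2) • S - (m * (1 - r * v ^ 2)) • (S * (G : A)) := by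
    rw [mul_comm, mul_smul, f3]
    linear_combination (norm := module) -((1 - r) • f1) - (r - r * v ^ 2) • f1'
  rw [g1, smul_sub, g3, mul_smul (1 - r * v ^ 2) (1 - m) D, g2]
  module

end IsSymmetrized
end EllipticHall

namespace EllipticHall

variable {n : ℕ}

/-! ### The commutator of `P_{-1,l}` and `P_{1,0}` -/

theorem commute_unitT_unitX_zero {j : ℕ} (h0 : 0 < j) (hj : j + 1 < n) :
    Commute (unitT n j : Daha n) (unitX n 0 : Daha n) :=
  congrArg Units.val (commute_unitT_unitX hj (by omega) (by omega) (by omega)).eq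

theorem commute_unitT_unitY_zero {j : ℕ} (h0 : 0 < j) (hj : j + 1 < n) :
    Commute (unitT n j : Daha n) (unitY n 0 : Daha n) :=
  congrArg Units.val (commute_unitT_unitY hj (by omega) (by omega) (by omega)).eq

theorem sandwich_mul_unitX_succ {z : Daha n}
    (hz : ∀ j, 0 < j → j + 1 < n → Commute (unitT n j : Daha n) z) {j : ℕ} (hj : j + 1 < n) :
    sandwich (z * (unitX n (j + 1) : Daha n)) = (v' ^ 2) ^ j • sandwich (z * (unitX n 1 : Daha n)) := by
  induction j with
  | zero => simp
  | succ j ih =>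
    rw [unitX_succ hj, Units.val_mul, Units.val_mul, ← mul_assoc, ← mul_assoc,
      sandwich_mul_eigen (isEigen_unitT hj), ← (hz (j + 1) (by omega) hj).eq, mul_assoc,
      sandwich_eigen_mul (isEigen_unitT hj), ih (by omega), smul_smul, smul_smul]
    congr 1
    ring

theorem sandwich_unitX_succ_mul {z : Daha n}
    (hz : ∀ j, 0 < j → j + 1 < n → Commute (unitT n j : Daha n) z) {j : ℕ} (hj : j + 1 < n) :
    sandwich ((unitX n (j + 1) : Daha n) * z) = (v' ^ 2) ^ j • sandwich ((unitX n 1 : Daha n) * z) := by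
  induction j with
  | zero => simp
  | succ j ih =>
    rw [unitX_succ hj, Units.val_mul, Units.val_mul, mul_assoc, (hz (j + 1) (by omega) hj).eq,
      ← mul_assoc, sandwich_mul_eigen (isEigen_unitT hj), mul_assoc,
      sandwich_eigen_mul (isEigen_unitT hj), ih (by omega), smul_smul, smul_smul]
    congr 1
    ring

/-- After symmetrization, conjugation by `X₁` replaces `Y₁` by `q⁻¹ Y_n` and `Y₂` by `Y₁` in a
monomial. -/
theorem sandwich_conj_unitX (hn : 0 < n) (a b : ℕ) (hb : 1 < n ∨ b = 0) :
    sandwich ((unitX n 0 : Daha n) * ((unitY n 0 : Daha n) ^ a * (unitY n 1 : Daha n) ^ b) *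
      (((unitX n 0)⁻¹ : (Daha n)ˣ) : Daha n)) =
      q'⁻¹ ^ a • sandwich ((unitY n (n - 1) : Daha n) ^ a * (unitY n 0 : Daha n) ^ b) := by
  have he := daha_isElliptic hn
  have h0 := he.x_conj_y
  rw [strand_unitY (by omega)] at h0
  set x := unitX n 0
  set t := downProd (unitT n) (n - 1)
  have h1 : x * unitY n 1 ^ b * x⁻¹ = t⁻¹ * unitY n 0 ^ b * t := by
    rcases hb with hb | rfl
    · have h2 := he.x_conj_strand_succ (j := 0) hb
      rw [strand_unitY hb] at h2
      have h3 := congrArg (fun u => u ^ b) h2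
      rw [conj_pow', show t⁻¹ * strand (unitT n)⁻¹ (unitY n 0) 0 * t =
        t⁻¹ * unitY n 0 * t⁻¹⁻¹ by rw [inv_inv]; rfl, conj_pow', inv_inv] at h3
      exact h3
    · simp
  have h3 := congrArg (fun u => u ^ a) h0
  rw [conj_pow', (qUnit_central _).inv_left.mul_pow,
    show t⁻¹ * unitY n (n - 1) * t = t⁻¹ * unitY n (n - 1) * t⁻¹⁻¹ by group, conj_pow',
    inv_inv] at h3
  have h4 : x * (unitY n 0 ^ a * unitY n 1 ^ b) * x⁻¹ =
      (qUnit _)⁻¹ ^ a * (t⁻¹ * (unitY n (n - 1) ^ a * unitY n 0 ^ b) * t) := by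
    have : x * (unitY n 0 ^ a * unitY n 1 ^ b) * x⁻¹ =
        (x * unitY n 0 ^ a * x⁻¹) * (x * unitY n 1 ^ b * x⁻¹) := by group
    rw [this, h1, h3]
    group
  have h5 := congrArg Units.val h4
  simp only [Units.val_mul, Units.val_pow_eq_pow_val] at h5
  rw [h5]
  have h6 : (((qUnit (Daha n))⁻¹ : (Daha n)ˣ) : Daha n) ^ a = algebraMap K' (Daha n) (q'⁻¹ ^ a) := by
    rw [map_pow]; rfl
  rw [h6, ← Algebra.smul_def, sandwich_smul,
    sandwich_conj (pow_ne_zero _ v'_ne_zero) (isEigen_downProd (by omega))]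

theorem sandwich_commutator_unitX_one (hn : 1 < n) (l : ℕ) :
    sandwich ((unitY n 0 : Daha n) ^ l * (((unitX n 0)⁻¹ : (Daha n)ˣ) : Daha n) *
        (unitX n 1 : Daha n)) -
      sandwich ((unitX n 1 : Daha n) * ((unitY n 0 : Daha n) ^ l * (((unitX n 0)⁻¹ : (Daha n)ˣ) : Daha n))) =
      -((v' ^ 2 - 1) • ∑ i ∈ Finset.range l, q'⁻¹ ^ (i + 1) •
        sandwich ((unitY n (n - 1) : Daha n) ^ (i + 1) * (unitY n 0 : Daha n) ^ (l - 1 - i))) := by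
  have he := daha_isElliptic (n := n) (by omega)
  have hX := unitX_succ hn
  have hY := unitY_succ hn
  have hm := he.mixed hn
  have hx : Commute (unitX n 0) (unitX n 1) := commute_unitX (by omega) hn
  simp only [Nat.zero_add] at hX hY
  set x := unitX n 0
  set y := unitY n 0
  set t := unitT n 0
  have h1 : y ^ l * x⁻¹ * unitX n 1 = t * x * unitY n 1 ^ l * t * x⁻¹ := by
    have h2 : (unitX n 1)⁻¹ * y * (unitX n 1)⁻¹⁻¹ = t⁻¹ * unitY n 1 * t⁻¹⁻¹ := by
      rw [hX, hY]
      calc (t * x * t)⁻¹ * y * (t * x * t)⁻¹⁻¹ = t⁻¹ * x⁻¹ * t⁻¹ * (y * t * x * t) := by group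
        _ = t⁻¹ * x⁻¹ * t⁻¹ * (t * x * t⁻¹ * y) := by rw [hm]
        _ = _ := by group
    have h3 := congrArg (fun u => u ^ l) h2
    rw [conj_pow', conj_pow'] at h3
    calc y ^ l * x⁻¹ * unitX n 1 = y ^ l * (x⁻¹ * unitX n 1) := by group
      _ = unitX n 1 * ((unitX n 1)⁻¹ * y ^ l * (unitX n 1)⁻¹⁻¹) * x⁻¹ := by
          rw [hx.inv_left.eq]; group
      _ = _ := by rw [h3, hX]; group
  have h2 := congrArg Units.val h1
  simp only [Units.val_mul, Units.val_pow_eq_pow_val] at h2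
  have hyc : Commute (y : Daha n) (unitY n 1 : Daha n) :=
    congrArg Units.val (commute_unitY (by omega) hn).eq
  have h3 := exchange_pow hyc
    (exchange_of (a := y) (b := unitY n 1) hn (by
      change t * _ * t = y
      rw [hY]; group)).1 l
  change (t : Daha n) * _ = _ * (t : Daha n) + _ at h3
  have h4 : (unitX n 1 : Daha n) * ((y : Daha n) ^ l * ((x⁻¹ : (Daha n)ˣ) : Daha n)) =
      t * x * (unitY n 1 : Daha n) ^ l * t * ((x⁻¹ : (Daha n)ˣ) : Daha n) +
      (v' - v'⁻¹) • ∑ i ∈ Finset.range l, (t : Daha n) * ((x : Daha n) *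
        ((y : Daha n) ^ (i + 1) * (unitY n 1 : Daha n) ^ (l - 1 - i)) *
          ((x⁻¹ : (Daha n)ˣ) : Daha n)) := by
    have h5 : (t : Daha n) * x * (t * (y : Daha n) ^ l) * ((x⁻¹ : (Daha n)ˣ) : Daha n) =
        (unitX n 1 : Daha n) * ((y : Daha n) ^ l * ((x⁻¹ : (Daha n)ˣ) : Daha n)) := by
      rw [hX]; simp only [Units.val_mul, mul_assoc]
    rw [← h5, h3, mul_add, add_mul, mul_smul_comm, smul_mul_assoc, Finset.mul_sum, Finset.sum_mul]
    simp only [mul_assoc]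
  rw [h2, h4, sandwich_add, sub_add_cancel_left, sandwich_smul, sandwich_sum]
  have hv : v' ^ 2 - 1 = (v' - v'⁻¹) * v' := by
    rw [sub_mul, inv_mul_cancel₀ v'_ne_zero, pow_two]
  rw [hv, mul_smul, Finset.smul_sum (r := v')]
  congr 2
  refine Finset.sum_congr rfl fun i _ => ?_
  rw [sandwich_eigen_mul (isEigen_unitT hn), sandwich_conj_unitX (by omega) _ _ (Or.inl hn)]

/-- The commutator of `P_{-1,l}` and `P_{1,0}`, up to a factor, in terms of symmetrized monomials in
the first and the last of the `Y_j`. -/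
theorem sandwich_commutator_psum_unitX (hn : 0 < n) (l : ℕ) :
    sandwich ((unitY n 0 : Daha n) ^ l * (((unitX n 0)⁻¹ : (Daha n)ˣ) : Daha n) *
        psum (unitX n) 1) -
      sandwich (psum (unitX n) 1 *
        ((unitY n 0 : Daha n) ^ l * (((unitX n 0)⁻¹ : (Daha n)ˣ) : Daha n))) =
      sandwich ((unitY n 0 : Daha n) ^ l) - q'⁻¹ ^ l • sandwich ((unitY n (n - 1) : Daha n) ^ l) -
      ((v' ^ 2) ^ (n - 1) - 1) • ∑ i ∈ Finset.range l, q'⁻¹ ^ (i + 1) •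
        sandwich ((unitY n (n - 1) : Daha n) ^ (i + 1) * (unitY n 0 : Daha n) ^ (l - 1 - i)) := by
  set z : Daha n := (unitY n 0 : Daha n) ^ l * (((unitX n 0)⁻¹ : (Daha n)ˣ) : Daha n) with hz
  have hzc : ∀ j, 0 < j → j + 1 < n → Commute (unitT n j : Daha n) z := fun j h0 hj =>
    ((commute_unitT_unitY_zero h0 hj).pow_right l).mul_right
      (commute_unitT_unitX_zero h0 hj).units_inv_right
  obtain ⟨m, rfl⟩ : ∃ m, n = m + 1 := ⟨n - 1, by omega⟩
  have h0 : z * (unitX (m + 1) 0 : Daha (m + 1)) = (unitY (m + 1) 0 : Daha (m + 1)) ^ l := by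
    rw [hz, Units.inv_mul_cancel_right]
  have h0' : sandwich ((unitX (m + 1) 0 : Daha (m + 1)) * z) =
      q'⁻¹ ^ l • sandwich ((unitY (m + 1) m : Daha (m + 1)) ^ l) := by
    have := sandwich_conj_unitX hn l 0 (Or.inr rfl)
    simp only [pow_zero, mul_one, Nat.add_sub_cancel] at this
    rw [hz, ← mul_assoc, this]
  simp only [Nat.add_sub_cancel]
  rw [psum, Finset.sum_range_succ', mul_add, add_mul, sandwich_add, sandwich_add, pow_one, h0, h0',
    Finset.mul_sum, Finset.sum_mul, sandwich_sum, sandwich_sum]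
  set R := ∑ i ∈ Finset.range l, q'⁻¹ ^ (i + 1) •
        sandwich ((unitY (m + 1) m : Daha (m + 1)) ^ (i + 1) *
          (unitY (m + 1) 0 : Daha (m + 1)) ^ (l - 1 - i)) with hR
  have h1 : ∑ j ∈ Finset.range m, sandwich (z * (unitX (m + 1) (j + 1) : Daha (m + 1)) ^ 1) -
      ∑ j ∈ Finset.range m, sandwich ((unitX (m + 1) (j + 1) : Daha (m + 1)) ^ 1 * z) =
      -(((v' ^ 2) ^ m - 1) • R) := by
    rw [← Finset.sum_sub_distrib, ← geom_sum_mul (v' ^ 2) m, mul_smul, Finset.sum_smul,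
      ← Finset.sum_neg_distrib]
    refine Finset.sum_congr rfl fun j hj => ?_
    have hj' := Finset.mem_range.mp hj
    rw [pow_one, sandwich_mul_unitX_succ hzc (by omega), sandwich_unitX_succ_mul hzc (by omega),
      ← smul_sub, hz, sandwich_commutator_unitX_one (by omega) l, smul_neg]
    rfl
  rw [← sub_eq_zero] at h1 ⊢
  rw [← h1]
  abel

section Members

variable {ρ : SL2Z →* (Spherical n ≃ₐ[K'] Spherical n)} {P : LatticeStar → Spherical n}

theorem IsPowerSumFamily.commutator_opposite (hn : 0 < n) (h : IsCherednikAction n ρ)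
    (hP : IsPowerSumFamily ρ P) (l : ℕ) :
    P (point (-1) l (by decide)) * P (point 1 0 one_ne_zero) -
      P (point 1 0 one_ne_zero) * P (point (-1) l (by decide)) =
      (q' * ∑ j ∈ Finset.range n, (v'⁻¹ ^ 2) ^ j) •
      (sandwich ((unitY n 0 : Daha n) ^ l) -
        q'⁻¹ ^ l • sandwich ((unitY n (n - 1) : Daha n) ^ l) -
        ((v' ^ 2) ^ (n - 1) - 1) • ∑ i ∈ Finset.range l, q'⁻¹ ^ (i + 1) •
          sandwich ((unitY n (n - 1) : Daha n) ^ (i + 1) * (unitY n 0 : Daha n) ^ (l - 1 - i))) := by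
  have hS := commute_symmetrizer (n := n) fun i hi => commute_psum_unitX 1 hi
  rw [hP.neg_one_left hn h, hP.one_zero hn h, smul_mul_smul_comm, smul_mul_smul_comm,
    ← sandwich_mul_left hS, ← sandwich_mul_right hS, mul_comm q', ← smul_sub,
    sandwich_commutator_psum_unitX hn]

end Members
end EllipticHall

namespace EllipticHall

open PowerSeries

/-! ### The Euler operator on power series -/

section Euler

variable {R : Type*} [Ring R]

/-- The operator `s d/ds` on power series in `s`. -/
noncomputable def euler (W : R⟦X⟧) : R⟦X⟧ := PowerSeries.mk fun l => l • coeff l W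

theorem coeff_euler (W : R⟦X⟧) (l : ℕ) : coeff l (euler W) = l • coeff l W := coeff_mk _ _

theorem euler_mul (W V : R⟦X⟧) : euler (W * V) = euler W * V + W * euler V := by
  ext l
  rw [map_add, coeff_euler, coeff_mul, coeff_mul, coeff_mul, Finset.smul_sum,
    ← Finset.sum_add_distrib]
  refine Finset.sum_congr rfl fun p hp => ?_
  rw [coeff_euler, coeff_euler, ← Finset.HasAntidiagonal.mem_antidiagonal.mp hp, add_smul, smul_mul_assoc,
    mul_smul_comm]

theorem euler_one : euler (1 : R⟦X⟧) = 0 := by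
  ext l
  rw [coeff_euler, coeff_one]
  split_ifs with h <;> simp [h]

theorem commute_of_coeff {W V : R⟦X⟧} (h : ∀ i j, Commute (coeff i W) (coeff j V)) :
    Commute W V := by
  ext l
  rw [coeff_mul, coeff_mul, ← Finset.Nat.sum_antidiagonal_swap]
  exact Finset.sum_congr rfl fun p _ => (h p.2 p.1).eq

/-- The series `L` is the logarithmic derivative of `W` for the Euler operator. -/
def HasLogDeriv (W L : R⟦X⟧) : Prop := euler W = L * W

theorem HasLogDeriv.mul {W V L M : R⟦X⟧} (hW : HasLogDeriv W L) (hV : HasLogDeriv V M)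
    (h : Commute W M) : HasLogDeriv (W * V) (L + M) := by
  rw [HasLogDeriv, euler_mul, hW, hV, ← mul_assoc, h.eq, add_mul, mul_assoc, mul_assoc]

theorem HasLogDeriv.inv {W : R⟦X⟧ˣ} {L : R⟦X⟧} (hW : HasLogDeriv (W : R⟦X⟧) L)
    (h : Commute (W : R⟦X⟧) L) : HasLogDeriv ((W⁻¹ : R⟦X⟧ˣ) : R⟦X⟧) (-L) := by
  have h1 := euler_mul (W : R⟦X⟧) ((W⁻¹ : R⟦X⟧ˣ) : R⟦X⟧)
  rw [Units.mul_inv, euler_one, hW, Units.mul_inv_cancel_right] at h1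
  have h2 : (W : R⟦X⟧) * euler ((W⁻¹ : R⟦X⟧ˣ) : R⟦X⟧) = -L := (neg_eq_of_add_eq_zero_right h1.symm).symm
  rw [HasLogDeriv, ← Units.mul_right_inj W, h2, ← mul_assoc, mul_neg, h.eq, neg_mul,
    Units.mul_inv_cancel_right]

theorem HasLogDeriv.upProd {W : ℕ → R⟦X⟧ˣ} {L : ℕ → R⟦X⟧} {n : ℕ}
    (h : ∀ j < n, HasLogDeriv (W j : R⟦X⟧) (L j))
    (hc : ∀ i < n, ∀ j < n, Commute (W i : R⟦X⟧) (L j)) :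
    HasLogDeriv ((upProd W n : R⟦X⟧ˣ) : R⟦X⟧) (∑ j ∈ Finset.range n, L j) := by
  have key : ∀ k ≤ n, HasLogDeriv ((EllipticHall.upProd W k : R⟦X⟧ˣ) : R⟦X⟧)
      (∑ j ∈ Finset.range k, L j) := by
    intro k hk
    induction k with
    | zero => simp [HasLogDeriv, EllipticHall.upProd, euler_one]
    | succ k ih =>
      rw [EllipticHall.upProd, Finset.sum_range_succ, Units.val_mul]
      refine (ih (by omega)).mul (h k (by omega)) ?_
      have : ∀ m ≤ k, Commute ((EllipticHall.upProd W m : R⟦X⟧ˣ) : R⟦X⟧) (L k) := by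
        intro m hm
        induction m with
        | zero => exact Commute.one_left _
        | succ m ih' => exact (ih' (by omega)).mul_left (hc m (by omega) k (by omega))
      exact this k le_rfl
  exact key n le_rfl

/-- The coefficient of `s^m` in the exponential of a series without constant term. -/
noncomputable def expCoeff (k : Type*) [Field k] [Module k R] (τ : R⟦X⟧) (m : ℕ) : R :=
  ∑ i ∈ Finset.range (m + 1), ((i.factorial : k)⁻¹) • coeff m (τ ^ i)

theorem coeff_pow_eq_zero {τ : R⟦X⟧} (h0 : coeff 0 τ = 0) {i m : ℕ} (h : m < i) :
    coeff m (τ ^ i) = 0 := by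
  induction i generalizing m with
  | zero => omega
  | succ i ih =>
    rw [pow_succ, coeff_mul]
    refine Finset.sum_eq_zero fun p hp => ?_
    have := Finset.HasAntidiagonal.mem_antidiagonal.mp hp
    rcases Nat.eq_zero_or_pos p.2 with h2 | h2
    · rw [h2, h0, mul_zero]
    · rw [ih (by omega), zero_mul]

theorem euler_pow {τ : R⟦X⟧} (h : Commute τ (euler τ)) (i : ℕ) :
    euler (τ ^ (i + 1)) = (i + 1) • (euler τ * τ ^ i) := by
  induction i with
  | zero => simp
  | succ i ih =>
    rw [pow_succ, euler_mul, ih, smul_mul_assoc, mul_assoc, ← pow_succ,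
      (h.pow_left (i + 1)).eq, ← succ_nsmul]

variable {k : Type*} [Field k] [CharZero k] [Algebra k R]

/-- The differential equation of the exponential series, in terms of coefficients. -/
theorem expCoeff_recursion {τ : R⟦X⟧} (h0 : coeff 0 τ = 0) (h : Commute τ (euler τ)) (m : ℕ) :
    m • expCoeff k τ m =
      ∑ p ∈ Finset.HasAntidiagonal.antidiagonal m, (p.1 • coeff p.1 τ) * expCoeff k τ p.2 := by
  have h1 : ∀ i, ((i + 1).factorial : k)⁻¹ • m • coeff m (τ ^ (i + 1)) =
      (i.factorial : k)⁻¹ •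
        ∑ p ∈ Finset.HasAntidiagonal.antidiagonal m, (p.1 • coeff p.1 τ) * coeff p.2 (τ ^ i) := by
    intro i
    have h2 := congrArg (coeff m) (euler_pow h i)
    rw [coeff_euler, map_nsmul, coeff_mul] at h2
    rw [h2]
    simp only [coeff_euler]
    rw [← Nat.cast_smul_eq_nsmul k (i + 1), smul_smul, Nat.factorial_succ]
    congr 1
    have h3 : ((i + 1 : ℕ) : k) ≠ 0 := Nat.cast_ne_zero.mpr (by omega)
    have h4 : (i.factorial : k) ≠ 0 := Nat.cast_ne_zero.mpr (Nat.factorial_ne_zero i)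
    push_cast at h3 ⊢
    field_simp
  have h2 : m • expCoeff k τ m = ∑ i ∈ Finset.range m, (i.factorial : k)⁻¹ •
        ∑ p ∈ Finset.HasAntidiagonal.antidiagonal m, (p.1 • coeff p.1 τ) * coeff p.2 (τ ^ i) := by
    rw [expCoeff, Finset.smul_sum, Finset.sum_range_succ']
    rw [Finset.sum_congr rfl fun i _ => by rw [smul_comm, h1 i]]
    rcases Nat.eq_zero_or_pos m with rfl | hm
    · simp
    · rw [pow_zero, coeff_one, if_neg hm.ne', smul_zero, smul_zero, add_zero]
  rw [h2]
  simp only [Finset.smul_sum]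
  rw [Finset.sum_comm]
  refine Finset.sum_congr rfl fun p hp => ?_
  have hp' := Finset.HasAntidiagonal.mem_antidiagonal.mp hp
  rcases Nat.eq_zero_or_pos p.1 with h3 | h3
  · simp [h3]
  · rw [expCoeff, Finset.mul_sum]
    simp only [mul_smul_comm]
    symm
    refine Finset.sum_subset (Finset.range_mono (by omega)) fun i _ hi => ?_
    rw [coeff_pow_eq_zero h0 (by simpa using hi), mul_zero, smul_zero]

/-- In characteristic zero, a sequence is determined by its first term and a recursion of the form
`m f(m) = ∑ L(i) f(m - i)` with `L(0) = 0`. -/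
theorem eq_of_recursion {f g L : ℕ → R} (hL : L 0 = 0) (h0 : f 0 = g 0)
    (hf : ∀ m, m • f m = ∑ p ∈ Finset.HasAntidiagonal.antidiagonal m, L p.1 * f p.2)
    (hg : ∀ m, m • g m = ∑ p ∈ Finset.HasAntidiagonal.antidiagonal m, L p.1 * g p.2) (k : Type*) [Field k]
    [CharZero k] [Algebra k R] (m : ℕ) : f m = g m := by
  induction m using Nat.strong_induction_on with
  | _ m ih =>
  rcases Nat.eq_zero_or_pos m with rfl | hm
  · exact h0
  · have h1 : m • f m = m • g m := by
      rw [hf, hg]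
      refine Finset.sum_congr rfl fun p hp => ?_
      have hp' := Finset.HasAntidiagonal.mem_antidiagonal.mp hp
      rcases Nat.eq_zero_or_pos p.1 with h3 | h3
      · rw [h3, hL, zero_mul, zero_mul]
      · rw [ih _ (by omega)]
    rw [← Nat.cast_smul_eq_nsmul k, ← Nat.cast_smul_eq_nsmul k] at h1
    have h2 : (m : k) ≠ 0 := Nat.cast_ne_zero.mpr hm.ne'
    have h3 := congrArg (fun a => (m : k)⁻¹ • a) h1
    simpa only [smul_smul, inv_mul_cancel₀ h2, one_smul] using h3

end Euler

/-! ### Generating functions in the double affine Hecke algebra -/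

section Series

variable {R : Type*} [Ring R]

theorem one_sub_mul_geom (b : R) : (1 - C b * X) * PowerSeries.mk (fun l => b ^ l) = 1 := by
  ext l
  rw [sub_mul, one_mul, map_sub, mul_assoc, coeff_C_mul, coeff_mk, coeff_one]
  rcases l with _ | l
  · simp
  · rw [coeff_succ_X_mul, coeff_mk, pow_succ', sub_self, if_neg (Nat.succ_ne_zero l)]

theorem geom_mul_one_sub (b : R) : PowerSeries.mk (fun l => b ^ l) * (1 - C b * X) = 1 := by
  ext l
  rw [mul_sub, mul_one, map_sub, ← mul_assoc, coeff_mk, coeff_one]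
  rcases l with _ | l
  · simp
  · rw [coeff_succ_mul_X, coeff_mul_C, coeff_mk, pow_succ, sub_self, if_neg (Nat.succ_ne_zero l)]

end Series

variable {n : ℕ}

theorem smul_C_mul_X (c : K') (a : Daha n) : c • (C a * X : (Daha n)⟦X⟧) = C (c • a) * X := by
  ext l
  rw [coeff_smul]
  rcases l with _ | l
  · simp
  · rw [coeff_succ_mul_X, coeff_succ_mul_X, coeff_C, coeff_C]
    split_ifs <;> simp

/-- The series `s Y_j` and the constant series `T_i`, `S`. -/
theorem series_isSymmetrized (n : ℕ) : IsSymmetrized v' n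
    (fun i => Units.map (C : Daha n →+* (Daha n)⟦X⟧).toMonoidHom (unitT n i))
    (C (symmetrizer n)) (fun j => (C (unitY n j : Daha n) * X : (Daha n)⟦X⟧)) where
  ne_zero := v'_ne_zero
  comm i j hi hj := by
    have h1 : Commute (C (unitY n i : Daha n)) (C (unitY n j : Daha n)) :=
      Commute.map (congrArg Units.val (commute_unitY hi hj).eq) C
    exact (h1.mul_right (commute_X _)).mul_left
      ((commute_X _).symm.mul_right (Commute.refl _))
  far i j hi hj h1 h2 := by
    have h3 : Commute (C (unitT n i : Daha n)) (C (unitY n j : Daha n)) :=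
      Commute.map (congrArg Units.val (commute_unitT_unitY hi hj h1 h2).eq) C
    exact h3.mul_right (commute_X _)
  loop i hi := by
    have h1 := congrArg Units.val (show unitT n i * unitY n (i + 1) * unitT n i = unitY n i by
      rw [unitY_succ hi]; group)
    change C (unitT n i : Daha n) * (C (unitY n (i + 1) : Daha n) * X) * C (unitT n i : Daha n) = _
    rw [mul_assoc, mul_assoc, ← (commute_X (C (unitT n i : Daha n))).eq, ← mul_assoc, ← mul_assoc,
      ← map_mul, ← map_mul, ← h1]
    rfl
  hecke i hi := by
    change C (((unitT n i)⁻¹ : (Daha n)ˣ) : Daha n) = C (unitT n i : Daha n) - _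
    rw [unitT_inv_eq hi, map_sub, Algebra.algebraMap_eq_smul_one]
    congr 1
    ext l
    rw [coeff_C, coeff_smul, coeff_one]
    split_ifs <;> simp
  T_mul i hi := by
    change C (unitT n i : Daha n) * C (symmetrizer n) = _
    rw [← map_mul, (isEigen_unitT hi).1]
    ext l
    rw [coeff_smul, coeff_C, coeff_C]
    split_ifs <;> simp
  mul_T i hi := by
    change C (symmetrizer n) * C (unitT n i : Daha n) = _
    rw [← map_mul, (isEigen_unitT hi).2]
    ext l
    rw [coeff_smul, coeff_C, coeff_C]
    split_ifs <;> simp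
  idem := by rw [← map_mul, (symmetrizer_idem n).eq]
  isUnit c j := by
    rw [smul_C_mul_X]
    exact ⟨⟨_, _, one_sub_mul_geom _, geom_mul_one_sub _⟩, rfl⟩
  commute_of a ha := by
    refine commute_of_coeff fun i j => ?_
    rw [coeff_C]
    split_ifs with h
    · refine commute_symmetrizer fun m hm => ?_
      have := congrArg (coeff i) (ha m hm).eq
      change coeff i (C (unitT n m : Daha n) * a) = coeff i (a * C (unitT n m : Daha n)) at this
      rwa [coeff_C_mul, coeff_mul_C] at this
    · exact Commute.zero_right _

theorem coeff_lin_inv (c : K') (j l : ℕ) :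
    coeff l ((((series_isSymmetrized n).lin c j)⁻¹ : (Daha n)⟦X⟧ˣ) : (Daha n)⟦X⟧) =
      c ^ l • (unitY n j : Daha n) ^ l := by
  have h : ((((series_isSymmetrized n).lin c j)⁻¹ : (Daha n)⟦X⟧ˣ) : (Daha n)⟦X⟧) =
      PowerSeries.mk fun l => (c • (unitY n j : Daha n)) ^ l := by
    apply Units.inv_eq_of_mul_eq_one_right
    rw [IsSymmetrized.lin_val, smul_C_mul_X, one_sub_mul_geom]
  rw [h, coeff_mk, smul_pow]

theorem hasLogDeriv_lin (c : K') (j : ℕ) :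
    HasLogDeriv ((series_isSymmetrized n).lin c j : (Daha n)⟦X⟧)
      (1 - ((((series_isSymmetrized n).lin c j)⁻¹ : (Daha n)⟦X⟧ˣ) : (Daha n)⟦X⟧)) := by
  rw [HasLogDeriv, sub_mul, Units.inv_mul, one_mul, IsSymmetrized.lin_val, smul_C_mul_X]
  ext l
  rw [coeff_euler, map_sub, map_sub, map_sub, coeff_one]
  rcases l with _ | _ | l
  · simp
  · simp
  · simp

/-- The logarithmic derivative of `(1 - d s Y_j) / (1 - c s Y_j)`. -/
theorem hasLogDeriv_lin_div {j : ℕ} (hj : j < n) (c d : K') :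
    HasLogDeriv ((((series_isSymmetrized n).lin d j *
        ((series_isSymmetrized n).lin c j)⁻¹ : (Daha n)⟦X⟧ˣ)) : (Daha n)⟦X⟧)
      (((((series_isSymmetrized n).lin c j)⁻¹ : (Daha n)⟦X⟧ˣ) : (Daha n)⟦X⟧) -
        ((((series_isSymmetrized n).lin d j)⁻¹ : (Daha n)⟦X⟧ˣ) : (Daha n)⟦X⟧)) := by
  have h := series_isSymmetrized n
  have hc : ∀ a b, Commute ((h.lin a j : (Daha n)⟦X⟧ˣ) : (Daha n)⟦X⟧)
      (-(1 - (((h.lin b j)⁻¹ : (Daha n)⟦X⟧ˣ) : (Daha n)⟦X⟧))) := fun a b =>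
    ((Commute.one_right _).sub_right
      (congrArg Units.val (h.commute_lin a b hj hj).inv_right.eq)).neg_right
  have h1 := (hasLogDeriv_lin (n := n) d j).mul ((hasLogDeriv_lin (n := n) c j).inv
    (by simp)) (hc d c)
  rw [Units.val_mul]
  convert h1 using 1
  abel

/-- The product of the symmetric functions `∏ (1 - v⁻² s Y_j) / (1 - s Y_j)` and
`∏ (1 - v² r s Y_j) / (1 - r s Y_j)`, where `r = q⁻¹`. -/
noncomputable def thetaSeries (n : ℕ) : (Daha n)⟦X⟧ :=
  ((upProd ((series_isSymmetrized n).frac 1) n : (Daha n)⟦X⟧ˣ) : (Daha n)⟦X⟧) *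
    ((upProd ((series_isSymmetrized n).flip.frac q'⁻¹) n : (Daha n)⟦X⟧ˣ) : (Daha n)⟦X⟧)

/-- The scalar by which the coefficient of `s^l` in the logarithmic derivative of the theta series
differs from the power sum. -/
noncomputable def logScalar (l : ℕ) : K' := 1 - (v'⁻¹ ^ 2) ^ l + q'⁻¹ ^ l * (1 - (v' ^ 2) ^ l)

theorem thetaSeries_logDeriv : HasLogDeriv (thetaSeries n)
    (PowerSeries.mk fun l => logScalar l • psum (unitY n) l) := by
  have h := series_isSymmetrized n
  have hcomm : ∀ (a b : K') (i j : ℕ), i < n → j < n →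
      Commute ((h.lin a i : (Daha n)⟦X⟧ˣ) : (Daha n)⟦X⟧)
        (((h.lin b j)⁻¹ : (Daha n)⟦X⟧ˣ) : (Daha n)⟦X⟧) := fun a b i j hi hj =>
    congrArg Units.val (h.commute_lin a b hi hj).inv_right.eq
  have hcomm' : ∀ (a b c d : K') (i j : ℕ), i < n → j < n →
      Commute ((h.lin a i * (h.lin b i)⁻¹ : (Daha n)⟦X⟧ˣ) : (Daha n)⟦X⟧)
        ((((h.lin c j)⁻¹ : (Daha n)⟦X⟧ˣ) : (Daha n)⟦X⟧) -
          (((h.lin d j)⁻¹ : (Daha n)⟦X⟧ˣ) : (Daha n)⟦X⟧)) := fun a b c d i j hi hj => by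
    rw [Units.val_mul]
    exact ((hcomm a c i j hi hj).sub_right (hcomm a d i j hi hj)).mul_left
      ((hcomm b c i j hi hj).units_inv_left.sub_right (hcomm b d i j hi hj).units_inv_left)
  have h1 := HasLogDeriv.upProd (W := h.frac 1) (n := n)
    (L := fun j => (((h.lin 1 j)⁻¹ : (Daha n)⟦X⟧ˣ) : (Daha n)⟦X⟧) -
      (((h.lin (v'⁻¹ ^ 2 * 1) j)⁻¹ : (Daha n)⟦X⟧ˣ) : (Daha n)⟦X⟧))
    (fun j hj => hasLogDeriv_lin_div hj 1 (v'⁻¹ ^ 2 * 1))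
    (fun i hi j hj => hcomm' _ _ _ _ i j hi hj)
  have h2 := HasLogDeriv.upProd (W := h.flip.frac q'⁻¹) (n := n)
    (L := fun j => (((h.lin q'⁻¹ (n - 1 - j))⁻¹ : (Daha n)⟦X⟧ˣ) : (Daha n)⟦X⟧) -
      (((h.lin (v'⁻¹⁻¹ ^ 2 * q'⁻¹) (n - 1 - j))⁻¹ : (Daha n)⟦X⟧ˣ) : (Daha n)⟦X⟧))
    (fun j hj => hasLogDeriv_lin_div (by omega) q'⁻¹ (v'⁻¹⁻¹ ^ 2 * q'⁻¹))
    (fun i hi j hj => hcomm' _ _ _ _ (n - 1 - i) (n - 1 - j) (by omega) (by omega))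
  have h3 := h1.mul h2 (by
    refine Commute.sum_right _ _ _ fun j hj => ?_
    have hj' := Finset.mem_range.mp hj
    have : ∀ m ≤ n, Commute ((upProd (h.frac 1) m : (Daha n)⟦X⟧ˣ) : (Daha n)⟦X⟧)
        ((((h.lin q'⁻¹ (n - 1 - j))⁻¹ : (Daha n)⟦X⟧ˣ) : (Daha n)⟦X⟧) -
      (((h.lin (v'⁻¹⁻¹ ^ 2 * q'⁻¹) (n - 1 - j))⁻¹ : (Daha n)⟦X⟧ˣ) : (Daha n)⟦X⟧)) := by
      intro m hm
      induction m with
      | zero => exact Commute.one_left _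
      | succ m ih =>
        exact (ih (by omega)).mul_left (hcomm' _ _ _ _ m (n - 1 - j) (by omega) (by omega))
    exact this n le_rfl)
  rw [thetaSeries]
  convert h3 using 1
  ext l
  rw [coeff_mk, map_add, map_sum, map_sum, Finset.sum_range_reflect
    (fun j => coeff l ((((h.lin q'⁻¹ j)⁻¹ : (Daha n)⟦X⟧ˣ) : (Daha n)⟦X⟧) -
      (((h.lin (v'⁻¹⁻¹ ^ 2 * q'⁻¹) j)⁻¹ : (Daha n)⟦X⟧ˣ) : (Daha n)⟦X⟧))), psum,
    ← Finset.sum_add_distrib, Finset.smul_sum]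
  refine Finset.sum_congr rfl fun j _ => ?_
  rw [map_sub, map_sub, coeff_lin_inv, coeff_lin_inv, coeff_lin_inv, coeff_lin_inv, logScalar,
    inv_inv, one_pow, mul_one]
  rw [← sub_smul, ← sub_smul, ← add_smul]
  congr 1
  ring

theorem coeff_zero_thetaSeries : coeff 0 (thetaSeries n) = 1 := by
  have h := series_isSymmetrized n
  have h0 : ∀ (c : K') (j : ℕ),
      Units.map (constantCoeff (R := Daha n)).toMonoidHom (h.lin c j) = 1 := fun c j => by
    apply Units.ext
    change constantCoeff ((h.lin c j : (Daha n)⟦X⟧ˣ) : (Daha n)⟦X⟧) = 1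
    rw [IsSymmetrized.lin_val, smul_C_mul_X]
    simp
  have h1 : ∀ m, upProd (fun _ : ℕ => (1 : (Daha n)ˣ)) m = 1 := fun m => by
    induction m with
    | zero => rfl
    | succ m ih => rw [upProd, ih, mul_one]
  have h2 : ∀ c m, Units.map (constantCoeff (R := Daha n)).toMonoidHom
      (upProd (h.frac c) m) = 1 := fun c m => by
    rw [map_upProd]
    simp only [IsSymmetrized.frac, map_mul, map_inv, h0, inv_one, mul_one]
    exact h1 m
  have h0' : ∀ (c : K') (j : ℕ),
      Units.map (constantCoeff (R := Daha n)).toMonoidHom (h.flip.lin c j) = 1 := fun c j =>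
    h0 c (n - 1 - j)
  have h3 : ∀ c m, Units.map (constantCoeff (R := Daha n)).toMonoidHom
      (upProd (h.flip.frac c) m) = 1 := fun c m => by
    rw [map_upProd]
    simp only [IsSymmetrized.frac, map_mul, map_inv, h0', inv_one, mul_one]
    exact h1 m
  have h4 := congrArg Units.val (h2 1 n)
  have h5 := congrArg Units.val (h3 q'⁻¹ n)
  change constantCoeff _ = 1 at h4 h5
  rw [coeff_zero_eq_constantCoeff_apply, thetaSeries, map_mul, h4, h5, mul_one]

end EllipticHall

namespace EllipticHall

open PowerSeries

variable {n : ℕ}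

/-! ### The commutator of `P_{-1,l}` and `P_{1,0}` as a theta element -/

theorem coeff_C_mul_mul_C (a b : Daha n) (W : (Daha n)⟦X⟧) (l : ℕ) :
    coeff l (C a * W * C b) = a * coeff l W * b := by
  rw [coeff_mul_C, coeff_C_mul]

theorem sum_antidiagonal_eq {A : Type*} [Ring A] [Algebra K' A] {a b : A} (hab : Commute a b)
    (r : K') (l : ℕ) :
    ∑ p ∈ Finset.HasAntidiagonal.antidiagonal l, a ^ p.1 * (r ^ p.2 • b ^ p.2) =
      a ^ l + ∑ i ∈ Finset.range l, r ^ (i + 1) • (b ^ (i + 1) * a ^ (l - 1 - i)) := by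
  rw [← Finset.Nat.sum_antidiagonal_swap,
    Finset.Nat.sum_antidiagonal_eq_sum_range_succ_mk, Finset.sum_range_succ', add_comm]
  congr 1
  · simp
  · refine Finset.sum_congr rfl fun i hi => ?_
    have := Finset.mem_range.mp hi
    simp only [Prod.swap]
    rw [mul_smul_comm, (hab.pow_pow _ _).eq]
    congr 3
    omega

/-- The coefficients of the symmetrized identity for the series `1 - s Y_j`, `1 - q⁻¹ s Y_j`. -/
theorem sandwich_thetaSeries (hn : 0 < n) {l : ℕ} (hl : 0 < l) :
    ((1 - q'⁻¹ * v' ^ 2) * (1 - (v'⁻¹ ^ 2) ^ n)) •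
      (sandwich ((unitY n 0 : Daha n) ^ l) -
        q'⁻¹ ^ l • sandwich ((unitY n (n - 1) : Daha n) ^ l) -
        ((v' ^ 2) ^ (n - 1) - 1) • ∑ i ∈ Finset.range l, q'⁻¹ ^ (i + 1) •
          sandwich ((unitY n (n - 1) : Daha n) ^ (i + 1) * (unitY n 0 : Daha n) ^ (l - 1 - i))) =
      (1 - q'⁻¹) • sandwich (coeff l (thetaSeries n)) := by
  have h := series_isSymmetrized n
  have hc : Commute (unitY n 0 : Daha n) (unitY n (n - 1) : Daha n) :=
    congrArg Units.val (commute_unitY hn (by omega)).eq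
  set R := ∑ i ∈ Finset.range l, q'⁻¹ ^ (i + 1) •
    ((unitY n (n - 1) : Daha n) ^ (i + 1) * (unitY n 0 : Daha n) ^ (l - 1 - i)) with hR
  have h1 := congrArg (coeff l) (h.symmetrized_identity hn q'⁻¹)
  rw [mul_assoc (C (symmetrizer n)) _ ((((h.lin q'⁻¹ (n - 1))⁻¹ : (Daha n)⟦X⟧ˣ) : (Daha n)⟦X⟧)),
    mul_assoc (C (symmetrizer n)) (((upProd (h.frac 1) n : (Daha n)⟦X⟧ˣ) : (Daha n)⟦X⟧))] at h1
  simp only [coeff_smul, map_sub, map_add, coeff_C_mul_mul_C] at h1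
  rw [coeff_mul] at h1
  simp only [coeff_lin_inv, one_pow, one_smul] at h1
  rw [sum_antidiagonal_eq hc, coeff_C, if_neg hl.ne', sub_zero] at h1
  have h2 : sandwich (((1 - q'⁻¹ * v' ^ 2) * (1 - (v'⁻¹ ^ 2) ^ n)) •
      ((v' ^ 2) ^ (n - 1) • (unitY n 0 : Daha n) ^ l +
        (1 - (v' ^ 2) ^ (n - 1)) • ((unitY n 0 : Daha n) ^ l + R) -
        q'⁻¹ ^ l • (unitY n (n - 1) : Daha n) ^ l)) =
      sandwich ((1 - q'⁻¹) • coeff l (thetaSeries n)) := by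
    apply Spherical.ext
    rw [sandwich_val, sandwich_val, thetaSeries]
    simp only [mul_smul_comm, smul_mul_assoc, mul_add, add_mul, mul_sub, sub_mul] at h1 ⊢
    exact h1
  rw [sandwich_smul, sandwich_smul] at h2
  rw [← h2]
  congr 1
  rw [sandwich_sub, sandwich_add, sandwich_smul, sandwich_smul, sandwich_smul, sandwich_add, hR,
    sandwich_sum]
  simp only [sandwich_smul, sub_smul, one_smul, smul_add]
  abel

theorem logScalar_zero : logScalar 0 = 0 := by simp [logScalar]

/-- The coefficients of the theta series are obtained by exponentiating power sums. -/
theorem expCoeff_eq_sandwich {k : Type*} [Field k] [CharZero k] [Algebra k (Spherical n)]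
    {τ : (Spherical n)⟦X⟧} (h0 : coeff 0 τ = 0)
    (hc : ∀ i j, Commute (coeff i τ) (coeff j τ))
    (hτ : ∀ l, l • coeff l τ = logScalar l • sandwich (psum (unitY n) l)) (m : ℕ) :
    expCoeff k τ m = sandwich (coeff m (thetaSeries n)) := by
  have h1 : Commute τ (euler τ) := commute_of_coeff fun i j => by
    rw [coeff_euler]; exact (hc i j).smul_right j
  refine eq_of_recursion (f := fun m => expCoeff k τ m)
    (g := fun m => sandwich (coeff m (thetaSeries n)))
    (L := fun l => logScalar l • sandwich (psum (unitY n) l)) ?_ ?_ ?_ ?_ k m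
  · rw [logScalar_zero, zero_smul]
  · rw [coeff_zero_thetaSeries, sandwich_one, expCoeff]
    simp
  · intro m
    rw [expCoeff_recursion h0 h1]
    simp only [hτ]
  · intro m
    have h2 := congrArg (coeff m) (thetaSeries_logDeriv (n := n))
    rw [coeff_euler, coeff_mul] at h2
    have h3 : ∀ (j : ℕ) (a : Daha n), sandwich (j • a) = j • sandwich a := fun j a => by
      rw [← Nat.cast_smul_eq_nsmul K', sandwich_smul, Nat.cast_smul_eq_nsmul]
    rw [← h3, h2, sandwich_sum]
    refine Finset.sum_congr rfl fun p _ => ?_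
    rw [coeff_mk, smul_mul_assoc, sandwich_smul, smul_mul_assoc, sandwich_mul_left]
    exact commute_symmetrizer fun i hi => commute_psum_unitY p.1 hi

section Members

variable {ρ : SL2Z →* (Spherical n ≃ₐ[K'] Spherical n)} {P : LatticeStar → Spherical n}

/-- The triangle relation for the pair `(1, 0)`, `(-1, l)`. -/
theorem IsPowerSumFamily.commutator_opposite_eq (hn : 0 < n) (h : IsCherednikAction n ρ)
    (hP : IsPowerSumFamily ρ P) {l : ℕ} (hl : 0 < l) :
    ((q'⁻¹ * v' - v'⁻¹) * (q'⁻¹ * v' - v'⁻¹)) •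
      (P (point (-1) l (by decide)) * P (point 1 0 one_ne_zero) -
        P (point 1 0 one_ne_zero) * P (point (-1) l (by decide))) =
      ((v' + v'⁻¹ - q' * v'⁻¹ - (q' * v'⁻¹)⁻¹) / (v'⁻¹ - v')) •
        sandwich (coeff l (thetaSeries n)) := by
  have hv := v'_ne_zero
  have hq := q'_ne_zero
  have hv2 : v' ^ 2 - 1 ≠ 0 := sub_ne_zero.mpr (v'_pow_ne_one (by omega))
  have hv2' : 1 - v'⁻¹ ^ 2 ≠ 0 := by
    intro h0
    apply hv2
    have : v' ^ 2 * (1 - v'⁻¹ ^ 2) = v' ^ 2 - 1 := by field_simp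
    rw [← this, h0, mul_zero]
  have hv3 : v'⁻¹ - v' ≠ 0 := by
    intro h0
    apply hv2
    have : -v' * (v'⁻¹ - v') = v' ^ 2 - 1 := by field_simp; ring
    rw [← this, h0, mul_zero]
  have hk : (∑ j ∈ Finset.range n, (v'⁻¹ ^ 2) ^ j) = (1 - (v'⁻¹ ^ 2) ^ n) / (1 - v'⁻¹ ^ 2) := by
    rw [eq_div_iff hv2', geom_sum_mul_neg]
  have h1 := sandwich_thetaSeries hn hl
  rw [hP.commutator_opposite hn h, smul_smul]
  set R := (sandwich ((unitY n 0 : Daha n) ^ l) -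
        q'⁻¹ ^ l • sandwich ((unitY n (n - 1) : Daha n) ^ l) -
        ((v' ^ 2) ^ (n - 1) - 1) • ∑ i ∈ Finset.range l, q'⁻¹ ^ (i + 1) •
          sandwich ((unitY n (n - 1) : Daha n) ^ (i + 1) * (unitY n 0 : Daha n) ^ (l - 1 - i)))
  set m := (v'⁻¹ ^ 2) ^ n
  set d := (q'⁻¹ * v' - v'⁻¹) * (-v'⁻¹) * q' / (1 - v'⁻¹ ^ 2)
  have e1 : (q'⁻¹ * v' - v'⁻¹) * (q'⁻¹ * v' - v'⁻¹) * (q' * ∑ j ∈ Finset.range n, (v'⁻¹ ^ 2) ^ j) =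
      d * ((1 - q'⁻¹ * v' ^ 2) * (1 - m)) := by
    rw [hk, show (q'⁻¹ * v' - v'⁻¹) * (q'⁻¹ * v' - v'⁻¹) =
      (q'⁻¹ * v' - v'⁻¹) * (-v'⁻¹) * (1 - q'⁻¹ * v' ^ 2) by field_simp; ring]
    simp only [d]
    ring
  have e2 : (v' + v'⁻¹ - q' * v'⁻¹ - (q' * v'⁻¹)⁻¹) / (v'⁻¹ - v') = d * (1 - q'⁻¹) := by
    simp only [d]
    rw [div_mul_eq_mul_div, div_eq_div_iff hv3 hv2']
    field_simp
    ring
  rw [e1, e2, mul_smul, h1, smul_smul]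

end Members
end EllipticHall

namespace EllipticHall

/-! ### The substitution `t = q v⁻¹` -/

section Substitution

open MvPolynomial

/-- The substitution `v ↦ v`, `q ↦ v t` for polynomials. -/
noncomputable def substPoly : MvPolynomial (Fin 2) ℂ →ₐ[ℂ] MvPolynomial (Fin 2) ℂ :=
  aeval ![X 0, X 0 * X 1]

theorem substPoly_injective : Function.Injective substPoly := by
  rw [injective_iff_map_eq_zero]
  intro p hp
  have h1 : X 0 * p = 0 := by
    apply MvPolynomial.funext
    intro x
    rw [map_zero, map_mul, eval_X]
    by_cases hx : x 0 = 0
    · rw [hx, zero_mul]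
    · have h2 : eval (![x 0, x 1 / x 0] : Fin 2 → ℂ) (substPoly p) = eval x p := by
        have h3 : ((aeval (![x 0, x 1 / x 0] : Fin 2 → ℂ)).comp substPoly) = aeval x := by
          apply MvPolynomial.algHom_ext
          intro i
          rw [AlgHom.comp_apply, substPoly, aeval_X]
          fin_cases i
          · simp
          · simp [mul_div_cancel₀ _ hx]
        have h4 := congrArg (fun f => f p) h3
        simpa [aeval_eq_eval] using h4
      rw [← h2, hp, map_zero, mul_zero]
  exact (mul_eq_zero.mp h1).resolve_left (X_ne_zero 0)

theorem substPoly_comp_injective : Function.Injective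
    ((IsScalarTower.toAlgHom ℂ (MvPolynomial (Fin 2) ℂ) RatField).comp substPoly) :=
  (IsFractionRing.injective (MvPolynomial (Fin 2) ℂ) RatField).comp substPoly_injective

/-- The substitution `v ↦ v`, `q ↦ v t` for rational functions. -/
noncomputable def substInv : RatField →ₐ[ℂ] RatField :=
  IsFractionRing.liftAlgHom (A := MvPolynomial (Fin 2) ℂ) substPoly_comp_injective

theorem substInv_algebraMap (p : MvPolynomial (Fin 2) ℂ) :
    substInv (algebraMap _ RatField p) = algebraMap _ RatField (substPoly p) := by
  rw [substInv, IsFractionRing.liftAlgHom_apply, IsFractionRing.lift_algebraMap]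
  rfl

theorem substInv_v : substInv v' = vK := by
  rw [v', substInv_algebraMap, substPoly, aeval_X]; rfl

theorem substInv_q : substInv q' = vK * tK := by
  rw [q', substInv_algebraMap, substPoly, aeval_X, vK, tK, ← map_mul]; rfl

theorem substInv_bijective : Function.Bijective substInv := by
  refine ⟨substInv.toRingHom.injective, fun a => ?_⟩
  have hv : vK ≠ 0 := v'_ne_zero
  have h0 : ∀ p : MvPolynomial (Fin 2) ℂ, algebraMap _ RatField p ∈ substInv.range := by
    intro p
    induction p using MvPolynomial.induction_on with
    | C c => exact ⟨algebraMap ℂ RatField c, by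
        rw [AlgHom.toRingHom_eq_coe, RingHom.coe_coe, AlgHom.commutes]; rfl⟩
    | add p q hp hq => rw [map_add]; exact add_mem hp hq
    | mul_X p i hp =>
      rw [map_mul]
      refine mul_mem hp ?_
      fin_cases i
      · exact ⟨v', substInv_v⟩
      · refine ⟨q' * v'⁻¹, ?_⟩
        change substInv (q' * v'⁻¹) = tK
        rw [map_mul, map_inv₀, substInv_q, substInv_v]
        field_simp
  obtain ⟨x, y, _, rfl⟩ := IsFractionRing.div_surjective (A := MvPolynomial (Fin 2) ℂ) a
  obtain ⟨b, hb⟩ := h0 x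
  obtain ⟨c, hc⟩ := h0 y
  refine ⟨b / c, ?_⟩
  rw [map_div₀]
  exact congrArg₂ _ hb hc

/-- The isomorphism `ℂ(v, t) ≃ ℂ(v, q)` with `v ↦ v`, `t ↦ q v⁻¹`. -/
noncomputable def subst : K ≃ₐ[ℂ] K' := (AlgEquiv.ofBijective substInv substInv_bijective).symm

theorem subst_v : subst vK = v' := by
  rw [subst, AlgEquiv.symm_apply_eq]
  exact substInv_v.symm

theorem subst_t : subst tK = q' * v'⁻¹ := by
  have hv : vK ≠ 0 := v'_ne_zero
  rw [subst, AlgEquiv.symm_apply_eq]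
  change tK = substInv (q' * v'⁻¹)
  rw [map_mul, map_inv₀, substInv_q, substInv_v]
  field_simp

end Substitution

/-- The coefficient `(q⁻ᵈ vᵈ - v⁻ᵈ) / d`. -/
noncomputable def weight (d : ℕ) : K' := (1 / (d : K')) * (q'⁻¹ ^ d * v' ^ d - v'⁻¹ ^ d)

theorem subst_qInt (d : ℕ) : subst (qInt d) = (v' ^ d - v'⁻¹ ^ d) / (v' - v'⁻¹) := by
  simp only [qInt, map_div₀, map_sub, map_pow, map_inv₀, subst_v]

theorem v'_sub_inv_ne_zero : v' - v'⁻¹ ≠ 0 := by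
  have hv := v'_ne_zero
  intro h
  have h1 : v' ^ 2 - 1 = v' * (v' - v'⁻¹) := by field_simp
  rw [h, mul_zero] at h1
  exact sub_ne_zero.mpr (v'_pow_ne_one (by omega)) h1

theorem subst_qInt_one : subst (qInt 1) = 1 := by
  rw [subst_qInt, pow_one, pow_one, div_self v'_sub_inv_ne_zero]

theorem qInt_ne_zero {d : ℕ} (hd : 0 < d) : qInt d ≠ 0 := by
  have hv := v'_ne_zero
  have h : subst (qInt d) ≠ 0 := by
    rw [subst_qInt]
    refine div_ne_zero (fun h => ?_) v'_sub_inv_ne_zero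
    have h1 : v' ^ (2 * d) - 1 = v' ^ d * (v' ^ d - v'⁻¹ ^ d) := by
      have h2 : v' ^ d * v'⁻¹ ^ d = 1 := by rw [← mul_pow, mul_inv_cancel₀ hv, one_pow]
      rw [mul_sub, h2, ← pow_add, two_mul]
    rw [h, mul_zero] at h1
    exact sub_ne_zero.mpr (v'_pow_ne_one (by omega)) h1
  exact fun h0 => h (by rw [h0, map_zero])

theorem subst_cCoeff (d : ℕ) :
    subst (cCoeff d) = subst (qInt d) * weight d * (q' ^ d - 1) := by
  have hv := v'_ne_zero
  have hq := q'_ne_zero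
  rw [cCoeff, map_div₀, map_mul, map_natCast, weight]
  simp only [map_add, map_sub, map_pow, map_inv₀, subst_v, subst_t]
  have h1 : v' ^ d + v'⁻¹ ^ d - (q' * v'⁻¹) ^ d - (q' * v'⁻¹)⁻¹ ^ d =
      (q'⁻¹ ^ d * v' ^ d - v'⁻¹ ^ d) * (q' ^ d - 1) := by
    simp only [mul_pow, inv_pow, mul_inv, inv_inv]
    field_simp
    ring
  rw [h1]
  ring

theorem weight_one : weight 1 = q'⁻¹ * v' - v'⁻¹ := by simp [weight]

/-- The weight times the quantum integer gives the logarithmic derivative of the theta series. -/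
theorem natCast_mul_weight {d : ℕ} (hd : 0 < d) :
    (d : K') * ((v'⁻¹ - v') * (subst (qInt d) * weight d)) = logScalar d := by
  have hv := v'_ne_zero
  have hq := q'_ne_zero
  have hd' : (d : K') ≠ 0 := Nat.cast_ne_zero.mpr hd.ne'
  have h1 := v'_sub_inv_ne_zero
  have h2 : (v'⁻¹ - v') = -(v' - v'⁻¹) := by ring
  rw [subst_qInt, weight, logScalar, h2]
  have h0 : ∀ D s u w : K', D ≠ 0 → s ≠ 0 → D * (-s * (u / s * (1 / D * w))) = -(u * w) := by
    intro D s u w hD hs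
    field_simp
  have h3 : (d : K') * (-(v' - v'⁻¹) * ((v' ^ d - v'⁻¹ ^ d) / (v' - v'⁻¹) *
      (1 / (d : K') * (q'⁻¹ ^ d * v' ^ d - v'⁻¹ ^ d)))) =
      -((v' ^ d - v'⁻¹ ^ d) * (q'⁻¹ ^ d * v' ^ d - v'⁻¹ ^ d)) := h0 _ _ _ _ hd' h1
  rw [h3, ← pow_mul, ← pow_mul, mul_comm 2, pow_mul, pow_mul, inv_pow, inv_pow]
  have : v' ^ d ≠ 0 := pow_ne_zero _ hv
  field_simp
  ring

/-! ### Normal forms of the triangle relations -/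

theorem A2_pow (k : ℕ) : (A2 ^ k).1 = !![1, (k : ℤ); 0, 1] := by
  induction k with
  | zero => rw [pow_zero]; simp [Matrix.one_fin_two]
  | succ k ih =>
    rw [pow_succ, Matrix.SpecialLinearGroup.coe_mul, ih]
    simp [A2, add_comm]

theorem A2_zpow (k : ℤ) : (A2 ^ k).1 = !![1, k; 0, 1] := by
  obtain ⟨m, rfl | rfl⟩ := k.eq_nat_or_neg
  · rw [zpow_natCast, A2_pow]
  · rw [zpow_neg, zpow_natCast, Matrix.SpecialLinearGroup.coe_inv, A2_pow]
    simp [Matrix.adjugate_fin_two_of]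

theorem A2_zpow_smul (k : ℤ) (x : LatticeStar) : (A2 ^ k • x).1 = ![x.1 0 + k * x.1 1, x.1 1] := by
  rw [coe_smul]
  apply lattice_ext
  · rw [smul_apply_zero, A2_zpow]; simp
  · rw [smul_apply_one, A2_zpow]; simp

/-- The lattice point `(1, 1)` lies inside the triangle. -/
theorem NoInteriorPoint.remainder_one {a b : ℤ} (ha : 0 < a) (hab : a + 1 < b) :
    ¬ NoInteriorPoint ![1, 0] ![a, b] := by
  intro h
  have hb : (0 : ℝ) < b := by exact_mod_cast (by omega : (0 : ℤ) < b)
  have h1 : (a : ℝ) + 1 < b := by exact_mod_cast hab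
  have h2 : (0 : ℝ) < a := by exact_mod_cast ha
  -- `(1, 1)` is a combination of `(1, 0)` and `(a + 1, b)` with weights `1 - (a + 1) / b`, `1 / b`
  refine h ![1, 1] ⟨1 - (a + 1) / b, 1 / b, ?_, by positivity, ?_, ?_⟩
  · rw [sub_pos, div_lt_one hb]; exact h1
  · have : 1 - ((a : ℝ) + 1) / b + 1 / b = 1 - a / b := by field_simp; ring
    rw [this]
    have : (0 : ℝ) < a / b := by positivity
    linarith
  · intro i
    fin_cases i
    · simp; field_simp; ring
    · simp; field_simp

/-- The lattice point `(0, 1)` lies inside the triangle. -/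
theorem NoInteriorPoint.remainder_neg_one {a b : ℤ} (ha : 1 < a) (hab : a < b) :
    ¬ NoInteriorPoint ![-1, 0] ![a, b] := by
  intro h
  have hb : (0 : ℝ) < b := by exact_mod_cast (by omega : (0 : ℤ) < b)
  have h1 : (a : ℝ) < b := by exact_mod_cast hab
  have h2 : (1 : ℝ) < a := by exact_mod_cast ha
  -- `(0, 1)` is a combination of `(-1, 0)` and `(a - 1, b)` with weights `(a - 1) / b`, `1 / b`
  refine h ![0, 1] ⟨(a - 1) / b, 1 / b, div_pos (by linarith) hb, by positivity, ?_, ?_⟩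
  · have : ((a : ℝ) - 1) / b + 1 / b = a / b := by field_simp; ring
    rw [this, div_lt_one hb]; exact h1
  · intro i
    fin_cases i
    · simp; field_simp; ring
    · simp; field_simp

/-- A pair of lattice points as in the triangle relations is equivalent, under `SL(2,ℤ)`, to one of
four standard pairs: `x` can be moved to `(±1, 0)`, and `y` to a point `(a, b)` with `b > 0`, where
`a` only matters modulo `b`. The absence of interior points excludes all but two residues. -/
theorem exists_normal_form (x y : LatticeStar) (hx : deg x.1 = 1) (hxy : det2 x.1 y.1 ≠ 0)
    (hT : NoInteriorPoint x.1 y.1) : ∃ (g : SL2Z) (b : ℕ) (hb : 0 < b),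
      (g • x = point 1 0 one_ne_zero ∧ g • y = vertical b hb) ∨
      (g • x = point (-1) 0 (by decide) ∧ g • y = vertical b hb) ∨
      (g • x = point 1 0 one_ne_zero ∧ g • y = point (-1) b (by decide)) ∨
      (g • x = point (-1) b (by decide) ∧ g • y = point 1 0 one_ne_zero) := by
  obtain ⟨h, hh⟩ := exists_smul_vertical x
  have h1 : h⁻¹ • x = vertical 1 one_pos := by
    rw [hh, inv_smul_smul]
    apply Subtype.ext
    rw [coe_vertical, coe_vertical, hx]
  have h2 : ∃ (g : SL2Z) (ε a : ℤ) (b : ℕ), 0 < b ∧ (ε = 1 ∨ ε = -1) ∧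
      (g • x).1 = ![ε, 0] ∧ (g • y).1 = ![a, b] := by
    have e1 : ((rotSL * h⁻¹) • x).1 = ![-1, 0] := by
      rw [mul_smul, h1, rotSL_smul]
      apply lattice_ext <;> simp [coe_vertical]
    have e2 : det2 ((rotSL * h⁻¹) • x).1 ((rotSL * h⁻¹) • y).1 ≠ 0 := by
      rw [coe_smul, coe_smul, det2_smul]; exact hxy
    rw [det2, e1] at e2
    have e3 : ((rotSL * h⁻¹) • y).1 1 ≠ 0 := by
      intro h0; apply e2; rw [h0]; simp
    set y' := (rotSL * h⁻¹) • y with hy'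
    rcases lt_or_gt_of_ne e3 with h0 | h0
    · refine ⟨rotSL * (rotSL * (rotSL * h⁻¹)), 1, -(y'.1 0), (-(y'.1 1)).toNat, by omega,
        Or.inl rfl, ?_, ?_⟩
      · rw [mul_smul, mul_smul, rotSL_smul, rotSL_smul, e1]
        apply lattice_ext <;> simp
      · rw [mul_smul, mul_smul, rotSL_smul, rotSL_smul, ← hy']
        apply lattice_ext
        · simp
        · simp; omega
    · refine ⟨rotSL * h⁻¹, -1, y'.1 0, (y'.1 1).toNat, by omega, Or.inr rfl, e1, ?_⟩
      rw [← hy']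
      apply lattice_ext
      · simp
      · simp; omega
  obtain ⟨g, ε, a, b, hb, hε, hgx, hgy⟩ := h2
  have hb' : (0 : ℤ) < b := by omega
  have hshear : ∀ k : ℤ, ((A2 ^ k * g) • x).1 = ![ε, 0] ∧
      ((A2 ^ k * g) • y).1 = ![a + k * b, b] := fun k => by
    constructor
    · rw [mul_smul, A2_zpow_smul, hgx]; simp
    · rw [mul_smul, A2_zpow_smul, hgy]; simp
  have hT' : NoInteriorPoint ![ε, 0] ![a % b, (b : ℤ)] := by
    obtain ⟨e1, e2⟩ := hshear (-(a / b))
    have := hT.smul (A2 ^ (-(a / b)) * g)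
    rw [← coe_smul, ← coe_smul, e1, e2] at this
    rw [Int.emod_def]
    convert this using 3
    ring
  have hr0 := Int.emod_nonneg a hb'.ne'
  have hr1 := Int.emod_lt_of_pos a hb'
  have hdiv := Int.mul_ediv_add_emod a b
  by_cases h0 : a % b = 0
  · obtain ⟨e1, e2⟩ := hshear (-(a / b))
    have e3 : a + -(a / b) * b = 0 := by linarith [mul_comm (a / b) (b : ℤ)]
    rw [e3] at e2
    refine ⟨A2 ^ (-(a / (b : ℤ))) * g, b, hb, ?_⟩
    rcases hε with rfl | rfl
    · exact Or.inl ⟨Subtype.ext e1, Subtype.ext e2⟩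
    · exact Or.inr (Or.inl ⟨Subtype.ext e1, Subtype.ext e2⟩)
  · rcases hε with rfl | rfl
    · have h3 : a % b = b - 1 := by
        by_contra h3
        exact NoInteriorPoint.remainder_one (a := a % b) (b := b) (by omega) (by omega) hT'
      obtain ⟨e1, e2⟩ := hshear (-(a / b) - 1)
      have e3 : a + (-(a / b) - 1) * b = -1 := by linarith [mul_comm (a / b) (b : ℤ)]
      rw [e3] at e2
      exact ⟨A2 ^ (-(a / (b : ℤ)) - 1) * g, b, hb,
        Or.inr (Or.inr (Or.inl ⟨Subtype.ext e1, Subtype.ext e2⟩))⟩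
    · have h3 : a % b = 1 := by
        by_contra h3
        exact NoInteriorPoint.remainder_neg_one (a := a % b) (b := b) (by omega) (by omega) hT'
      obtain ⟨e1, e2⟩ := hshear (-(a / b))
      have e3 : a + (-(a / b)) * b = 1 := by linarith [mul_comm (a / b) (b : ℤ)]
      rw [e3] at e2
      refine ⟨A1 ^ (-(b : ℤ)) * (A2 ^ (-(a / b)) * g), b, hb,
        Or.inr (Or.inr (Or.inr ⟨Subtype.ext ?_, Subtype.ext ?_⟩))⟩
      · rw [mul_smul, A1_zpow_smul, e1]
        apply lattice_ext <;> simp [point]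
      · rw [mul_smul, A1_zpow_smul, e2]
        apply lattice_ext <;> simp [point]

/-! ### Collinear points -/

variable {n : ℕ} {ρ : SL2Z →* (Spherical n ≃ₐ[K'] Spherical n)} {P : LatticeStar → Spherical n}

/-- The matrices of `SL(2,ℤ)` move a line to the vertical axis, where the `P_x` are power sums of the
`Y_j` or of their inverses. -/
theorem IsPowerSumFamily.commute (hn : 0 < n) (h : IsCherednikAction n ρ)
    (hP : IsPowerSumFamily ρ P) {x y : LatticeStar} (hxy : det2 x.1 y.1 = 0) :
    Commute (P x) (P y) := by
  obtain ⟨g, e, hd, hg⟩ : ∃ (g : SL2Z) (e : ℕ) (hd : 0 < e),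
      x = g • EllipticHall.vertical e hd :=
    ⟨_, _, _, (exists_smul_vertical x).choose_spec⟩
  obtain ⟨y', rfl⟩ : ∃ y', y = g • y' := ⟨g⁻¹ • y, (smul_inv_smul g y).symm⟩
  rw [hg, coe_smul, coe_smul, det2_smul] at hxy
  have h0 : y'.1 0 = 0 := by
    rw [det2, coe_vertical] at hxy
    have h1 : (e : ℤ) * y'.1 0 = 0 := by simpa using hxy
    exact (mul_eq_zero.mp h1).resolve_left (by omega)
  have h1 : y'.1 1 ≠ 0 := fun h1 => y'.2 (lattice_ext h0 h1)
  have key : Commute (P (EllipticHall.vertical e hd)) (P y') := by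
    have hS : ∀ l, Commute (psum (unitY n) l) (symmetrizer n) := fun l =>
      commute_symmetrizer fun i hi => commute_psum_unitY l hi
    rw [hP.vertical]
    rcases lt_or_gt_of_ne h1 with h2 | h2
    · have h3 : y' = rotSL • rotSL • EllipticHall.vertical (-(y'.1 1)).toNat (by omega) := by
        apply Subtype.ext
        rw [rotSL_smul, rotSL_smul]
        apply lattice_ext
        · simp [coe_vertical, h0]
        · simp [coe_vertical]; omega
      rw [h3, hP.rot_sq_vertical hn h]
      refine Commute.smul_right ?_ _
      rw [Commute, SemiconjBy, ← sandwich_mul_left (hS e), ← sandwich_mul_right (hS e)]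
      congr 1
      exact (commute_psum_psum (fun i hi j hj => (commute_unitY hi hj).inv_right) _ _).eq
    · have h3 : y' = EllipticHall.vertical (y'.1 1).toNat (by omega) := by
        apply Subtype.ext
        apply lattice_ext
        · simp [coe_vertical, h0]
        · simp [coe_vertical]; omega
      rw [h3, hP.vertical]
      rw [Commute, SemiconjBy, ← sandwich_mul_left (hS e), ← sandwich_mul_right (hS e)]
      congr 1
      exact (commute_psum_psum (fun i hi j hj => (commute_unitY hi hj)) _ _).eq
  rw [hg, hP.smul, hP.smul]
  exact key.map (ρ g)

end EllipticHall

namespace EllipticHall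

open PowerSeries

/-! ### The homomorphism from the elliptic Hall algebra -/

/-- The spherical algebra, seen as an algebra over `K` through the substitution `t = q v⁻¹`. -/
def SphericalTwist (n : ℕ) : Type := Spherical n

noncomputable instance (n : ℕ) : Ring (SphericalTwist n) := inferInstanceAs (Ring (Spherical n))

noncomputable instance (n : ℕ) : Algebra K (SphericalTwist n) :=
  ((algebraMap K' (Spherical n)).comp (subst : K →+* K')).toAlgebra'
    fun c x => Algebra.commutes (A := Spherical n) (subst c) x

/-- The identity, from the twisted spherical algebra to the spherical algebra. -/
noncomputable def untwist (n : ℕ) : SphericalTwist n ≃+* Spherical n := RingEquiv.refl _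

variable {n : ℕ}

theorem untwist_smul (c : K) (a : SphericalTwist n) :
    untwist n (c • a) = subst c • untwist n a := (Algebra.smul_def (subst c) (untwist n a)).symm

/-- The image of the generator `t_x`. -/
noncomputable def genImage (P : LatticeStar → Spherical n) (x : LatticeStar) : SphericalTwist n :=
  (untwist n).symm ((subst (qInt (deg x.1)) * weight (deg x.1)) • P x)

theorem untwist_genImage (P : LatticeStar → Spherical n) (x : LatticeStar) :
    untwist n (genImage P x) = (subst (qInt (deg x.1)) * weight (deg x.1)) • P x := rfl

/-- The homomorphism `t_x ↦ [d] (q⁻ᵈ vᵈ - v⁻ᵈ) / d · P_x` on the free algebra. -/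
noncomputable def freePsi (P : LatticeStar → Spherical n) : FreeHall →ₐ[K] SphericalTwist n :=
  FreeAlgebra.lift K (genImage P)

theorem freePsi_T (P : LatticeStar → Spherical n) (x : LatticeStar) :
    freePsi P (freeT x) = genImage P x := FreeAlgebra.lift_ι_apply _ _

theorem freePsi_theta (P : LatticeStar → Spherical n) (x : LatticeStar) (m : ℕ) :
    freePsi P (freeTheta x m) =
      expCoeff K (PowerSeries.map (freePsi P : FreeHall →+* SphericalTwist n) (tSeries x)) m := by
  simp only [freeTheta, expCoeff, map_sum, map_smul]
  refine Finset.sum_congr rfl fun k _ => ?_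
  rw [← map_pow, PowerSeries.coeff_map]
  rfl

theorem point_deg (a b : ℤ) (ha : a = 1 ∨ a = -1) (ha' : a ≠ 0) : deg (point a b ha').1 = 1 := by
  rcases ha with rfl | rfl <;> simp [deg, point]

theorem freeTheta_one (x : LatticeStar) : freeTheta x 1 = (vK⁻¹ - vK) • freeT x := by
  have : multiple 0 x = x := Subtype.ext (by simp [multiple])
  simp [freeTheta, Finset.sum_range_succ, coeff_one, tSeries, this]

theorem multiple_vertical (k : ℕ) : multiple k (vertical 1 one_pos) =
    vertical (k + 1) (Nat.succ_pos k) := by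
  apply Subtype.ext
  apply lattice_ext <;> simp [multiple, coe_vertical]

theorem vK_inv_sub_ne_zero : vK⁻¹ - vK ≠ 0 := by
  intro h0
  apply v'_sub_inv_ne_zero
  have h1 := congrArg subst h0
  rw [map_sub, map_inv₀, subst_v, map_zero] at h1
  rw [← neg_sub, h1, neg_zero]

section Relations

variable {ρ : SL2Z →* (Spherical n ≃ₐ[K'] Spherical n)} {P : LatticeStar → Spherical n}

theorem freePsi_freeAct (hP : IsPowerSumFamily ρ P) (g : SL2Z) (a : FreeHall) :
    untwist n (freePsi P (freeAct g a)) = ρ g (untwist n (freePsi P a)) := by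
  induction a using FreeAlgebra.induction with
  | grade0 c =>
    rw [AlgHom.commutes, AlgHom.commutes, Algebra.algebraMap_eq_smul_one, untwist_smul, map_one,
      map_smul, map_one]
  | grade1 x =>
    change untwist n (freePsi P (freeAct g (freeT x))) = ρ g (untwist n (freePsi P (freeT x)))
    rw [freeAct_T, freePsi_T, freePsi_T, untwist_genImage, untwist_genImage, map_smul, hP.smul,
      coe_smul, deg_smul]
  | mul a b ha hb => simp only [map_mul, ha, hb]
  | add a b ha hb => simp only [map_add, ha, hb]

/-- The elements `θ_{0,m}` are mapped to the coefficients of the theta series. -/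
theorem freePsi_theta_vertical (hn : 0 < n) (h : IsCherednikAction n ρ)
    (hP : IsPowerSumFamily ρ P) (m : ℕ) :
    untwist n (freePsi P (freeTheta (vertical 1 one_pos) m)) =
      sandwich (coeff m (thetaSeries n)) := by
  rw [freePsi_theta]
  set τ := PowerSeries.map (freePsi P : FreeHall →+* SphericalTwist n)
    (tSeries (vertical 1 one_pos)) with hτ
  have h0 : coeff 0 τ = 0 := by
    rw [hτ, PowerSeries.coeff_map, tSeries, coeff_mk, map_zero]
  have h1 : ∀ k, coeff (k + 1) τ =
      (vK⁻¹ - vK) • genImage P (vertical (k + 1) (Nat.succ_pos k)) := fun k => by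
    rw [hτ, PowerSeries.coeff_map, tSeries, coeff_mk]
    simp only [RingHom.coe_coe, map_smul, freePsi_T, multiple_vertical]
  have hgen : ∀ i j, Commute (genImage P (vertical (i + 1) (Nat.succ_pos i)))
      (genImage P (vertical (j + 1) (Nat.succ_pos j))) := fun i j => by
    have h2 : Commute (P (vertical (i + 1) (Nat.succ_pos i)))
        (P (vertical (j + 1) (Nat.succ_pos j))) :=
      hP.commute hn h (by simp [det2, coe_vertical])
    exact ((h2.smul_left _).smul_right _).map (untwist n).symm
  have hcomm : ∀ i j, Commute (coeff i τ) (coeff j τ) := fun i j => by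
    rcases i with _ | i
    · rw [h0]; exact Commute.zero_left _
    rcases j with _ | j
    · rw [h0]; exact Commute.zero_right _
    rw [h1, h1]
    exact ((hgen i j).smul_left _).smul_right _
  have hlog : ∀ l, untwist n (l • coeff l τ) =
      logScalar l • sandwich (psum (unitY n) l) := fun l => by
    rcases l with _ | l
    · rw [logScalar_zero, zero_smul, zero_smul, map_zero]
    · rw [h1, map_nsmul, untwist_smul, untwist_genImage, deg_vertical, hP.vertical, smul_smul,
        ← Nat.cast_smul_eq_nsmul K', smul_smul, ← natCast_mul_weight (Nat.succ_pos l), map_sub,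
        map_inv₀, subst_v]
  exact @expCoeff_eq_sandwich n K _ _ (inferInstanceAs (Algebra K (SphericalTwist n))) τ h0
    hcomm hlog m

/-- The generators of degree `1` are mapped to multiples of the `P_x`. -/
theorem genImage_of_deg_one {x : LatticeStar} (hx : deg x.1 = 1) :
    untwist n (genImage P x) = (q'⁻¹ * v' - v'⁻¹) • P x := by
  rw [untwist_genImage, hx, subst_qInt_one, weight_one, one_mul]

theorem eq_one_of_eq_smul {x z : LatticeStar} {m : ℕ} (h : x.1 = (m : ℤ) • z.1)
    (h0 : x.1 0 = 1 ∨ x.1 0 = -1) : m = 1 ∧ z = x := by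
  have h1 := congrFun h 0
  rw [Pi.smul_apply, smul_eq_mul] at h1
  have h2 : (m : ℤ) ∣ 1 := by
    rcases h0 with h0 | h0
    · exact ⟨z.1 0, by rw [← h1, h0]⟩
    · exact ⟨-(z.1 0), by rw [mul_neg, ← h1, h0]; rfl⟩
  have h3 : m = 1 := by
    have := Int.natCast_dvd_natCast.mp (by simpa using h2 : (m : ℤ) ∣ ((1 : ℕ) : ℤ))
    exact Nat.dvd_one.mp this
  subst h3
  refine ⟨rfl, Subtype.ext ?_⟩
  rw [h]; simp

theorem eq_vertical_of_eq_smul {z : LatticeStar} {m b : ℕ} (hb : 0 < b)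
    (h : ![0, (b : ℤ)] = (m : ℤ) • z.1) (hz : deg z.1 = 1) : m = b ∧ z = vertical 1 one_pos := by
  have h0 := congrFun h 0
  have h1 := congrFun h 1
  rw [Pi.smul_apply, smul_eq_mul] at h0 h1
  simp only [Matrix.cons_val_zero, Matrix.cons_val_one] at h0 h1
  have hm : (m : ℤ) ≠ 0 := by
    rintro hm
    rw [hm, zero_mul] at h1
    omega
  have h2 : z.1 0 = 0 := (mul_eq_zero.mp h0.symm).resolve_left hm
  rw [deg, h2, Int.gcd_zero_left] at hz
  have h3 : z.1 1 = 1 := by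
    rcases Int.natAbs_eq (z.1 1) with h4 | h4
    · rw [h4, hz]; rfl
    · rw [hz] at h4
      rw [h4] at h1
      omega
  refine ⟨?_, Subtype.ext (lattice_ext (by simp [h2, coe_vertical]) (by simp [h3, coe_vertical]))⟩
  rw [h3, mul_one] at h1
  omega

/-- The triangle relation for the standard pairs. -/
theorem freePsi_triangle (hn : 0 < n) (h : IsCherednikAction n ρ) (hP : IsPowerSumFamily ρ P)
    {x y z : LatticeStar} {m b : ℕ} (hb : 0 < b) (hz : deg z.1 = 1)
    (hm : x.1 + y.1 = (m : ℤ) • z.1)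
    (hxy : (x = point 1 0 one_ne_zero ∧ y = vertical b hb) ∨
      (x = point (-1) 0 (by decide) ∧ y = vertical b hb) ∨
      (x = point 1 0 one_ne_zero ∧ y = point (-1) b (by decide)) ∨
      (x = point (-1) b (by decide) ∧ y = point 1 0 one_ne_zero)) :
    untwist n (freePsi P (freeT y * freeT x - freeT x * freeT y)) =
      untwist n (freePsi P
        ((((det2 x.1 y.1).sign : K) * cCoeff (deg y.1) / (vK⁻¹ - vK)) • freeTheta z m)) := by
  have hv := vK_inv_sub_ne_zero
  have hb' : (0 : ℤ) < b := by omega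
  have hsign : Int.sign b = 1 := Int.sign_eq_one_of_pos hb'
  have d1 : ∀ l : ℤ, deg (point 1 l one_ne_zero).1 = 1 := fun l => point_deg 1 l (Or.inl rfl) _
  have d2 : ∀ l : ℤ, deg (point (-1) l (by decide)).1 = 1 :=
    fun l => point_deg (-1) l (Or.inr rfl) _
  rw [map_sub, map_mul, map_mul, map_smul, freePsi_T, freePsi_T, map_sub, map_mul, map_mul,
    untwist_smul]
  rcases hxy with ⟨rfl, rfl⟩ | ⟨rfl, rfl⟩ | ⟨rfl, rfl⟩ | ⟨rfl, rfl⟩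
  · have e0 : (point 1 0 one_ne_zero).1 + (vertical b hb).1 = (point 1 b one_ne_zero).1 := by
      apply lattice_ext <;> simp [point, coe_vertical]
    rw [e0] at hm
    obtain ⟨rfl, rfl⟩ := eq_one_of_eq_smul hm (Or.inl rfl)
    have hs : (det2 (point 1 0 one_ne_zero).1 (vertical b hb).1).sign = 1 := by
      rw [show det2 _ _ = (b : ℤ) by simp [det2, point, coe_vertical], hsign]
    rw [hs, Int.cast_one, one_mul, freeTheta_one, map_smul, freePsi_T, untwist_smul, smul_smul,
      ← map_mul subst, div_mul_cancel₀ _ hv, deg_vertical, subst_cCoeff, genImage_of_deg_one (d1 _),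
      genImage_of_deg_one (d1 _), untwist_genImage, deg_vertical, smul_mul_smul_comm,
      smul_mul_smul_comm, mul_comm (q'⁻¹ * v' - v'⁻¹), ← smul_sub, hP.commutator_one hn h b hb,
      smul_smul, smul_smul]
    congr 1
    ring
  · have e0 : (point (-1) 0 (by decide)).1 + (vertical b hb).1 = (point (-1) b (by decide)).1 := by
      apply lattice_ext <;> simp [point, coe_vertical]
    rw [e0] at hm
    obtain ⟨rfl, rfl⟩ := eq_one_of_eq_smul hm (Or.inr rfl)
    have hs : (det2 (point (-1) 0 (by decide)).1 (vertical b hb).1).sign = -1 := by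
      rw [show det2 _ _ = -(b : ℤ) by simp [det2, point, coe_vertical], Int.sign_neg, hsign]
    rw [hs, freeTheta_one, map_smul, freePsi_T, untwist_smul, smul_smul,
      ← map_mul subst, div_mul_cancel₀ _ hv, deg_vertical, Int.cast_neg, Int.cast_one, neg_one_mul,
      map_neg, subst_cCoeff, genImage_of_deg_one (d2 _),
      genImage_of_deg_one (d2 _), untwist_genImage, deg_vertical, smul_mul_smul_comm,
      smul_mul_smul_comm, mul_comm (q'⁻¹ * v' - v'⁻¹), ← smul_sub, hP.commutator_neg_one hn h b hb,
      ← neg_smul, smul_smul, smul_smul]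
    congr 1
    ring
  · have e0 : (point 1 0 one_ne_zero).1 + (point (-1) b (by decide)).1 = ![0, (b : ℤ)] := by
      apply lattice_ext <;> simp [point]
    rw [e0] at hm
    obtain ⟨rfl, rfl⟩ := eq_vertical_of_eq_smul hb hm hz
    have hs : (det2 (point 1 0 one_ne_zero).1 (point (-1) m (by decide)).1).sign = 1 := by
      rw [show det2 _ _ = (m : ℤ) by simp [det2, point], hsign]
    rw [hs, Int.cast_one, one_mul, freePsi_theta_vertical hn h hP, d2, genImage_of_deg_one (d1 _),
      genImage_of_deg_one (d2 _), smul_mul_smul_comm, smul_mul_smul_comm, ← smul_sub,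
      hP.commutator_opposite_eq hn h hb, cCoeff]
    congr 1
    simp only [map_div₀, map_mul, map_sub, map_add, map_inv₀, subst_v, subst_t,
      subst_qInt_one, pow_one, mul_one, Nat.cast_one, div_one]
  · have e0 : (point (-1) b (by decide)).1 + (point 1 0 one_ne_zero).1 = ![0, (b : ℤ)] := by
      apply lattice_ext <;> simp [point]
    rw [e0] at hm
    obtain ⟨rfl, rfl⟩ := eq_vertical_of_eq_smul hb hm hz
    have hs : (det2 (point (-1) m (by decide)).1 (point 1 0 one_ne_zero).1).sign = -1 := by
      rw [show det2 _ _ = -(m : ℤ) by simp [det2, point], Int.sign_neg, hsign]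
    rw [hs, Int.cast_neg, Int.cast_one, neg_one_mul, neg_div, map_neg, neg_smul,
      freePsi_theta_vertical hn h hP, d1, genImage_of_deg_one (d1 _),
      genImage_of_deg_one (d2 _), smul_mul_smul_comm, smul_mul_smul_comm, ← smul_sub,
      ← neg_sub (P (point (-1) m (by decide)) * _), smul_neg,
      hP.commutator_opposite_eq hn h hb, cCoeff]
    congr 2
    simp only [map_div₀, map_mul, map_sub, map_add, map_inv₀, subst_v, subst_t,
      subst_qInt_one, pow_one, mul_one, Nat.cast_one, div_one]

theorem freePsi_rel (hn : 0 < n) (h : IsCherednikAction n ρ) (hP : IsPowerSumFamily ρ P)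
    {a b : FreeHall} (hab : HallRel a b) : freePsi P a = freePsi P b := by
  cases hab with
  | line x y hxy =>
    rw [map_mul, map_mul, freePsi_T, freePsi_T]
    exact (((hP.commute hn h hxy).smul_left _).smul_right _).map (untwist n).symm
  | triangle x y z m hx hxy hT hz hm =>
    obtain ⟨g, b, hb, hg⟩ := exists_normal_form x y hx hxy hT
    have hz' : deg (g • z).1 = 1 := by rw [coe_smul, deg_smul]; exact hz
    have hm' : (g • x).1 + (g • y).1 = (m : ℤ) • (g • z).1 := by
      rw [coe_smul, coe_smul, coe_smul, ← Matrix.mulVec_add, hm, Matrix.mulVec_smul]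
    have hdet : det2 (g • x).1 (g • y).1 = det2 x.1 y.1 := by
      rw [coe_smul, coe_smul, det2_smul]
    have hdeg : deg (g • y).1 = deg y.1 := by rw [coe_smul, deg_smul]
    apply (untwist n).injective
    apply (ρ g).injective
    rw [← freePsi_freeAct hP, ← freePsi_freeAct hP, map_sub, map_mul, map_mul, map_smul,
      freeAct_T, freeAct_T, freeAct_theta, ← hdet, ← hdeg]
    exact freePsi_triangle hn h hP hb hz' hm' hg

/-- The homomorphism from the elliptic Hall algebra to the twisted spherical algebra. -/
noncomputable def psiTwist (hn : 0 < n) (h : IsCherednikAction n ρ) (hP : IsPowerSumFamily ρ P) :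
    Hall →ₐ[K] SphericalTwist n :=
  RingQuot.liftAlgHom K ⟨freePsi P, fun _ _ => freePsi_rel hn h hP⟩

theorem psiTwist_mk (hn : 0 < n) (h : IsCherednikAction n ρ) (hP : IsPowerSumFamily ρ P)
    (a : FreeHall) : psiTwist hn h hP (hallMk a) = freePsi P a :=
  RingQuot.liftAlgHom_mkAlgHom_apply K _ _ a

theorem algebraMap_complex_hall (c : ℂ) :
    algebraMap ℂ Hall c = algebraMap K Hall (algebraMap ℂ K c) := rfl

theorem algebraMap_complex_spherical (c : ℂ) :
    algebraMap ℂ (Spherical n) c = algebraMap K' (Spherical n) (algebraMap ℂ K' c) := by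
  rw [Algebra.algebraMap_eq_smul_one, Algebra.algebraMap_eq_smul_one]
  apply Spherical.ext
  change c • (1 : Spherical n).val = algebraMap ℂ K' c • (1 : Spherical n).val
  rw [Algebra.smul_def, Algebra.smul_def]
  rfl

/-- The homomorphism `Ψ_n`, over `ℂ` and with values in the spherical algebra itself. -/
noncomputable def psi (hn : 0 < n) (h : IsCherednikAction n ρ) (hP : IsPowerSumFamily ρ P) :
    Hall →ₐ[ℂ] Spherical n :=
  { ((untwist n : SphericalTwist n →+* Spherical n).comp
      (psiTwist hn h hP : Hall →+* SphericalTwist n)) with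
    commutes' := fun c => by
      change untwist n (psiTwist hn h hP (algebraMap ℂ Hall c)) = _
      rw [algebraMap_complex_hall, AlgHom.commutes, algebraMap_complex_spherical]
      exact congrArg (algebraMap K' (Spherical n)) (AlgEquiv.commutes subst c) }

theorem psi_mk (hn : 0 < n) (h : IsCherednikAction n ρ) (hP : IsPowerSumFamily ρ P)
    (a : FreeHall) : psi hn h hP (hallMk a) = untwist n (freePsi P a) :=
  congrArg (untwist n) (psiTwist_mk hn h hP a)

theorem psi_algebraMap (hn : 0 < n) (h : IsCherednikAction n ρ) (hP : IsPowerSumFamily ρ P)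
    (c : K) : psi hn h hP (algebraMap K Hall c) = algebraMap K' (Spherical n) (subst c) := by
  change untwist n (psiTwist hn h hP (algebraMap K Hall c)) = _
  rw [AlgHom.commutes]; rfl

theorem psi_smul (hn : 0 < n) (h : IsCherednikAction n ρ) (hP : IsPowerSumFamily ρ P)
    (c : K) (a : Hall) : psi hn h hP (c • a) = subst c • psi hn h hP a := by
  rw [Algebra.smul_def, map_mul, psi_algebraMap, ← Algebra.smul_def]

theorem psi_Tt (hn : 0 < n) (h : IsCherednikAction n ρ) (hP : IsPowerSumFamily ρ P)
    (x : LatticeStar) : psi hn h hP (hallTt x) = weight (deg x.1) • P x := by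
  have hq : subst (qInt (deg x.1)) ≠ 0 := fun h0 =>
    qInt_ne_zero (deg_pos x) (by rw [← map_zero subst] at h0; exact subst.injective h0)
  rw [hallTt, psi_smul, hallT, psi_mk, freePsi_T, untwist_genImage, smul_smul, map_inv₀,
    inv_mul_cancel_left₀ hq]

theorem hallMk_surjective : Function.Surjective hallMk := RingQuot.mkAlgHom_surjective K HallRel

theorem hallAct_mk (g : SL2Z) (a : FreeHall) : hallAct g (hallMk a) = hallMk (freeAct g a) :=
  RingQuot.liftAlgHom_mkAlgHom_apply K (hallMk.comp (freeAct g))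
    (fun _ _ h => RingQuot.mkAlgHom_rel K (freeAct_rel g h)) a

theorem psi_hallAct (hn : 0 < n) (h : IsCherednikAction n ρ) (hP : IsPowerSumFamily ρ P)
    (g : SL2Z) (a : Hall) : psi hn h hP (hallAct g a) = ρ g (psi hn h hP a) := by
  obtain ⟨a, rfl⟩ := hallMk_surjective a
  rw [hallAct_mk, psi_mk, psi_mk, freePsi_freeAct hP]

theorem weight_ne_zero {d : ℕ} (hd : 0 < d) : weight d ≠ 0 := by
  have hd' : (d : K') ≠ 0 := Nat.cast_ne_zero.mpr hd.ne'
  refine mul_ne_zero (one_div_ne_zero hd') fun h => ?_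
  have h2 : v' ^ (2 * d) = q' ^ d := by
    have hv := v'_ne_zero
    have hq := q'_ne_zero
    have h1 : q'⁻¹ ^ d * v' ^ d = v'⁻¹ ^ d := sub_eq_zero.mp h
    rw [inv_pow, inv_pow] at h1
    field_simp at h1
    rw [← h1]; ring
  have h3 : (MvPolynomial.X 0 ^ (2 * d) : MvPolynomial (Fin 2) ℂ) = MvPolynomial.X 1 ^ d := by
    apply IsFractionRing.injective (MvPolynomial (Fin 2) ℂ) K'
    rw [map_pow, map_pow]; exact h2
  have h4 := congrArg (MvPolynomial.eval ![(0 : ℂ), 1]) h3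
  simp [hd.ne'] at h4

/-- The image of a subalgebra generated by elements `t̃_x` is generated by the `P_x`. -/
theorem psi_image_adjoin (hn : 0 < n) (h : IsCherednikAction n ρ) (hP : IsPowerSumFamily ρ P)
    (s : Set LatticeStar) :
    psi hn h hP '' (Algebra.adjoin K (hallTt '' s) : Set Hall) =
      (Algebra.adjoin K' (P '' s) : Set (Spherical n)) := by
  apply Set.Subset.antisymm
  · rintro _ ⟨a, ha, rfl⟩
    induction ha using Algebra.adjoin_induction with
    | mem a ha =>
      obtain ⟨x, hx, rfl⟩ := ha
      rw [psi_Tt]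
      exact Subalgebra.smul_mem _ (Algebra.subset_adjoin (Set.mem_image_of_mem _ hx)) _
    | algebraMap c => rw [psi_algebraMap]; exact Subalgebra.algebraMap_mem _ _
    | add a b _ _ ha hb => rw [map_add]; exact add_mem ha hb
    | mul a b _ _ ha hb => rw [map_mul]; exact mul_mem ha hb
  · intro b hb
    induction hb using Algebra.adjoin_induction with
    | mem b hb =>
      obtain ⟨x, hx, rfl⟩ := hb
      refine ⟨subst.symm (weight (deg x.1))⁻¹ • hallTt x,
        Subalgebra.smul_mem _ (Algebra.subset_adjoin (Set.mem_image_of_mem _ hx)) _, ?_⟩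
      rw [psi_smul, AlgEquiv.apply_symm_apply, psi_Tt, smul_smul,
        inv_mul_cancel₀ (weight_ne_zero (deg_pos x)), one_smul]
    | algebraMap c =>
      exact ⟨algebraMap K Hall (subst.symm c), Subalgebra.algebraMap_mem _ _, by
        rw [psi_algebraMap, AlgEquiv.apply_symm_apply]⟩
    | add a b _ _ ha hb =>
      obtain ⟨a', ha', rfl⟩ := ha
      obtain ⟨b', hb', rfl⟩ := hb
      exact ⟨a' + b', add_mem ha' hb', map_add _ _ _⟩
    | mul a b _ _ ha hb =>
      obtain ⟨a', ha', rfl⟩ := ha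
      obtain ⟨b', hb', rfl⟩ := hb
      exact ⟨a' * b', mul_mem ha' hb', map_mul _ _ _⟩

end Relations
end EllipticHall

namespace EllipticHall

open DirectSum Equiv

/-! ### Reduction of a filtered family of lattices modulo an ideal -/

section Reduction

variable {R H ι : Type*} [CommRing R] [Ring H] [Algebra R H] [AddMonoid ι] [DecidableEq ι]
  (F : ι → Submodule R H) [SetLike.GradedMonoid F] (I : Ideal R)

/-- The two-sided ideal generated by `I` in the external direct sum of the submodules `F d`. -/
def reductionIdeal : @Ideal (⨁ d, F d) (DirectSum.ring fun d => F d).toSemiring where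
  carrier := (I • ⊤ : Submodule R (⨁ d, F d))
  add_mem' := add_mem
  zero_mem' := zero_mem _
  smul_mem' c a ha := by
    change a ∈ (I • ⊤ : Submodule R (⨁ d, F d)) at ha
    change c * a ∈ (I • ⊤ : Submodule R (⨁ d, F d))
    induction ha using Submodule.smul_induction_on' with
    | smul r hr a _ =>
      rw [mul_smul_comm]
      exact Submodule.smul_mem_smul hr Submodule.mem_top
    | add a _ b _ ha hb => rw [mul_add]; exact add_mem ha hb

instance : (reductionIdeal F I).IsTwoSided where
  mul_mem_of_left {a} c ha := by
    change a ∈ (I • ⊤ : Submodule R (⨁ d, F d)) at ha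
    change a * c ∈ (I • ⊤ : Submodule R (⨁ d, F d))
    induction ha using Submodule.smul_induction_on' with
    | smul r hr a _ =>
      rw [smul_mul_assoc]
      exact Submodule.smul_mem_smul hr Submodule.mem_top
    | add a _ b _ ha hb => rw [add_mul]; exact add_mem ha hb

/-- The graded ring with components `F d / I F d`. The `F d` need not be independent in `H`: the
product of the symbols of `a ∈ F d` and `b ∈ F e` is the symbol of `a b` seen in `F (d + e)`. -/
abbrev Reduction : Type _ := (⨁ d, F d) ⧸ reductionIdeal F I

variable {F}

/-- The class of `a ∈ F d` modulo `I F d`. -/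
def symb (d : ι) (a : H) (ha : a ∈ F d) : Reduction F I :=
  Ideal.Quotient.mk (reductionIdeal F I) (DirectSum.of (fun d => F d) d ⟨a, ha⟩)

theorem symb_congr {d e : ι} {a b : H} (h : d = e) (hab : a = b) (ha : a ∈ F d) :
    symb I d a ha = symb I e b (h ▸ hab ▸ ha) := by
  subst h; subst hab; rfl

theorem symb_add {d : ι} {a b : H} (ha : a ∈ F d) (hb : b ∈ F d) :
    symb I d (a + b) (add_mem ha hb) = symb I d a ha + symb I d b hb := by
  rw [symb, symb, symb, ← map_add, ← map_add]; rfl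

theorem symb_zero (d : ι) : symb I d (0 : H) (zero_mem (F d)) = 0 := by
  have : (⟨0, zero_mem (F d)⟩ : F d) = 0 := rfl
  rw [symb, this, map_zero, map_zero]

theorem symb_neg {d : ι} {a : H} (ha : a ∈ F d) :
    symb I d (-a) (neg_mem ha) = -symb I d a ha := by
  apply eq_neg_of_add_eq_zero_left
  rw [← symb_add I (neg_mem ha) ha, ← symb_zero I d]
  exact symb_congr I rfl (neg_add_cancel a) _

theorem symb_sum {d : ι} {α : Type*} (s : Finset α) (f : α → H) (hf : ∀ i, f i ∈ F d) :
    symb I d (∑ i ∈ s, f i) (Submodule.sum_mem _ fun i _ => hf i) =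
      ∑ i ∈ s, symb I d (f i) (hf i) := by
  classical
  induction s using Finset.induction_on with
  | empty => exact symb_zero I d
  | insert i s hi ih =>
    simp only [Finset.sum_insert hi]
    rw [symb_add I (hf i) (Submodule.sum_mem _ fun i _ => hf i), ih]

theorem symb_mul {d e : ι} {a b : H} (ha : a ∈ F d) (hb : b ∈ F e) :
    symb I (d + e) (a * b) (SetLike.mul_mem_graded ha hb) = symb I d a ha * symb I e b hb := by
  rw [symb, symb, symb, ← map_mul, DirectSum.of_mul_of]; rfl

theorem symb_one : symb I 0 (1 : H) (SetLike.one_mem_graded F) = 1 := by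
  rw [symb]; exact map_one (Ideal.Quotient.mk (reductionIdeal F I))

theorem symb_eq_zero_iff {d : ι} {a : H} (ha : a ∈ F d) : symb I d a ha = 0 ↔ a ∈ I • F d := by
  rw [symb, Ideal.Quotient.eq_zero_iff_mem]
  change DirectSum.of (fun d => F d) d ⟨a, ha⟩ ∈ (I • ⊤ : Submodule R (⨁ d, F d)) ↔ _
  constructor
  · intro h
    have h1 := Submodule.mem_map_of_mem
      (f := (F d).subtype ∘ₗ DirectSum.component R ι (fun d => F d) d) h
    rw [Submodule.map_smul'', LinearMap.comp_apply] at h1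
    have h2 : DirectSum.component R ι (fun d => F d) d (DirectSum.of (fun d => F d) d ⟨a, ha⟩) =
      ⟨a, ha⟩ := DirectSum.of_eq_same d _
    rw [h2] at h1
    refine Submodule.smul_mono le_rfl ?_ h1
    rintro _ ⟨b, -, rfl⟩
    exact Subtype.property _
  · intro h
    have h1 : (F d).subtype ⟨a, ha⟩ ∈ Submodule.map (F d).subtype (I • ⊤ : Submodule R (F d)) := by
      rw [Submodule.map_smul'', Submodule.map_subtype_top]; exact h
    obtain ⟨b, hb, hb'⟩ := h1
    obtain rfl : b = ⟨a, ha⟩ := Subtype.ext hb'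
    have h2 := Submodule.mem_map_of_mem (f := DirectSum.lof R ι (fun d => F d) d) hb
    rw [Submodule.map_smul''] at h2
    exact Submodule.smul_mono le_rfl le_top h2

theorem symb_eq_iff {d : ι} {a b : H} (ha : a ∈ F d) (hb : b ∈ F d) :
    symb I d a ha = symb I d b hb ↔ a - b ∈ I • F d := by
  rw [← symb_eq_zero_iff I (sub_mem ha hb), ← sub_eq_zero]
  have h : symb I d (a - b) (sub_mem ha hb) = symb I d a ha - symb I d b hb := by
    have := symb_add I ha (neg_mem hb)
    rw [symb_neg I hb, ← sub_eq_add_neg (symb I d a ha)] at this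
    exact (symb_congr I rfl (sub_eq_add_neg a b) _).trans this
  rw [h]

theorem symb_smul {d : ι} {a : H} (ha : a ∈ F d) (r : R) :
    symb I d (r • a) (Submodule.smul_mem _ r ha) = r • symb I d a ha := by
  have h : DirectSum.of (fun d => F d) d ⟨r • a, Submodule.smul_mem _ r ha⟩ =
      r • DirectSum.of (fun d => F d) d ⟨a, ha⟩ :=
    map_smul (DirectSum.lof R ι (fun d => F d) d) r ⟨a, ha⟩
  rw [symb, symb, h]
  rfl

end Reduction

/-! ### Symmetric elements of a crossed product with the symmetric group -/

/-- The relations, at `v = q = 1`, between the `T_i`, `X_j`, `Y_j` and the symmetrizer: those of the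
crossed product of the symmetric group with the ring of polynomials in `X_j`, `Y_j`. -/
structure IsCrossed (n : ℕ) {A : Type*} [Ring A] (t : Fin (n - 1) → A) (x y : Fin n → A) (s : A) :
    Prop where
  t_sq : ∀ i, t i * t i = 1
  t_x : ∀ i j, t i * x j = x (simpleRefl i j) * t i
  t_y : ∀ i j, t i * y j = y (simpleRefl i j) * t i
  comm_x : ∀ i j, Commute (x i) (x j)
  comm_y : ∀ i j, Commute (y i) (y j)
  comm_xy : ∀ i j, Commute (x i) (y j)
  t_s : ∀ i, t i * s = s
  s_t : ∀ i, s * t i = s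
  s_s : s * s = s
  comm_s : ∀ a, (∀ i, Commute (t i) a) → Commute a s

namespace IsCrossed

variable {n : ℕ} {A : Type*} [Ring A] {t : Fin (n - 1) → A} {x y : Fin n → A} {s : A}

/-- The monomials `x_j^a y_j^b`, for a given `j`. -/
def site (h : IsCrossed n t x y s) (j : Fin n) : Multiplicative (ℕ × ℕ) →* A where
  toFun d := x j ^ d.toAdd.1 * y j ^ d.toAdd.2
  map_one' := by simp
  map_mul' d e := by
    have h1 : Commute (y j ^ d.toAdd.2) (x j ^ e.toAdd.1) := ((h.comm_xy j j).symm.pow_pow _ _)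
    simp only [toAdd_mul, Prod.fst_add, Prod.snd_add, pow_add]
    rw [mul_assoc, mul_assoc, ← mul_assoc (x j ^ e.toAdd.1), ← h1.eq]
    simp only [mul_assoc]

theorem site_apply (h : IsCrossed n t x y s) (j : Fin n) (d : Multiplicative (ℕ × ℕ)) :
    h.site j d = x j ^ d.toAdd.1 * y j ^ d.toAdd.2 := rfl

theorem commute_site (h : IsCrossed n t x y s) (i j : Fin n) (d e : Multiplicative (ℕ × ℕ)) :
    Commute (h.site i d) (h.site j e) :=
  Commute.mul_left
    (((h.comm_x i j).pow_pow _ _).mul_right ((h.comm_xy i j).pow_pow _ _))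
    (((h.comm_xy j i).symm.pow_pow _ _).mul_right ((h.comm_y i j).pow_pow _ _))

/-- The monomials in the `x_j` and `y_j`. -/
def monomial (h : IsCrossed n t x y s) : (Fin n → Multiplicative (ℕ × ℕ)) →* A :=
  MonoidHom.noncommPiCoprod h.site fun i j _ d e => h.commute_site i j d e

theorem monomial_mulSingle (h : IsCrossed n t x y s) (j : Fin n) (d : Multiplicative (ℕ × ℕ)) :
    h.monomial (Pi.mulSingle j d) = h.site j d := MonoidHom.noncommPiCoprod_mulSingle _ _ _

theorem t_site (h : IsCrossed n t x y s) (i : Fin (n - 1)) (j : Fin n)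
    (d : Multiplicative (ℕ × ℕ)) :
    t i * h.site j d = h.site (simpleRefl i j) d * t i := by
  have hx : SemiconjBy (t i) (x j) (x (simpleRefl i j)) := h.t_x i j
  have hy : SemiconjBy (t i) (y j) (y (simpleRefl i j)) := h.t_y i j
  exact (hx.pow_right _).mul_right (hy.pow_right _)

theorem t_monomial (h : IsCrossed n t x y s) (i : Fin (n - 1))
    (c : Fin n → Multiplicative (ℕ × ℕ)) :
    t i * h.monomial c = h.monomial (c ∘ simpleRefl i) * t i := by
  let f : (Fin n → Multiplicative (ℕ × ℕ)) →* A :=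
    { toFun := fun c => t i * h.monomial c * t i
      map_one' := by rw [map_one, mul_one, h.t_sq]
      map_mul' := fun c d => by
        have : t i * h.monomial c * t i * (t i * h.monomial d * t i) =
            t i * h.monomial c * (t i * t i) * h.monomial d * t i := by simp only [mul_assoc]
        rw [this, h.t_sq, map_mul, mul_one]
        simp only [mul_assoc] }
  let g : (Fin n → Multiplicative (ℕ × ℕ)) →* A :=
    { toFun := fun c => h.monomial (c ∘ simpleRefl i)
      map_one' := map_one h.monomial
      map_mul' := fun c d => map_mul h.monomial (c ∘ simpleRefl i) (d ∘ simpleRefl i) }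
  have hfg : f = g := by
    apply MonoidHom.pi_ext
    intro j d
    change t i * h.monomial (Pi.mulSingle j d) * t i =
      h.monomial (Pi.mulSingle j d ∘ simpleRefl i)
    have h1 : Pi.mulSingle j d ∘ simpleRefl i =
        (Pi.mulSingle (simpleRefl i j) d : Fin n → Multiplicative (ℕ × ℕ)) := by
      funext k
      have h2 : simpleRefl i k = j ↔ k = simpleRefl i j := by
        have h3 : ∀ a, simpleRefl i (simpleRefl i a) = a := fun a => by
          simpa using congrArg (fun f : Perm (Fin n) => f a) (simpleRefl_mul_self i)
        exact ⟨fun h => by rw [← h, h3], fun h => by rw [h, h3]⟩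
      simp only [Function.comp_apply, Pi.mulSingle_apply, h2]
    rw [h1, h.monomial_mulSingle, h.monomial_mulSingle, h.t_site, mul_assoc, h.t_sq, mul_one]
  have h2 : t i * h.monomial c * t i = h.monomial (c ∘ simpleRefl i) :=
    congrArg (fun f : (Fin n → Multiplicative (ℕ × ℕ)) →* A => f c) hfg
  rw [← h2, mul_assoc, h.t_sq, mul_one]

/-- Symmetrized monomials only depend on the orbit of the monomial. -/
theorem symmetrized_comp (h : IsCrossed n t x y s) (w : Perm (Fin n))
    (c : Fin n → Multiplicative (ℕ × ℕ)) :
    s * h.monomial (c ∘ w) * s = s * h.monomial c * s := by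
  obtain ⟨L, rfl⟩ := exists_word w
  induction L generalizing c with
  | nil => rfl
  | cons i L ih =>
    have h1 : c ∘ wordPerm (i :: L) = (c ∘ simpleRefl i) ∘ wordPerm L := by
      rw [wordPerm_cons]; rfl
    rw [h1, ih]
    calc s * h.monomial (c ∘ simpleRefl i) * s
        = s * (h.monomial (c ∘ simpleRefl i) * t i) * s := by
          rw [mul_assoc, mul_assoc, mul_assoc, h.t_s]
      _ = s * t i * h.monomial c * s := by rw [← h.t_monomial]; simp only [mul_assoc]
      _ = _ := by rw [h.s_t]

/-- The power sum `∑_j x_j^a y_j^b`. -/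
def powerSum (h : IsCrossed n t x y s) (d : Multiplicative (ℕ × ℕ)) : A := ∑ j, h.site j d

theorem commute_powerSum (h : IsCrossed n t x y s) (d : Multiplicative (ℕ × ℕ)) :
    Commute (h.powerSum d) s := by
  refine h.comm_s _ fun i => ?_
  rw [Commute, SemiconjBy, powerSum, Finset.mul_sum, Finset.sum_mul,
    ← Equiv.sum_comp (simpleRefl i) fun j => h.site j d * t i]
  exact Finset.sum_congr rfl fun j _ => h.t_site i j d

/-- The total degree of a monomial. -/
def totalDeg (c : Fin n → Multiplicative (ℕ × ℕ)) : ℕ × ℕ := ∑ j, (c j).toAdd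

theorem totalDeg_mul (c d : Fin n → Multiplicative (ℕ × ℕ)) :
    totalDeg (c * d) = totalDeg c + totalDeg d := by
  simp only [totalDeg, Pi.mul_apply, toAdd_mul, Finset.sum_add_distrib]

theorem totalDeg_mulSingle (j : Fin n) (d : Multiplicative (ℕ × ℕ)) :
    totalDeg (Pi.mulSingle j d : Fin n → Multiplicative (ℕ × ℕ)) = d.toAdd := by
  rw [totalDeg, Finset.sum_eq_single j]
  · simp
  · intro k _ hk
    simp [hk]
  · simp

/-- Symmetrized monomials are polynomials in the symmetrized power sums. When the monomial is
factored as a monomial in the variables with a given index `i` times a monomial in the other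
variables, the product of the corresponding power sum with the second factor is a sum of
monomials which involve fewer indices, or lie in the orbit of the given monomial. -/
theorem symmetrized_mem (h : IsCrossed n t x y s) {Q : ℕ × ℕ → AddSubgroup A}
    (h0 : s ∈ Q 0) (hmul : ∀ {d e a b}, a ∈ Q d → b ∈ Q e → a * b ∈ Q (d + e))
    (hdiv : ∀ {k : ℕ} {d a}, 0 < k → k • a ∈ Q d → a ∈ Q d)
    (hp : ∀ d : Multiplicative (ℕ × ℕ), d ≠ 1 → s * h.powerSum d * s ∈ Q d.toAdd)
    (c : Fin n → Multiplicative (ℕ × ℕ)) : s * h.monomial c * s ∈ Q (totalDeg c) := by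
  classical
  let supp : (Fin n → Multiplicative (ℕ × ℕ)) → Finset (Fin n) :=
    fun c => Finset.univ.filter fun j => c j ≠ 1
  induction hm : (supp c).card using Nat.strong_induction_on generalizing c with
  | _ m ih =>
  by_cases hc : c = 1
  · have h1 : totalDeg c = 0 := by simp [hc, totalDeg]
    rw [h1, hc, map_one, mul_one, h.s_s]
    exact h0
  obtain ⟨i, hi⟩ : ∃ i, c i ≠ 1 := Function.ne_iff.mp hc
  set d := c i with hd
  set c' := Function.update c i 1 with hc'
  have hcc : c = Pi.mulSingle i d * c' := by
    funext k
    by_cases hk : k = i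
    · subst hk; simp [hc', hd]
    · simp [hc', hk]
  have hi' : i ∉ supp c' := by simp [supp, hc']
  have hsub : supp c' ⊆ supp c := by
    intro k hk
    have hk1 : k ≠ i := fun h => hi' (h ▸ hk)
    simp only [supp, Finset.mem_filter, Finset.mem_univ, true_and, hc'] at hk ⊢
    rwa [Function.update_of_ne hk1] at hk
  have hlt : (supp c').card < m := by
    rw [← hm]
    exact Finset.card_lt_card ⟨hsub, fun h => hi' (h (by simp [supp, ← hd, hi]))⟩
  have hdeg : ∀ k, totalDeg (Pi.mulSingle k d * c') = totalDeg c := fun k => by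
    rw [hcc, totalDeg_mul, totalDeg_mul, totalDeg_mulSingle, totalDeg_mulSingle]
  have hprod : s * h.powerSum d * s * (s * h.monomial c' * s) =
      ∑ k, s * h.monomial (Pi.mulSingle k d * c') * s := by
    have h1 := (h.commute_powerSum d).eq
    calc _ = s * (h.powerSum d * s) * s * (h.monomial c' * s) := by simp only [mul_assoc]
      _ = s * s * h.powerSum d * (s * (h.monomial c' * s)) := by rw [h1]; simp only [mul_assoc]
      _ = s * (h.powerSum d * s) * (h.monomial c' * s) := by
          rw [h.s_s]; simp only [mul_assoc]
      _ = s * s * h.powerSum d * h.monomial c' * s := by rw [h1]; simp only [mul_assoc]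
      _ = _ := by
        rw [h.s_s, powerSum, Finset.mul_sum, Finset.sum_mul, Finset.sum_mul]
        refine Finset.sum_congr rfl fun k _ => ?_
        rw [map_mul, h.monomial_mulSingle, mul_assoc s]
  have hmem := hmul (hp d hi) (ih _ hlt c' rfl)
  have hdeg' : d.toAdd + totalDeg c' = totalDeg c := by
    rw [← totalDeg_mulSingle i d, ← totalDeg_mul, ← hcc]
  rw [hdeg', hprod, ← Finset.sum_filter_add_sum_filter_not Finset.univ fun k => k ∈ supp c'] at hmem
  have hfew : ∑ k ∈ Finset.univ.filter (fun k => k ∈ supp c'),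
      s * h.monomial (Pi.mulSingle k d * c') * s ∈ Q (totalDeg c) := by
    refine sum_mem fun k hk => ?_
    have hk' : k ∈ supp c' := (Finset.mem_filter.mp hk).2
    rw [← hdeg k]
    refine ih _ (lt_of_le_of_lt (Finset.card_le_card ?_) hlt) _ rfl
    intro l hl
    by_contra hl'
    have hlk : l ≠ k := fun h => hl' (h ▸ hk')
    have h1 : c' l = 1 := by simpa [supp] using hl'
    simp [supp, hlk, h1] at hl
  have horbit : ∀ k, k ∉ supp c' →
      s * h.monomial (Pi.mulSingle k d * c') * s = s * h.monomial c * s := fun k hk => by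
    rw [← h.symmetrized_comp (swap k i) c]
    congr 3
    have h1 : c' k = 1 := by simpa [supp] using hk
    have h2 : c' i = 1 := by simp [hc']
    conv_rhs => rw [hcc]
    funext l
    simp only [Pi.mul_apply, Function.comp_apply, Pi.mulSingle_apply]
    rcases eq_or_ne l k with rfl | hlk
    · simp [h1, h2]
    · rcases eq_or_ne l i with rfl | hli
      · simp [h1, h2, hlk, hlk.symm]
      · rw [swap_apply_of_ne_of_ne hlk hli]
        simp [hlk, hli]
  have hmany := (add_mem_cancel_left hfew).mp hmem
  rw [Finset.sum_congr rfl fun k hk => horbit k (Finset.mem_filter.mp hk).2,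
    Finset.sum_const] at hmany
  exact hdiv (Finset.card_pos.mpr ⟨i, by simpa using hi'⟩) hmany

end IsCrossed
end EllipticHall

namespace EllipticHall

/-! ### The local ring at `v = q = 1` -/

/-- The ideal of the point `v = q = 1`. -/
noncomputable def basePrime : Ideal (MvPolynomial (Fin 2) ℂ) :=
  RingHom.ker (MvPolynomial.eval fun _ => (1 : ℂ))

instance : basePrime.IsPrime := RingHom.ker_isPrime _

/-- The rational functions in `v` and `q` which are regular at `v = q = 1`. -/
noncomputable def regularSubalgebra : Subalgebra (MvPolynomial (Fin 2) ℂ) K' :=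
  Localization.subalgebra.ofField K' basePrime.primeCompl basePrime.primeCompl_le_nonZeroDivisors

/-- The local ring of rational functions which are regular at `v = q = 1`. -/
def Regular : Type := regularSubalgebra

noncomputable instance : CommRing Regular := inferInstanceAs (CommRing regularSubalgebra)

noncomputable instance : Algebra (MvPolynomial (Fin 2) ℂ) Regular :=
  inferInstanceAs (Algebra (MvPolynomial (Fin 2) ℂ) regularSubalgebra)

noncomputable instance : Algebra Regular K' := inferInstanceAs (Algebra regularSubalgebra K')

instance : IsLocalization.AtPrime Regular basePrime :=
  Localization.subalgebra.isLocalization_ofField K' _ _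

instance : IsLocalRing Regular := IsLocalization.AtPrime.isLocalRing Regular basePrime

instance : IsNoetherianRing Regular :=
  IsLocalization.isNoetherianRing basePrime.primeCompl Regular inferInstance

/-- The maximal ideal of the local ring. -/
noncomputable def vanishing : Ideal Regular := IsLocalRing.maximalIdeal Regular

noncomputable instance (n : ℕ) : Module Regular (Daha n) := Algebra.toModule

noncomputable instance (n : ℕ) : Module Regular (Spherical n) := Algebra.toModule

instance (n : ℕ) : IsScalarTower Regular K' (Daha n) := IsScalarTower.of_algebraMap_eq fun _ => rfl

theorem regular_smul {n : ℕ} (r : Regular) (a : Daha n) : r • a = algebraMap Regular K' r • a :=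
  (algebraMap_smul K' r a).symm

theorem Spherical.val_regular_smul {n : ℕ} (r : Regular) (a : Spherical n) :
    (r • a).val = r • a.val := rfl

theorem regular_smul_spherical {n : ℕ} (r : Regular) (a : Spherical n) :
    r • a = algebraMap Regular K' r • a :=
  Spherical.ext (by rw [Spherical.val_regular_smul, Spherical.val_smul, regular_smul])

/-- `c` is a rational function which is regular at `v = q = 1`, with value `1`. -/
def IsOneUnit (c : K') : Prop := ∃ r : Regular, algebraMap Regular K' r = c ∧ r - 1 ∈ vanishing

theorem isOneUnit_one : IsOneUnit 1 := ⟨1, map_one _, by rw [sub_self]; exact zero_mem _⟩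

theorem IsOneUnit.mul {c d : K'} (hc : IsOneUnit c) (hd : IsOneUnit d) : IsOneUnit (c * d) := by
  obtain ⟨r, rfl, hr⟩ := hc
  obtain ⟨t, rfl, ht⟩ := hd
  refine ⟨r * t, map_mul _ _ _, ?_⟩
  have : r * t - 1 = r * (t - 1) + (r - 1) := by ring
  rw [this]
  exact add_mem (Ideal.mul_mem_left _ _ ht) hr

theorem isUnit_of_sub_one_mem {r : Regular} (hr : r - 1 ∈ vanishing) : IsUnit r := by
  by_contra h
  have h1 : r ∈ vanishing := (IsLocalRing.mem_maximalIdeal r).mpr h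
  have h2 := sub_mem h1 hr
  rw [sub_sub_cancel] at h2
  exact (IsLocalRing.mem_maximalIdeal 1).mp h2 isUnit_one

theorem IsOneUnit.inv {c : K'} (hc : IsOneUnit c) : IsOneUnit c⁻¹ := by
  obtain ⟨r, rfl, hr⟩ := hc
  obtain ⟨u, rfl⟩ := isUnit_of_sub_one_mem hr
  refine ⟨(u⁻¹ : Regularˣ), ?_, ?_⟩
  · refine eq_inv_of_mul_eq_one_left ?_
    rw [← map_mul, Units.inv_mul, map_one]
  · have : ((u⁻¹ : Regularˣ) : Regular) - 1 = -((u⁻¹ : Regularˣ) : Regular) * (u - 1) := by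
      linear_combination Units.inv_mul u
    rw [this]
    exact Ideal.mul_mem_left _ _ hr

theorem isOneUnit_variable (i : Fin 2) :
    IsOneUnit (algebraMap (MvPolynomial (Fin 2) ℂ) K' (MvPolynomial.X i)) := by
  refine ⟨algebraMap (MvPolynomial (Fin 2) ℂ) Regular (MvPolynomial.X i), rfl, ?_⟩
  rw [← map_one (algebraMap (MvPolynomial (Fin 2) ℂ) Regular), ← map_sub]
  exact (IsLocalization.AtPrime.to_map_mem_maximal_iff Regular basePrime _).mpr (by
    rw [basePrime, RingHom.mem_ker]; simp)

theorem isOneUnit_v : IsOneUnit v' := isOneUnit_variable 0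

theorem isOneUnit_q : IsOneUnit q' := isOneUnit_variable 1

theorem isUnit_natCast {k : ℕ} (hk : 0 < k) : IsUnit (k : Regular) := by
  have : (k : Regular) = algebraMap (MvPolynomial (Fin 2) ℂ) Regular k := (map_natCast _ k).symm
  rw [this]
  refine (IsLocalization.AtPrime.isUnit_to_map_iff Regular basePrime _).mpr ?_
  intro h
  rw [basePrime, SetLike.mem_coe, RingHom.mem_ker, map_natCast] at h
  exact hk.ne' (Nat.cast_eq_zero.mp h)

/-- The quantum factorial is invertible in the local ring: its value at `v = 1` is `n!`. -/
theorem exists_plusFactorial_inv (n : ℕ) : ∃ r : Regular, algebraMap Regular K' r = (plusFactorial n)⁻¹ := by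
  obtain ⟨v, hv, hv1⟩ := isOneUnit_v.mul isOneUnit_v
  set p : Regular := ∑ w : Equiv.Perm (Fin n), v ^ permLength w with hp
  have h1 : algebraMap Regular K' p = plusFactorial n := by
    rw [← sum_pow_permLength, hp, map_sum]
    refine Finset.sum_congr rfl fun w _ => ?_
    rw [map_pow, hv, sq]
  have h2 : p - (n.factorial : Regular) ∈ vanishing := by
    have h3 : (n.factorial : Regular) = ∑ w : Equiv.Perm (Fin n), 1 := by
      simp [Fintype.card_perm]
    rw [h3, hp, ← Finset.sum_sub_distrib]
    refine sum_mem fun w _ => ?_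
    obtain ⟨c, hc⟩ := sub_one_dvd_pow_sub_one v (permLength w)
    rw [hc]
    exact Ideal.mul_mem_right _ _ hv1
  have h4 : IsUnit p := by
    by_contra h
    have h5 := sub_mem ((IsLocalRing.mem_maximalIdeal p).mpr h) h2
    rw [sub_sub_cancel] at h5
    exact (IsLocalRing.mem_maximalIdeal _).mp h5 (isUnit_natCast (Nat.factorial_pos n))
  obtain ⟨u, hu⟩ := h4
  refine ⟨(u⁻¹ : Regularˣ), eq_inv_of_mul_eq_one_left ?_⟩
  rw [← h1, ← hu, ← map_mul, Units.inv_mul, map_one]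

end EllipticHall

namespace EllipticHall

open Equiv

/-! ### The lattices of positive words and their reduction -/

/-- The generators of the positive part of the double affine Hecke algebra. -/
inductive Letter (n : ℕ) : Type
  | T (i : Fin (n - 1))
  | X (j : Fin n)
  | Y (j : Fin n)

variable {n : ℕ}

/-- The value of a letter. -/
noncomputable def Letter.val : Letter n → Daha n
  | T i => Daha.T i
  | X j => Daha.X j
  | Y j => Daha.Y j

/-- The bidegree of a letter. -/
def Letter.wt : Letter n → ℕ × ℕ
  | T _ => 0
  | X _ => (1, 0)
  | Y _ => (0, 1)

/-- The value of a word. -/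
noncomputable def wordVal (l : List (Letter n)) : Daha n := (l.map Letter.val).prod

/-- The bidegree of a word: the numbers of letters `X_j` and of letters `Y_j`. -/
def wordWt (l : List (Letter n)) : ℕ × ℕ := (l.map Letter.wt).sum

/-- The lattice, over the local ring at `v = q = 1`, spanned by the words of bidegree `d`. -/
noncomputable def lattice (n : ℕ) (d : ℕ × ℕ) : Submodule Regular (Daha n) :=
  Submodule.span Regular {a | ∃ l : List (Letter n), wordWt l = d ∧ wordVal l = a}

theorem wordVal_mem (l : List (Letter n)) : wordVal l ∈ lattice n (wordWt l) :=
  Submodule.subset_span ⟨l, rfl, rfl⟩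

theorem wordVal_append (l m : List (Letter n)) : wordVal (l ++ m) = wordVal l * wordVal m := by
  simp [wordVal]

theorem wordWt_append (l m : List (Letter n)) : wordWt (l ++ m) = wordWt l + wordWt m := by
  simp [wordWt]

instance : SetLike.GradedMonoid (lattice n) where
  one_mem := Submodule.subset_span ⟨[], rfl, rfl⟩
  mul_mem d e a b ha hb := by
    have h1 := Submodule.mul_mem_mul ha hb
    rw [lattice, lattice, Submodule.span_mul_span] at h1
    refine Submodule.span_mono ?_ h1
    rintro _ ⟨_, ⟨l, rfl, rfl⟩, _, ⟨m, rfl, rfl⟩, rfl⟩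
    exact ⟨l ++ m, wordWt_append l m, wordVal_append l m⟩

theorem mul_mem_lattice {d e f : ℕ × ℕ} (h : d + e = f) {a b : Daha n} (ha : a ∈ lattice n d)
    (hb : b ∈ lattice n e) : a * b ∈ lattice n f := by
  subst h
  exact SetLike.mul_mem_graded ha hb

theorem T_mem_lattice (i : Fin (n - 1)) : Daha.T i ∈ lattice n 0 :=
  Submodule.subset_span ⟨[.T i], by simp [wordWt, Letter.wt], by simp [wordVal, Letter.val]⟩

theorem X_mem_lattice (j : Fin n) : Daha.X j ∈ lattice n (1, 0) :=
  Submodule.subset_span ⟨[.X j], by simp [wordWt, Letter.wt], by simp [wordVal, Letter.val]⟩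

theorem Y_mem_lattice (j : Fin n) : Daha.Y j ∈ lattice n (0, 1) :=
  Submodule.subset_span ⟨[.Y j], by simp [wordWt, Letter.wt], by simp [wordVal, Letter.val]⟩

theorem list_prod_T_mem_lattice (L : List (Fin (n - 1))) : (L.map Daha.T).prod ∈ lattice n 0 := by
  induction L with
  | nil => exact SetLike.one_mem_graded (lattice n)
  | cons i L ih =>
    rw [List.map_cons, List.prod_cons]
    exact mul_mem_lattice (zero_add 0) (T_mem_lattice i) ih

theorem dahaT_mem_lattice (w : Perm (Fin n)) : (dahaT w : Daha n) ∈ lattice n 0 := by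
  rw [dahaT, reducedProd]
  exact list_prod_T_mem_lattice _

theorem IsOneUnit.smul_mem {c : K'} (hc : IsOneUnit c) {d : ℕ × ℕ} {a : Daha n}
    (ha : a ∈ lattice n d) : c • a ∈ lattice n d := by
  obtain ⟨r, rfl, -⟩ := hc
  rw [← regular_smul]
  exact Submodule.smul_mem _ r ha

theorem IsOneUnit.sub_smul_mem {c c' : K'} (hc : IsOneUnit c) (hc' : IsOneUnit c') {d : ℕ × ℕ}
    {a : Daha n} (ha : a ∈ lattice n d) : (c - c') • a ∈ vanishing • lattice n d := by
  obtain ⟨r, rfl, hr⟩ := hc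
  obtain ⟨t, rfl, ht⟩ := hc'
  have h1 : r - t ∈ vanishing := by
    have := sub_mem hr ht
    rwa [sub_sub_sub_cancel_right] at this
  rw [← map_sub, ← regular_smul]
  exact Submodule.smul_mem_smul h1 ha

theorem exists_symmetrizer_eq (n : ℕ) : ∃ (r : Regular) (c : Perm (Fin n) → Regular),
    symmetrizer n = r • ∑ w, c w • dahaT w := by
  obtain ⟨r, hr⟩ := exists_plusFactorial_inv n
  obtain ⟨v, hv, -⟩ := isOneUnit_v
  refine ⟨r, fun w => v ^ permLength w, ?_⟩
  rw [symmetrizer, preSymm, ← hr, ← hv, regular_smul]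
  simp only [regular_smul, map_pow]

theorem symmetrizer_mem_lattice (n : ℕ) : symmetrizer n ∈ lattice n 0 := by
  obtain ⟨r, c, h⟩ := exists_symmetrizer_eq n
  rw [h]
  exact Submodule.smul_mem _ _ (Submodule.sum_mem _ fun w _ =>
    Submodule.smul_mem _ _ (dahaT_mem_lattice w))

/-- The lattice spanned by the `T_w`. -/
noncomputable def heckeLattice (n : ℕ) : Submodule Regular (Daha n) :=
  Submodule.span Regular (Set.range dahaT)

/-- An upper bound for the lattice of words with `m` letters `X_j` or `Y_j`. -/
noncomputable def boundLattice (n : ℕ) : ℕ → Submodule Regular (Daha n)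
  | 0 => heckeLattice n
  | m + 1 => heckeLattice n *
      (Submodule.span Regular (Set.range Daha.X ∪ Set.range Daha.Y) * boundLattice n m)

theorem dahaT_one : (dahaT 1 : Daha n) = 1 := by
  have h : (reducedWord (1 : Perm (Fin n))).length = 0 := by
    change permLength (1 : Perm (Fin n)) = 0
    rw [permLength_eq, invCard_one]
  rw [dahaT, reducedProd, List.length_eq_zero_iff.mp h]
  rfl

theorem one_mem_heckeLattice : (1 : Daha n) ∈ heckeLattice n :=
  Submodule.subset_span ⟨1, dahaT_one⟩

theorem T_mul_dahaT_of_up (i : Fin (n - 1)) {w : Perm (Fin n)} (h : w.symm (lo i) < w.symm (hi i)) :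
    (Daha.T i : Daha n) * dahaT w = dahaT (simpleRefl i * w) :=
  (reducedProd_up Daha.T Daha.T_comm Daha.T_braid i w h).symm

theorem T_mul_mem_heckeLattice (i : Fin (n - 1)) {a : Daha n} (ha : a ∈ heckeLattice n) :
    Daha.T i * a ∈ heckeLattice n := by
  induction ha using Submodule.span_induction with
  | mem a ha =>
    obtain ⟨w, rfl⟩ := ha
    rcases up_or_down i w with h | h
    · rw [T_mul_dahaT_of_up i h]
      exact Submodule.subset_span ⟨_, rfl⟩
    · have h1 : (simpleRefl i * w).symm (lo i) < (simpleRefl i * w).symm (hi i) := by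
        rw [symm_simpleRefl_mul, symm_simpleRefl_mul, simpleRefl_lo, simpleRefl_hi]; exact h
      have h2 := T_mul_dahaT_of_up i h1
      rw [simpleRefl_cancel] at h2
      obtain ⟨r, hr, -⟩ := isOneUnit_v
      obtain ⟨t, ht, -⟩ := isOneUnit_v.inv
      rw [← h2, ← mul_assoc, Daha.T_sq, add_mul, one_mul, smul_mul_assoc, h2, ← ht, ← hr, ← map_sub, ← regular_smul]
      exact add_mem (Submodule.smul_mem _ (r - t) (Submodule.subset_span ⟨_, rfl⟩))
        (Submodule.subset_span ⟨_, rfl⟩)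
  | zero => rw [mul_zero]; exact zero_mem _
  | add a b _ _ ha hb => rw [mul_add]; exact add_mem ha hb
  | smul r a _ ha => rw [mul_smul_comm]; exact Submodule.smul_mem _ _ ha

theorem T_mul_mem_boundLattice (i : Fin (n - 1)) (m : ℕ) {a : Daha n}
    (ha : a ∈ boundLattice n m) : Daha.T i * a ∈ boundLattice n m := by
  rcases m with _ | m
  · exact T_mul_mem_heckeLattice i ha
  · induction ha using Submodule.mul_induction_on' with
    | mem_mul_mem a ha b hb =>
      rw [← mul_assoc]
      exact Submodule.mul_mem_mul (T_mul_mem_heckeLattice i ha) hb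
    | add a _ b _ ha hb => rw [mul_add]; exact add_mem ha hb

theorem wordVal_mem_boundLattice (l : List (Letter n)) :
    wordVal l ∈ boundLattice n ((wordWt l).1 + (wordWt l).2) := by
  induction l with
  | nil => exact one_mem_heckeLattice
  | cons a l ih =>
    have h1 : wordVal (a :: l) = a.val * wordVal l := by simp [wordVal]
    have h2 : wordWt (a :: l) = a.wt + wordWt l := by simp [wordWt]
    rw [h1, h2]
    have h3 : ∀ z ∈ Set.range Daha.X ∪ Set.range Daha.Y, z * wordVal l ∈
        boundLattice n ((wordWt l).1 + (wordWt l).2 + 1) := fun z hz => by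
      rw [← one_mul (z * _)]
      exact Submodule.mul_mem_mul one_mem_heckeLattice
        (Submodule.mul_mem_mul (Submodule.subset_span hz) ih)
    rcases a with i | j | j
    · simp only [Letter.wt, zero_add]
      exact T_mul_mem_boundLattice i _ ih
    · have h4 := h3 _ (Or.inl ⟨j, rfl⟩)
      have h5 : ((Letter.X j).wt + wordWt l).1 + ((Letter.X j).wt + wordWt l).2 =
        (wordWt l).1 + (wordWt l).2 + 1 := by simp [Letter.wt]; omega
      rw [h5]; exact h4
    · have h4 := h3 _ (Or.inr ⟨j, rfl⟩)
      have h5 : ((Letter.Y j).wt + wordWt l).1 + ((Letter.Y j).wt + wordWt l).2 =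
        (wordWt l).1 + (wordWt l).2 + 1 := by simp [Letter.wt]; omega
      rw [h5]; exact h4

theorem boundLattice_fg (n m : ℕ) : (boundLattice n m).FG := by
  have h : (heckeLattice n).FG := Submodule.fg_span (Set.finite_range _)
  induction m with
  | zero => exact h
  | succ m ih =>
    exact h.mul ((Submodule.fg_span ((Set.finite_range _).union (Set.finite_range _))).mul ih)

/-- The lattices are finitely generated, as submodules of finitely generated modules over a
noetherian ring. -/
theorem lattice_fg (n : ℕ) (d : ℕ × ℕ) : (lattice n d).FG := by
  have h1 : lattice n d ≤ boundLattice n (d.1 + d.2) := by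
    refine Submodule.span_le.mpr ?_
    rintro _ ⟨l, rfl, rfl⟩
    exact wordVal_mem_boundLattice l
  have := isNoetherian_of_fg_of_noetherian _ (boundLattice_fg n (d.1 + d.2))
  exact isNoetherian_submodule.mp this _ h1

end EllipticHall

namespace EllipticHall

open Equiv

variable {n : ℕ}

/-! ### The reduction is a crossed product -/

/-- The reduction, modulo the maximal ideal, of the positive part of the double affine Hecke
algebra. -/
abbrev DahaReduction (n : ℕ) : Type := Reduction (lattice n) vanishing

/-- The class of an element of the lattice of bidegree `d`. -/
noncomputable def sym (d : ℕ × ℕ) (a : Daha n) (ha : a ∈ lattice n d) : DahaReduction n :=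
  symb vanishing d a ha

theorem sym_mul {d e f : ℕ × ℕ} (h : d + e = f) {a b : Daha n} (ha : a ∈ lattice n d)
    (hb : b ∈ lattice n e) :
    sym d a ha * sym e b hb = sym f (a * b) (mul_mem_lattice h ha hb) := by
  subst h
  exact (symb_mul vanishing ha hb).symm

theorem sym_congr {d : ℕ × ℕ} {a b : Daha n} (h : a = b) (ha : a ∈ lattice n d) :
    sym d a ha = sym d b (h ▸ ha) := by
  subst h; rfl

theorem one_mem_lattice : (1 : Daha n) ∈ lattice n 0 := SetLike.one_mem_graded (lattice n)

theorem sym_one : sym 0 (1 : Daha n) one_mem_lattice = 1 := symb_one vanishing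

theorem sym_eq_iff {d : ℕ × ℕ} {a b : Daha n} (ha : a ∈ lattice n d) (hb : b ∈ lattice n d) :
    sym d a ha = sym d b hb ↔ a - b ∈ vanishing • lattice n d := symb_eq_iff vanishing ha hb

theorem sym_smul {c : K'} (hc : IsOneUnit c) {d : ℕ × ℕ} {a : Daha n} (ha : a ∈ lattice n d) :
    sym d (c • a) (hc.smul_mem ha) = sym d a ha := by
  rw [sym_eq_iff]
  have h := hc.sub_smul_mem isOneUnit_one ha
  rwa [sub_smul, one_smul] at h

/-- The scalars of the local ring are central in the reduction. -/
theorem commute_sym_smul {d : ℕ × ℕ} {a : Daha n} (ha : a ∈ lattice n d) (r : Regular)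
    {b : DahaReduction n} (h : Commute (sym d a ha) b) :
    Commute (sym d (r • a) (Submodule.smul_mem _ r ha)) b := by
  have h1 : sym d (r • a) (Submodule.smul_mem _ r ha) = r • sym d a ha := symb_smul vanishing ha r
  rw [h1]
  exact h.smul_left r

theorem sym_sum {α : Type*} {d : ℕ × ℕ} (s : Finset α) (f : α → Daha n)
    (hf : ∀ i, f i ∈ lattice n d) :
    sym d (∑ i ∈ s, f i) (Submodule.sum_mem _ fun i _ => hf i) = ∑ i ∈ s, sym d (f i) (hf i) :=
  symb_sum vanishing s f hf

/-- The class of `T_i`. -/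
noncomputable def redT (i : Fin (n - 1)) : DahaReduction n := sym 0 (Daha.T i) (T_mem_lattice i)

/-- The class of `X_j`. -/
noncomputable def redX (j : Fin n) : DahaReduction n := sym (1, 0) (Daha.X j) (X_mem_lattice j)

/-- The class of `Y_j`. -/
noncomputable def redY (j : Fin n) : DahaReduction n := sym (0, 1) (Daha.Y j) (Y_mem_lattice j)

/-- The class of the symmetrizer. -/
noncomputable def redS (n : ℕ) : DahaReduction n :=
  sym 0 (symmetrizer n) (symmetrizer_mem_lattice n)

theorem redT_mul_self (i : Fin (n - 1)) : redT i * redT i = 1 := by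
  rw [redT, sym_mul (zero_add 0), ← sym_one, sym_eq_iff, Daha.T_sq, add_sub_cancel_right]
  exact isOneUnit_v.sub_smul_mem isOneUnit_v.inv (T_mem_lattice i)

theorem sym_list_prod (L : List (Fin (n - 1))) :
    sym 0 (L.map Daha.T).prod (list_prod_T_mem_lattice L) = (L.map redT).prod := by
  induction L with
  | nil => exact sym_one
  | cons i L ih =>
    rw [List.map_cons (f := redT), List.prod_cons, ← ih, redT, sym_mul (zero_add 0)]
    exact sym_congr (by rw [List.map_cons, List.prod_cons]) _

theorem redS_commute {b : DahaReduction n} (h : ∀ i, Commute (redT i) b) :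
    Commute b (redS n) := by
  obtain ⟨r, c, hs⟩ := exists_symmetrizer_eq n
  have hsum : ∀ w, c w • (dahaT w : Daha n) ∈ lattice n 0 := fun w =>
    Submodule.smul_mem _ _ (dahaT_mem_lattice w)
  have h1 : redS n = sym 0 (r • ∑ w, c w • (dahaT w : Daha n))
      (Submodule.smul_mem _ _ (Submodule.sum_mem _ fun w _ => hsum w)) := sym_congr hs _
  rw [h1]
  refine (commute_sym_smul (Submodule.sum_mem _ fun w _ => hsum w) r ?_).symm
  rw [sym_sum _ _ hsum]
  refine Commute.sum_left _ _ _ fun w _ => commute_sym_smul (dahaT_mem_lattice w) _ ?_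
  have h2 : sym 0 (dahaT w : Daha n) (dahaT_mem_lattice w) =
      ((reducedWord w).map redT).prod := by rw [← sym_list_prod]; rfl
  rw [h2]
  generalize reducedWord w = L
  induction L with
  | nil => exact Commute.one_left b
  | cons i L ih =>
    rw [List.map_cons, List.prod_cons]
    exact (h i).mul_left ih

theorem redT_mul_redS (i : Fin (n - 1)) : redT i * redS n = redS n := by
  rw [redT, redS, sym_mul (zero_add 0)]
  exact (sym_congr (isEigen_T i).1 _).trans (sym_smul isOneUnit_v _)

theorem redS_mul_redT (i : Fin (n - 1)) : redS n * redT i = redS n := by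
  rw [redT, redS, sym_mul (zero_add 0)]
  exact (sym_congr (isEigen_T i).2 _).trans (sym_smul isOneUnit_v _)

theorem redS_mul_self : redS n * redS n = redS n := by
  rw [redS, sym_mul (zero_add 0)]
  exact sym_congr (symmetrizer_idem n).eq _

/-- The relation `T_i Z_j ≡ Z_{s_i(j)} T_i` for a family `Z` such as `X` or `Y`. -/
theorem sym_exchange {d : ℕ × ℕ} {u : ℕ → (Daha n)ˣ} (hu : ∀ j, j < n → (u j : Daha n) ∈ lattice n d)
    (hT : ∀ i j, i + 1 < n → j < n → j ≠ i → j ≠ i + 1 → Commute (unitT n i) (u j))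
    (h : ∀ i, i + 1 < n → unitT n i * u i * unitT n i = u (i + 1) ∨
      unitT n i * u (i + 1) * unitT n i = u i) (i : Fin (n - 1)) (j : Fin n) :
    redT i * sym d (u j) (hu j j.2) =
      sym d (u (simpleRefl i j)) (hu _ (simpleRefl i j).2) * redT i := by
  have hi : i.val + 1 < n := by omega
  have hval : ((simpleRefl i j : Fin n) : ℕ) =
    if j.val = i.val then i.val + 1 else if j.val = i.val + 1 then i.val else j.val :=
    simpleRefl_val i j
  have hTi : (unitT n i : Daha n) = Daha.T i := unitT_val i.2
  have hsmul : ∀ k, k < n → (v' - v'⁻¹) • (u k : Daha n) ∈ vanishing • lattice n d := fun k hk =>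
    isOneUnit_v.sub_smul_mem isOneUnit_v.inv (hu k hk)
  rw [redT, sym_mul (zero_add d), sym_mul (add_zero d), sym_eq_iff, ← hTi]
  split_ifs at hval with h1 h2
  · rw [hval, h1]
    rcases h i hi with h3 | h3
    · rw [(exchange_of hi h3).2, sub_sub_cancel_left]
      exact neg_mem (hsmul _ hi)
    · rw [(exchange_of hi h3).1, add_sub_cancel_left]
      exact hsmul _ (by omega)
  · rw [hval, h2]
    rcases h i hi with h3 | h3
    · rw [(exchange_of hi h3).1, add_sub_cancel_left]
      exact hsmul _ hi
    · rw [(exchange_of hi h3).2, sub_sub_cancel_left]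
      exact neg_mem (hsmul _ (by omega))
  · have h3 := congrArg Units.val (hT i j hi j.2 h1 h2).eq
    rw [Units.val_mul, Units.val_mul] at h3
    rw [hval, h3, sub_self]
    exact zero_mem _

theorem unitX_mem_lattice {j : ℕ} (hj : j < n) : (unitX n j : Daha n) ∈ lattice n (1, 0) := by
  rw [unitX_val hj]; exact X_mem_lattice _

theorem unitY_mem_lattice {j : ℕ} (hj : j < n) : (unitY n j : Daha n) ∈ lattice n (0, 1) := by
  rw [unitY_val hj]; exact Y_mem_lattice _

theorem redX_eq (j : Fin n) : redX j = sym (1, 0) (unitX n j : Daha n) (unitX_mem_lattice j.2) :=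
  sym_congr (unitX_val j.2).symm _

theorem redY_eq (j : Fin n) : redY j = sym (0, 1) (unitY n j : Daha n) (unitY_mem_lattice j.2) :=
  sym_congr (unitY_val j.2).symm _

theorem redT_mul_redX (i : Fin (n - 1)) (j : Fin n) :
    redT i * redX j = redX (simpleRefl i j) * redT i := by
  rw [redX_eq, redX_eq]
  exact sym_exchange (fun _ => unitX_mem_lattice) (fun _ _ => commute_unitT_unitX)
    (fun _ hi => Or.inl (unitX_succ hi).symm) i j

theorem redT_mul_redY (i : Fin (n - 1)) (j : Fin n) :
    redT i * redY j = redY (simpleRefl i j) * redT i := by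
  rw [redY_eq, redY_eq]
  exact sym_exchange (fun _ => unitY_mem_lattice) (fun _ _ => commute_unitT_unitY)
    (fun _ hi => Or.inr (by rw [unitY_succ hi]; group)) i j

theorem redX_commute (i j : Fin n) : Commute (redX i) (redX j) := by
  have h := congrArg Units.val (commute_unitX i.2 j.2).eq
  rw [Units.val_mul, Units.val_mul] at h
  rw [redX_eq, redX_eq, Commute, SemiconjBy, sym_mul rfl, sym_mul rfl]
  exact sym_congr h _

theorem redY_commute (i j : Fin n) : Commute (redY i) (redY j) := by
  have h := congrArg Units.val (commute_unitY i.2 j.2).eq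
  rw [Units.val_mul, Units.val_mul] at h
  rw [redY_eq, redY_eq, Commute, SemiconjBy, sym_mul rfl, sym_mul rfl]
  exact sym_congr h _

theorem unitT_mem_lattice (n i : ℕ) : (unitT n i : Daha n) ∈ lattice n 0 := by
  by_cases h : i < n - 1
  · rw [unitT_val h]; exact T_mem_lattice _
  · rw [unitT, dif_neg h]; exact one_mem_lattice

theorem sym_unitT_mul_self (n i : ℕ) :
    sym 0 (unitT n i : Daha n) (unitT_mem_lattice n i) * sym 0 (unitT n i) (unitT_mem_lattice n i) =
      1 := by
  by_cases h : i < n - 1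
  · have h1 := sym_congr (unitT_val h) (unitT_mem_lattice n i)
    rw [h1]; exact redT_mul_self _
  · have h1 : (unitT n i : Daha n) = 1 := by rw [unitT, dif_neg h]; rfl
    have h2 := sym_congr h1 (unitT_mem_lattice n i)
    rw [h2, sym_one, mul_one]

/-- The full twist `T_0 ⋯ T_{k-1} T_{k-1} ⋯ T_0` reduces to `1`. -/
theorem sym_upProd_mul_downProd (n k : ℕ) :
    ∃ h, sym 0 ((upProd (unitT n) k * downProd (unitT n) k : (Daha n)ˣ) : Daha n) h = 1 := by
  have hup : ∀ k, ∃ h, sym 0 ((upProd (unitT n) k : (Daha n)ˣ) : Daha n) h =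
      upProd (fun i => sym 0 (unitT n i : Daha n) (unitT_mem_lattice n i)) k := by
    intro k
    induction k with
    | zero => exact ⟨one_mem_lattice, sym_one⟩
    | succ k ih =>
      obtain ⟨h, ih⟩ := ih
      exact ⟨mul_mem_lattice (zero_add 0) h (unitT_mem_lattice n k), by
        refine Eq.trans ?_ (congrArg (· * sym 0 (unitT n k : Daha n) (unitT_mem_lattice n k)) ih)
        exact (sym_mul (zero_add 0) _ _).symm⟩
  have hdn : ∀ k, ∃ h, sym 0 ((downProd (unitT n) k : (Daha n)ˣ) : Daha n) h =
      downProd (fun i => sym 0 (unitT n i : Daha n) (unitT_mem_lattice n i)) k := by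
    intro k
    induction k with
    | zero => exact ⟨one_mem_lattice, sym_one⟩
    | succ k ih =>
      obtain ⟨h, ih⟩ := ih
      exact ⟨mul_mem_lattice (zero_add 0) (unitT_mem_lattice n k) h, by
        refine Eq.trans ?_ (congrArg (sym 0 (unitT n k : Daha n) (unitT_mem_lattice n k) * ·) ih)
        exact (sym_mul (zero_add 0) _ _).symm⟩
  obtain ⟨h1, e1⟩ := hup k
  obtain ⟨h2, e2⟩ := hdn k
  refine ⟨mul_mem_lattice (zero_add 0) h1 h2, ?_⟩
  have h3 := sym_mul (zero_add 0) h1 h2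
  refine h3.symm.trans ?_
  rw [e1, e2]
  clear h1 e1 h2 e2 h3
  induction k with
  | zero => rw [upProd, downProd, mul_one]
  | succ k ih =>
    rw [upProd, downProd, mul_assoc, ← mul_assoc (sym 0 _ _) (sym 0 _ _), sym_unitT_mul_self,
      one_mul, ih]

theorem unitT_inv_mem_lattice (n i : ℕ) :
    (((unitT n i)⁻¹ : (Daha n)ˣ) : Daha n) ∈ lattice n 0 := by
  by_cases h : i + 1 < n
  · rw [unitT_inv_eq h, Algebra.algebraMap_eq_smul_one, sub_smul]
    exact sub_mem (unitT_mem_lattice n i) (sub_mem (isOneUnit_v.smul_mem one_mem_lattice)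
      (isOneUnit_v.inv.smul_mem one_mem_lattice))
  · rw [unitT, dif_neg (by omega)]; exact one_mem_lattice

theorem sym_unitT_inv (i : Fin (n - 1)) :
    sym 0 (((unitT n i)⁻¹ : (Daha n)ˣ) : Daha n) (unitT_inv_mem_lattice n i) = redT i := by
  rw [redT, sym_eq_iff, unitT_inv_eq (by omega), unitT_val i.2, sub_sub_cancel_left,
    Algebra.algebraMap_eq_smul_one]
  exact neg_mem (isOneUnit_v.sub_smul_mem isOneUnit_v.inv one_mem_lattice)

theorem redX_hi (i : Fin (n - 1)) : redX (hi i) = redT i * redX (lo i) * redT i := by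
  rw [redT_mul_redX, simpleRefl_lo, mul_assoc, redT_mul_self, mul_one]

theorem redY_hi (i : Fin (n - 1)) : redY (hi i) = redT i * redY (lo i) * redT i := by
  rw [redT_mul_redY, simpleRefl_lo, mul_assoc, redT_mul_self, mul_one]

theorem redX_zero_commute_redY_zero (hn : 0 < n) :
    Commute (redX (⟨0, hn⟩ : Fin n)) (redY ⟨0, hn⟩) := by
  have h1 := congrArg Units.val (daha_isElliptic hn).loop
  rw [Units.val_mul, Units.val_mul, Units.val_mul, Units.val_mul, qUnit_val, ← Algebra.smul_def,
    smul_mul_assoc, smul_mul_assoc, mul_assoc] at h1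
  obtain ⟨hL, h2⟩ := sym_upProd_mul_downProd n (n - 1)
  have hx := unitX_mem_lattice (n := n) hn
  have hy := unitY_mem_lattice (n := n) hn
  rw [redX_eq, redY_eq, Commute, SemiconjBy, sym_mul (f := (1, 1)) rfl,
    sym_mul (d := (0, 1)) (f := (1, 1)) rfl]
  have h3 := sym_mul (zero_add ((1, 1) : ℕ × ℕ)) hL
    (mul_mem_lattice (f := (1, 1)) rfl hx hy)
  rw [h2, one_mul] at h3
  have h4 := sym_smul isOneUnit_q (mul_mem_lattice (zero_add ((1, 1) : ℕ × ℕ)) hL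
    (mul_mem_lattice (f := (1, 1)) rfl hx hy))
  exact h3.trans (h4.symm.trans (sym_congr h1.symm _))

theorem redX_one_commute_redY_zero (i : Fin (n - 1)) (h : i.val = 0) :
    Commute (redX (hi i)) (redY (lo i)) := by
  have hn : 0 < n := by omega
  have h1 := congrArg Units.val ((daha_isElliptic hn).mixed (by omega))
  have hx := unitX_mem_lattice (n := n) hn
  have hy := unitY_mem_lattice (n := n) hn
  have hT := unitT_mem_lattice n 0
  have hT' := unitT_inv_mem_lattice n 0
  have e1 : sym 0 (unitT n 0 : Daha n) hT = redT i := by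
    have : (unitT n 0 : Daha n) = Daha.T i := by
      rw [unitT_val (by omega)]; congr 1; exact Fin.ext h.symm
    exact sym_congr this _
  have e2 : sym 0 _ hT' = redT i := by
    rw [← sym_unitT_inv]
    exact sym_congr (by rw [h]) _
  have e3 : sym (1, 0) _ hx = redX (lo i) := by
    rw [redX_eq]; exact sym_congr (by simp [lo, h]) _
  have e4 : sym (0, 1) _ hy = redY (lo i) := by
    rw [redY_eq]; exact sym_congr (by simp [lo, h]) _
  have h2 : redT i * redX (lo i) * redT i * redY (lo i) =
      redY (lo i) * redT i * redX (lo i) * redT i := by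
    rw [← e3, ← e4]
    nth_rewrite 2 [← e2]
    rw [← e1, sym_mul (f := (1, 0)) rfl, sym_mul (f := (1, 0)) rfl, sym_mul (f := (1, 1)) rfl,
      sym_mul (f := (0, 1)) rfl, sym_mul (f := (1, 1)) rfl, sym_mul (f := (1, 1)) rfl]
    exact sym_congr h1 _
  rw [redX_hi, Commute, SemiconjBy, h2]
  simp only [mul_assoc]

theorem redX_commute_redY (i j : Fin n) : Commute (redX i) (redY j) := by
  have key : ∀ (k : ℕ) (hk : k < n), Commute (redX ⟨k, hk⟩) (redY (⟨0, by omega⟩ : Fin n)) := by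
    intro k
    induction k with
    | zero => exact fun hk => redX_zero_commute_redY_zero hk
    | succ k ih =>
      intro hk
      rcases k with _ | k
      · exact redX_one_commute_redY_zero ⟨0, by omega⟩ rfl
      · have h1 := redX_hi (⟨k + 1, by omega⟩ : Fin (n - 1))
        have h2 : Commute (redT (⟨k + 1, by omega⟩ : Fin (n - 1)))
            (redY (⟨0, by omega⟩ : Fin n)) := by
          rw [Commute, SemiconjBy, redT_mul_redY, simpleRefl_fix _ _ (by simp) (by simp)]
        change Commute (redX (hi ⟨k + 1, by omega⟩)) _
        rw [h1]
        exact (h2.mul_left (ih (by omega))).mul_left h2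
  obtain ⟨j, hj⟩ := j
  induction j generalizing i with
  | zero => exact key i i.2
  | succ j ih =>
    have h1 := redY_hi (⟨j, by omega⟩ : Fin (n - 1))
    set t := redT (⟨j, by omega⟩ : Fin (n - 1))
    set σ := simpleRefl (⟨j, by omega⟩ : Fin (n - 1))
    change Commute _ (redY (hi ⟨j, by omega⟩))
    rw [h1]
    have h2 : redX i * t = t * redX (σ i) := by
      have hσ : σ (σ i) = i := by
        simpa using congrArg (fun f : Perm (Fin n) => f i) (simpleRefl_mul_self _)
      rw [redT_mul_redX, hσ]
    have h3 : redX (σ i) * t = t * redX i := by rw [redT_mul_redX]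
    have h4 : redX (σ i) * redY (lo ⟨j, by omega⟩) = redY (lo ⟨j, by omega⟩) * redX (σ i) :=
      (ih (σ i) (by omega)).eq
    calc redX i * (t * redY (lo ⟨j, by omega⟩) * t)
        = (redX i * t) * redY (lo ⟨j, by omega⟩) * t := by simp only [mul_assoc]
      _ = t * (redX (σ i) * redY (lo ⟨j, by omega⟩)) * t := by rw [h2]; simp only [mul_assoc]
      _ = t * redY (lo ⟨j, by omega⟩) * (redX (σ i) * t) := by rw [h4]; simp only [mul_assoc]
      _ = _ := by rw [h3]; simp only [mul_assoc]

theorem isCrossed (n : ℕ) : IsCrossed n redT redX redY (redS n) where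
  t_sq := redT_mul_self
  t_x := redT_mul_redX
  t_y := redT_mul_redY
  comm_x := redX_commute
  comm_y := redY_commute
  comm_xy := redX_commute_redY
  t_s := redT_mul_redS
  s_t := redS_mul_redT
  s_s := redS_mul_self
  comm_s _ h := redS_commute h

theorem totalDeg_mulSingle_mul (j : Fin n) (d : Multiplicative (ℕ × ℕ))
    (c : Fin n → Multiplicative (ℕ × ℕ)) :
    IsCrossed.totalDeg (Pi.mulSingle j d * c) = d.toAdd + IsCrossed.totalDeg c := by
  rw [IsCrossed.totalDeg_mul, IsCrossed.totalDeg_mulSingle]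

/-- In the reduction, a word is a monomial times a permutation. -/
theorem exists_sym_wordVal (l : List (Letter n)) :
    ∃ (c : Fin n → Multiplicative (ℕ × ℕ)) (τ : DahaReduction n), IsCrossed.totalDeg c = wordWt l ∧
      τ * redS n = redS n ∧
      sym (wordWt l) (wordVal l) (wordVal_mem l) = (isCrossed n).monomial c * τ := by
  induction l with
  | nil =>
    refine ⟨1, 1, by simp [IsCrossed.totalDeg, wordWt], one_mul _, ?_⟩
    rw [map_one, mul_one]
    exact sym_one
  | cons a l ih =>
    obtain ⟨c, τ, hc, hτ, h⟩ := ih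
    rcases a with i | j | j
    · refine ⟨c ∘ simpleRefl i, redT i * τ, ?_, by rw [mul_assoc, hτ, redT_mul_redS], ?_⟩
      · have h1 : wordWt (Letter.T i :: l) = wordWt l := by simp [wordWt, Letter.wt]
        rw [h1, ← hc]
        exact Equiv.sum_comp (simpleRefl i) fun j => (c j).toAdd
      · rw [← mul_assoc, ← (isCrossed n).t_monomial, mul_assoc, ← h, redT, sym_mul rfl]
        rfl
    · refine ⟨Pi.mulSingle j (Multiplicative.ofAdd (1, 0)) * c, τ, ?_, hτ, ?_⟩
      · rw [totalDeg_mulSingle_mul, hc]; simp [wordWt, Letter.wt]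
      · rw [map_mul, (isCrossed n).monomial_mulSingle, mul_assoc, ← h, IsCrossed.site_apply]
        simp only [toAdd_ofAdd, pow_one, pow_zero, mul_one]
        rw [redX, sym_mul rfl]
        rfl
    · refine ⟨Pi.mulSingle j (Multiplicative.ofAdd (0, 1)) * c, τ, ?_, hτ, ?_⟩
      · rw [totalDeg_mulSingle_mul, hc]; simp [wordWt, Letter.wt]
      · rw [map_mul, (isCrossed n).monomial_mulSingle, mul_assoc, ← h, IsCrossed.site_apply]
        simp only [toAdd_ofAdd, pow_one, pow_zero, one_mul]
        rw [redY, sym_mul rfl]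
        rfl

end EllipticHall

namespace EllipticHall

open Equiv

variable {n : ℕ}

/-! ### Power sums and the positive quadrant -/

/-- `a` lies in the lattice of bidegree `d`, and has the class `z`. -/
def HasSym (d : ℕ × ℕ) (a : Daha n) (z : DahaReduction n) : Prop := ∃ h, sym d a h = z

namespace HasSym

variable {d e f : ℕ × ℕ} {a b : Daha n} {z w : DahaReduction n}

theorem mul (ha : HasSym d a z) (hb : HasSym e b w) (h : d + e = f) : HasSym f (a * b) (z * w) := by
  obtain ⟨ha, rfl⟩ := ha
  obtain ⟨hb, rfl⟩ := hb
  exact ⟨_, (sym_mul h ha hb).symm⟩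

theorem one : HasSym 0 (1 : Daha n) 1 := ⟨_, sym_one⟩

theorem pow (ha : HasSym d a z) (k : ℕ) : HasSym (k • d) (a ^ k) (z ^ k) := by
  induction k with
  | zero => rw [zero_smul, pow_zero, pow_zero]; exact one
  | succ k ih => rw [pow_succ, pow_succ]; exact ih.mul ha (succ_nsmul d k).symm

theorem add (ha : HasSym d a z) (hb : HasSym d b w) : HasSym d (a + b) (z + w) := by
  obtain ⟨ha, rfl⟩ := ha
  obtain ⟨hb, rfl⟩ := hb
  exact ⟨add_mem ha hb, symb_add vanishing ha hb⟩

theorem neg (ha : HasSym d a z) : HasSym d (-a) (-z) := by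
  obtain ⟨ha, rfl⟩ := ha
  exact ⟨neg_mem ha, symb_neg vanishing ha⟩

theorem zero (d : ℕ × ℕ) : HasSym d (0 : Daha n) 0 := ⟨zero_mem _, symb_zero vanishing d⟩

theorem sum {α : Type*} {s : Finset α} {f : α → Daha n} {g : α → DahaReduction n}
    (h : ∀ i, HasSym d (f i) (g i)) : HasSym d (∑ i ∈ s, f i) (∑ i ∈ s, g i) := by
  classical
  induction s using Finset.induction_on with
  | empty => exact zero d
  | insert i s hi ih => rw [Finset.sum_insert hi, Finset.sum_insert hi]; exact (h i).add ih

theorem smul (ha : HasSym d a z) (r : Regular) : HasSym d (r • a) (r • z) := by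
  obtain ⟨ha, rfl⟩ := ha
  exact ⟨Submodule.smul_mem _ r ha, symb_smul vanishing ha r⟩

theorem smul_oneUnit (ha : HasSym d a z) {c : K'} (hc : IsOneUnit c) : HasSym d (c • a) z := by
  obtain ⟨ha, rfl⟩ := ha
  exact ⟨_, sym_smul hc ha⟩

theorem sub_mem (ha : HasSym d a z) (hb : HasSym d b z) : a - b ∈ vanishing • lattice n d := by
  obtain ⟨ha, rfl⟩ := ha
  obtain ⟨hb, h⟩ := hb
  exact (sym_eq_iff ha hb).mp h.symm

theorem of_sub_mem (hb : HasSym d b z) (h : a - b ∈ vanishing • lattice n d) : HasSym d a z := by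
  obtain ⟨hb, rfl⟩ := hb
  have ha : a ∈ lattice n d := by
    have := add_mem (Submodule.smul_le_right h) hb
    rwa [sub_add_cancel] at this
  exact ⟨ha, (sym_eq_iff ha hb).mpr h⟩

end HasSym

theorem hasSym_T (i : Fin (n - 1)) : HasSym 0 (Daha.T i) (redT i) := ⟨_, rfl⟩

theorem hasSym_X (j : Fin n) : HasSym (1, 0) (Daha.X j) (redX j) := ⟨_, rfl⟩

theorem hasSym_Y (j : Fin n) : HasSym (0, 1) (Daha.Y j) (redY j) := ⟨_, rfl⟩

theorem hasSym_symmetrizer (n : ℕ) : HasSym 0 (symmetrizer n) (redS n) := ⟨_, rfl⟩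

theorem HasSym.conj {d : ℕ × ℕ} {a : Daha n} {z : DahaReduction n} (ha : HasSym d a z) :
    HasSym d (symmetrizer n * a * symmetrizer n) (redS n * z * redS n) :=
  ((hasSym_symmetrizer n).mul ha (zero_add d)).mul (hasSym_symmetrizer n) (add_zero d)

/-- If an automorphism fixes the `T_i` and maps the lattices into each other, then it is
compatible with classes modulo the maximal ideal. -/
theorem hasSym_aut (r : Daha n ≃ₐ[K'] Daha n) (φ : ℕ × ℕ →+ ℕ × ℕ)
    (hT : ∀ i, r (Daha.T i) = Daha.T i) {z w : Fin n → DahaReduction n}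
    (hX : ∀ j, HasSym (φ (1, 0)) (r (Daha.X j)) (z j))
    (hY : ∀ j, HasSym (φ (0, 1)) (r (Daha.Y j)) (w j)) {a b : ℕ} {u : Daha n}
    (hu : HasSym (a, b) u (redS n * (∑ j, redX j ^ a * redY j ^ b) * redS n)) :
    HasSym (φ (a, b)) (r u) (redS n * (∑ j, z j ^ a * w j ^ b) * redS n) := by
  have hword : ∀ l : List (Letter n), r (wordVal l) ∈ lattice n (φ (wordWt l)) := by
    intro l
    induction l with
    | nil =>
      rw [show wordVal ([] : List (Letter n)) = 1 from rfl, map_one,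
        show wordWt ([] : List (Letter n)) = 0 from rfl, map_zero]
      exact one_mem_lattice
    | cons c l ih =>
      have h1 : wordVal (c :: l) = c.val * wordVal l := by simp [wordVal]
      have h2 : wordWt (c :: l) = c.wt + wordWt l := by simp [wordWt]
      rw [h1, h2, map_mul, map_add]
      refine mul_mem_lattice rfl ?_ ih
      rcases c with i | j | j
      · simp only [Letter.val, Letter.wt, map_zero, hT]
        exact T_mem_lattice i
      · exact (hX j).choose
      · exact (hY j).choose
  have hsmul : ∀ (t : Regular) (x : Daha n), r (t • x) = t • r x := fun t x => by
    rw [regular_smul, map_smul, ← regular_smul]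
  have hlat : ∀ {d : ℕ × ℕ} {x : Daha n}, x ∈ lattice n d → r x ∈ lattice n (φ d) := by
    intro d x hx
    induction hx using Submodule.span_induction with
    | mem x hx => obtain ⟨l, rfl, rfl⟩ := hx; exact hword l
    | zero => rw [map_zero]; exact zero_mem _
    | add x y _ _ hx hy => rw [map_add]; exact add_mem hx hy
    | smul t x _ hx => rw [hsmul]; exact Submodule.smul_mem _ t hx
  have hideal : ∀ {d : ℕ × ℕ} {x : Daha n}, x ∈ vanishing • lattice n d →
      r x ∈ vanishing • lattice n (φ d) := by
    intro d x hx
    induction hx using Submodule.smul_induction_on' with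
    | smul t ht x hx => rw [hsmul]; exact Submodule.smul_mem_smul ht (hlat hx)
    | add x _ y _ hx hy => rw [map_add]; exact add_mem hx hy
  have hmodel : HasSym (a, b)
      (symmetrizer n * (∑ j, Daha.X j ^ a * Daha.Y j ^ b) * symmetrizer n)
      (redS n * (∑ j, redX j ^ a * redY j ^ b) * redS n) :=
    HasSym.conj (HasSym.sum fun j => ((hasSym_X j).pow a).mul ((hasSym_Y j).pow b) (by simp))
  have himage : HasSym (φ (a, b))
      (r (symmetrizer n * (∑ j, Daha.X j ^ a * Daha.Y j ^ b) * symmetrizer n))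
      (redS n * (∑ j, z j ^ a * w j ^ b) * redS n) := by
    rw [map_mul, map_mul, map_symmetrizer r hT, map_sum]
    simp only [map_mul, map_pow]
    refine HasSym.conj (HasSym.sum fun j => ((hX j).pow a).mul ((hY j).pow b) ?_)
    rw [← map_nsmul, ← map_nsmul, ← map_add]
    simp
  refine himage.of_sub_mem ?_
  rw [← map_sub]
  exact hideal (hu.sub_mem hmodel)

theorem unitAct_T_val (r : Daha n ≃ₐ[K'] Daha n) (hT : ∀ i, unitAct r (unitT n i) = unitT n i)
    (i : Fin (n - 1)) : r (Daha.T i) = Daha.T i := by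
  have := congrArg Units.val (hT i)
  rwa [unitAct_val, unitT_val i.2] at this

theorem redT_conj (i : Fin (n - 1)) :
    redT i * (redX (lo i) * redY (lo i)) * redT i = redX (hi i) * redY (hi i) := by
  have h3 := redT_mul_self i
  rw [redX_hi, redY_hi]
  calc _ = redT i * redX (lo i) * (redT i * redT i) * redY (lo i) * redT i := by
        rw [h3, mul_one]; simp only [mul_assoc]
    _ = _ := by simp only [mul_assoc]

theorem hasSym_rho1_X (hn : 0 < n) (j : Fin n) :
    HasSym (1, 1) (rho1 hn (Daha.X j)) (redX j * redY j) := by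
  obtain ⟨j, hj⟩ := j
  induction j with
  | zero =>
    have h := congrArg Units.val (rho1_X hn)
    rw [unitAct_val, Units.val_mul, unitX_val hn, unitY_val hn] at h
    rw [h]
    exact (hasSym_X _).mul (hasSym_Y _) rfl
  | succ j ih =>
    have hX : (Daha.X ⟨j + 1, hj⟩ : Daha n) =
        Daha.T ⟨j, by omega⟩ * Daha.X ⟨j, by omega⟩ * Daha.T ⟨j, by omega⟩ := by
      have := congrArg Units.val (unitX_succ hj)
      rwa [Units.val_mul, Units.val_mul, unitX_val hj, unitX_val (by omega),
        unitT_val (by omega : j < n - 1)] at this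
    rw [hX, map_mul, map_mul, unitAct_T_val _ (rho1_T hn)]
    have h1 := ((hasSym_T (⟨j, by omega⟩ : Fin (n - 1))).mul (ih (by omega)) (zero_add _)).mul
      (hasSym_T ⟨j, by omega⟩) (add_zero _)
    change HasSym (1, 1) _ (redT ⟨j, by omega⟩ * (redX (lo ⟨j, by omega⟩) *
      redY (lo ⟨j, by omega⟩)) * redT ⟨j, by omega⟩) at h1
    rw [redT_conj] at h1
    exact h1

theorem hasSym_rho2_Y (hn : 0 < n) (j : Fin n) :
    HasSym (1, 1) (rho2 hn (Daha.Y j)) (redX j * redY j) := by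
  obtain ⟨j, hj⟩ := j
  induction j with
  | zero =>
    have h := congrArg Units.val (rho2_Y hn)
    rw [unitAct_val, Units.val_mul, unitX_val hn, unitY_val hn] at h
    rw [h, (redX_commute_redY _ _).eq]
    exact (hasSym_Y _).mul (hasSym_X _) rfl
  | succ j ih =>
    have hY := congrArg (fun u => (unitAct (rho2 hn) u : Daha n)) (unitY_succ hj)
    simp only [map_mul, map_inv, rho2_T, Units.val_mul] at hY
    rw [unitAct_val, unitAct_val, unitY_val hj, unitY_val (by omega)] at hY
    have hT : HasSym 0 (((unitT n j)⁻¹ : (Daha n)ˣ) : Daha n) (redT ⟨j, by omega⟩) :=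
      ⟨_, sym_unitT_inv (⟨j, by omega⟩ : Fin (n - 1))⟩
    rw [hY]
    have h1 := (hT.mul (ih (by omega)) (zero_add _)).mul hT (add_zero _)
    change HasSym (1, 1) _ (redT ⟨j, by omega⟩ * (redX (lo ⟨j, by omega⟩) *
      redY (lo ⟨j, by omega⟩)) * redT ⟨j, by omega⟩) at h1
    rw [redT_conj] at h1
    exact h1

variable {ρ : SL2Z →* (Spherical n ≃ₐ[K'] Spherical n)} {P : LatticeStar → Spherical n}

theorem IsOneUnit.pow {c : K'} (hc : IsOneUnit c) (k : ℕ) : IsOneUnit (c ^ k) := by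
  induction k with
  | zero => rw [pow_zero]; exact isOneUnit_one
  | succ k ih => rw [pow_succ]; exact ih.mul hc

/-- The elements `P_{a,b}` of the positive quadrant reduce to power sums. They are obtained
from the `P_{0,e}` and `P_{e,0}` by products of the matrices `A₁` and `A₂`, as in Euclid's
algorithm. -/
theorem IsPowerSumFamily.hasSym_quadrant (hn : 0 < n) (h : IsCherednikAction n ρ)
    (hP : IsPowerSumFamily ρ P) (a b : ℕ) (x : LatticeStar) (hx : x.1 = ![(a : ℤ), (b : ℤ)]) :
    HasSym (a, b) (P x).val (redS n * (∑ j, redX j ^ a * redY j ^ b) * redS n) := by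
  induction hm : a + b using Nat.strong_induction_on generalizing a b x with
  | _ m ih =>
  rcases Nat.eq_zero_or_pos a with rfl | ha
  · have hb : 0 < b := Nat.pos_of_ne_zero fun hb => x.2 (by rw [hx, hb]; ext i; fin_cases i <;> rfl)
    have h1 : x = EllipticHall.vertical b hb := Subtype.ext hx
    rw [h1, hP.vertical, sandwich_val, psum, Finset.sum_range]
    refine HasSym.conj (HasSym.sum fun j => ?_)
    rw [unitY_val j.2, pow_zero, one_mul]
    have h2 := (hasSym_Y j).pow b
    simpa using h2
  rcases Nat.eq_zero_or_pos b with rfl | hb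
  · have h1 : x = rotSL • rotSL • rotSL • EllipticHall.vertical a ha := by
      apply Subtype.ext
      rw [rotSL_smul, rotSL_smul, rotSL_smul, hx, coe_vertical]
      simp
    rw [h1, hP.rot_cube_vertical hn h, Spherical.val_smul, sandwich_val, psum, Finset.sum_range]
    refine (HasSym.conj (HasSym.sum fun j => ?_)).smul_oneUnit (isOneUnit_q.pow a)
    rw [unitX_val j.2, pow_zero, mul_one]
    have h2 := (hasSym_X j).pow a
    simpa using h2
  rcases Nat.le_total a b with hab | hab
  · have hx' : ![(a : ℤ), ((b - a : ℕ) : ℤ)] ≠ 0 := fun h0 => by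
      have := congrFun h0 0
      simp at this
      omega
    have h1 : x = A1 • (⟨_, hx'⟩ : LatticeStar) := by
      apply Subtype.ext
      rw [hx, coe_smul]
      apply lattice_ext
      · rw [smul_apply_zero]; simp [A1]
      · rw [smul_apply_one]; simp [A1]; omega
    have h2 := ih (a + (b - a)) (by omega) a (b - a) ⟨_, hx'⟩ rfl rfl
    have h3 := hasSym_aut (rho1 hn)
      ((AddMonoidHom.fst ℕ ℕ).prod (AddMonoidHom.fst ℕ ℕ + AddMonoidHom.snd ℕ ℕ))
      (unitAct_T_val _ (rho1_T hn)) (z := fun j => redX j * redY j) (w := redY)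
      (fun j => hasSym_rho1_X hn j)
      (fun j => by rw [(rho1_isRho1 hn).2.2]; exact hasSym_Y j) h2
    rw [h1, hP.smul, h.A1_val hn]
    have h4 : ∀ j : Fin n, (redX j * redY j) ^ a * redY j ^ (b - a) = redX j ^ a * redY j ^ b :=
      fun j => by
        rw [(redX_commute_redY j j).mul_pow, mul_assoc, ← pow_add, Nat.add_sub_cancel' hab]
    simp only [h4] at h3
    have h5 : a + (b - a) = b := by omega
    simpa [h5] using h3
  · have hx' : ![((a - b : ℕ) : ℤ), (b : ℤ)] ≠ 0 := fun h0 => by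
      have := congrFun h0 1
      simp at this
      omega
    have h1 : x = A2 • (⟨_, hx'⟩ : LatticeStar) := by
      apply Subtype.ext
      rw [hx, coe_smul]
      apply lattice_ext
      · rw [smul_apply_zero]; simp [A2]; omega
      · rw [smul_apply_one]; simp [A2]
    have h2 := ih (a - b + b) (by omega) (a - b) b ⟨_, hx'⟩ rfl rfl
    have h3 := hasSym_aut (rho2 hn)
      ((AddMonoidHom.fst ℕ ℕ + AddMonoidHom.snd ℕ ℕ).prod (AddMonoidHom.snd ℕ ℕ))
      (unitAct_T_val _ (rho2_T hn)) (z := redX) (w := fun j => redX j * redY j)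
      (fun j => by rw [(rho2_isRho2 hn).2.2]; exact hasSym_X j)
      (fun j => hasSym_rho2_Y hn j) h2
    rw [h1, hP.smul, h.A2_val hn]
    have h4 : ∀ j : Fin n, redX j ^ (a - b) * (redX j * redY j) ^ b = redX j ^ a * redY j ^ b :=
      fun j => by
        rw [(redX_commute_redY j j).mul_pow, ← mul_assoc, ← pow_add, Nat.sub_add_cancel hab]
    simp only [h4] at h3
    have h5 : a - b + b = a := by omega
    simpa [h5] using h3

/-! ### Generation of the positive part -/

/-- The group of classes of bidegree `d` of elements of a subalgebra `N`. -/
def classesOf (N : Subalgebra K' (Spherical n)) (d : ℕ × ℕ) : AddSubgroup (DahaReduction n) where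
  carrier := {z | ∃ p ∈ N, HasSym d p.val z}
  zero_mem' := ⟨0, zero_mem _, HasSym.zero d⟩
  add_mem' := by
    rintro z w ⟨p, hp, hz⟩ ⟨q, hq, hw⟩
    exact ⟨p + q, add_mem hp hq, hz.add hw⟩
  neg_mem' := by
    rintro z ⟨p, hp, hz⟩
    exact ⟨-p, neg_mem hp, hz.neg⟩

theorem classesOf_smul {N : Subalgebra K' (Spherical n)} {d : ℕ × ℕ} {z : DahaReduction n}
    (hz : z ∈ classesOf N d) (r : Regular) : r • z ∈ classesOf N d := by
  obtain ⟨p, hp, hz⟩ := hz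
  refine ⟨r • p, ?_, hz.smul r⟩
  rw [regular_smul_spherical]
  exact N.smul_mem hp _

theorem symmetrized_monomial_mem (hn : 0 < n) (h : IsCherednikAction n ρ)
    (hP : IsPowerSumFamily ρ P) (c : Fin n → Multiplicative (ℕ × ℕ)) :
    redS n * (isCrossed n).monomial c * redS n ∈
      classesOf (Algebra.adjoin K' (Set.range P)) (IsCrossed.totalDeg c) := by
  refine (isCrossed n).symmetrized_mem ?_ ?_ ?_ ?_ c
  · exact ⟨1, one_mem _, hasSym_symmetrizer n⟩
  · rintro d e z w ⟨p, hp, hz⟩ ⟨q, hq, hw⟩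
    exact ⟨p * q, mul_mem hp hq, hz.mul hw rfl⟩
  · intro k d z hk hz
    obtain ⟨u, hu⟩ := isUnit_natCast hk
    have h1 := classesOf_smul hz ((u⁻¹ : Regularˣ) : Regular)
    rwa [← Nat.cast_smul_eq_nsmul Regular, smul_smul, ← hu, Units.inv_mul, one_smul] at h1
  · intro d hd
    have hx : ![((d.toAdd.1 : ℕ) : ℤ), ((d.toAdd.2 : ℕ) : ℤ)] ≠ 0 := fun h0 => hd (by
      have h1 := congrFun h0 0
      have h2 := congrFun h0 1
      simp only [Matrix.cons_val_zero, Matrix.cons_val_one, Pi.zero_apply, Nat.cast_eq_zero] at h1 h2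
      exact Multiplicative.toAdd.injective (Prod.ext h1 h2))
    exact ⟨P ⟨_, hx⟩, Algebra.subset_adjoin ⟨_, rfl⟩,
      hP.hasSym_quadrant hn h d.toAdd.1 d.toAdd.2 ⟨_, hx⟩ rfl⟩

/-- Every element of the lattice is congruent to a combination of products of monomials with
permutations, the latter being absorbed by the symmetrizer. -/
theorem symmetrized_sym_mem (hn : 0 < n) (h : IsCherednikAction n ρ)
    (hP : IsPowerSumFamily ρ P) {d : ℕ × ℕ} {a : Daha n} (ha : a ∈ lattice n d) :
    ∃ z, HasSym d a z ∧ redS n * z * redS n ∈ classesOf (Algebra.adjoin K' (Set.range P)) d := by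
  induction ha using Submodule.span_induction with
  | mem a ha =>
    obtain ⟨l, rfl, rfl⟩ := ha
    obtain ⟨c, τ, hc, hτ, h1⟩ := exists_sym_wordVal l
    refine ⟨_, ⟨_, h1⟩, ?_⟩
    rw [← hc, mul_assoc, mul_assoc, hτ, ← mul_assoc]
    exact symmetrized_monomial_mem hn h hP c
  | zero => exact ⟨0, HasSym.zero d, by rw [mul_zero, zero_mul]; exact zero_mem _⟩
  | add a b _ _ ha hb =>
    obtain ⟨z, hz, hz'⟩ := ha
    obtain ⟨w, hw, hw'⟩ := hb
    exact ⟨z + w, hz.add hw, by rw [mul_add, add_mul]; exact add_mem hz' hw'⟩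
  | smul r a _ ha =>
    obtain ⟨z, hz, hz'⟩ := ha
    exact ⟨r • z, hz.smul r, by
      rw [mul_smul_comm, smul_mul_assoc]; exact classesOf_smul hz' r⟩

/-- The map `a ↦ S a S`, over the local ring. -/
noncomputable def sandwichHom (n : ℕ) : Daha n →ₗ[Regular] Spherical n where
  toFun := sandwich
  map_add' := sandwich_add
  map_smul' r a := by
    rw [RingHom.id_apply, regular_smul, sandwich_smul, regular_smul_spherical]

theorem sandwich_sandwich (a : Daha n) : sandwich (symmetrizer n * a * symmetrizer n) = sandwich a :=
  Spherical.ext (by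
    rw [sandwich_val, sandwich_val, mul_assoc, mul_assoc, (symmetrizer_idem n).eq, ← mul_assoc,
      ← mul_assoc, (symmetrizer_idem n).eq, mul_assoc])

theorem sandwich_coe (p : Spherical n) : sandwich p.val = p :=
  Spherical.ext (by rw [sandwich_val, p.symm_mul_val, p.val_mul_symm])

/-- The symmetrized positive words are polynomials in the `P_x`: this holds modulo the maximal
ideal of the local ring, and thus, by Nakayama's lemma, over the local ring. -/
theorem sandwich_mem_of_mem_lattice (hn : 0 < n) (h : IsCherednikAction n ρ)
    (hP : IsPowerSumFamily ρ P) {d : ℕ × ℕ} {a : Daha n} (ha : a ∈ lattice n d) :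
    sandwich a ∈ Algebra.adjoin K' (Set.range P) := by
  let N : Submodule Regular (Spherical n) :=
    { carrier := Algebra.adjoin K' (Set.range P)
      add_mem' := add_mem
      zero_mem' := zero_mem _
      smul_mem' := fun r p hp => by
        rw [regular_smul_spherical]; exact Subalgebra.smul_mem _ hp _ }
  let M := (lattice n d).map (sandwichHom n)
  have hle : M ≤ N := by
    refine Submodule.le_of_le_smul_of_le_jacobson_bot (I := vanishing) ((lattice_fg n d).map _)
      (IsLocalRing.maximalIdeal_le_jacobson ⊥) ?_
    rintro _ ⟨a, ha, rfl⟩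
    obtain ⟨z, hz, p, hp, hpz⟩ := symmetrized_sym_mem hn h hP ha
    have h1 := hz.conj.sub_mem hpz
    have h2 := Submodule.mem_map_of_mem (f := sandwichHom n) h1
    rw [Submodule.map_smul''] at h2
    change sandwich (_ - _) ∈ _ at h2
    rw [sandwich_sub, sandwich_sandwich, sandwich_coe] at h2
    change sandwich a ∈ N ⊔ vanishing • M
    rw [← add_sub_cancel p (sandwich a)]
    exact Submodule.add_mem_sup hp h2
  exact hle ⟨a, ha, rfl⟩

end EllipticHall

namespace EllipticHall

open Equiv

variable {n : ℕ} {ρ : SL2Z →* (Spherical n ≃ₐ[K'] Spherical n)} {P : LatticeStar → Spherical n}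

/-! ### Clearing denominators -/

/-- The subalgebra of `Daha n` generated by the `T_i`, `X_j` and `Y_j`. -/
noncomputable def positivePart (n : ℕ) : Subalgebra K' (Daha n) :=
  Algebra.adjoin K' (Set.range (Letter.val : Letter n → Daha n))

theorem letter_mem (a : Letter n) : a.val ∈ positivePart n := Algebra.subset_adjoin ⟨a, rfl⟩

theorem sandwich_mem_of_mem_positivePart (hn : 0 < n) (h : IsCherednikAction n ρ)
    (hP : IsPowerSumFamily ρ P) {a : Daha n} (ha : a ∈ positivePart n) :
    sandwich a ∈ Algebra.adjoin K' (Set.range P) := by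
  rw [positivePart, ← Subalgebra.mem_toSubmodule, Algebra.adjoin_eq_span] at ha
  induction ha using Submodule.span_induction with
  | mem a ha =>
    have hl : ∃ l : List (Letter n), wordVal l = a := by
      induction ha using Submonoid.closure_induction with
      | mem a ha => obtain ⟨c, rfl⟩ := ha; exact ⟨[c], by simp [wordVal]⟩
      | one => exact ⟨[], rfl⟩
      | mul a b _ _ ha hb =>
        obtain ⟨l, rfl⟩ := ha
        obtain ⟨m, rfl⟩ := hb
        exact ⟨l ++ m, wordVal_append l m⟩
    obtain ⟨l, rfl⟩ := hl
    exact sandwich_mem_of_mem_lattice hn h hP (wordVal_mem l)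
  | zero => rw [sandwich_zero]; exact zero_mem _
  | add a b _ _ ha hb => rw [sandwich_add]; exact add_mem ha hb
  | smul c a _ ha => rw [sandwich_smul]; exact Subalgebra.smul_mem _ ha _

/-- The product of the `X_j`. -/
noncomputable def prodX (n : ℕ) : (Daha n)ˣ := upProd (unitX n) n

/-- The product of the `Y_j`. -/
noncomputable def prodY (n : ℕ) : (Daha n)ˣ := upProd (unitY n) n

theorem commute_unitT_prodX (i : Fin (n - 1)) : Commute (unitT n i) (prodX n) := by
  have hi := i.2
  have he := daha_isElliptic (n := n) (by omega)
  have h := he.affX.commute_prod he.isBraid le_rfl (by omega : i.val + 1 < n)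
  rwa [upProd_congr fun j hj => strand_unitX hj] at h

theorem commute_unitT_prodY (i : Fin (n - 1)) : Commute (unitT n i) (prodY n) := by
  have hi := i.2
  have he := (daha_isElliptic (n := n) (by omega)).swap
  have h := he.affX.commute_prod he.isBraid le_rfl (by omega : i.val + 1 < n)
  rw [upProd_congr fun j hj => strand_unitY hj, Pi.inv_apply] at h
  have h1 := h.inv_left
  rwa [inv_inv] at h1

theorem commute_unitX_prodX {j : ℕ} (hj : j < n) : Commute (unitX n j) (prodX n) :=
  (commute_upProd_of fun _ hi => commute_unitX hi hj).symm

theorem commute_unitY_prodY {j : ℕ} (hj : j < n) : Commute (unitY n j) (prodY n) :=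
  (commute_upProd_of fun _ hi => commute_unitY hi hj).symm

/-- `Y_j` and the product of the `X_i` commute up to a power of `q`. -/
theorem unitY_mul_prodX {j : ℕ} (hj : j < n) :
    unitY n j * prodX n = qUnit (Daha n) * (prodX n * unitY n j) := by
  induction j with
  | zero =>
    have h := (daha_isElliptic hj).y_mul_upProd hj
    rwa [upProd_congr fun j hj => strand_unitX hj] at h
  | succ j ih =>
    have hT := (commute_unitT_prodX (⟨j, by omega⟩ : Fin (n - 1))).inv_left
    rw [unitY_succ hj]
    set t := (unitT n j)⁻¹
    have hT' : t * prodX n = prodX n * t := hT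
    calc t * unitY n j * t * prodX n = t * (unitY n j * prodX n) * t := by
          simp only [mul_assoc, hT']
      _ = qUnit (Daha n) * (t * prodX n) * (unitY n j * t) := by
          rw [ih (by omega), ← mul_assoc t, ← (qUnit_central t).eq]
          simp only [mul_assoc]
      _ = _ := by rw [hT']; simp only [mul_assoc]

theorem unitX_mul_prodY {j : ℕ} (hj : j < n) :
    unitX n j * prodY n = (qUnit (Daha n))⁻¹ * (prodY n * unitX n j) := by
  induction j with
  | zero =>
    have h := (daha_isElliptic hj).swap.y_mul_upProd hj
    rwa [upProd_congr fun j hj => strand_unitY hj] at h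
  | succ j ih =>
    have hT' := (commute_unitT_prodY (⟨j, by omega⟩ : Fin (n - 1))).eq
    rw [unitX_succ hj]
    set t := unitT n j
    change t * prodY n = prodY n * t at hT'
    calc t * unitX n j * t * prodY n = t * (unitX n j * prodY n) * t := by
          simp only [mul_assoc, hT']
      _ = (qUnit (Daha n))⁻¹ * (t * prodY n) * (unitX n j * t) := by
          rw [ih (by omega), ← mul_assoc t, ← (qUnit_central t).inv_left.eq]
          simp only [mul_assoc]
      _ = _ := by rw [hT']; simp only [mul_assoc]

/-- `u` commutes with `a` up to a nonzero scalar. -/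
def ScalarCommute (u a : Daha n) : Prop := ∃ c : K', c ≠ 0 ∧ u * a = c • (a * u)

namespace ScalarCommute

theorem of_commute {u a : (Daha n)ˣ} (h : Commute u a) : ScalarCommute (u : Daha n) a :=
  ⟨1, one_ne_zero, by rw [one_smul, ← Units.val_mul, h.eq, Units.val_mul]⟩

theorem pow_left {u a : Daha n} (h : ScalarCommute u a) (k : ℕ) : ScalarCommute (u ^ k) a := by
  obtain ⟨c, hc, h⟩ := h
  induction k with
  | zero => exact ⟨1, one_ne_zero, by simp⟩
  | succ k ih =>
    obtain ⟨d, hd, ih⟩ := ih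
    refine ⟨c * d, mul_ne_zero hc hd, ?_⟩
    rw [pow_succ, mul_assoc, h, mul_smul_comm, ← mul_assoc, ih, smul_mul_assoc, smul_smul,
      mul_assoc]

theorem mul_left {u w a : Daha n} (hu : ScalarCommute u a) (hw : ScalarCommute w a) :
    ScalarCommute (u * w) a := by
  obtain ⟨c, hc, hu⟩ := hu
  obtain ⟨d, hd, hw⟩ := hw
  exact ⟨d * c, mul_ne_zero hd hc, by
    rw [mul_assoc, hw, mul_smul_comm, ← mul_assoc, hu, smul_mul_assoc, smul_smul, mul_assoc]⟩

theorem inv_right {u : Daha n} {a : (Daha n)ˣ} (h : ScalarCommute u (a : Daha n)) :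
    ScalarCommute u ((a⁻¹ : (Daha n)ˣ) : Daha n) := by
  obtain ⟨c, hc, h⟩ := h
  refine ⟨c⁻¹, inv_ne_zero hc, ?_⟩
  have h1 : ((a⁻¹ : (Daha n)ˣ) : Daha n) * (u * a) * ((a⁻¹ : (Daha n)ˣ) : Daha n) =
      c • (u * ((a⁻¹ : (Daha n)ˣ) : Daha n)) := by
    rw [h, mul_smul_comm, smul_mul_assoc, Units.inv_mul_cancel_left]
  rw [mul_assoc, mul_assoc, Units.mul_inv, mul_one] at h1
  rw [h1, smul_smul, inv_mul_cancel₀ hc, one_smul]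

theorem of_units {u a c : (Daha n)ˣ} {c' : K'} (hc' : c' ≠ 0)
    (hc : (c : Daha n) = algebraMap K' (Daha n) c') (h : u * a = c * (a * u)) :
    ScalarCommute (u : Daha n) a :=
  ⟨c', hc', by
    have := congrArg Units.val h
    rw [Units.val_mul, Units.val_mul, Units.val_mul, hc, ← Algebra.smul_def] at this
    exact this⟩

end ScalarCommute

theorem scalarCommute_prodX_unitY {j : ℕ} (hj : j < n) :
    ScalarCommute (prodX n : Daha n) (unitY n j : Daha n) := by
  refine ScalarCommute.of_units (c := (qUnit _)⁻¹) (c' := q'⁻¹) (inv_ne_zero q'_ne_zero) rfl ?_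
  rw [unitY_mul_prodX hj, inv_mul_cancel_left]

theorem scalarCommute_prodY_unitX {j : ℕ} (hj : j < n) :
    ScalarCommute (prodY n : Daha n) (unitX n j : Daha n) := by
  refine ScalarCommute.of_units (c := qUnit _) (c' := q') q'_ne_zero rfl ?_
  rw [unitX_mul_prodY hj, mul_inv_cancel_left]

/-- The common denominator `X_1 ⋯ X_n Y_1 ⋯ Y_n`. -/
noncomputable def denom (n : ℕ) : (Daha n)ˣ := prodX n * prodY n

theorem scalarCommute_denom_T (i : Fin (n - 1)) :
    ScalarCommute (denom n : Daha n) (unitT n i : Daha n) :=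
  ScalarCommute.of_commute ((commute_unitT_prodX i).mul_right (commute_unitT_prodY i)).symm

theorem scalarCommute_denom_X {j : ℕ} (hj : j < n) :
    ScalarCommute (denom n : Daha n) (unitX n j : Daha n) := by
  rw [denom, Units.val_mul]
  exact (ScalarCommute.of_commute (commute_unitX_prodX hj).symm).mul_left
    (scalarCommute_prodY_unitX hj)

theorem scalarCommute_denom_Y {j : ℕ} (hj : j < n) :
    ScalarCommute (denom n : Daha n) (unitY n j : Daha n) := by
  rw [denom, Units.val_mul]
  exact (scalarCommute_prodX_unitY hj).mul_left
    (ScalarCommute.of_commute (commute_unitY_prodY hj).symm)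

theorem upProd_mem {u : ℕ → (Daha n)ˣ} {B : Subalgebra K' (Daha n)} {k : ℕ}
    (hu : ∀ j < k, (u j : Daha n) ∈ B) : ((upProd u k : (Daha n)ˣ) : Daha n) ∈ B := by
  induction k with
  | zero => exact one_mem B
  | succ k ih =>
    rw [upProd, Units.val_mul]
    exact mul_mem (ih fun j hj => hu j (by omega)) (hu k (by omega))

/-- A product of commuting units, divided by one of the factors. -/
theorem upProd_mul_inv_mem {u : ℕ → (Daha n)ˣ} {B : Subalgebra K' (Daha n)} {k : ℕ}
    (hu : ∀ j < k, (u j : Daha n) ∈ B) (hc : ∀ i j, i < k → j < k → Commute (u i) (u j))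
    {j : ℕ} (hj : j < k) : ((upProd u k * (u j)⁻¹ : (Daha n)ˣ) : Daha n) ∈ B := by
  induction k with
  | zero => omega
  | succ k ih =>
    rcases Nat.lt_succ_iff_lt_or_eq.mp hj with h | rfl
    · rw [upProd, mul_assoc, ((hc k j (by omega) (by omega)).inv_right).eq, ← mul_assoc,
        Units.val_mul]
      exact mul_mem (ih (fun j hj => hu j (by omega))
        (fun i j hi hj => hc i j (by omega) (by omega)) h) (hu k (by omega))
    · rw [upProd, mul_inv_cancel_right]
      exact upProd_mem fun i hi => hu i (by omega)

theorem unitT_mem_positivePart (i : Fin (n - 1)) : (unitT n i : Daha n) ∈ positivePart n := by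
  rw [unitT_val i.2]; exact letter_mem (.T i)

theorem unitX_mem_positivePart {j : ℕ} (hj : j < n) : (unitX n j : Daha n) ∈ positivePart n := by
  rw [unitX_val hj]; exact letter_mem (.X ⟨j, hj⟩)

theorem unitY_mem_positivePart {j : ℕ} (hj : j < n) : (unitY n j : Daha n) ∈ positivePart n := by
  rw [unitY_val hj]; exact letter_mem (.Y ⟨j, hj⟩)

theorem prodX_mem_positivePart : (prodX n : Daha n) ∈ positivePart n :=
  upProd_mem fun _ => unitX_mem_positivePart

theorem prodY_mem_positivePart : (prodY n : Daha n) ∈ positivePart n :=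
  upProd_mem fun _ => unitY_mem_positivePart

theorem denom_mem_positivePart : (denom n : Daha n) ∈ positivePart n := by
  rw [denom, Units.val_mul]; exact mul_mem prodX_mem_positivePart prodY_mem_positivePart

/-- If `g` can be moved through the denominator, and its product with the denominator is positive,
then multiplication by `g` preserves the elements which have a denominator. -/
theorem exists_denom_mul {g : Daha n} (hg : ScalarCommute (denom n : Daha n) g)
    (hg' : (denom n : Daha n) * g ∈ positivePart n) {a : Daha n}
    (ha : ∃ k : ℕ, (denom n : Daha n) ^ k * a ∈ positivePart n) :
    ∃ k : ℕ, (denom n : Daha n) ^ k * (g * a) ∈ positivePart n := by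
  obtain ⟨k, hk⟩ := ha
  obtain ⟨c, -, hc⟩ := hg.pow_left k
  refine ⟨k + 1, ?_⟩
  have h1 : (denom n : Daha n) ^ (k + 1) * (g * a) =
      c • ((denom n : Daha n) * g * ((denom n : Daha n) ^ k * a)) := by
    rw [pow_succ', mul_assoc, ← mul_assoc _ g a, hc, smul_mul_assoc, mul_smul_comm]
    simp only [mul_assoc]
  rw [h1]
  exact Subalgebra.smul_mem _ (mul_mem hg' hk) c

theorem denom_mul_mem {g : Daha n} (hg : g ∈ positivePart n) :
    (denom n : Daha n) * g ∈ positivePart n := mul_mem denom_mem_positivePart hg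

theorem dahaMk_surjective (n : ℕ) : Function.Surjective (dahaMk n) :=
  RingQuot.mkAlgHom_surjective K' (DahaRel n)

theorem denom_mul_gen (c : DahaGen n) {a : Daha n}
    (ha : ∃ k : ℕ, (denom n : Daha n) ^ k * a ∈ positivePart n) :
    ∃ k : ℕ, (denom n : Daha n) ^ k * (dahaMk n (gen c) * a) ∈ positivePart n := by
  rcases c with i | i | j | j | j | j
  · change ∃ k : ℕ, _ * (Daha.T i * a) ∈ _
    rw [← unitT_val i.2]
    exact exists_denom_mul (scalarCommute_denom_T i) (denom_mul_mem (unitT_mem_positivePart i)) ha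
  · change ∃ k : ℕ, _ * (Daha.Tinv i * a) ∈ _
    rw [← unitT_inv_val i.2]
    refine exists_denom_mul (scalarCommute_denom_T i).inv_right (denom_mul_mem ?_) ha
    rw [unitT_inv_eq (by omega)]
    exact sub_mem (unitT_mem_positivePart i) (Subalgebra.algebraMap_mem _ _)
  · change ∃ k : ℕ, _ * (Daha.X j * a) ∈ _
    rw [← unitX_val j.2]
    exact exists_denom_mul (scalarCommute_denom_X j.2)
      (denom_mul_mem (unitX_mem_positivePart j.2)) ha
  · rw [← unitX_inv_val j.2]
    refine exists_denom_mul (scalarCommute_denom_X j.2).inv_right ?_ ha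
    obtain ⟨c, -, hc⟩ := (scalarCommute_prodY_unitX j.2).inv_right
    rw [denom, Units.val_mul, mul_assoc, hc, mul_smul_comm, ← mul_assoc, ← Units.val_mul]
    exact Subalgebra.smul_mem _ (mul_mem (upProd_mul_inv_mem (fun _ => unitX_mem_positivePart)
      (fun _ _ => commute_unitX) j.2) prodY_mem_positivePart) c
  · change ∃ k : ℕ, _ * (Daha.Y j * a) ∈ _
    rw [← unitY_val j.2]
    exact exists_denom_mul (scalarCommute_denom_Y j.2)
      (denom_mul_mem (unitY_mem_positivePart j.2)) ha
  · rw [← unitY_inv_val j.2]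
    refine exists_denom_mul (scalarCommute_denom_Y j.2).inv_right ?_ ha
    rw [denom, Units.val_mul, mul_assoc, ← Units.val_mul (prodY n)]
    exact mul_mem prodX_mem_positivePart (upProd_mul_inv_mem (fun _ => unitY_mem_positivePart)
      (fun _ _ => commute_unitY) j.2)

/-- Every element of the double affine Hecke algebra has a denominator. -/
theorem exists_denom (a : Daha n) : ∃ k : ℕ, (denom n : Daha n) ^ k * a ∈ positivePart n := by
  suffices H : ∀ (g : FreeDaha n) (a : Daha n),
      (∃ k : ℕ, (denom n : Daha n) ^ k * a ∈ positivePart n) →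
        ∃ k : ℕ, (denom n : Daha n) ^ k * (dahaMk n g * a) ∈ positivePart n by
    obtain ⟨g, rfl⟩ := dahaMk_surjective n a
    have := H g 1 ⟨0, by rw [pow_zero, one_mul]; exact one_mem _⟩
    rwa [mul_one] at this
  intro g
  induction g using FreeAlgebra.induction with
  | grade0 c =>
    rintro a ⟨k, hk⟩
    refine ⟨k, ?_⟩
    rw [AlgHom.commutes, ← Algebra.smul_def, mul_smul_comm]
    exact Subalgebra.smul_mem _ hk c
  | grade1 c => exact fun a ha => denom_mul_gen c ha
  | mul g g' hg hg' =>
    intro a ha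
    rw [map_mul, mul_assoc]
    exact hg _ (hg' _ ha)
  | add g g' hg hg' =>
    intro a ha
    obtain ⟨k, hk⟩ := hg a ha
    obtain ⟨l, hl⟩ := hg' a ha
    refine ⟨k + l, ?_⟩
    have h1 : (denom n : Daha n) ^ (k + l) * (dahaMk n (g + g') * a) =
        (denom n : Daha n) ^ l * ((denom n : Daha n) ^ k * (dahaMk n g * a)) +
          (denom n : Daha n) ^ k * ((denom n : Daha n) ^ l * (dahaMk n g' * a)) := by
      rw [map_add, add_mul, mul_add, ← mul_assoc, ← mul_assoc, ← mul_assoc, ← mul_assoc,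
        ← mul_assoc, ← mul_assoc, ← pow_add, ← pow_add, add_comm l k]
    rw [h1]
    exact add_mem (mul_mem (pow_mem denom_mem_positivePart l) hk)
      (mul_mem (pow_mem denom_mem_positivePart k) hl)

/-! ### Surjectivity -/

theorem smul_mem_adjoin (hP : IsPowerSumFamily ρ P) (g : SL2Z) {p : Spherical n}
    (hp : p ∈ Algebra.adjoin K' (Set.range P)) : ρ g p ∈ Algebra.adjoin K' (Set.range P) := by
  induction hp using Algebra.adjoin_induction with
  | mem p hp =>
    obtain ⟨x, rfl⟩ := hp
    exact Algebra.subset_adjoin ⟨g • x, hP.smul g x⟩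
  | algebraMap c => rw [AlgEquiv.commutes]; exact Subalgebra.algebraMap_mem _ c
  | add p q _ _ hp hq => rw [map_add]; exact add_mem hp hq
  | mul p q _ _ hp hq => rw [map_mul]; exact mul_mem hp hq

theorem upProd_inv_of_commute {u : ℕ → (Daha n)ˣ} {k : ℕ}
    (hc : ∀ i j, i < k → j < k → Commute (u i) (u j)) :
    upProd (fun j => (u j)⁻¹) k = (upProd u k)⁻¹ := by
  induction k with
  | zero => simp [upProd]
  | succ k ih =>
    have h1 : Commute (upProd u k) (u k) :=
      commute_upProd_of fun i hi => hc i k (by omega) (by omega)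
    rw [upProd, upProd, ih fun i j hi hj => hc i j (by omega) (by omega), h1.eq, mul_inv_rev]

/-- The quarter turn moves the `P_x` of the positive quadrant to another quadrant, and thus also
provides the inverse of the denominator. -/
theorem rot_prodY (hn : 0 < n) : unitAct (rot hn) (prodY n) = (prodX n)⁻¹ := by
  rw [prodX, ← upProd_inv_of_commute fun _ _ => commute_unitX, prodY, map_upProd]
  exact upProd_congr fun j hj => rot_Y_eq hn hj

theorem sandwich_prodX_inv_mem (hn : 0 < n) (h : IsCherednikAction n ρ)
    (hP : IsPowerSumFamily ρ P) :
    sandwich (((prodX n)⁻¹ : (Daha n)ˣ) : Daha n) ∈ Algebra.adjoin K' (Set.range P) := by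
  have h1 := smul_mem_adjoin hP rotSL
    (sandwich_mem_of_mem_positivePart hn h hP prodY_mem_positivePart)
  rwa [h.rot_sandwich hn, ← unitAct_val, rot_prodY] at h1

theorem sandwich_prodY_inv_mem (hn : 0 < n) (h : IsCherednikAction n ρ)
    (hP : IsPowerSumFamily ρ P) :
    sandwich (((prodY n)⁻¹ : (Daha n)ˣ) : Daha n) ∈ Algebra.adjoin K' (Set.range P) := by
  have h1 := smul_mem_adjoin hP rotSL⁻¹
    (sandwich_mem_of_mem_positivePart hn h hP prodX_mem_positivePart)
  have h2 : ρ rotSL (sandwich (((prodY n)⁻¹ : (Daha n)ˣ) : Daha n)) =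
      sandwich (prodX n : Daha n) := by
    rw [h.rot_sandwich hn, ← unitAct_val, map_inv, rot_prodY, inv_inv]
  rwa [← h2, ← AlgEquiv.mul_apply, ← map_mul, inv_mul_cancel, map_one, AlgEquiv.one_apply] at h1

theorem prodX_inv_commute_symmetrizer :
    Commute ((prodX n)⁻¹ : (Daha n)ˣ).val (symmetrizer n) := by
  refine commute_symmetrizer fun i hi => ?_
  exact congrArg Units.val (commute_unitT_prodX (⟨i, by omega⟩ : Fin (n - 1))).inv_right.eq

theorem prodY_inv_commute_symmetrizer :
    Commute ((prodY n)⁻¹ : (Daha n)ˣ).val (symmetrizer n) := by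
  refine commute_symmetrizer fun i hi => ?_
  exact congrArg Units.val (commute_unitT_prodY (⟨i, by omega⟩ : Fin (n - 1))).inv_right.eq

/-- The denominators become invertible elements of the spherical algebra, with inverses in the
algebra generated by the `P_x`. -/
theorem sandwich_mem_of_denom_mul (hn : 0 < n) (h : IsCherednikAction n ρ)
    (hP : IsPowerSumFamily ρ P) (k : ℕ) {a : Daha n}
    (ha : sandwich ((denom n : Daha n) ^ k * a) ∈ Algebra.adjoin K' (Set.range P)) :
    sandwich a ∈ Algebra.adjoin K' (Set.range P) := by
  induction k generalizing a with
  | zero => rwa [pow_zero, one_mul] at ha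
  | succ k ih =>
    rw [pow_succ, mul_assoc] at ha
    have h1 : a = ((prodY n)⁻¹ : (Daha n)ˣ).val * (((prodX n)⁻¹ : (Daha n)ˣ).val *
        ((denom n : Daha n) * a)) := by
      rw [denom, ← mul_assoc, ← mul_assoc, ← Units.val_mul, ← Units.val_mul, ← mul_inv_rev,
        inv_mul_cancel, Units.val_one, one_mul]
    rw [h1, sandwich_mul_left prodY_inv_commute_symmetrizer,
      sandwich_mul_left prodX_inv_commute_symmetrizer]
    exact mul_mem (sandwich_prodY_inv_mem hn h hP)
      (mul_mem (sandwich_prodX_inv_mem hn h hP) (ih ha))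

/-- The `P_x` generate the spherical algebra. -/
theorem adjoin_range_eq_top (hn : 0 < n) (h : IsCherednikAction n ρ) (hP : IsPowerSumFamily ρ P) :
    Algebra.adjoin K' (Set.range P) = ⊤ := by
  refine eq_top_iff.mpr fun p _ => ?_
  obtain ⟨k, hk⟩ := exists_denom p.val
  have h1 := sandwich_mem_of_denom_mul hn h hP k (sandwich_mem_of_mem_positivePart hn h hP hk)
  rwa [sandwich_coe] at h1

end EllipticHall

open EllipticHall in
theorem theorem3p1 (n : ℕ) (hn : 1 ≤ n) :
    (∃! ρ : SL2Z →* (Spherical n ≃ₐ[K'] Spherical n), IsCherednikAction n ρ) ∧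
    ∀ ρ : SL2Z →* (Spherical n ≃ₐ[K'] Spherical n), IsCherednikAction n ρ →
      (∃! P : LatticeStar → Spherical n, IsPowerSumFamily ρ P) ∧
      ∀ P : LatticeStar → Spherical n, IsPowerSumFamily ρ P →
        ∃ Ψ : Hall →ₐ[ℂ] Spherical n,
          Ψ (algebraMap K Hall vK) = algebraMap K' (Spherical n) v' ∧
          Ψ (algebraMap K Hall tK) = algebraMap K' (Spherical n) (q' * v'⁻¹) ∧
          (∀ x : LatticeStar, Ψ (hallTt x) =
            ((1 / (deg x.1 : K')) * (q'⁻¹ ^ deg x.1 * v' ^ deg x.1 - v'⁻¹ ^ deg x.1)) • P x) ∧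
          Function.Surjective Ψ ∧
          (∀ (g : SL2Z) (a : Hall), Ψ (hallAct g a) = ρ g (Ψ a)) ∧
          Ψ '' (hallPlus : Set Hall) = (sphericalPlus P : Set (Spherical n)) := by
  refine ⟨?_, fun ρ h => ⟨⟨_, powerFamily_isPowerSumFamily hn h,
    fun P hP => hP.unique (powerFamily_isPowerSumFamily hn h)⟩, fun P hP =>
    ⟨psi hn h hP, ?_, ?_, psi_Tt hn h hP, ?_, psi_hallAct hn h hP, ?_⟩⟩⟩
  · obtain ⟨ρ, h⟩ := exists_cherednikAction hn
    exact ⟨ρ, h, fun σ hσ => IsCherednikAction.unique hn hσ h⟩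
  · rw [psi_algebraMap, subst_v]
  · rw [psi_algebraMap, subst_t]
  · intro a
    have ha : a ∈ (Algebra.adjoin K' (P '' Set.univ) : Set (Spherical n)) := by
      rw [Set.image_univ, adjoin_range_eq_top hn h hP]; trivial
    rw [← psi_image_adjoin hn h hP] at ha
    obtain ⟨b, -, hb⟩ := ha
    exact ⟨b, hb⟩
  · have hs : ∀ {α : Type} (f : LatticeStar → α),
        {a | ∃ x : LatticeStar, IsPositive x.1 ∧ a = f x} = f '' {x | IsPositive x.1} :=
      fun f => Set.ext fun a => exists_congr fun x => and_congr_right fun _ => eq_comm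
    rw [hallPlus, sphericalPlus, hs, hs, psi_image_adjoin hn h hP]
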